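/- **Setting.** Let $d\ge 1$, let $n$ be a power of two, $N=n^d$, $\omega=e^{2\pi i/n}$, and index signals $x\in\mathbb C^N$ by $[n]^d=(\mathbb Z/n)^d$. Let $\hat x_j=N^{-1/2}\sum_i\omega^{-i^Tj}x_i$ and $\mathrm{Err}_k(x)=\min_{k\text{-sparse }y}\|x-y\|_2$. Put $F=2d$. For a power of two $b$ let $G_j=\prod_{s=1}^d\bigl(\frac1{b-1}\sum_{|t|<b/2}\omega^{tj_s}\bigr)^F$ (the filter with $b^d$ buckets). For a $d\times d$ matrix $\Sigma$ over $\mathbb Z/n$ with odd determinant and $q\in[n]^d$ let $\pi(i)=\Sigma(i-q)$, and let $h(i)\in[b]^d$ be $(b/n)\pi(i)$ rounded to the nearest integer point. **The algorithm.** It has constants $\alpha,C,c>0$. * $\mathrm{HashToBins}(\hat x,\chi,(\Sigma,q,b,a))$ returns $u_j=\sqrt N\,\mathcal F^{-1}\bigl(\hat G\cdot P(\hat x-\hat\chi')\bigr)_{(n/b)j}$ for $j\in[b]^d$, where $(Py)_i=y_{\Sigma^T(i-a)}\,\omega^{i^T\Sigma q}$. Here $P\hat\chi'$ is the approximation of $P\hat\chi$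 computed by a semi-equispaced Fourier transform: each nonzero entry is spread, by a truncated sinc–Gaussian window of width $c\log N$, to an oversampled grid, to which one FFT is applied. With exact $\hat\chi$ one would get $u_j=\sum_l G_{\pi(l)-(n/b)j}(x-\chi)_l\,\omega^{a^T\Sigma l}$. * $\mathrm{RecoverAtConstantSNR}(\hat x,\chi,k,\epsilon)$: 1. Let $b$ be the least power of two with $b^d\ge(2\pi)^{4dF}k/(\epsilon\alpha^d)$, and $B=b^d$. Choose $\Sigma$ and $q$ uniformly, and $\lceil C\log\log N\rceil$ uniform pairs $(\gamma,\beta)\in[n]^d\times[n]^d$, all independently. 2. Let $\Delta=2^{\lfloor\frac12\log_2\log_2 n\rfloor}$ and let $\mathcal H$ consist of $0$ and all $w=n\Delta^{-g}e_s$, $1\le s\le d$, $1\le g\le\lceil\log_\Delta n\rceil$ (with $n\Delta^{-g}$ replaced by $1$ if it is less than $1$). For every pair and every $w\in\mathcal H$ call HashToBins with $a_s=\gamma_s+\beta_sw_s$, and update the result to a measurement $m_j(\gamma,\beta,w)$ of the residual $x-\chi$. 3. For each bucket $j$, decode a vector $f\in[n]^d$, each coordinate $f_s$ in base $\Delta$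 from the least significant digit: the $g$-th digit is the unique admissible $r$ with $|\omega^{-n\Delta^{-g}(f_s+\Delta^{g-1}r)\beta_s}\,m_j(\gamma,\beta,w)/m_j(\gamma,\beta,0)-1|<1/3$ (where $w=n\Delta^{-g}e_s$) for at least $3/5$ of the pairs. The bucket is skipped if some digit has no unique such $r$. Put $\Sigma^{-1}f$ into a set $L$. 4. Estimate $(x-\chi)_i$ for $i\in L$ by the coordinatewise median, over $\lceil C\log N\rceil$ fresh independent uniform triples $(\Sigma_t,q_t,z_t)$, of $G_{\pi_t(i)-(n/b')h_t(i)}^{-1}\,\omega^{-z_t^T\Sigma_ti}\,u^t_{h_t(i)}$, where $u^t=\mathrm{HashToBins}(\hat x,\chi,(\Sigma_t,q_t,b',z_t))$ and $b'$ is the least power of two with $b'^d\ge(2\pi)^{4dF}\cdot 2k/(\epsilon\alpha^{2d})$. 5. Output the restriction $\chi'$ of these estimates to the $4k$ largest ones in absolute value. **Lemma.** Let $\alpha$ be smaller than an absolute constant and let $C$ be sufficiently large. Let $0<\epsilon\le1$, let $k\ge1$ be an integer, and let $x,\chi\in\mathbb C^N$ and $x'=x-\chi$. Suppose that the number of buckets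 $b'^d$ used for estimation in the call $\mathrm{RecoverAtConstantSNR}(\hat x,\chi,2k,\epsilon)$ is at most $N$. Consider the output $\chi'$ of this call. 1. Suppose that, for a set $Q$ of $2k$ largest entries of $x'$ in absolute value, $\|x'_Q\|_1\le A\sqrt k\,\mathrm{Err}_k(x)$ and $\|x'_{[n]^d\setminus Q}\|_2^2\le\mathrm{Err}_k(x)^2$. Suppose also that $\|x\|_\infty\le N^p\mu$ with $\mu=\mathrm{Err}_k(x)/\sqrt k$. Here $A,p$ are arbitrary constants, and the precision constant $c$ is sufficiently large in terms of the other constants. Then with probability at least $99/100$ over the internal randomness $$\|x'-\chi'\|_2^2\le(1+O(\epsilon))\,\mathrm{Err}_k(x)^2 .$$ 2. The number of samples of $\hat x$ is at most $2^{O(d^2)}\frac1\epsilon k\log N$. 3. If $\chi$ has $O(B)$ nonzero entries, where $B$ is the number of buckets in step 1 of the call, then the running time is at most $2^{O(d^2)}\frac1\epsilon k\log^{d+1}N$ elementary operations of a unit-cost random access machine with real and complex words. The implied constants depend only on the constants: the one in (1) on $\alpha,C,A$, the one in (2) on $\alpha,C$, and the one in (3) on $\alpha,C,c$, on $A,p$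 and on the constant in the bound on the number of nonzero entries. -/

import Mathlib

open Real BigOperators
open scoped Classical Matrix

noncomputable section

namespace SparseFT

/-! ## Cost model

A computation on a unit-cost random access machine whose words hold a real or complex number or an
element of `ℤ/n`. `time` counts elementary operations (arithmetic, comparison, evaluation of
`exp`, `sin`, of a root of unity, reading or writing a table cell, drawing a random word) and
`samples` counts the accesses to the Fourier transform of the unknown signal. -/

structure Cost (α : Type) where
  val : α
  time : ℕ
  samples : ℕ

instance : Monad Cost where
  pure a := ⟨a, 0, 0⟩
  bind m f := ⟨(f m.val).val, m.time + (f m.val).time, m.samples + (f m.val).samples⟩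

/-- A value obtained by at most `t` elementary operations from values already available. -/
def op {α : Type} (t : ℕ) (v : α) : Cost α := ⟨v, t, 0⟩

/-- Run `body` for the elements of a list in turn, with one unit of overhead per round. -/
def loop {ι σ : Type} : List ι → σ → (ι → σ → Cost σ) → Cost σ
  | [], s, _ => pure s
  | i :: l, s, body => do
      let t ← body i s
      let t ← op 1 t
      loop l t body

/-- Fill a table with the values of `f` at the listed positions. -/
def tabulate {ι β : Type} [Zero β] (l : List ι) (f : ι → Cost β) : Cost (ι → β) :=
  loop l (fun _ => 0) fun i t => do
    let v ← f i
    op 1 (Function.update t i v)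

/-- Merging two sorted lists. -/
def mergeLists {α : Type} (le : α → α → Prop) : List α → List α → Cost (List α)
  | [], ys => pure ys
  | xs, [] => pure xs
  | x :: xs, y :: ys =>
      if le x y then do
        let r ← mergeLists le xs (y :: ys)
        op 2 (x :: r)
      else do
        let r ← mergeLists le (x :: xs) ys
        op 2 (y :: r)
  termination_by xs ys => xs.length + ys.length

/-- Merge sort; the first argument is the depth of the recursion. -/
def sortDepth {α : Type} (le : α → α → Prop) : ℕ → List α → Cost (List α)
  | 0, l => pure l
  | t + 1, l =>
      if l.length ≤ 1 then pure l
      else do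
        let p ← op (2 * l.length) (l.splitAt (l.length / 2))
        let u ← sortDepth le t p.1
        let v ← sortDepth le t p.2
        mergeLists le u v

/-- Merge sort. -/
def sortList {α : Type} (le : α → α → Prop) (l : List α) : Cost (List α) :=
  sortDepth le (Nat.clog 2 l.length) l

/-- The (lower) median of a list of reals. -/
def median (l : List ℝ) : Cost ℝ := do
  let s ← sortList (fun a b => a ≤ b) l
  op 1 (s.getD ((l.length - 1) / 2) 0)

/-! ## Signals and the Fourier transform -/

/-- The index set `[n]^d`, with its arithmetic modulo `n`. -/
abbrev Idx (d n : ℕ) : Type := Fin d → ZMod n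

/-- The powers of `ω = exp (2 π i / n)`. -/
def om {n : ℕ} [NeZero n] (z : ZMod n) : ℂ :=
  Complex.exp (2 * π * Complex.I * (z.val : ℂ) / (n : ℂ))

/-- The signal length `N = n ^ d`. -/
def len (d n : ℕ) : ℝ := (n : ℝ) ^ d

/-- The orthonormal forward Fourier transform. -/
def dft {d n : ℕ} [NeZero n] (x : Idx d n → ℂ) (j : Idx d n) : ℂ :=
  (1 / √(len d n) : ℝ) * ∑ i, om (-(i ⬝ᵥ j)) * x i

/-- The support of a vector. -/
def supp {d n : ℕ} [NeZero n] (x : Idx d n → ℂ) : Finset (Idx d n) :=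
  Finset.univ.filter fun i => x i ≠ 0

/-- The `ℓ₂` error of the best `k`-sparse approximation. -/
def errK {d n : ℕ} [NeZero n] (k : ℕ) (x : Idx d n → ℂ) : ℝ :=
  sInf {e | ∃ y : Idx d n → ℂ, (supp y).card ≤ k ∧ e = √(∑ i, ‖x i - y i‖ ^ 2)}

/-- `Q` is a set of `m` largest coefficients of `x` in absolute value. -/
def IsTop {d n : ℕ} (m : ℕ) (x : Idx d n → ℂ) (Q : Finset (Idx d n)) : Prop :=
  Q.card = m ∧ ∀ i ∈ Q, ∀ j ∉ Q, ‖x j‖ ≤ ‖x i‖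

/-- `d × d` matrices over `ℤ/n` with odd determinant. -/
abbrev OddMat (d n : ℕ) : Type :=
  {S : Matrix (Fin d) (Fin d) (ZMod n) // Odd S.det.val}

/-- Probability under the uniform distribution on a finite set. -/
def prob {Ω : Type} [Fintype Ω] (P : Ω → Prop) : ℝ :=
  ((Finset.univ.filter P).card : ℝ) / (Fintype.card Ω : ℝ)

/-! ## Fast Fourier transform -/

/-- `d`-dimensional arrays; only finitely many cells of an array are ever used. -/
abbrev Arr (d : ℕ) : Type := (Fin d → ℕ) → ℂ

/-- Radix-2 transform along axis `s`, on `lines` many lines of length `2 ^ m` at once; it computes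
`∑ t < 2 ^ m, v t * exp (i θ t f / 2 ^ m)` on each line, where `θ = ± 2 π`. -/
def fftAxis {d : ℕ} (θ : ℝ) (lines : ℕ) (s : Fin d) : ℕ → Arr d → Cost (Arr d)
  | 0, v => pure fun f => v (Function.update f s 0)
  | m + 1, v => do
      let e ← fftAxis θ lines s m fun i => v (Function.update i s (2 * i s))
      let o ← fftAxis θ lines s m fun i => v (Function.update i s (2 * i s + 1))
      op ((2 * d + 4) * lines * 2 ^ (m + 1)) fun f =>
        e (Function.update f s (f s % 2 ^ m)) +
          Complex.exp (Complex.I * (θ * (f s : ℝ) / 2 ^ (m + 1) : ℝ)) *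
            o (Function.update f s (f s % 2 ^ m))

/-- The `d`-dimensional (unnormalised) transform of side `2 ^ m`, axis by axis. -/
def fft {d : ℕ} (θ : ℝ) (m : ℕ) (v : Arr d) : Cost (Arr d) :=
  loop (List.finRange d) v fun s y => fftAxis θ ((2 ^ m) ^ (d - 1)) s m y

/-- The cell of an array of side `M` at an integer point, taken modulo `M`. -/
def cell {d : ℕ} (M : ℕ) (p : Fin d → ℤ) : Fin d → ℕ := fun s => (p s % (M : ℤ)).toNat

/-! ## Semi-equispaced Fourier transform -/

/-- The flat window in the time domain, in units of the grid: a sinc cut off by a Gaussian. Its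
Fourier transform is the indicator of `[-1/2, 1/2]` smoothed by a Gaussian, hence nearly `1` on
`[-1/4, 1/4]` and nearly `0` outside `[-3/4, 3/4]`. -/
def flatWindow (W : ℕ) (u : ℝ) : ℝ := Real.sinc (π * u) * Real.exp (-u ^ 2 / (2 * W))

/-- Given the nonzero entries `(l, v)` of a sparse vector, approximate its orthonormal Fourier
transform at all frequencies `f` with `‖f‖∞ ≤ 2 ^ m / 4`: spread each entry to the points of a grid
of side `2 ^ m` at distance at most `W`, and apply one FFT to the grid. -/
def semiEquispaced {d n : ℕ} [NeZero n] (W m : ℕ) (entries : List (Idx d n × ℂ)) :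
    Cost (Arr d) := do
  let y : Arr d ← op ((2 ^ m) ^ d) fun _ => 0
  let y ← loop entries y fun e y => do
    let v : Fin d → ℝ ← op (3 * d) fun s => ((e.1 s).val : ℝ) * 2 ^ m / n
    let g : Fin d → ℤ → ℝ ← op (10 * d * (2 * W + 1)) fun s p => flatWindow W ((p : ℝ) - v s)
    let grid := Fintype.piFinset fun s => Finset.Icc ⌈v s - W⌉ ⌊v s + W⌋
    loop grid.toList y fun p y =>
      op (4 * d + 4) (Function.update y (cell (2 ^ m) p)
        (y (cell (2 ^ m) p) + e.2 * ((∏ s, g s (p s) : ℝ) : ℂ)))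
  let z ← fft (-(2 * π)) m y
  op (2 * (2 ^ m) ^ d) fun f => z f * ((1 / √(len d n) : ℝ) : ℂ)

/-! ## Filter and hashing -/

/-- The sharpness `F` of the filter. -/
def sharp (d : ℕ) : ℕ := 2 * d

/-- The normalised Dirichlet kernel `(b - 1)⁻¹ ∑_{|t| < b/2} ω ^ (t z)`, for even `b`. -/
def dirichlet {n : ℕ} (b : ℕ) (z : ZMod n) : ℝ :=
  if z = 0 then 1
  else Real.sin (π * ((b : ℝ) - 1) * z.val / n) / (((b : ℝ) - 1) * Real.sin (π * z.val / n))

/-- The filter `G` with `b ^ d` buckets and sharpness `F`, in the time domain. -/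
def filterG {d n : ℕ} (b : ℕ) (j : Idx d n) : ℝ := ∏ s, dirichlet b (j s) ^ sharp d

/-- The largest frequency per coordinate in the support of the filter. -/
def filterRadius (d b : ℕ) : ℕ := sharp d * (b / 2 - 1)

/-- Convolution with the rectangular pulse `(b - 1)⁻¹ 1_{|t| < b/2}` of a sequence supported in
`[-R, R]`, by means of prefix sums. -/
def pulseConv (b R : ℕ) (v : ℤ → ℝ) : Cost (ℤ → ℝ) := do
  let h : ℕ := b / 2 - 1
  let lo : ℤ := -(R : ℤ) - h - 1
  let st ← loop (List.range (2 * R + 2 * h + 2)) ((0 : ℝ), fun _ : ℤ => (0 : ℝ)) fun t st =>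
    op 4 (st.1 + v (lo + t), Function.update st.2 (lo + t) (st.1 + v (lo + t)))
  tabulate (List.map (fun t : ℕ => -(R : ℤ) + t) (List.range (2 * R + 1))) fun i =>
    op 6 ((st.2 (i + h) - st.2 (i - h - 1)) / ((b : ℝ) - 1))

/-- The coefficients of the one-dimensional filter in the frequency domain: the `F`-fold
convolution of the rectangular pulse with itself. -/
def filterTable (d b : ℕ) : Cost (ℤ → ℝ) :=
  loop (List.range (sharp d)) (fun t : ℤ => if t = 0 then (1 : ℝ) else 0) fun _ v =>
    pulseConv b (filterRadius d b) v

/-- The permutation `π(i) = Σ (i - q)`. -/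
def perm {d n : ℕ} (S : Matrix (Fin d) (Fin d) (ZMod n)) (q i : Idx d n) : Idx d n :=
  S *ᵥ (i - q)

/-- The bucket `h(i)`: the nearest integer point to `(b / n) π(i)`, modulo `b`. -/
def bucket {d n : ℕ} (b : ℕ) (S : Matrix (Fin d) (Fin d) (ZMod n)) (q i : Idx d n) : Fin d → ℕ :=
  fun s => ((perm S q i s).val + n / (2 * b)) / (n / b) % b

/-- The offset `o_i(j) = π(j) - (n / b) h(i)`. -/
def offset {d n : ℕ} (b : ℕ) (S : Matrix (Fin d) (Fin d) (ZMod n)) (q i j : Idx d n) : Idx d n :=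
  fun s => perm S q j s - ((n / b * bucket b S q i s : ℕ) : ZMod n)

/-- One access to the Fourier transform of the signal. -/
def sample {d n : ℕ} (xhat : Idx d n → ℂ) (j : Idx d n) : Cost ℂ := ⟨xhat j, d + 1, 1⟩

/-- The transform of the zero signal, which is known and is not sampled. -/
def zeroSignal {d n : ℕ} (_ : Idx d n) : Cost ℂ := pure 0

/-- The width, in grid points, of the window of the semi-equispaced transform; the constant `c`
governs the precision of the computation. -/
def windowWidth (d n c : ℕ) : ℕ := ⌈(c : ℝ) * Real.log (len d n)⌉₊

/-- `HashToBins (x̂, χ, (H, a))` for the hashing `H = ((Σ, q), (2 ^ β) ^ d, F)`: with `G` the filter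
and `P` the spectrum permutation `(P y)_i = y_{Σᵀ (i - a)} ω^{iᵀ Σ q}`, form `Ĝ · P (x̂ - χ̂)` with
`χ̂` replaced by its semi-equispaced approximation, and evaluate `√N` times its inverse transform at
the multiples of `n / b`. For a vector `χ` one has
`(P χ̂)_i = N^{-1/2} ∑_l χ_l ω^{aᵀ Σ l} ω^{-iᵀ π(l)}`. -/
def hashToBins {d n : ℕ} [NeZero n] (c : ℕ) (read : Idx d n → Cost ℂ) (χ : Idx d n → ℂ) (β : ℕ)
    (S : Matrix (Fin d) (Fin d) (ZMod n)) (q a : Idx d n) : Cost (Arr d) := do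
  let b : ℕ := 2 ^ β
  let R : ℕ := filterRadius d b
  let m : ℕ := Nat.clog 2 (4 * sharp d * b)
  let g ← filterTable d b
  let entries ← loop (supp χ).toList ([] : List (Idx d n × ℂ)) fun l es =>
    op (4 * d ^ 2 + 4 * d + 4) ((perm S q l, χ l * om (a ⬝ᵥ (S *ᵥ l))) :: es)
  let z ← semiEquispaced (windowWidth d n c) m entries
  let y : Arr d ← op (b ^ d) fun _ => 0
  let y ← loop (Fintype.piFinset fun _ : Fin d => Finset.Icc (-(R : ℤ)) R).toList y fun i y => do
    let f : Idx d n ← op d fun s => (i s : ZMod n)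
    let t ← op (2 * d ^ 2 + 2 * d) (Sᵀ *ᵥ (f - a))
    let v ← read t
    op (2 * d ^ 2 + 8 * d + 8) (Function.update y (cell b i) (y (cell b i) +
      ((√(len d n) * ∏ s, g (i s) : ℝ) : ℂ) * (v * om (f ⬝ᵥ (S *ᵥ q)) - z (cell (2 ^ m) i))))
  fft (2 * π) β y

/-! ## Location -/

/-- `Δ = 2 ^ ⌊(1/2) log₂ log₂ n⌋`, the base in which locations are decoded. -/
def base (n : ℕ) : ℕ := 2 ^ (Nat.log 2 (Nat.log 2 n) / 2)

/-- The number `⌈log_Δ n⌉` of digits. -/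
def numDigits (n : ℕ) : ℕ := Nat.clog (base n) n

/-- The shift `n Δ ^ (-g)`, or `1` for the last digit if `n` is not a power of `Δ`. -/
def digitStep (n g : ℕ) : ℕ := max 1 (n / base n ^ g)

/-- The number of values of the `g`-th digit: `Δ`, or fewer for an incomplete last digit. -/
def digitRange (n g : ℕ) : ℕ := min (base n) (n / base n ^ (g - 1))

/-- The shift vector `n Δ ^ (-g) e_s`. -/
def digitShift {d n : ℕ} (s : Fin d) (g : ℕ) : Idx d n := Pi.single s (digitStep n g : ZMod n)

/-- The pairs of a coordinate and the number of a digit, coordinate by coordinate. -/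
def digits (d n : ℕ) : List (Fin d × ℕ) :=
  (List.finRange d).flatMap fun s => (List.range (numDigits n)).map fun g => (s, g + 1)

/-- The set of shifts: the zero vector and all `n Δ ^ (-g) e_s`. -/
def shifts (d n : ℕ) : List (Idx d n) := 0 :: (digits d n).map fun p => digitShift p.1 p.2

/-- `(a₁, a₂) ⋆ (1, w)`. -/
def star {d n : ℕ} (a : Idx d n × Idx d n) (w : Idx d n) : Idx d n := fun s => a.1 s + a.2 s * w s

/-- Decode the position held by bucket `j` from the measurements `mm a w` of the residual signal at
`a ⋆ (1, w)`, digit by digit; `none` if for some digit there is not exactly one admissible value. -/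
def decodeBucket {d n : ℕ} [NeZero n] {cA : ℕ} (A : Fin cA → Idx d n × Idx d n)
    (mm : Fin cA × Idx d n → Arr d) (j : Fin d → ℕ) : Cost (Option (Fin d → ℕ)) :=
  loop (digits d n) (some fun _ => 0) fun p st =>
    match st with
    | none => op 1 none
    | some f => do
        let s := p.1
        let g := p.2
        let good ← loop (List.range (digitRange n g)) ([] : List ℕ) fun r acc => do
          let cnt ← loop (List.finRange cA) (0 : ℕ) fun a cnt =>
            op (2 * d + 16) (if
              ‖om (-(((digitStep n g * (f s + base n ^ (g - 1) * r) : ℕ) : ZMod n) * (A a).2 s)) *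
                (mm (a, digitShift s g) j / mm (a, 0) j) - 1‖ < 1 / 3
              then cnt + 1 else cnt)
          op 4 (if 3 * cA ≤ 5 * cnt then r :: acc else acc)
        match good with
        | [r] => op 4 (some (Function.update f s (f s + base n ^ (g - 1) * r)))
        | _ => op 1 none

/-- `LocateSignal`: update the given measurements `m` of the signal to measurements of the residual
`x - χ`, then decode every bucket. -/
def locateSignal {d n : ℕ} [NeZero n] (c : ℕ) (χ : Idx d n → ℂ) (β : ℕ)
    (S : Matrix (Fin d) (Fin d) (ZMod n)) (q : Idx d n) {cA : ℕ} (A : Fin cA → Idx d n × Idx d n)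
    (m : Fin cA × Idx d n → Arr d) : Cost (Finset (Idx d n)) := do
  let mm ← tabulate (List.product (List.finRange cA) (shifts d n)) fun p => do
    let v ← hashToBins c zeroSignal χ β S q (star (A p.1) p.2)
    op (3 * d + (2 ^ β) ^ d) (m p + v)
  let Sinv ← op (8 * d ^ 3 * (Nat.log 2 n + 1)) S⁻¹
  loop (Fintype.piFinset fun _ : Fin d => Finset.range (2 ^ β)).toList ∅ fun j L => do
    let r ← decodeBucket A mm j
    match r with
    | none => op 1 L
    | some f => op (2 * d ^ 2 + d + 1) (insert (Sinv *ᵥ fun s => (f s : ZMod n)) L)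

/-! ## Estimation -/

/-- The exponent `β` of the side `b = 2 ^ β` of the hash table: `b` is the least power of two with
`T ≤ b ^ d`, where `T` is the prescribed number of buckets. -/
def bucketExp (d : ℕ) (T : ℝ) : ℕ := sInf {β : ℕ | T ≤ ((2 : ℝ) ^ β) ^ d}

/-- The prescribed number of buckets for location. -/
def locBuckets (d : ℕ) (α : ℝ) (k : ℕ) (ε : ℝ) : ℝ :=
  (2 * π) ^ (4 * d * sharp d) * k / (ε * α ^ d)

/-- The prescribed number of buckets for estimation. -/
def estBuckets (d : ℕ) (α : ℝ) (k : ℕ) (ε : ℝ) : ℝ :=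
  (2 * π) ^ (4 * d * sharp d) * k / (ε * α ^ (2 * d))

/-- `EstimateValues (x̂, χ, L, k, ε, ν, r)` with the random choices `(Σ_t, q_t, z_t)` for `t < r`:
estimate `x - χ` on `L` by coordinatewise medians, and keep the values that exceed `ν`. The result
is a sparse vector together with a set that contains its support. -/
def estimateValues {d n : ℕ} [NeZero n] (α : ℝ) (c : ℕ) (xhat χ : Idx d n → ℂ)
    (L : Finset (Idx d n)) (k : ℕ) (ε ν : ℝ) {r : ℕ} (ρ : Fin r → OddMat d n × Idx d n × Idx d n) :
    Cost (Finset (Idx d n) × (Idx d n → ℂ)) := do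
  let β := bucketExp d (estBuckets d α k ε)
  let b : ℕ := 2 ^ β
  let u ← tabulate (List.finRange r) fun t => do
    let ρt ← op (8 * d ^ 3 + 2 * d) (ρ t)
    hashToBins c (sample xhat) χ β ρt.1.1 ρt.2.1 ρt.2.2
  loop L.toList ((∅ : Finset (Idx d n)), fun _ : Idx d n => (0 : ℂ)) fun f st => do
    let w ← loop (List.finRange r) ([] : List ℂ) fun t ws =>
      op (6 * d ^ 2 + 16 * d + 8) ((u t (bucket b (ρ t).1.1 (ρ t).2.1 f) *
        (((filterG b (offset b (ρ t).1.1 (ρ t).2.1 f f))⁻¹ : ℝ) : ℂ) *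
          om (-((ρ t).2.2 ⬝ᵥ ((ρ t).1.1 *ᵥ f)))) :: ws)
    let re ← median (w.map Complex.re)
    let im ← median (w.map Complex.im)
    op (d + 4) (if ν < ‖(⟨re, im⟩ : ℂ)‖ then
      (insert f st.1, Function.update st.2 f ⟨re, im⟩) else st)

/-- The restriction of a sparse vector to its `m` largest elements in absolute value. -/
def keepTop {d n : ℕ} (m : ℕ) (w : Finset (Idx d n) × (Idx d n → ℂ)) : Cost (Idx d n → ℂ) := do
  let l ← sortList (fun i j => ‖w.2 j‖ ≤ ‖w.2 i‖) w.1.toList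
  loop (l.take m) (fun _ => 0) fun i y => op (d + 1) (Function.update y i (w.2 i))

/-! ## Recovery at constant signal-to-noise ratio -/

/-- The number `⌈C log log N⌉` of pairs of evaluation points. -/
def numShifts (C : ℝ) (d n : ℕ) : ℕ := ⌈C * Real.log (Real.log (len d n))⌉₊

/-- The number `⌈C log N⌉` of hashings used for estimation. -/
def numEst (C : ℝ) (d n : ℕ) : ℕ := ⌈C * Real.log (len d n)⌉₊

/-- The random choices: `(Σ, q)` and the pairs of evaluation points for location, and the triples
`(Σ_t, q_t, z_t)` for estimation. -/
abbrev Coins (C : ℝ) (d n : ℕ) : Type :=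
  (OddMat d n × Idx d n) × (Fin (numShifts C d n) → Idx d n × Idx d n) ×
    (Fin (numEst C d n) → OddMat d n × Idx d n × Idx d n)

/-- `RecoverAtConstantSNR (x̂, χ, k, ε)`. -/
def recoverAtConstantSNR {d n : ℕ} [NeZero n] (α C : ℝ) (c : ℕ) (xhat χ : Idx d n → ℂ) (k : ℕ)
    (ε : ℝ) (ρ : Coins C d n) : Cost (Idx d n → ℂ) := do
  let β := bucketExp d (locBuckets d α k ε)
  let H ← op (8 * d ^ 3 + d) ρ.1
  let A ← op (2 * d * numShifts C d n) ρ.2.1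
  let m ← tabulate (List.product (List.finRange (numShifts C d n)) (shifts d n)) fun p =>
    hashToBins c (sample xhat) 0 β H.1.1 H.2 (star (A p.1) p.2)
  let L ← locateSignal c χ β H.1.1 H.2 A m
  let w ← estimateValues α c xhat χ L (2 * k) ε 0 ρ.2.2
  keepTop (4 * k) w

end SparseFT

end

/-! The residual `x' = x - χ` is hashed by a random affine map. The bucket of a position `i` then
holds `G x'_i`, with a phase that is linear in the evaluation point, plus noise from the other
positions. The proof bounds this noise and shows that phases reveal positions and that medians
reveal values.

Noise. After removal of a power of two, the image of a fixed difference `j - i` is uniform over the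
vectors with an odd coordinate (`card_mulVec_eq`), so it lies within `2 ^ g` bucket widths of zero
with probability at most `2 (3 · 2 ^ g / b) ^ d`. With sharpness `2 d` the filter decays like `4 ^
(-g d)`, and its mean at the offset of `j` is `O(48 ^ d / b ^ d)` (`avg_abs_filterG_offset_le`).
This controls the head in `ℓ₁` and, by orthogonality of characters in the evaluation point, the tail
in `ℓ₂` (`avg_noiseTail_sq`). The number of buckets is chosen so that the collision factor, even
multiplied by the squared loss of the filter, is at most `ε / (2k)` (`GoodCall.collision_le`).

Location. If most pairs of evaluation points are accurate and no two digit values look alike at too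
many of them, voting recovers every digit (`decodeBucket_of_balanced`). The probability of missing
`i` is bounded linearly in head over `|x'_i|` and in tail energy over `|x'_i| ^ 2`. Weighted with
`|x'_i| ^ 2` and summed over `Q`, this gives an expected missed energy of order `ε Err ^ 2`
(`prob_missedMass`).

Estimation and selection. Medians of order `log N` estimates are simultaneously accurate to `O(√ε
μ)` at all positions (`prob_medEst`). More positions are kept than `Q` contains, so an element of
`Q` that is dropped can be charged to kept elements outside `Q`, whose energy has left the residual;
the leading constant therefore remains `1` (`selection_error`).

Numerical error. Poisson summation shows that the truncated sinc–Gaussian window reproduces low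
frequencies up to `exp (-W / 4)` (`exists_flatWindow_error`). With `W` of order `log N` this is any
prescribed power of `1 / N`.

Cost. There are about `log log N` pairs and `log n / log Δ` digits per axis; since `log Δ` is of
order `log log n`, the number of measurements is linear in `log N` up to powers of `d`
(`dom_measurements`). Each takes `2 ^ O(d ^ 2) k / ε` samples, and the window with its `O(log N) ^
d` grid points per entry accounts for the remaining logarithms of the running time. -/

namespace SparseFT

/-! ## Evaluation of the cost monad -/

section CostLemmas

variable {α β ι σ : Type}

@[simp] theorem pure_val (a : α) : (pure a : Cost α).val = a := rfl
@[simp] theorem pure_time (a : α) : (pure a : Cost α).time = 0 := rfl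
@[simp] theorem pure_samples (a : α) : (pure a : Cost α).samples = 0 := rfl
@[simp] theorem bind_val (m : Cost α) (f : α → Cost β) : (m >>= f).val = (f m.val).val := rfl
@[simp] theorem bind_time (m : Cost α) (f : α → Cost β) :
    (m >>= f).time = m.time + (f m.val).time := rfl
@[simp] theorem bind_samples (m : Cost α) (f : α → Cost β) :
    (m >>= f).samples = m.samples + (f m.val).samples := rfl
@[simp] theorem op_val (t : ℕ) (v : α) : (op t v).val = v := rfl
@[simp] theorem op_time (t : ℕ) (v : α) : (op t v).time = t := rfl
@[simp] theorem op_samples (t : ℕ) (v : α) : (op t v).samples = 0 := rfl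

theorem loop_val (l : List ι) (s : σ) (body : ι → σ → Cost σ) :
    (loop l s body).val = l.foldl (fun s i => (body i s).val) s := by
  induction l generalizing s with
  | nil => rfl
  | cons i l ih => simp [loop, ih]

theorem loop_time_le (l : List ι) (s : σ) (body : ι → σ → Cost σ) (T : ℕ)
    (h : ∀ i ∈ l, ∀ s, (body i s).time ≤ T) : (loop l s body).time ≤ l.length * (T + 1) := by
  induction l generalizing s with
  | nil => simp [loop]
  | cons i l ih =>
    have h1 := h i (by simp) s
    have h2 := ih (body i s).val fun j hj s => h j (by simp [hj]) s
    simp only [loop, bind_time, op_time, op_val, List.length_cons]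
    linarith

theorem loop_samples_le (l : List ι) (s : σ) (body : ι → σ → Cost σ) (T : ℕ)
    (h : ∀ i ∈ l, ∀ s, (body i s).samples ≤ T) : (loop l s body).samples ≤ l.length * T := by
  induction l generalizing s with
  | nil => simp [loop]
  | cons i l ih =>
    have h1 := h i (by simp) s
    have h2 := ih (body i s).val fun j hj s => h j (by simp [hj]) s
    simp only [loop, bind_samples, op_samples, op_val, List.length_cons]
    linarith

theorem tabulate_val [Zero β] (l : List ι) (f : ι → Cost β) (p : ι) (hp : p ∈ l) :
    (tabulate l f).val p = (f p).val := by
  have key : ∀ (l : List ι) (t : ι → β),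
      (l.foldl (fun t i => Function.update t i (f i).val) t) p =
        if p ∈ l then (f p).val else t p := by
    intro l
    induction l with
    | nil => simp
    | cons i l ih =>
      intro t
      rw [List.foldl_cons, ih]
      by_cases h : p = i
      · subst h; simp
      · simp [h]
  rw [tabulate, loop_val]
  simp only [bind_val, op_val]
  rw [key, if_pos hp]

theorem tabulate_val_of_notMem [Zero β] (l : List ι) (f : ι → Cost β) (p : ι) (hp : p ∉ l) :
    (tabulate l f).val p = 0 := by
  have key : ∀ (l : List ι) (t : ι → β), p ∉ l →
      (l.foldl (fun t i => Function.update t i (f i).val) t) p = t p := by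
    intro l
    induction l with
    | nil => simp
    | cons i l ih =>
      intro t hm
      rw [List.mem_cons, not_or] at hm
      rw [List.foldl_cons, ih _ hm.2, Function.update_of_ne hm.1]
  rw [tabulate, loop_val]
  exact key l _ hp

theorem tabulate_time_le [Zero β] (l : List ι) (f : ι → Cost β) (T : ℕ)
    (h : ∀ i ∈ l, (f i).time ≤ T) : (tabulate l f).time ≤ l.length * (T + 2) := by
  refine loop_time_le l _ _ (T + 1) fun i hi s => ?_
  simpa using h i hi

theorem tabulate_samples_le [Zero β] (l : List ι) (f : ι → Cost β) (T : ℕ)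
    (h : ∀ i ∈ l, (f i).samples ≤ T) : (tabulate l f).samples ≤ l.length * T := by
  refine loop_samples_le l _ _ T fun i hi s => ?_
  simpa using h i hi

/-- Two loops accumulate into a table: the spreading of window values over a grid and the folding of
frequencies modulo the number of buckets. By linearity a cell ends up with the sum of all
contributions addressed to it, collisions included. -/
theorem foldl_update_add {κ : Type} [DecidableEq κ] [AddCommMonoid β] (l : List ι) (y : κ → β) (c : ι → κ)
    (v : ι → β) (j : κ) :
    l.foldl (fun y p => Function.update y (c p) (y (c p) + v p)) y j =
      y j + (l.map fun p => if c p = j then v p else 0).sum := by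
  induction l generalizing y with
  | nil => simp
  | cons i l ih =>
    rw [List.foldl_cons, ih, List.map_cons, List.sum_cons, ← add_assoc]
    congr 1
    by_cases h : c i = j
    · subst h; simp
    · simp [h, Function.update_of_ne (Ne.symm h)]

theorem foldl_cons_map (l : List ι) (f : ι → β) (s : List β) :
    l.foldl (fun s i => f i :: s) s = (l.map f).reverse ++ s := by
  induction l generalizing s with
  | nil => simp
  | cons i l ih => simp [ih]

end CostLemmas

/-! ## Sorting and medians -/

section Sorting

variable {α : Type} (le : α → α → Prop)

theorem mergeLists_perm (xs ys : List α) : (mergeLists le xs ys).val.Perm (xs ++ ys) := by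
  induction xs, ys using mergeLists.induct le with
  | case1 ys => simp [mergeLists]
  | case2 xs h => cases xs <;> simp [mergeLists]
  | case3 x xs y ys h ih =>
    rw [mergeLists, if_pos h]
    exact ih.cons x
  | case4 x xs y ys h ih =>
    rw [mergeLists, if_neg h]
    exact (ih.cons y).trans (List.perm_middle (l₁ := x :: xs)).symm

theorem mergeLists_time (xs ys : List α) :
    (mergeLists le xs ys).time ≤ 2 * (xs.length + ys.length) := by
  induction xs, ys using mergeLists.induct le with
  | case1 ys => simp [mergeLists]
  | case2 xs h => cases xs <;> simp [mergeLists]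
  | case3 x xs y ys h ih =>
    rw [mergeLists, if_pos h]
    simp only [bind_time, op_time, List.length_cons] at ih ⊢
    omega
  | case4 x xs y ys h ih =>
    rw [mergeLists, if_neg h]
    simp only [bind_time, op_time, List.length_cons] at ih ⊢
    omega

theorem mergeLists_samples (xs ys : List α) : (mergeLists le xs ys).samples = 0 := by
  induction xs, ys using mergeLists.induct le with
  | case1 ys => simp [mergeLists]
  | case2 xs h => cases xs <;> simp [mergeLists]
  | case3 x xs y ys h ih =>
    rw [mergeLists, if_pos h]
    simpa using ih
  | case4 x xs y ys h ih =>
    rw [mergeLists, if_neg h]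
    simpa using ih

variable {le} in
theorem mergeLists_sorted (htr : ∀ a b c, le a b → le b c → le a c)
    (hto : ∀ a b, le a b ∨ le b a) (xs ys : List α) (hx : xs.Pairwise le) (hy : ys.Pairwise le) :
    (mergeLists le xs ys).val.Pairwise le := by
  induction xs, ys using mergeLists.induct le with
  | case1 ys => simpa [mergeLists] using hy
  | case2 xs h => cases xs <;> simpa [mergeLists] using hx
  | case3 x xs y ys h ih =>
    rw [mergeLists, if_pos h]
    rw [List.pairwise_cons] at hx
    refine List.pairwise_cons.2 ⟨fun z hz => ?_, ih hx.2 hy⟩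
    have hz := (mergeLists_perm le xs (y :: ys)).mem_iff.1 hz
    rw [List.pairwise_cons] at hy
    simp only [List.mem_append, List.mem_cons] at hz
    rcases hz with hz | rfl | hz
    · exact hx.1 z hz
    · exact h
    · exact htr _ _ _ h (hy.1 z hz)
  | case4 x xs y ys h ih =>
    rw [mergeLists, if_neg h]
    have h' : le y x := (hto x y).resolve_left h
    rw [List.pairwise_cons] at hy
    refine List.pairwise_cons.2 ⟨fun z hz => ?_, ih hx hy.2⟩
    have hz := (mergeLists_perm le (x :: xs) ys).mem_iff.1 hz
    rw [List.pairwise_cons] at hx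
    simp only [List.mem_append, List.mem_cons] at hz
    rcases hz with (rfl | hz) | hz
    · exact h'
    · exact htr _ _ _ h' (hx.1 z hz)
    · exact hy.1 z hz

theorem sortDepth_perm (t : ℕ) (l : List α) : (sortDepth le t l).val.Perm l := by
  induction t generalizing l with
  | zero => simp [sortDepth]
  | succ t ih =>
    rw [sortDepth]
    split_ifs with h
    · simp
    · simp only [bind_val, op_val, List.splitAt_eq]
      refine (mergeLists_perm le _ _).trans ?_
      refine ((ih _).append (ih _)).trans ?_
      rw [List.take_append_drop]

theorem sortDepth_time (t : ℕ) (l : List α) : (sortDepth le t l).time ≤ 4 * l.length * t := by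
  induction t generalizing l with
  | zero => simp [sortDepth]
  | succ t ih =>
    rw [sortDepth]
    split_ifs with h
    · simp
    · simp only [bind_val, bind_time, op_time, op_val, List.splitAt_eq]
      have h1 := ih (l.take (l.length / 2))
      have h2 := ih (l.drop (l.length / 2))
      have h3 := mergeLists_time le (sortDepth le t (l.take (l.length / 2))).val
        (sortDepth le t (l.drop (l.length / 2))).val
      rw [(sortDepth_perm le t _).length_eq, (sortDepth_perm le t _).length_eq] at h3
      have h4 : (l.take (l.length / 2)).length + (l.drop (l.length / 2)).length = l.length := by
        rw [← List.length_append, List.take_append_drop]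
      have h5 : 4 * (l.take (l.length / 2)).length * t + 4 * (l.drop (l.length / 2)).length * t
          = 4 * l.length * t := by
        rw [← add_mul, ← mul_add, h4]
      rw [h4] at h3
      calc _ ≤ 2 * l.length + (4 * l.length * t + 2 * l.length) := by omega
        _ = _ := by ring

theorem sortDepth_samples (t : ℕ) (l : List α) : (sortDepth le t l).samples = 0 := by
  induction t generalizing l with
  | zero => simp [sortDepth]
  | succ t ih =>
    rw [sortDepth]
    split_ifs with h
    · simp
    · simp [ih, mergeLists_samples]

variable {le} in
theorem sortDepth_sorted (htr : ∀ a b c, le a b → le b c → le a c)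
    (hto : ∀ a b, le a b ∨ le b a) (t : ℕ) (l : List α) (hl : l.length ≤ 2 ^ t) :
    (sortDepth le t l).val.Pairwise le := by
  induction t generalizing l with
  | zero =>
    rcases l with _ | ⟨a, _ | ⟨b, l⟩⟩
    · simp [sortDepth]
    · simp [sortDepth]
    · simp at hl
  | succ t ih =>
    rw [sortDepth]
    split_ifs with h
    · rcases l with _ | ⟨a, _ | ⟨b, l⟩⟩
      · simp
      · simp
      · simp at h
    · simp only [bind_val, op_val, List.splitAt_eq]
      rw [pow_succ] at hl
      exact mergeLists_sorted htr hto _ _ (ih _ (by simp; omega)) (ih _ (by simp; omega))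

theorem sortList_perm (l : List α) : (sortList le l).val.Perm l := sortDepth_perm _ _ _

variable {le} in
theorem sortList_sorted (htr : ∀ a b c, le a b → le b c → le a c)
    (hto : ∀ a b, le a b ∨ le b a) (l : List α) : (sortList le l).val.Pairwise le :=
  sortDepth_sorted htr hto _ _ (Nat.le_pow_clog (by norm_num) _)

theorem sortList_time (l : List α) :
    (sortList le l).time ≤ 4 * l.length * Nat.clog 2 l.length := sortDepth_time _ _ _

theorem sortList_samples (l : List α) : (sortList le l).samples = 0 := sortDepth_samples _ _ _

theorem median_samples (l : List ℝ) : (median l).samples = 0 := by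
  simp [median, sortList_samples]

theorem median_time (l : List ℝ) :
    (median l).time ≤ 4 * l.length * Nat.clog 2 l.length + 1 := by
  simpa [median] using sortList_time (fun a b : ℝ => a ≤ b) l

/-- If more than half of the entries are within `δ` of `x`, then so is the median. -/
theorem median_near (l : List ℝ) (x δ : ℝ)
    (h : l.length < 2 * l.countP fun v => decide (|v - x| ≤ δ)) :
    |(median l).val - x| ≤ δ := by
  set s := (sortList (fun a b : ℝ => a ≤ b) l).val with hs
  have hp : s.Perm l := sortList_perm _ l
  have hsort : s.Pairwise (fun a b => a ≤ b) :=
    sortList_sorted (le := fun a b : ℝ => a ≤ b) (fun a b c => le_trans) (fun a b => le_total a b) l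
  have hlen : s.length = l.length := hp.length_eq
  set k := (l.length - 1) / 2 with hk
  have hpos : 0 < l.length := by
    rcases Nat.eq_zero_or_pos l.length with h0 | h0
    · rw [List.length_eq_zero_iff.1 h0] at h; simp at h
    · exact h0
  have hks : k < s.length := by omega
  have hv : (median l).val = s[k] := by
    simp only [median, bind_val, op_val, ← hs]
    exact List.getD_eq_getElem _ _ hks
  rw [hv]
  rw [← hp.countP_eq] at h
  have hle : ∀ i j : ℕ, ∀ hi : i < s.length, ∀ hj : j < s.length, i ≤ j → s[i] ≤ s[j] := by
    intro i j hi hj hij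
    rcases hij.eq_or_lt with rfl | hij
    · exact le_rfl
    · exact List.pairwise_iff_getElem.1 hsort i j hi hj hij
  rw [abs_le]
  by_contra hcon
  rw [not_and_or, not_le, not_le] at hcon
  rcases hcon with hcon | hcon
  -- If the median is below `x - δ`, so are the first `k + 1` sorted entries, at least half of all;
  -- if it is above `x + δ`, the same holds for the entries from index `k` on. Either way at most
  -- half of the entries are good.
  · have h0 : (s.take (k + 1)).countP (fun v => decide (|v - x| ≤ δ)) = 0 := by
      rw [List.countP_eq_zero]
      intro v hv
      obtain ⟨i, hi, rfl⟩ := List.mem_take_iff_getElem.1 hv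
      have := hle i k (by omega) hks (by omega)
      rw [decide_eq_true_eq, abs_le]
      intro hh
      linarith [hh.1]
    have h1 := List.countP_append (p := fun v => decide (|v - x| ≤ δ)) (l₁ := s.take (k + 1))
      (l₂ := s.drop (k + 1))
    rw [List.take_append_drop, h0, zero_add] at h1
    have h2 := List.countP_le_length (p := fun v => decide (|v - x| ≤ δ)) (l := s.drop (k + 1))
    rw [List.length_drop] at h2
    omega
  · have h0 : (s.drop k).countP (fun v => decide (|v - x| ≤ δ)) = 0 := by
      rw [List.countP_eq_zero]
      intro v hv
      obtain ⟨i, hi, rfl⟩ := List.mem_iff_getElem.1 hv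
      rw [List.length_drop] at hi
      rw [List.getElem_drop]
      have := hle k (k + i) hks (by omega) (by omega)
      rw [decide_eq_true_eq, abs_le]
      intro hh
      linarith [hh.2]
    have h1 := List.countP_append (p := fun v => decide (|v - x| ≤ δ)) (l₁ := s.take k)
      (l₂ := s.drop k)
    rw [List.take_append_drop, h0, add_zero] at h1
    have h2 := List.countP_le_length (p := fun v => decide (|v - x| ≤ δ)) (l := s.take k)
    rw [List.length_take] at h2
    omega

end Sorting

/-! ## The fast Fourier transform -/

section FFT

variable {d : ℕ}

/-- The twiddle factor of the radix-2 transform. -/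
noncomputable def twiddle (θ : ℝ) (m : ℕ) (t f : ℕ) : ℂ :=
  Complex.exp (Complex.I * ((θ * (t : ℝ) * (f : ℝ) / 2 ^ m : ℝ) : ℂ))

/-- Splitting into even and odd `t` is the radix-2 recursion. The angle is an integer multiple of `2
π`, so a transform of length `2 ^ m` has period `2 ^ m` in the output frequency; this is what
permits reading the halves at `f s % 2 ^ m`. -/
theorem fftAxis_val (a : ℤ) (lines : ℕ) (s : Fin d) (m : ℕ) (v : Arr d) (f : Fin d → ℕ) :
    (fftAxis (a * (2 * π)) lines s m v).val f =
      ∑ t ∈ Finset.range (2 ^ m),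
        v (Function.update f s t) * twiddle (a * (2 * π)) m t (f s) := by
  induction m generalizing v f with
  | zero => simp [fftAxis, twiddle]
  | succ m ih =>
    rw [fftAxis]
    simp only [bind_val, op_val, ih, Function.update_self, Function.update_idem]
    have hsplit : ∀ g : ℕ → ℂ, ∑ t ∈ Finset.range (2 ^ (m + 1)), g t =
        ∑ t ∈ Finset.range (2 ^ m), g (2 * t) + ∑ t ∈ Finset.range (2 ^ m), g (2 * t + 1) := by
      intro g
      rw [pow_succ]
      induction 2 ^ m with
      | zero => simp
      | succ r ihr =>
        rw [show (r + 1) * 2 = r * 2 + 1 + 1 by ring, Finset.sum_range_succ,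
          Finset.sum_range_succ, ihr, Finset.sum_range_succ, Finset.sum_range_succ,
          mul_comm r 2]
        ring
    rw [hsplit, Finset.mul_sum]
    have hmod : ∀ t : ℕ, twiddle (a * (2 * π)) m t (f s % 2 ^ m) = twiddle (a * (2 * π)) m t (f s) := by
      intro t
      rw [twiddle, twiddle, Complex.exp_eq_exp_iff_exists_int]
      obtain ⟨q, hq⟩ : ∃ q, f s = f s % 2 ^ m + 2 ^ m * q := ⟨_, (Nat.mod_add_div _ _).symm⟩
      refine ⟨-(a * t * q), ?_⟩
      have hf : ((f s : ℕ) : ℂ) = ((f s % 2 ^ m : ℕ) : ℂ) + 2 ^ m * (q : ℂ) := by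
        exact_mod_cast hq
      push_cast
      rw [hf]
      field_simp
      ring
    congr 1
    · refine Finset.sum_congr rfl fun t _ => ?_
      rw [hmod]
      congr 1
      rw [twiddle, twiddle]
      congr 3
      push_cast
      rw [pow_succ]
      field_simp
    · refine Finset.sum_congr rfl fun t _ => ?_
      rw [hmod, mul_left_comm]
      congr 1
      rw [twiddle, twiddle, ← Complex.exp_add, ← mul_add]
      congr 2
      rw [← Complex.ofReal_add]
      congr 1
      push_cast
      field_simp
      ring

/-- The box of side `M`, restricted to the axes in `l` and with the other coordinates fixed. -/
noncomputable def axisBox (M : ℕ) (l : List (Fin d)) (f : Fin d → ℕ) : Finset (Fin d → ℕ) :=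
  Fintype.piFinset fun s => if s ∈ l then Finset.range M else {f s}

/-- Induction over the axes still to be transformed. A transformed axis holds an output frequency,
which must stay fixed at `f s` during the later passes; hence no axis may recur in the list. -/
theorem loop_fftAxis_val (a : ℤ) (lines m : ℕ) (l : List (Fin d)) (hl : l.Nodup) (v : Arr d)
    (f : Fin d → ℕ) :
    (loop l v fun s y => fftAxis (a * (2 * π)) lines s m y).val f =
      ∑ t ∈ axisBox (2 ^ m) l f, v t * (l.map fun s => twiddle (a * (2 * π)) m (t s) (f s)).prod := by
  induction l generalizing v with
  | nil =>
    have : axisBox (2 ^ m) [] f = {f} := by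
      ext t; simp [axisBox, funext_iff]
    simp [this, loop]
  | cons s l ih =>
    rw [List.nodup_cons] at hl
    have : (loop (s :: l) v fun s y => fftAxis (a * (2 * π)) lines s m y).val f =
      (loop l (fftAxis (a * (2 * π)) lines s m v).val
        fun s y => fftAxis (a * (2 * π)) lines s m y).val f := rfl
    rw [this, ih hl.2]
    simp only [fftAxis_val, Finset.sum_mul]
    rw [← Finset.sum_product']
    refine Finset.sum_nbij' (fun p => Function.update p.1 s p.2)
      (fun t => (Function.update t s (f s), t s)) ?_ ?_ ?_ ?_ ?_
    · rintro ⟨t, r⟩ h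
      simp only [axisBox, Finset.mem_product, Fintype.mem_piFinset] at h ⊢
      intro u
      by_cases hu : u = s
      · subst hu; simpa using h.2
      · have := h.1 u
        simpa [hu] using this
    · intro t h
      simp only [axisBox, Finset.mem_product, Fintype.mem_piFinset] at h ⊢
      refine ⟨fun u => ?_, by simpa using h s⟩
      by_cases hu : u = s
      · subst hu; simp [hl.1]
      · have := h u
        simpa [hu] using this
    · rintro ⟨t, r⟩ h
      simp only [axisBox, Finset.mem_product, Fintype.mem_piFinset] at h
      have := h.1 s
      simp only [hl.1, if_false, Finset.mem_singleton] at this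
      simp [← this]
    · intro t h
      simp
    · rintro ⟨t, r⟩ h
      simp only [axisBox, Finset.mem_product, Fintype.mem_piFinset] at h
      have := h.1 s
      simp only [hl.1, if_false, Finset.mem_singleton] at this
      simp only [List.map_cons, List.prod_cons, Function.update_self, this, mul_assoc]
      congr 3
      refine List.map_congr_left fun u hu => ?_
      rw [Function.update_of_ne]
      rintro rfl
      exact hl.1 hu

theorem fft_val (a : ℤ) (m : ℕ) (v : Arr d) (f : Fin d → ℕ) :
    (fft (a * (2 * π)) m v).val f =
      ∑ t ∈ Fintype.piFinset (fun _ : Fin d => Finset.range (2 ^ m)),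
        v t * ∏ s, twiddle (a * (2 * π)) m (t s) (f s) := by
  rw [fft, loop_fftAxis_val _ _ _ _ (List.nodup_finRange d)]
  have : axisBox (2 ^ m) (List.finRange d) f =
      Fintype.piFinset (fun _ : Fin d => Finset.range (2 ^ m)) := by
    simp [axisBox]
  rw [this]
  refine Finset.sum_congr rfl fun t _ => ?_
  rw [← List.ofFn_eq_map, List.prod_ofFn]

theorem fftAxis_time (θ : ℝ) (lines : ℕ) (s : Fin d) (m : ℕ) (v : Arr d) :
    (fftAxis θ lines s m v).time = (2 * d + 4) * lines * (m * 2 ^ m) := by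
  induction m generalizing v with
  | zero => simp [fftAxis]
  | succ m ih =>
    rw [fftAxis]
    simp only [bind_time, op_time, ih]
    ring

theorem fftAxis_samples (θ : ℝ) (lines : ℕ) (s : Fin d) (m : ℕ) (v : Arr d) :
    (fftAxis θ lines s m v).samples = 0 := by
  induction m generalizing v with
  | zero => simp [fftAxis]
  | succ m ih =>
    rw [fftAxis]
    simp [ih]

theorem fft_time (θ : ℝ) (m : ℕ) (v : Arr d) :
    (fft θ m v).time ≤ d * ((2 * d + 4) * (2 ^ m) ^ (d - 1) * (m * 2 ^ m) + 1) := by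
  have := loop_time_le (List.finRange d) v (fun s y => fftAxis θ ((2 ^ m) ^ (d - 1)) s m y) _
    fun s _ y => (fftAxis_time θ ((2 ^ m) ^ (d - 1)) s m y).le
  rwa [List.length_finRange] at this

theorem fft_samples (θ : ℝ) (m : ℕ) (v : Arr d) : (fft θ m v).samples = 0 := by
  have := loop_samples_le (List.finRange d) v (fun s y => fftAxis θ ((2 ^ m) ^ (d - 1)) s m y) 0
    fun s _ y => (fftAxis_samples θ ((2 ^ m) ^ (d - 1)) s m y).le
  exact Nat.le_zero.1 this

end FFT

end SparseFT

namespace SparseFT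

/-! ## Roots of unity -/

section RootsOfUnity

variable {d n : ℕ} [NeZero n]

theorem om_eq_stdAddChar (z : ZMod n) : om z = ZMod.stdAddChar z := by
  rw [ZMod.stdAddChar_apply, ZMod.toCircle_apply, om]

theorem om_add (y z : ZMod n) : om (y + z) = om y * om z := by
  simp only [om_eq_stdAddChar, AddChar.map_add_eq_mul]

@[simp] theorem om_zero : om (0 : ZMod n) = 1 := by
  simp only [om_eq_stdAddChar, AddChar.map_zero_eq_one]

@[simp] theorem norm_om (z : ZMod n) : ‖om z‖ = 1 := by
  rw [om_eq_stdAddChar, ZMod.stdAddChar_apply, Circle.norm_coe]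

theorem om_ne_zero (z : ZMod n) : om z ≠ 0 := by
  rw [← norm_ne_zero_iff, norm_om]; exact one_ne_zero

theorem om_neg_mul (z : ZMod n) : om (-z) * om z = 1 := by
  rw [← om_add, neg_add_cancel, om_zero]

theorem om_neg (z : ZMod n) : om (-z) = (starRingEnd ℂ) (om z) := by
  have h := om_neg_mul z
  have h2 : (starRingEnd ℂ) (om z) * om z = 1 := by
    rw [mul_comm, Complex.mul_conj, Complex.normSq_eq_norm_sq, norm_om]; simp
  exact mul_right_cancel₀ (om_ne_zero z) (h.trans h2.symm)

theorem om_intCast (j : ℤ) : om (j : ZMod n) = Complex.exp (2 * π * Complex.I * j / n) := by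
  rw [om_eq_stdAddChar, ZMod.stdAddChar_coe]

theorem om_sum {ι : Type*} (s : Finset ι) (f : ι → ZMod n) :
    om (∑ i ∈ s, f i) = ∏ i ∈ s, om (f i) := by
  induction s using Finset.induction_on with
  | empty => simp
  | insert i s hi ih => rw [Finset.sum_insert hi, Finset.prod_insert hi, om_add, ih]

theorem om_dotProduct (y z : Idx d n) : om (y ⬝ᵥ z) = ∏ s, om (y s * z s) := om_sum _ _

/-- Orthogonality of characters. -/
theorem sum_om_dotProduct (z : Idx d n) :
    ∑ a : Idx d n, om (a ⬝ᵥ z) = if z = 0 then ((n ^ d : ℕ) : ℂ) else 0 := by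
  have h1 : ∑ a : Idx d n, om (a ⬝ᵥ z) = ∏ s, ∑ a : ZMod n, om (a * z s) := by
    rw [Finset.prod_univ_sum, Fintype.piFinset_univ]
    exact Finset.sum_congr rfl fun a _ => om_dotProduct a z
  have h2 : ∀ y : ZMod n, ∑ a : ZMod n, om (a * y) = if y = 0 then (n : ℂ) else 0 := by
    intro y
    simp only [om_eq_stdAddChar]
    rw [AddChar.sum_mulShift y (ZMod.isPrimitive_stdAddChar n), ZMod.card]
    split_ifs <;> simp
  rw [h1]
  simp only [h2]
  split_ifs with hz
  · subst hz; simp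
  · obtain ⟨s, hs⟩ : ∃ s, z s ≠ 0 := by
      by_contra! h; exact hz (funext h)
    exact Finset.prod_eq_zero (Finset.mem_univ s) (if_neg hs)

/-- Parseval's identity for sums of distinct characters. -/
theorem sum_norm_sq_characters {ι : Type*} (s : Finset ι) (φ : ι → Idx d n)
    (hφ : Set.InjOn φ s) (c : ι → ℂ) :
    ∑ a : Idx d n, ‖∑ j ∈ s, c j * om (a ⬝ᵥ φ j)‖ ^ 2 = (n : ℝ) ^ d * ∑ j ∈ s, ‖c j‖ ^ 2 := by
  have h : ((∑ a : Idx d n, ‖∑ j ∈ s, c j * om (a ⬝ᵥ φ j)‖ ^ 2 : ℝ) : ℂ) =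
      (((n : ℝ) ^ d * ∑ j ∈ s, ‖c j‖ ^ 2 : ℝ) : ℂ) := by
    push_cast
    have h1 : ∀ a : Idx d n, ((‖∑ j ∈ s, c j * om (a ⬝ᵥ φ j)‖ : ℂ)) ^ 2 =
        ∑ j ∈ s, ∑ l ∈ s, c j * (starRingEnd ℂ) (c l) * om (a ⬝ᵥ (φ j - φ l)) := by
      intro a
      rw [← Complex.mul_conj', map_sum, Finset.sum_mul_sum]
      refine Finset.sum_congr rfl fun j _ => Finset.sum_congr rfl fun l _ => ?_
      rw [map_mul, ← om_neg, dotProduct_sub, sub_eq_add_neg, om_add]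
      ring
    simp only [h1]
    rw [Finset.sum_comm, Finset.mul_sum]
    refine Finset.sum_congr rfl fun j hj => ?_
    rw [Finset.sum_comm]
    simp only [← Finset.mul_sum, sum_om_dotProduct]
    rw [Finset.sum_eq_single j]
    · rw [sub_self, if_pos rfl, Complex.mul_conj']; push_cast; ring
    · intro l hl hlj
      rw [if_neg, mul_zero]
      rw [sub_eq_zero]
      exact fun h => hlj (hφ hl hj h.symm)
    · exact fun h => absurd hj h
  exact_mod_cast h

end RootsOfUnity

/-! ## The Dirichlet kernel -/

section Dirichlet

variable {n : ℕ} [NeZero n]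

/-- Multiplication by `sin θ` turns each exponential into a difference of two whose exponents are `2
θ` apart, and the sum telescopes. -/
theorem dirichlet_sum_mul_sin (h : ℕ) (θ : ℝ) :
    (∑ u ∈ Finset.range (2 * h + 1), Complex.exp (Complex.I * (((h : ℝ) - u) * (2 * θ) : ℝ))) *
      Complex.sin θ = Complex.sin (((2 * h + 1 : ℝ) * θ : ℝ)) := by
  have key : ∀ u : ℕ, Complex.exp (Complex.I * (((h : ℝ) - u) * (2 * θ) : ℝ)) * Complex.sin θ =
      Complex.exp (Complex.I * (θ * (2 * h + 1 - 2 * (u + 1 : ℕ)) : ℝ)) * (Complex.I / 2) -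
      Complex.exp (Complex.I * (θ * (2 * h + 1 - 2 * (u : ℕ)) : ℝ)) * (Complex.I / 2) := by
    intro u
    rw [Complex.sin]
    have e1 : Complex.exp (Complex.I * (θ * (2 * h + 1 - 2 * (u + 1 : ℕ)) : ℝ)) =
      Complex.exp (Complex.I * (((h : ℝ) - u) * (2 * θ) : ℝ)) * Complex.exp (-θ * Complex.I) := by
      rw [← Complex.exp_add]; congr 1; push_cast; ring
    have e2 : Complex.exp (Complex.I * (θ * (2 * h + 1 - 2 * (u : ℕ)) : ℝ)) =
      Complex.exp (Complex.I * (((h : ℝ) - u) * (2 * θ) : ℝ)) * Complex.exp (θ * Complex.I) := by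
      rw [← Complex.exp_add]; congr 1; push_cast; ring
    rw [e1, e2]
    ring
  rw [Finset.sum_mul]
  simp only [key]
  rw [Finset.sum_range_sub (fun u : ℕ =>
    Complex.exp (Complex.I * (θ * (2 * h + 1 - 2 * (u : ℕ)) : ℝ)) * (Complex.I / 2)),
    Complex.sin, ← sub_mul]
  have e1 : Complex.I * ((θ * (2 * h + 1 - 2 * ((2 * h + 1 : ℕ))) : ℝ) : ℂ) =
      -(((2 * h + 1) * θ : ℝ) : ℂ) * Complex.I := by push_cast; ring
  have e2 : Complex.I * ((θ * (2 * h + 1 - 2 * ((0 : ℕ) : ℝ)) : ℝ) : ℂ) =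
      (((2 * h + 1) * θ : ℝ) : ℂ) * Complex.I := by push_cast; ring
  rw [e1, e2]
  ring

theorem sin_pi_val_ne_zero {z : ZMod n} (hz : z ≠ 0) : Real.sin (π * z.val / n) ≠ 0 := by
  have hn : (0 : ℝ) < n := by exact_mod_cast NeZero.pos n
  have h1 : (0 : ℝ) < z.val := by
    exact_mod_cast Nat.pos_of_ne_zero fun h => hz ((ZMod.val_eq_zero z).1 h)
  have h2 : (z.val : ℝ) < n := by exact_mod_cast ZMod.val_lt z
  refine (Real.sin_pos_of_pos_of_lt_pi (by positivity) ?_).ne'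
  rw [div_lt_iff₀ hn]
  exact mul_lt_mul_of_pos_left h2 Real.pi_pos

/-- The Dirichlet kernel is the transform of the rectangular pulse. -/
theorem sum_om_eq_dirichlet {b h : ℕ} (hb : b = 2 * h + 2) (z : ZMod n) :
    ∑ u ∈ Finset.range (2 * h + 1), om ((((h : ℤ) - u : ℤ) : ZMod n) * z) =
      (((b : ℝ) - 1) * dirichlet b z : ℝ) := by
  have hb' : (b : ℝ) - 1 = 2 * h + 1 := by rw [hb]; push_cast; ring
  have hn : (n : ℝ) ≠ 0 := NeZero.ne _
  rw [dirichlet, hb']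
  split_ifs with hz
  · subst hz; simp
  · set θ : ℝ := π * z.val / n with hθ
    have hs := sin_pi_val_ne_zero hz
    rw [← hθ] at hs
    have h1 := dirichlet_sum_mul_sin h θ
    have h2 : ∀ u : ℕ, om ((((h : ℤ) - u : ℤ) : ZMod n) * z) =
        Complex.exp (Complex.I * (((h : ℝ) - u) * (2 * θ) : ℝ)) := by
      intro u
      have : ((((h : ℤ) - u : ℤ) : ZMod n) * z) = ((((h : ℤ) - u) * z.val : ℤ) : ZMod n) := by
        push_cast
        rw [ZMod.natCast_zmod_val]
      rw [this, om_intCast]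
      congr 1
      rw [hθ]
      push_cast
      ring
    simp only [h2]
    have h3 : π * (2 * (h : ℝ) + 1) * z.val / n = (2 * h + 1) * θ := by rw [hθ]; ring
    rw [h3]
    have hs' : (Complex.sin θ) ≠ 0 := by exact_mod_cast hs
    rw [eq_div_iff hs'|>.2 h1, ← Complex.ofReal_sin, ← Complex.ofReal_sin, ← Complex.ofReal_div]
    congr 1
    have : (2 * (h : ℝ) + 1) ≠ 0 := by positivity
    field_simp

/-- The kernel is the mean of `2 h + 1` roots of unity. -/
theorem abs_dirichlet_le_one {b h : ℕ} (hb : b = 2 * h + 2) (z : ZMod n) : |dirichlet b z| ≤ 1 := by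
  have h1 := sum_om_eq_dirichlet hb z
  have h2 : ‖∑ u ∈ Finset.range (2 * h + 1), om ((((h : ℤ) - u : ℤ) : ZMod n) * z)‖ ≤ 2 * h + 1 := by
    refine (norm_sum_le _ _).trans ?_
    simp
  have hb' : (b : ℝ) - 1 = 2 * h + 1 := by rw [hb]; push_cast; ring
  have hp : (0 : ℝ) < 2 * h + 1 := by positivity
  rw [h1, Complex.norm_real, hb', Real.norm_eq_abs, abs_mul, abs_of_pos hp] at h2
  exact le_of_mul_le_mul_left (by linarith) hp

/-- Passing to the representative nearest to zero may shift the argument by `π`. Both sines then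
change sign, the numerator because `2 h + 1` is odd. In the new form the argument of the denominator
is at most `π / 2` in size, where sine has linear bounds. -/
theorem dirichlet_eq_valMinAbs {b h : ℕ} (hb : b = 2 * h + 2) {z : ZMod n} (hz : z ≠ 0) :
    dirichlet b z = Real.sin ((2 * h + 1) * (π * z.valMinAbs / n)) /
      ((2 * h + 1) * Real.sin (π * z.valMinAbs / n)) := by
  have hb' : (b : ℝ) - 1 = 2 * h + 1 := by rw [hb]; push_cast; ring
  have hn : (n : ℝ) ≠ 0 := NeZero.ne _
  rw [dirichlet, if_neg hz, hb', ZMod.valMinAbs_def_pos]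
  split_ifs with hv
  · congr 2
    push_cast; ring
  · have e1 : π * (((z.val : ℤ) - n : ℤ) : ℝ) / n = π * z.val / n - π := by
      push_cast; field_simp
    have e2 : (2 * (h : ℝ) + 1) * (π * z.val / n - π) =
        π * (2 * h + 1) * z.val / n - π - h * (2 * π) := by ring
    rw [e1, e2, Real.sin_sub_nat_mul_two_pi, Real.sin_sub_pi, Real.sin_sub_pi, mul_neg, neg_div_neg_eq]

theorem abs_valMinAbs_le (z : ZMod n) : |(z.valMinAbs : ℝ)| ≤ n / 2 := by
  have := ZMod.natAbs_valMinAbs_le z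
  have h2 : (z.valMinAbs.natAbs : ℝ) ≤ ((n / 2 : ℕ) : ℝ) := by exact_mod_cast this
  rw [Nat.cast_natAbs, Int.cast_abs] at h2
  exact h2.trans Nat.cast_div_le

/-- Decay of the Dirichlet kernel. -/
theorem abs_dirichlet_mul_le {b h : ℕ} (hb : b = 2 * h + 2) (z : ZMod n) :
    |dirichlet b z| * (b * |(z.valMinAbs : ℝ)|) ≤ n := by
  have hn : (0 : ℝ) < n := by exact_mod_cast NeZero.pos n
  by_cases hz : z = 0
  · subst hz; simp
  have hy0 : (0 : ℝ) < |(z.valMinAbs : ℝ)| := by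
    rw [abs_pos]; exact_mod_cast fun h => hz ((ZMod.valMinAbs_eq_zero z).1 h)
  rw [dirichlet_eq_valMinAbs hb hz, abs_div, abs_mul]
  set y : ℝ := (z.valMinAbs : ℝ)
  have hy : |π * y / n| ≤ π / 2 := by
    rw [abs_div, abs_mul, abs_of_pos Real.pi_pos, abs_of_pos hn, div_le_iff₀ hn]
    have := abs_valMinAbs_le z
    calc π * |y| ≤ π * (n / 2) := by gcongr
      _ = _ := by ring
  have h1 := Real.mul_abs_le_abs_sin hy
  have h2 : 2 / π * |π * y / n| = 2 * |y| / n := by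
    rw [abs_div, abs_mul, abs_of_pos Real.pi_pos, abs_of_pos hn]
    field_simp
  rw [h2] at h1
  have hb2 : (b : ℝ) ≤ 2 * (2 * h + 1) := by rw [hb]; push_cast; linarith
  have h3 : (0 : ℝ) < |2 * (h : ℝ) + 1| := by positivity
  have h4 : 0 < 2 * |y| / n := by positivity
  have h5 : 0 < |Real.sin (π * y / n)| := lt_of_lt_of_le h4 h1
  rw [div_mul_eq_mul_div, div_le_iff₀ (mul_pos h3 h5)]
  calc _ ≤ 1 * (2 * (2 * h + 1) * |y|) := by
        gcongr
        exact Real.abs_sin_le_one _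
    _ = n * (|2 * (h : ℝ) + 1| * (2 * |y| / n)) := by
        rw [abs_of_nonneg (by positivity : (0 : ℝ) ≤ 2 * (h : ℝ) + 1)]; field_simp
    _ ≤ _ := by gcongr

/-- The Dirichlet kernel on the central bucket. -/
theorem two_div_pi_le_dirichlet {b h : ℕ} (hb : b = 2 * h + 2) {z : ZMod n}
    (hz : |(z.valMinAbs : ℝ)| * (2 * b) ≤ n) : 2 / π ≤ dirichlet b z := by
  have hn : (0 : ℝ) < n := by exact_mod_cast NeZero.pos n
  by_cases h0 : z = 0
  · subst h0
    rw [dirichlet, if_pos rfl, div_le_one Real.pi_pos]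
    linarith [Real.pi_gt_three]
  rw [dirichlet_eq_valMinAbs hb h0]
  have hsym : ∀ x : ℝ, Real.sin ((2 * h + 1) * x) / ((2 * h + 1) * Real.sin x) =
      Real.sin ((2 * h + 1) * |x|) / ((2 * h + 1) * Real.sin |x|) := by
    intro x
    rcases abs_choice x with hx | hx <;> rw [hx]
    rw [mul_neg, Real.sin_neg, Real.sin_neg, mul_neg, neg_div_neg_eq]
  rw [hsym]
  have hy0 : (0 : ℝ) < |(z.valMinAbs : ℝ)| := by
    rw [abs_pos]; exact_mod_cast fun h => h0 ((ZMod.valMinAbs_eq_zero z).1 h)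
  set y : ℝ := (z.valMinAbs : ℝ)
  have e : |π * y / n| = π * |y| / n := by
    rw [abs_div, abs_mul, abs_of_pos Real.pi_pos, abs_of_pos hn]
  rw [e]
  set θ := π * |y| / n with hθ
  have hθ0 : 0 < θ := by positivity
  have hb1 : 2 * (h : ℝ) + 1 ≤ b := by rw [hb]; push_cast; linarith
  have h1 : (2 * h + 1) * θ ≤ π / 2 := by
    rw [hθ, ← mul_div_assoc, div_le_iff₀ hn]
    have : (2 * h + 1) * |y| ≤ n / 2 := by nlinarith
    nlinarith [Real.pi_pos]
  have h2 : 2 / π * ((2 * h + 1) * θ) ≤ Real.sin ((2 * h + 1) * θ) :=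
    Real.mul_le_sin (by positivity) h1
  have h3 : Real.sin θ ≤ θ := Real.sin_le hθ0.le
  have h4 : 0 < Real.sin θ := Real.sin_pos_of_pos_of_lt_pi hθ0 (by
    have : θ ≤ (2 * h + 1) * θ := by nlinarith [hθ0, (Nat.cast_nonneg h : (0 : ℝ) ≤ h)]
    linarith [Real.pi_pos])
  rw [le_div_iff₀ (by positivity)]
  refine le_trans ?_ h2
  gcongr

end Dirichlet

/-! ## The coefficients of the filter -/

section FilterTable

/-- A window sum is a difference of two prefix sums. The prefix sums start at `-R - h - 1`, one cell
before the first window, so that the left one also exists for `i = -R`. -/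
theorem pulseConv_val {b h R : ℕ} (hb : b = 2 * h + 2) (v : ℤ → ℝ) (i : ℤ) :
    (pulseConv b R v).val i = if i ∈ Finset.Icc (-(R : ℤ)) R then
      (∑ u ∈ Finset.range (2 * h + 1), v (i - h + u)) / ((b : ℝ) - 1) else 0 := by
  have hh : b / 2 - 1 = h := by omega
  have key : ∀ (lo : ℤ) (T : ℕ),
      ((List.range T).foldl (fun (st : ℝ × (ℤ → ℝ)) (t : ℕ) =>
        (st.1 + v (lo + t), Function.update st.2 (lo + t) (st.1 + v (lo + t))))
        ((0 : ℝ), fun _ : ℤ => (0 : ℝ))).1 = ∑ t ∈ Finset.range T, v (lo + t) ∧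
      ∀ t < T, ((List.range T).foldl (fun (st : ℝ × (ℤ → ℝ)) (t : ℕ) =>
        (st.1 + v (lo + t), Function.update st.2 (lo + t) (st.1 + v (lo + t))))
        ((0 : ℝ), fun _ : ℤ => (0 : ℝ))).2 (lo + t) = ∑ r ∈ Finset.range (t + 1), v (lo + r) := by
    intro lo T
    induction T with
    | zero => simp
    | succ T ih =>
      rw [List.range_succ, List.foldl_append]
      simp only [List.foldl_cons, List.foldl_nil]
      refine ⟨by rw [ih.1, Finset.sum_range_succ], fun t ht => ?_⟩
      rcases (Nat.lt_succ_iff.1 ht).eq_or_lt with rfl | ht'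
      · rw [Function.update_self, ih.1, Finset.sum_range_succ]
      · rw [Function.update_of_ne (by simpa using ht'.ne), ih.2 t ht']
  rw [pulseConv]
  simp only [bind_val, hh, loop_val, op_val]
  set st := (List.range (2 * R + 2 * h + 2)).foldl (fun (st : ℝ × (ℤ → ℝ)) (t : ℕ) =>
        (st.1 + v (-(R : ℤ) - h - 1 + t), Function.update st.2 (-(R : ℤ) - h - 1 + t)
          (st.1 + v (-(R : ℤ) - h - 1 + t)))) ((0 : ℝ), fun _ : ℤ => (0 : ℝ)) with hst
  have hk := (key (-(R : ℤ) - h - 1) (2 * R + 2 * h + 2)).2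
  rw [← hst] at hk
  have hmem : i ∈ List.map (fun t : ℕ => -(R : ℤ) + t) (List.range (2 * R + 1)) ↔
      i ∈ Finset.Icc (-(R : ℤ)) R := by
    simp only [List.mem_map, List.mem_range, Finset.mem_Icc]
    constructor
    · rintro ⟨t, ht, rfl⟩; omega
    · rintro ⟨h1, h2⟩; exact ⟨(i + R).toNat, by omega, by omega⟩
  split_ifs with hi
  · rw [tabulate_val _ _ _ (hmem.2 hi), op_val]
    congr 1
    rw [Finset.mem_Icc] at hi
    obtain ⟨t, ht⟩ : ∃ t : ℕ, i = -(R : ℤ) + t := ⟨(i + R).toNat, by omega⟩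
    have e1 : i + h = -(R : ℤ) - h - 1 + (t + (2 * h + 1) : ℕ) := by rw [ht]; push_cast; ring
    have e2 : i - h - 1 = -(R : ℤ) - h - 1 + (t : ℕ) := by rw [ht]; ring
    rw [e1, e2, hk _ (by omega), hk _ (by omega), show t + (2 * h + 1) + 1 = (t + 1) + (2 * h + 1) by ring,
      Finset.sum_range_add, add_sub_cancel_left]
    refine Finset.sum_congr rfl fun u _ => ?_
    congr 1
    rw [ht]; push_cast; ring
  · exact tabulate_val_of_notMem _ _ _ fun hm => hi (hmem.1 hm)

/-- The properties of the table of filter coefficients after `j` convolutions. -/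
structure IsFilterTable (n h R j : ℕ) [NeZero n] (v : ℤ → ℝ) : Prop where
  nonneg : ∀ t, 0 ≤ v t
  support : ∀ t, ((j * h : ℕ) : ℤ) < |t| → v t = 0
  transform : ∀ z : ZMod n, ∑ t ∈ Finset.Icc (-(R : ℤ)) R, (v t : ℂ) * om ((t : ZMod n) * z) =
    ((dirichlet (2 * h + 2) z ^ j : ℝ) : ℂ)

/-- Convolution with the pulse multiplies the transform by the Dirichlet kernel. The support grows
by `h` in each round, and `(j + 1) * h ≤ R` ensures that the truncation to `[-R, R]` cuts nothing
off. -/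
theorem IsFilterTable.pulseConv {n h R j : ℕ} [NeZero n] {v : ℤ → ℝ}
    (hv : IsFilterTable n h R j v) (hR : (j + 1) * h ≤ R) :
    IsFilterTable n h R (j + 1) (pulseConv (2 * h + 2) R v).val := by
  have hb1 : (0 : ℝ) < ((2 * h + 2 : ℕ) : ℝ) - 1 := by push_cast; linarith [(Nat.cast_nonneg h : (0 : ℝ) ≤ h)]
  have hRZ : ((j * h : ℕ) : ℤ) + h ≤ R := by
    have : j * h + h ≤ R := by linarith [add_mul j 1 h]
    exact_mod_cast this
  refine ⟨fun t => ?_, fun t ht => ?_, fun z => ?_⟩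
  · rw [pulseConv_val rfl]
    split_ifs
    · exact div_nonneg (Finset.sum_nonneg fun u _ => hv.nonneg _) hb1.le
    · exact le_rfl
  · rw [pulseConv_val rfl]
    split_ifs
    · rw [Finset.sum_eq_zero, zero_div]
      intro u hu
      refine hv.support _ ?_
      rw [Finset.mem_range] at hu
      have : ((j + 1) * h : ℕ) = j * h + h := by ring
      rw [this, Nat.cast_add, lt_abs] at ht
      rw [lt_abs]
      omega
    · rfl
  · have hD := sum_om_eq_dirichlet (n := n) (rfl : 2 * h + 2 = 2 * h + 2) z
    -- Both sums are first restricted to the true supports, between which `t ↦ t - h + u` is a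
    -- bijection of intervals.
    have hsh : ∀ u ∈ Finset.range (2 * h + 1),
        ∑ t ∈ Finset.Icc (-(R : ℤ)) R, (v (t - h + u) : ℂ) * om ((t : ZMod n) * z) =
        om ((((h : ℤ) - u : ℤ) : ZMod n) * z) *
          ∑ t ∈ Finset.Icc (-(R : ℤ)) R, (v t : ℂ) * om ((t : ZMod n) * z) := by
      intro u hu
      rw [Finset.mem_range] at hu
      have e1 : ∑ t ∈ Finset.Icc (-(R : ℤ)) R, (v t : ℂ) * om ((t : ZMod n) * z) =
          ∑ t ∈ Finset.Icc (-((j * h : ℕ) : ℤ)) (j * h : ℕ), (v t : ℂ) * om ((t : ZMod n) * z) := by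
        symm
        refine Finset.sum_subset (fun t ht => ?_) fun t _ ht => ?_
        · rw [Finset.mem_Icc] at ht ⊢; omega
        · rw [hv.support t, Complex.ofReal_zero, zero_mul]
          rw [Finset.mem_Icc] at ht
          rw [lt_abs]; omega
      have e2 : ∑ t ∈ Finset.Icc (-(R : ℤ)) R, (v (t - h + u) : ℂ) * om ((t : ZMod n) * z) =
          ∑ t ∈ Finset.Icc (-((j * h : ℕ) : ℤ) + (h - u)) ((j * h : ℕ) + (h - u)),
            (v (t - h + u) : ℂ) * om ((t : ZMod n) * z) := by
        symm
        refine Finset.sum_subset (fun t ht => ?_) fun t _ ht => ?_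
        · rw [Finset.mem_Icc] at ht ⊢; omega
        · rw [hv.support (t - h + u), Complex.ofReal_zero, zero_mul]
          rw [Finset.mem_Icc] at ht
          rw [lt_abs]; omega
      rw [e1, e2, Finset.mul_sum]
      refine Finset.sum_nbij' (fun t => t - h + u) (fun t => t + h - u) ?_ ?_ ?_ ?_ ?_
      · intro t ht; rw [Finset.mem_Icc] at ht ⊢; omega
      · intro t ht; rw [Finset.mem_Icc] at ht ⊢; omega
      · intro t _; ring
      · intro t _; ring
      · intro t _
        rw [mul_left_comm, ← om_add, ← add_mul]
        congr 3
        push_cast; ring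
    rw [Finset.sum_congr rfl fun t ht => by rw [pulseConv_val rfl, if_pos ht]]
    have e3 : ∀ t : ℤ, (((∑ u ∈ Finset.range (2 * h + 1), v (t - h + u)) /
        (((2 * h + 2 : ℕ) : ℝ) - 1) : ℝ) : ℂ) * om ((t : ZMod n) * z) =
        (∑ u ∈ Finset.range (2 * h + 1), (v (t - h + u) : ℂ) * om ((t : ZMod n) * z)) *
          (((((2 * h + 2 : ℕ) : ℝ) - 1)⁻¹ : ℝ) : ℂ) := by
      intro t
      rw [← Finset.sum_mul]
      push_cast
      ring
    simp only [e3]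
    rw [← Finset.sum_mul, Finset.sum_comm, Finset.sum_congr rfl hsh, ← Finset.sum_mul, hD,
      hv.transform, ← Complex.ofReal_mul, ← Complex.ofReal_mul]
    congr 1
    rw [pow_succ']
    field_simp

theorem filterTable_spec {n : ℕ} [NeZero n] (d : ℕ) {b h : ℕ} (hb : b = 2 * h + 2) :
    IsFilterTable n h (filterRadius d b) (sharp d) (filterTable d b).val := by
  have hh : b / 2 - 1 = h := by omega
  have hR : filterRadius d b = sharp d * h := by rw [filterRadius, hh]
  subst hb
  rw [filterTable, loop_val]
  have key : ∀ j ≤ sharp d, IsFilterTable n h (filterRadius d (2 * h + 2)) j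
      ((List.range j).foldl (fun v _ => (pulseConv (2 * h + 2) (filterRadius d (2 * h + 2)) v).val)
        (fun t : ℤ => if t = 0 then (1 : ℝ) else 0)) := by
    intro j
    induction j with
    | zero =>
      intro _
      refine ⟨fun t => by simp; split_ifs <;> norm_num, fun t ht => ?_, fun z => ?_⟩
      · have : t ≠ 0 := by rintro rfl; simp at ht
        simp [this]
      · rw [Finset.sum_eq_single 0]
        · simp
        · intro t _ ht; simp [ht]
        · intro h0; simp at h0
    | succ j ih =>
      intro hj
      rw [List.range_succ, List.foldl_append]
      refine (ih (by omega)).pulseConv ?_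
      rw [hR]
      exact Nat.mul_le_mul_right _ hj
  exact key _ le_rfl

variable {d n : ℕ} [NeZero n]

/-- The box of frequencies in the support of the filter. -/
noncomputable def freqBox (d R : ℕ) : Finset (Fin d → ℤ) :=
  Fintype.piFinset fun _ => Finset.Icc (-(R : ℤ)) R

/-- The transform of the product filter. -/
theorem sum_filterTable_mul_om {b h : ℕ} (hb : b = 2 * h + 2) (z : Idx d n) :
    ∑ i ∈ freqBox d (filterRadius d b), ((∏ s, (filterTable d b).val (i s) : ℝ) : ℂ) *
      om (-((fun s => ((i s : ℤ) : ZMod n)) ⬝ᵥ z)) = filterG b z := by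
  have hT := filterTable_spec (n := n) d hb
  have h1 : ∀ i : Fin d → ℤ, ((∏ s, (filterTable d b).val (i s) : ℝ) : ℂ) *
      om (-((fun s => ((i s : ℤ) : ZMod n)) ⬝ᵥ z)) =
      ∏ s, (starRingEnd ℂ) (((filterTable d b).val (i s) : ℂ) * om ((i s : ZMod n) * z s)) := by
    intro i
    rw [om_neg, om_dotProduct, map_prod]
    push_cast
    rw [← Finset.prod_mul_distrib]
    simp [map_mul]
  simp only [h1, freqBox]
  rw [← Finset.prod_univ_sum (fun _ => Finset.Icc (-(filterRadius d b : ℤ)) (filterRadius d b))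
    (fun s t => (starRingEnd ℂ) (((filterTable d b).val t : ℂ) * om ((t : ZMod n) * z s)))]
  simp only [← map_sum, hT.transform, filterG, Complex.conj_ofReal, ← hb]
  push_cast
  rfl

/-- The transform at zero, read off with `n = 1`. Together with nonnegativity it makes the
coefficients of the filter a probability distribution, so that numerical errors are averaged over
the frequencies and not amplified. -/
theorem sum_filterTable_prod {b h : ℕ} (d : ℕ) (hb : b = 2 * h + 2) :
    ∑ i ∈ freqBox d (filterRadius d b), ∏ s, (filterTable d b).val (i s) = 1 := by
  have h1 := sum_filterTable_mul_om (n := 1) (d := d) hb 0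
  simp only [dotProduct_zero, neg_zero, om_zero, mul_one] at h1
  have h2 : filterG b (0 : Idx d 1) = 1 := by simp [filterG, dirichlet]
  rw [h2] at h1
  exact_mod_cast h1

theorem filterTable_prod_nonneg {b h : ℕ} (d : ℕ) (hb : b = 2 * h + 2) (i : Fin d → ℤ) :
    0 ≤ ∏ s, (filterTable d b).val (i s) :=
  Finset.prod_nonneg fun _ _ => (filterTable_spec (n := 1) d hb).nonneg _

end FilterTable

end SparseFT

namespace SparseFT

/-! ## The flat window -/

section FlatWindow

/-- The sinc is the Fourier transform of the indicator of `[-1/2, 1/2]`. This writes the window as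
an average of Gaussian wave packets, to which Poisson summation applies. -/
theorem integral_exp_eq_sinc (u : ℝ) :
    ∫ ξ in (-(1 / 2) : ℝ)..(1 / 2), Complex.exp ((2 * π * u * Complex.I) * ξ) =
      (Real.sinc (π * u) : ℂ) := by
  by_cases hu : u = 0
  · subst hu; simp; norm_num
  have hπ : (π : ℂ) ≠ 0 := by exact_mod_cast Real.pi_ne_zero
  have hu' : (u : ℂ) ≠ 0 := by exact_mod_cast hu
  have hc : (2 * π * u * Complex.I : ℂ) ≠ 0 := by simp [hπ, hu']
  rw [integral_exp_mul_complex hc, Real.sinc_of_ne_zero (by simp [hu])]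
  push_cast
  rw [Complex.sin]
  have e1 : (2 * π * u * Complex.I : ℂ) * (1 / 2) = π * u * Complex.I := by ring
  have e2 : (2 * π * u * Complex.I : ℂ) * -(1 / 2) = -(π * u) * Complex.I := by ring
  rw [e1, e2]
  field_simp
  rw [Complex.I_sq]
  ring

theorem summable_exp_neg_abs : Summable fun k : ℤ => Real.exp (-(|(k : ℝ)| / 4)) := by
  have h : Summable fun k : ℕ => Real.exp (-((k : ℝ) / 4)) := by
    have := Real.summable_exp_nat_mul_iff (a := -(1 / 4)) |>.2 (by norm_num)
    refine this.congr fun k => ?_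
    congr 1; ring
  refine Summable.of_nat_of_neg ?_ ?_
  · simpa using h
  · simpa using h

/-- Replacing `v` by its integer part costs the factor `exp (1 / 4)` only, so the bound is uniform
in `v`. -/
theorem summable_exp_neg_abs_sub (v : ℝ) : Summable (fun p : ℤ => Real.exp (-(|(p : ℝ) - v| / 4))) ∧
    ∑' p : ℤ, Real.exp (-(|(p : ℝ) - v| / 4)) ≤
      Real.exp (1 / 4) * ∑' k : ℤ, Real.exp (-(|(k : ℝ)| / 4)) := by
  have hb : ∀ p : ℤ, Real.exp (-(|(p : ℝ) - v| / 4)) ≤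
      Real.exp (1 / 4) * Real.exp (-(|((p - ⌊v⌋ : ℤ) : ℝ)| / 4)) := by
    intro p
    rw [← Real.exp_add]
    refine Real.exp_le_exp.2 ?_
    have h1 : |((p - ⌊v⌋ : ℤ) : ℝ)| ≤ |(p : ℝ) - v| + |v - ⌊v⌋| := by
      push_cast
      have := abs_add_le ((p : ℝ) - v) (v - ⌊v⌋)
      rwa [sub_add_sub_cancel] at this
    have h2 : |v - ⌊v⌋| ≤ 1 := by
      rw [abs_le]; constructor <;> linarith [Int.floor_le v, Int.lt_floor_add_one v]
    linarith
  have hs : Summable fun p : ℤ => Real.exp (1 / 4) * Real.exp (-(|((p - ⌊v⌋ : ℤ) : ℝ)| / 4)) :=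
    ((Equiv.subRight ⌊v⌋).summable_iff.2 summable_exp_neg_abs).mul_left _
  refine ⟨Summable.of_nonneg_of_le (fun p => (Real.exp_pos _).le) hb hs, ?_⟩
  refine ((Summable.of_nonneg_of_le (fun p => (Real.exp_pos _).le) hb hs).tsum_le_tsum hb hs).trans ?_
  rw [tsum_mul_left]
  refine mul_le_mul_of_nonneg_left (le_of_eq ?_) (Real.exp_pos _).le
  exact (Equiv.subRight ⌊v⌋).tsum_eq fun k : ℤ => Real.exp (-(|(k : ℝ)| / 4))

/-- The Gaussian of the flat window decays at least exponentially. -/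
theorem exp_gauss_le {W : ℝ} (hW : 0 < W) (u : ℝ) :
    Real.exp (-u ^ 2 / (2 * W)) ≤ Real.exp W * Real.exp (-(|u| / 4)) := by
  rw [← Real.exp_add]
  refine Real.exp_le_exp.2 ?_
  rw [div_le_iff₀ (by positivity)]
  nlinarith [sq_nonneg (|u| - W / 4), sq_abs u, abs_nonneg u, sq_nonneg W]

/-- Poisson summation for a Gaussian wave packet. -/
theorem gauss_poisson {W : ℝ} (hW : 0 < W) (v η : ℝ) :
    ∑' p : ℤ, Complex.exp (-(((p : ℝ) - v : ℝ) : ℂ) ^ 2 / (2 * W) +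
        2 * π * Complex.I * η * (((p : ℝ) - v : ℝ) : ℂ)) =
      ∑' m : ℤ, ((√(2 * π * W) * Real.exp (-(2 * π ^ 2 * W * ((m : ℝ) - η) ^ 2)) : ℝ) : ℂ) *
        Complex.exp (-(2 * π * Complex.I * v * m)) := by
  have hπ : (π : ℂ) ≠ 0 := by exact_mod_cast Real.pi_ne_zero
  have hW' : (W : ℂ) ≠ 0 := by exact_mod_cast hW.ne'
  set a : ℝ := 1 / (2 * π * W) with ha
  have hapos : 0 < a := by positivity
  have haC : (a : ℂ) = 1 / (2 * π * W) := by rw [ha]; push_cast; rfl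
  -- The real part of the linear coefficient recentres the Gaussian at `v`, the imaginary part
  -- carries the frequency `η`; the summand then has the form required by the functional equation of
  -- the theta function.
  set b : ℂ := v / (2 * π * W) + Complex.I * η with hb
  have key := Complex.tsum_exp_neg_quadratic (a := (a : ℂ)) (by simpa using hapos) b
  have e1 : ∀ p : ℤ, Complex.exp (-(((p : ℝ) - v : ℝ) : ℂ) ^ 2 / (2 * W) +
        2 * π * Complex.I * η * (((p : ℝ) - v : ℝ) : ℂ)) =
      Complex.exp (-v ^ 2 / (2 * W) - 2 * π * Complex.I * η * v) *
        Complex.exp (-π * a * p ^ 2 + 2 * π * b * p) := by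
    intro p
    rw [← Complex.exp_add]
    congr 1
    rw [haC, hb]
    push_cast
    field_simp
    ring
  have e2 : 1 / (a : ℂ) ^ (1 / 2 : ℂ) = ((√(2 * π * W) : ℝ) : ℂ) := by
    have : (a : ℂ) ^ (1 / 2 : ℂ) = ((a ^ (1 / 2 : ℝ) : ℝ) : ℂ) := by
      rw [Complex.ofReal_cpow hapos.le]; norm_num
    rw [this, ← Real.sqrt_eq_rpow, ha, Real.sqrt_div zero_le_one, Real.sqrt_one]
    push_cast
    rw [one_div_one_div]
  have e3 : ∀ m : ℤ, Complex.exp (-v ^ 2 / (2 * W) - 2 * π * Complex.I * η * v) *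
        Complex.exp (-π / a * (m + Complex.I * b) ^ 2) =
      ((Real.exp (-(2 * π ^ 2 * W * ((m : ℝ) - η) ^ 2)) : ℝ) : ℂ) *
        Complex.exp (-(2 * π * Complex.I * v * m)) := by
    intro m
    rw [Complex.ofReal_exp, ← Complex.exp_add, ← Complex.exp_add]
    congr 1
    rw [haC, hb]
    have hI : (m : ℂ) + Complex.I * (v / (2 * π * W) + Complex.I * η) =
        (m - η) + Complex.I * (v / (2 * π * W)) := by
      linear_combination (η : ℂ) * Complex.I_sq
    rw [hI]
    push_cast
    have hsq : ((m : ℂ) - η + Complex.I * (v / (2 * π * W))) ^ 2 =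
        (m - η) ^ 2 + 2 * (m - η) * Complex.I * (v / (2 * π * W)) - (v / (2 * π * W)) ^ 2 := by
      linear_combination ((v : ℂ) / (2 * π * W)) ^ 2 * Complex.I_sq
    rw [hsq]
    field_simp
    ring
  simp only [e1]
  rw [tsum_mul_left, key, e2, mul_left_comm, ← tsum_mul_left, ← tsum_mul_left]
  refine tsum_congr fun m => ?_
  rw [e3]
  push_cast
  ring

/-- The mass that the `m`-th translate of the periodised Gaussian gives to the unit interval. -/
noncomputable def gaussMass (W τ : ℝ) (m : ℤ) : ℝ :=
  ∫ ξ in (-(1 / 2) : ℝ)..(1 / 2), √(2 * π * W) * Real.exp (-(2 * π ^ 2 * W * ((m : ℝ) - (ξ - τ)) ^ 2))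

/-- Since `|ξ - τ| ≤ 3/4`, a nonzero integer `m` has distance at least `|m| / 4` from `ξ - τ`, and
the exponent is then at least `W / 2 + |m| / 4`. Every translate but the central one is
exponentially small in `W`, summably in `m`. -/
theorem gauss_translate_le {W τ ξ : ℝ} (hW : 1 ≤ W) (hτ : |τ| ≤ 1 / 4) (hξ : |ξ| ≤ 1 / 2) (m : ℤ) :
    Real.exp (-(2 * π ^ 2 * W * ((m : ℝ) - (ξ - τ)) ^ 2)) ≤
      (if m = 0 then 1 else Real.exp (-(W / 2))) * Real.exp (-(|(m : ℝ)| / 4)) := by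
  split_ifs with hm
  · subst hm; simp; positivity
  · rw [← Real.exp_add]
    refine Real.exp_le_exp.2 ?_
    have hm1 : (1 : ℝ) ≤ |(m : ℝ)| := by
      rw [← Int.cast_abs]; exact_mod_cast Int.one_le_abs hm
    have h1 : |(m : ℝ)| / 4 ≤ |(m : ℝ) - (ξ - τ)| := by
      have h2 := abs_sub_abs_le_abs_sub (m : ℝ) (ξ - τ)
      have h3 := abs_sub ξ τ
      linarith
    have h4 : (|(m : ℝ)| / 4) ^ 2 ≤ ((m : ℝ) - (ξ - τ)) ^ 2 := by
      rw [← sq_abs ((m : ℝ) - (ξ - τ))]; gcongr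
    have hπ : 9 ≤ π ^ 2 := by nlinarith [Real.pi_gt_three]
    have h5 : 18 * W * (|(m : ℝ)| / 4) ^ 2 ≤ 2 * π ^ 2 * W * ((m : ℝ) - (ξ - τ)) ^ 2 := by
      have : 18 * W ≤ 2 * π ^ 2 * W := by nlinarith
      gcongr
    nlinarith [mul_le_mul hW hm1 zero_le_one (by linarith)]

theorem gaussMass_nonneg (W τ : ℝ) (m : ℤ) : 0 ≤ gaussMass W τ m :=
  intervalIntegral.integral_nonneg (by norm_num) fun ξ _ => by positivity

theorem gaussMass_le {W τ : ℝ} (hW : 1 ≤ W) (hτ : |τ| ≤ 1 / 4) {m : ℤ} (hm : m ≠ 0) :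
    gaussMass W τ m ≤ √(2 * π * W) * Real.exp (-(W / 2)) * Real.exp (-(|(m : ℝ)| / 4)) := by
  have h : gaussMass W τ m ≤ ∫ ξ in (-(1 / 2) : ℝ)..(1 / 2),
      √(2 * π * W) * Real.exp (-(W / 2)) * Real.exp (-(|(m : ℝ)| / 4)) := by
    refine intervalIntegral.integral_mono_on (by norm_num) ?_ ?_ fun ξ hξ => ?_
    · exact (by fun_prop : Continuous _).intervalIntegrable _ _
    · exact (by fun_prop : Continuous _).intervalIntegrable _ _
    · have := gauss_translate_le hW hτ (abs_le.2 hξ) m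
      rw [if_neg hm] at this
      exact (mul_le_mul_of_nonneg_left this (Real.sqrt_nonneg _)).trans_eq (mul_assoc _ _ _).symm
  refine h.trans (le_of_eq ?_)
  rw [intervalIntegral.integral_const]
  norm_num

/-- The window, summed against an exponential over all integers. -/
theorem hasSum_flatWindow {W : ℕ} (hW : 1 ≤ W) (v : ℝ) {τ : ℝ} (hτ : |τ| ≤ 1 / 4) :
    ∃ T : ℂ, HasSum (fun p : ℤ => (flatWindow W ((p : ℝ) - v) : ℂ) *
        Complex.exp (-(2 * π * Complex.I * τ * (((p : ℝ) - v : ℝ) : ℂ)))) T ∧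
      HasSum (fun m : ℤ => (gaussMass W τ m : ℂ) * Complex.exp (-(2 * π * Complex.I * v * m))) T := by
  have hW1 : (1 : ℝ) ≤ W := by exact_mod_cast hW
  have hW0 : (0 : ℝ) < W := by linarith
  have hle : (-(1 / 2) : ℝ) ≤ 1 / 2 := by norm_num
  set F : ℤ → ℝ → ℂ := fun p ξ => Complex.exp (-(((p : ℝ) - v : ℝ) : ℂ) ^ 2 / (2 * (W : ℝ)) +
        2 * π * Complex.I * ((ξ - τ : ℝ) : ℂ) * (((p : ℝ) - v : ℝ) : ℂ)) with hF
  set G : ℤ → ℝ → ℂ := fun m ξ =>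
    ((√(2 * π * W) * Real.exp (-(2 * π ^ 2 * W * ((m : ℝ) - (ξ - τ)) ^ 2)) : ℝ) : ℂ) *
        Complex.exp (-(2 * π * Complex.I * v * m)) with hG
  have hFn : ∀ p ξ, ‖F p ξ‖ ≤ Real.exp W * Real.exp (-(|(p : ℝ) - v| / 4)) := by
    intro p ξ
    rw [hF]
    simp only
    rw [Complex.norm_exp]
    refine le_trans (le_of_eq ?_) (exp_gauss_le hW0 ((p : ℝ) - v))
    congr 1
    have e1 : -(((p : ℝ) - v : ℝ) : ℂ) ^ 2 / (2 * (W : ℝ)) = ((-((p : ℝ) - v) ^ 2 / (2 * W) : ℝ) : ℂ) := by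
      push_cast; ring
    have e2 : 2 * π * Complex.I * ((ξ - τ : ℝ) : ℂ) * (((p : ℝ) - v : ℝ) : ℂ) =
        ((2 * π * (ξ - τ) * (p - v) : ℝ) : ℂ) * Complex.I := by push_cast; ring
    rw [e1, e2, Complex.add_re, Complex.ofReal_re, Complex.re_ofReal_mul, Complex.I_re, mul_zero, add_zero]
  have hFs : Summable fun p : ℤ => Real.exp W * Real.exp (-(|(p : ℝ) - v| / 4)) :=
    (summable_exp_neg_abs_sub v).1.mul_left _
  have hGn : ∀ m ξ, |ξ| ≤ 1 / 2 → ‖G m ξ‖ ≤ √(2 * π * W) * Real.exp (-(|(m : ℝ)| / 4)) := by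
    intro m ξ hξ
    rw [hG]
    simp only
    have e : -(2 * π * Complex.I * v * m : ℂ) = ((-(2 * π * v * m) : ℝ) : ℂ) * Complex.I := by
      push_cast; ring
    rw [norm_mul, e, Complex.norm_exp_ofReal_mul_I, mul_one, Complex.norm_real, Real.norm_eq_abs,
      abs_of_nonneg (by positivity)]
    have := gauss_translate_le hW1 hτ hξ m
    refine mul_le_mul_of_nonneg_left (this.trans ?_) (by positivity)
    refine mul_le_of_le_one_left (by positivity) ?_
    split_ifs
    · exact le_rfl
    · rw [Real.exp_le_one_iff]; linarith
  have hGs : Summable fun m : ℤ => √(2 * π * W) * Real.exp (-(|(m : ℝ)| / 4)) :=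
    summable_exp_neg_abs.mul_left _
  -- Poisson summation at each `ξ`. Dominated convergence moves the integral over `ξ` inside both
  -- sums; it produces window values on one side and the masses `gaussMass` on the other.
  have hFG : ∀ ξ, ∑' p, F p ξ = ∑' m, G m ξ := fun ξ => gauss_poisson hW0 v (ξ - τ)
  have hI : ∀ ξ ∈ Set.uIoc (-(1 / 2) : ℝ) (1 / 2), |ξ| ≤ 1 / 2 := by
    intro ξ hξ
    rw [Set.uIoc_of_le hle] at hξ
    exact abs_le.2 ⟨hξ.1.le, hξ.2⟩
  have H1 : HasSum (fun p => ∫ ξ in (-(1 / 2) : ℝ)..(1 / 2), F p ξ)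
      (∫ ξ in (-(1 / 2) : ℝ)..(1 / 2), ∑' p, F p ξ) := by
    refine intervalIntegral.hasSum_integral_of_dominated_convergence
      (fun p _ => Real.exp W * Real.exp (-(|(p : ℝ) - v| / 4))) (fun p => ?_) (fun p => ?_) ?_ ?_ ?_
    · exact (by fun_prop : Continuous (F p)).aestronglyMeasurable
    · exact Filter.Eventually.of_forall fun ξ _ => hFn p ξ
    · exact Filter.Eventually.of_forall fun ξ _ => hFs
    · exact intervalIntegrable_const
    · exact Filter.Eventually.of_forall fun ξ _ =>
        (Summable.of_norm_bounded hFs fun p => hFn p ξ).hasSum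
  have H2 : HasSum (fun m => ∫ ξ in (-(1 / 2) : ℝ)..(1 / 2), G m ξ)
      (∫ ξ in (-(1 / 2) : ℝ)..(1 / 2), ∑' m, G m ξ) := by
    refine intervalIntegral.hasSum_integral_of_dominated_convergence
      (fun m _ => √(2 * π * W) * Real.exp (-(|(m : ℝ)| / 4))) (fun p => ?_) (fun m => ?_) ?_ ?_ ?_
    · exact (by fun_prop : Continuous (G p)).aestronglyMeasurable
    · exact Filter.Eventually.of_forall fun ξ hξ => hGn m ξ (hI ξ hξ)
    · exact Filter.Eventually.of_forall fun ξ _ => hGs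
    · exact intervalIntegrable_const
    · exact Filter.Eventually.of_forall fun ξ hξ =>
        (Summable.of_norm_bounded hGs fun m => hGn m ξ (hI ξ hξ)).hasSum
  refine ⟨∫ ξ in (-(1 / 2) : ℝ)..(1 / 2), ∑' p, F p ξ, ?_, ?_⟩
  · convert H1 using 2 with p
    have e : ∀ ξ : ℝ, F p ξ = ((Real.exp (-((p : ℝ) - v) ^ 2 / (2 * W)) : ℝ) : ℂ) *
        Complex.exp (-(2 * π * Complex.I * τ * (((p : ℝ) - v : ℝ) : ℂ))) *
        Complex.exp ((2 * π * (((p : ℝ) - v : ℝ) : ℂ) * Complex.I) * ξ) := by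
      intro ξ
      simp only [hF]
      rw [Complex.ofReal_exp, ← Complex.exp_add, ← Complex.exp_add]
      congr 1
      push_cast
      ring
    simp only [e]
    rw [intervalIntegral.integral_const_mul, integral_exp_eq_sinc, flatWindow]
    push_cast
    ring
  · simp only [hFG]
    convert H2 using 2 with m
    rw [gaussMass, intervalIntegral.integral_mul_const]
    congr 1
    exact (intervalIntegral.integral_ofReal).symm

theorem abs_flatWindow_le (W : ℕ) (u : ℝ) : |flatWindow W u| ≤ Real.exp (-u ^ 2 / (2 * W)) := by
  rw [flatWindow, abs_mul, abs_of_pos (Real.exp_pos _)]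
  exact mul_le_of_le_one_left (Real.exp_pos _).le (Real.abs_sinc_le_one _)

theorem flatWindow_intCast (W : ℕ) (p : ℤ) : flatWindow W p = if p = 0 then 1 else 0 := by
  split_ifs with hp
  · subst hp; simp [flatWindow]
  · rw [flatWindow, Real.sinc_of_ne_zero (by simp [hp, Real.pi_ne_zero]), mul_comm π,
      Real.sin_int_mul_pi]
    simp

theorem norm_exp_two_pi_I (x y : ℝ) : ‖Complex.exp (-(2 * π * Complex.I * x * (y : ℂ)))‖ = 1 := by
  have e : -(2 * π * Complex.I * x * y : ℂ) = ((-(2 * π * x * y) : ℝ) : ℂ) * Complex.I := by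
    push_cast; ring
  rw [e, Complex.norm_exp_ofReal_mul_I]

/-- The truncated sum over the window reproduces low frequencies up to an exponentially small
error. -/
theorem exists_flatWindow_error : ∃ K : ℝ, 0 < K ∧ ∀ W : ℕ, 1 ≤ W → ∀ v τ : ℝ, |τ| ≤ 1 / 4 →
    ‖∑ p ∈ Finset.Icc ⌈v - W⌉ ⌊v + W⌋, (flatWindow W ((p : ℝ) - v) : ℂ) *
        Complex.exp (-(2 * π * Complex.I * τ * (((p : ℝ) - v : ℝ) : ℂ))) - 1‖ ≤
      K * Real.exp (-((W : ℝ) / 4)) := by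
  set K0 := ∑' k : ℤ, Real.exp (-(|(k : ℝ)| / 4)) with hK0
  have hK0pos : 0 ≤ K0 := tsum_nonneg fun k => (Real.exp_pos _).le
  refine ⟨64 * K0 + Real.exp (1 / 4) * K0 + 1, by positivity, fun W hW v τ hτ => ?_⟩
  have hW1 : (1 : ℝ) ≤ W := by exact_mod_cast hW
  have hW0 : (0 : ℝ) < W := by linarith
  obtain ⟨T, hT1, hT2⟩ := hasSum_flatWindow hW v hτ
  obtain ⟨T0, hT01, hT02⟩ := hasSum_flatWindow hW 0 hτ
  -- For `v = 0` the sinc vanishes at all nonzero integers, so the window sum is `1`, while the dual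
  -- phases are trivial. Hence the masses add up to `1`, without any integral being computed.
  have hone : HasSum (fun m : ℤ => (gaussMass W τ m : ℂ)) 1 := by
    have h1 : T0 = 1 := by
      refine hT01.unique ?_
      convert hasSum_single (0 : ℤ) ?_ using 1
      · simp [flatWindow]
      · intro p hp
        rw [sub_zero, flatWindow_intCast, if_neg hp, Complex.ofReal_zero, zero_mul]
    rw [h1] at hT02
    simpa using hT02
  -- The phases for `v` and for `0` differ only at `m ≠ 0`, where the masses are exponentially
  -- small.
  have hA : ‖T - 1‖ ≤ 64 * K0 * Real.exp (-((W : ℝ) / 4)) := by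
    have hd := hT2.sub hone
    rw [← hd.tsum_eq]
    refine tsum_of_norm_bounded (g := fun m : ℤ =>
      64 * Real.exp (-((W : ℝ) / 4)) * Real.exp (-(|(m : ℝ)| / 4))) ?_ fun m => ?_
    · have := summable_exp_neg_abs.hasSum.mul_left (64 * Real.exp (-((W : ℝ) / 4)))
      rwa [show 64 * Real.exp (-((W : ℝ) / 4)) * K0 = 64 * K0 * Real.exp (-((W : ℝ) / 4)) by ring]
        at this
    · by_cases hm : m = 0
      · subst hm; simp; positivity
      have h1 : (gaussMass W τ m : ℂ) * Complex.exp (-(2 * π * Complex.I * v * m)) -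
          (gaussMass W τ m : ℂ) = gaussMass W τ m *
            (Complex.exp (-(2 * π * Complex.I * v * m)) - 1) := by ring
      rw [h1, norm_mul, Complex.norm_real, Real.norm_eq_abs, abs_of_nonneg (gaussMass_nonneg _ _ _)]
      have h2 : ‖Complex.exp (-(2 * π * Complex.I * v * m)) - 1‖ ≤ 2 := by
        refine (norm_sub_le _ _).trans ?_
        have := norm_exp_two_pi_I v m
        rw [Complex.ofReal_intCast] at this
        rw [this, norm_one]
        norm_num
      have h3 := gaussMass_le hW1 hτ hm
      have h4 : √(2 * π * W) * Real.exp (-(W / 2 : ℝ)) ≤ 32 * Real.exp (-((W : ℝ) / 4)) := by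
        have h5 : √(2 * π * W) ≤ 32 * Real.exp ((W : ℝ) / 4) := by
          rw [Real.sqrt_le_left (by positivity)]
          have h6 := Real.add_one_le_exp ((W : ℝ) / 4)
          have h7 : 8 * (W : ℝ) ≤ 32 * Real.exp ((W : ℝ) / 4) := by linarith
          have h8 : (8 * (W : ℝ)) ^ 2 ≤ (32 * Real.exp ((W : ℝ) / 4)) ^ 2 := by gcongr
          nlinarith [Real.pi_lt_four]
        calc _ ≤ 32 * Real.exp ((W : ℝ) / 4) * Real.exp (-(W / 2 : ℝ)) := by gcongr
          _ = 32 * Real.exp (-((W : ℝ) / 4)) := by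
            rw [mul_assoc, ← Real.exp_add]; congr 2; ring
      calc _ ≤ (√(2 * π * W) * Real.exp (-(W / 2 : ℝ)) * Real.exp (-(|(m : ℝ)| / 4))) * 2 := by
            gcongr
        _ ≤ (32 * Real.exp (-((W : ℝ) / 4)) * Real.exp (-(|(m : ℝ)| / 4))) * 2 := by gcongr
        _ = _ := by ring
  set S := Finset.Icc ⌈v - W⌉ ⌊v + W⌋ with hS
  set f : ℤ → ℂ := fun p => (flatWindow W ((p : ℝ) - v) : ℂ) *
        Complex.exp (-(2 * π * Complex.I * τ * (((p : ℝ) - v : ℝ) : ℂ))) with hf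
  -- For `|p - v| > W` the Gaussian exponent exceeds `|p - v| / 2`, half of which gives `W / 4` and
  -- the other half a summable bound.
  have hB : ‖∑ p ∈ S, f p - T‖ ≤ Real.exp (1 / 4) * K0 * Real.exp (-((W : ℝ) / 4)) := by
    have hg : HasSum (fun p => if p ∈ S then f p else 0) (∑ p ∈ S, f p) := by
      have : HasSum (fun p => if p ∈ S then f p else 0) (∑ p ∈ S, if p ∈ S then f p else 0) :=
        hasSum_sum_of_ne_finset_zero fun p hp => if_neg hp
      rwa [Finset.sum_congr rfl fun p hp => if_pos hp] at this
    have hd := hg.sub hT1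
    rw [← hd.tsum_eq]
    refine (tsum_of_norm_bounded (g := fun p : ℤ =>
      Real.exp (-((W : ℝ) / 4)) * Real.exp (-(|(p : ℝ) - v| / 4)))
        ((summable_exp_neg_abs_sub v).1.hasSum.mul_left _) fun p => ?_).trans ?_
    · split_ifs with hp
      · rw [sub_self, norm_zero]; positivity
      · have hp' : (W : ℝ) < |(p : ℝ) - v| := by
          by_contra hcon
          rw [not_lt, abs_le] at hcon
          refine hp (Finset.mem_Icc.2 ⟨Int.ceil_le.2 (by linarith), Int.le_floor.2 (by linarith)⟩)
        rw [zero_sub, norm_neg, norm_mul, norm_exp_two_pi_I, mul_one, Complex.norm_real,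
          Real.norm_eq_abs]
        refine (abs_flatWindow_le _ _).trans ?_
        rw [← Real.exp_add]
        refine Real.exp_le_exp.2 ?_
        rw [div_le_iff₀ (by positivity), ← sq_abs ((p : ℝ) - v)]
        nlinarith
    · have := (summable_exp_neg_abs_sub v).2
      calc _ ≤ Real.exp (-((W : ℝ) / 4)) * (Real.exp (1 / 4) * K0) := by gcongr
        _ = _ := by ring
  calc ‖∑ p ∈ S, f p - 1‖ = ‖(∑ p ∈ S, f p - T) + (T - 1)‖ := by rw [sub_add_sub_cancel]
    _ ≤ _ := norm_add_le _ _
    _ ≤ Real.exp (1 / 4) * K0 * Real.exp (-((W : ℝ) / 4)) + 64 * K0 * Real.exp (-((W : ℝ) / 4)) :=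
      add_le_add hB hA
    _ ≤ _ := by nlinarith [Real.exp_pos (-((W : ℝ) / 4))]

end FlatWindow

/-! ## The semi-equispaced transform -/

section SemiEquispaced

variable {d n : ℕ} [NeZero n]

/-- One factor is exchanged at a time: the exchange costs `δ`, and the factors not yet exchanged
have norm at most `1 + δ`. -/
theorem norm_prod_sub_prod_le {ι : Type*} (s : Finset ι) (x y : ι → ℂ) (δ : ℝ)
    (hy : ∀ i ∈ s, ‖y i‖ = 1) (h : ∀ i ∈ s, ‖x i - y i‖ ≤ δ) :
    ‖∏ i ∈ s, x i - ∏ i ∈ s, y i‖ ≤ (1 + δ) ^ s.card - 1 := by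
  induction s using Finset.induction_on with
  | empty => simp
  | insert i s hi ih =>
    have ih' := ih (fun j hj => hy j (Finset.mem_insert_of_mem hj))
      fun j hj => h j (Finset.mem_insert_of_mem hj)
    have h1 := h i (Finset.mem_insert_self i s)
    have hyi := hy i (Finset.mem_insert_self i s)
    have hδ : 0 ≤ δ := (norm_nonneg _).trans h1
    rw [Finset.prod_insert hi, Finset.prod_insert hi, Finset.card_insert_of_notMem hi]
    have hx : ‖x i‖ ≤ 1 + δ := by
      have := norm_add_le (x i - y i) (y i)
      rw [sub_add_cancel, hyi] at this
      linarith
    have hp : ‖∏ j ∈ s, y j‖ = 1 := by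
      rw [norm_prod]
      exact Finset.prod_eq_one fun j hj => hy j (Finset.mem_insert_of_mem hj)
    calc _ = ‖x i * (∏ j ∈ s, x j - ∏ j ∈ s, y j) + (x i - y i) * ∏ j ∈ s, y j‖ := by
          congr 1; ring
      _ ≤ ‖x i‖ * ‖∏ j ∈ s, x j - ∏ j ∈ s, y j‖ + ‖x i - y i‖ * ‖∏ j ∈ s, y j‖ := by
          rw [← norm_mul, ← norm_mul]; exact norm_add_le _ _
      _ ≤ (1 + δ) * ((1 + δ) ^ s.card - 1) + δ * 1 := by
          rw [hp]; gcongr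
      _ = _ := by ring

/-- Reduction of the grid point and of the frequency modulo `2 ^ m` changes the exponent by an
integer multiple of `2 π i`, also for negative integers. -/
theorem twiddle_cell (a : ℤ) {m : ℕ} (p i : ℤ) :
    twiddle (a * (2 * π)) m (p % ((2 ^ m : ℕ) : ℤ)).toNat (i % ((2 ^ m : ℕ) : ℤ)).toNat =
      Complex.exp (2 * π * Complex.I * a * p * i / 2 ^ m) := by
  have hM : ((2 ^ m : ℕ) : ℤ) ≠ 0 := by positivity
  have key : ∀ q : ℤ, ∃ r : ℤ, (((q % ((2 ^ m : ℕ) : ℤ)).toNat : ℕ) : ℂ) = q - 2 ^ m * r := by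
    intro q
    refine ⟨q / ((2 ^ m : ℕ) : ℤ), ?_⟩
    have h1 : (((q % ((2 ^ m : ℕ) : ℤ)).toNat : ℕ) : ℤ) = q - (2 ^ m : ℕ) * (q / ((2 ^ m : ℕ) : ℤ)) := by
      rw [Int.toNat_of_nonneg (Int.emod_nonneg _ hM), Int.emod_def]
    have h2 : ((((q % ((2 ^ m : ℕ) : ℤ)).toNat : ℕ) : ℤ) : ℂ) =
      ((q - (2 ^ m : ℕ) * (q / ((2 ^ m : ℕ) : ℤ)) : ℤ) : ℂ) := by rw [h1]
    rw [Int.cast_natCast] at h2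
    rw [h2, Int.cast_sub, Int.cast_mul]
    push_cast
    rfl
  obtain ⟨r, hr⟩ := key p
  obtain ⟨t, ht⟩ := key i
  rw [twiddle]
  rw [Complex.ofReal_div, Complex.ofReal_mul, Complex.ofReal_mul, Complex.ofReal_natCast,
    Complex.ofReal_natCast, hr, ht, Complex.exp_eq_exp_iff_exists_int]
  refine ⟨-(a * (p * t + r * i - 2 ^ m * r * t)), ?_⟩
  push_cast
  field_simp
  ring

theorem cell_mem {M : ℕ} (hM : 0 < M) (p : Fin d → ℤ) :
    cell M p ∈ Fintype.piFinset fun _ : Fin d => Finset.range M := by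
  rw [Fintype.mem_piFinset]
  intro s
  rw [Finset.mem_range, cell]
  have h1 := Int.emod_lt_of_pos (p s) (by exact_mod_cast hM : (0 : ℤ) < M)
  have h2 := Int.emod_nonneg (p s) (by positivity : (M : ℤ) ≠ 0)
  omega

/-- The transform of an array that was filled by accumulation. -/
theorem fft_accumulate {ι : Type} (a : ℤ) (m : ℕ) (l : List ι) (c : ι → Fin d → ℤ) (v : ι → ℂ)
    (y : Arr d) (hy : ∀ t, y t = (l.map fun p => if cell (2 ^ m) (c p) = t then v p else 0).sum)
    (i : Fin d → ℤ) :
    (fft (a * (2 * π)) m y).val (cell (2 ^ m) i) =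
      (l.map fun p => v p * ∏ s, Complex.exp (2 * π * Complex.I * a * c p s * i s / 2 ^ m)).sum := by
  have hM : 0 < 2 ^ m := by positivity
  rw [fft_val]
  simp only [hy]
  clear hy
  induction l with
  | nil => simp
  | cons p l ih =>
    simp only [List.map_cons, List.sum_cons, add_mul, Finset.sum_add_distrib]
    rw [ih]
    congr 1
    rw [Finset.sum_eq_single (cell (2 ^ m) (c p))]
    · rw [if_pos rfl]
      congr 1
      refine Finset.prod_congr rfl fun s _ => ?_
      exact twiddle_cell a (c p s) (i s)
    · intro t _ ht
      rw [if_neg (Ne.symm ht), zero_mul]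
    · intro h
      exact absurd (cell_mem hM (c p)) h

/-- The window in `d` variables is a product, so the sum over the grid points of one entry factors
into one-dimensional truncated sums. -/
theorem semiEquispaced_val (W m : ℕ) (entries : List (Idx d n × ℂ)) (i : Fin d → ℤ) :
    (semiEquispaced W m entries).val (cell (2 ^ m) i) =
      (entries.map fun e => e.2 * ∏ s, ∑ p ∈ Finset.Icc ⌈((e.1 s).val : ℝ) * 2 ^ m / n - W⌉
          ⌊((e.1 s).val : ℝ) * 2 ^ m / n + W⌋,
        (flatWindow W ((p : ℝ) - ((e.1 s).val : ℝ) * 2 ^ m / n) : ℂ) *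
          Complex.exp (-(2 * π * Complex.I * p * i s / 2 ^ m))).sum *
        ((1 / √(len d n) : ℝ) : ℂ) := by
  set v : Idx d n × ℂ → Fin d → ℝ := fun e s => ((e.1 s).val : ℝ) * 2 ^ m / n with hv
  set grid : Idx d n × ℂ → Finset (Fin d → ℤ) := fun e =>
    Fintype.piFinset fun s => Finset.Icc ⌈v e s - W⌉ ⌊v e s + W⌋ with hgrid
  -- The nested loops are flattened into one loop over pairs of an entry and a grid point, to which
  -- `foldl_update_add` applies.
  set L : List ((Idx d n × ℂ) × (Fin d → ℤ)) :=
    entries.flatMap fun e => (grid e).toList.map fun p => (e, p) with hL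
  have h1 : (semiEquispaced W m entries).val (cell (2 ^ m) i) =
      (fft (-(2 * π)) m (L.foldl (fun (y : Arr d) p => Function.update y (cell (2 ^ m) p.2)
        (y (cell (2 ^ m) p.2) + p.1.2 * ((∏ s, flatWindow W ((p.2 s : ℝ) - v p.1 s) : ℝ) : ℂ)))
          fun _ => 0)).val (cell (2 ^ m) i) * ((1 / √(len d n) : ℝ) : ℂ) := by
    rw [semiEquispaced]
    simp only [bind_val, op_val, loop_val]
    rw [hL, List.foldl_flatMap]
    simp only [List.foldl_map]
    rfl
  rw [h1]
  congr 1
  have h2 : (-(2 * π) : ℝ) = ((-1 : ℤ) : ℝ) * (2 * π) := by push_cast; ring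
  rw [h2, fft_accumulate (-1) m L (fun p => p.2)
    (fun p => p.1.2 * ((∏ s, flatWindow W ((p.2 s : ℝ) - v p.1 s) : ℝ) : ℂ))]
  · rw [hL, List.map_flatMap, List.flatMap_def, List.sum_flatten, List.map_map]
    congr 1
    refine List.map_congr_left fun e _ => ?_
    simp only [Function.comp_apply]
    rw [List.map_map, Finset.sum_map_toList, Finset.prod_univ_sum, Finset.mul_sum]
    refine Finset.sum_congr rfl fun p _ => ?_
    simp only [Function.comp_apply]
    rw [mul_assoc]
    push_cast
    rw [← Finset.prod_mul_distrib]
    congr 1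
    refine Finset.prod_congr rfl fun s _ => ?_
    congr 2
    ring
  · intro t
    have := foldl_update_add L (fun _ => (0 : ℂ)) (fun p => cell (2 ^ m) p.2)
      (fun p => p.1.2 * ((∏ s, flatWindow W ((p.2 s : ℝ) - v p.1 s) : ℝ) : ℂ)) t
    rw [this, zero_add]

/-- The constant in the error of the flat window. -/
noncomputable def windowConst : ℝ := exists_flatWindow_error.choose

theorem windowConst_pos : 0 < windowConst := exists_flatWindow_error.choose_spec.1

theorem flatWindow_error {W : ℕ} (hW : 1 ≤ W) (v : ℝ) {τ : ℝ} (hτ : |τ| ≤ 1 / 4) :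
    ‖∑ p ∈ Finset.Icc ⌈v - W⌉ ⌊v + W⌋, (flatWindow W ((p : ℝ) - v) : ℂ) *
        Complex.exp (-(2 * π * Complex.I * τ * (((p : ℝ) - v : ℝ) : ℂ))) - 1‖ ≤
      windowConst * Real.exp (-((W : ℝ) / 4)) :=
  exists_flatWindow_error.choose_spec.2 W hW v τ hτ

/-- The relative error of the semi-equispaced transform with window width `W`. -/
noncomputable def semiErr (d W : ℕ) : ℝ := (1 + windowConst * Real.exp (-((W : ℝ) / 4))) ^ d - 1

theorem semiErr_nonneg (d W : ℕ) : 0 ≤ semiErr d W := by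
  have := windowConst_pos
  exact sub_nonneg.2 (one_le_pow₀ (by nlinarith [Real.exp_pos (-((W : ℝ) / 4))]))

/-- On each axis the wanted phase is `exp (-2 π i τ v)` with `τ = i / 2 ^ m`. Once it is factored
out, the truncated window sum remains, which is nearly `1`. The hypothesis on `i` says `|τ| ≤ 1/4`,
the range on which the window is flat. -/
theorem semiEquispaced_error {W : ℕ} (hW : 1 ≤ W) (m : ℕ) (entries : List (Idx d n × ℂ))
    (i : Fin d → ℤ) (hi : ∀ s, 4 * |i s| ≤ 2 ^ m) :
    ‖(semiEquispaced W m entries).val (cell (2 ^ m) i) -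
      (entries.map fun e => e.2 * om (-((fun s => ((i s : ℤ) : ZMod n)) ⬝ᵥ e.1))).sum *
        ((1 / √(len d n) : ℝ) : ℂ)‖ ≤
      semiErr d W * (entries.map fun e => ‖e.2‖).sum * (1 / √(len d n)) := by
  have hn : (n : ℝ) ≠ 0 := NeZero.ne _
  rw [semiEquispaced_val, ← sub_mul, norm_mul, Complex.norm_real, Real.norm_eq_abs,
    abs_of_nonneg (by positivity : 0 ≤ 1 / √(len d n))]
  refine mul_le_mul_of_nonneg_right ?_ (by positivity)
  have hterm : ∀ e : Idx d n × ℂ, ‖(∏ s, ∑ p ∈ Finset.Icc ⌈((e.1 s).val : ℝ) * 2 ^ m / n - W⌉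
          ⌊((e.1 s).val : ℝ) * 2 ^ m / n + W⌋,
        (flatWindow W ((p : ℝ) - ((e.1 s).val : ℝ) * 2 ^ m / n) : ℂ) *
          Complex.exp (-(2 * π * Complex.I * p * i s / 2 ^ m))) -
        om (-((fun s => ((i s : ℤ) : ZMod n)) ⬝ᵥ e.1))‖ ≤ semiErr d W := by
    intro e
    have h0 : om (-((fun s => ((i s : ℤ) : ZMod n)) ⬝ᵥ e.1)) =
        ∏ s, om (-(((i s : ℤ) : ZMod n) * e.1 s)) := by
      rw [dotProduct, ← Finset.sum_neg_distrib, om_sum]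
    rw [h0, semiErr]
    have hcard : d = (Finset.univ : Finset (Fin d)).card := by simp
    conv_rhs => rw [hcard]
    refine norm_prod_sub_prod_le _ _ _ _ (fun s _ => norm_om _) fun s _ => ?_
    set v : ℝ := ((e.1 s).val : ℝ) * 2 ^ m / n with hv
    set τ : ℝ := (i s : ℝ) / 2 ^ m with hτ
    have hτ4 : |τ| ≤ 1 / 4 := by
      rw [hτ, abs_div, abs_of_pos (by positivity : (0 : ℝ) < 2 ^ m), div_le_iff₀ (by positivity)]
      have : (4 : ℝ) * |(i s : ℝ)| ≤ 2 ^ m := by exact_mod_cast hi s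
      linarith
    have hom : om (-(((i s : ℤ) : ZMod n) * e.1 s)) =
        Complex.exp (-(2 * π * Complex.I * τ * v)) := by
      have : -(((i s : ℤ) : ZMod n) * e.1 s) = ((-(i s * (e.1 s).val) : ℤ) : ZMod n) := by
        push_cast; rw [ZMod.natCast_zmod_val]
      rw [this, om_intCast]
      congr 1
      have hn' : (n : ℂ) ≠ 0 := by exact_mod_cast hn
      rw [hτ, hv]
      push_cast
      field_simp
    have hexp : ∀ p : ℤ, Complex.exp (-(2 * π * Complex.I * p * i s / 2 ^ m)) =
        Complex.exp (-(2 * π * Complex.I * τ * (((p : ℝ) - v : ℝ) : ℂ))) *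
          Complex.exp (-(2 * π * Complex.I * τ * v)) := by
      intro p
      rw [← Complex.exp_add]
      congr 1
      rw [hτ]
      push_cast
      ring
    simp only [hexp]
    rw [hom]
    simp only [← mul_assoc]
    rw [← Finset.sum_mul]
    have hnorm : ‖Complex.exp (-(2 * π * Complex.I * τ * v))‖ = 1 := norm_exp_two_pi_I τ v
    have hspec := flatWindow_error hW v hτ4
    simp only [mul_assoc] at hnorm hspec ⊢
    rw [← sub_one_mul, norm_mul, hnorm, mul_one]
    exact hspec
  induction entries with
  | nil => simp
  | cons e l ih =>
    simp only [List.map_cons, List.sum_cons, mul_add]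
    rw [add_sub_add_comm]
    refine (norm_add_le _ _).trans (add_le_add ?_ ih)
    rw [← mul_sub, norm_mul, mul_comm]
    exact mul_le_mul_of_nonneg_right (hterm e) (norm_nonneg _)

end SemiEquispaced

end SparseFT

namespace SparseFT

/-! ## The value of `hashToBins` -/

section HashValue

variable {d n : ℕ} [NeZero n]

theorem len_pos (d n : ℕ) [NeZero n] : 0 < len d n :=
  pow_pos (by exact_mod_cast NeZero.pos n) d

/-- The measurement of `x` in bucket `j` that exact arithmetic would yield. -/
noncomputable def exactBin (b : ℕ) (S : Matrix (Fin d) (Fin d) (ZMod n)) (q a : Idx d n)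
    (x : Idx d n → ℂ) (j : Fin d → ℕ) : ℂ :=
  ∑ l, (filterG b (fun s => perm S q l s - ((n / b * j s : ℕ) : ZMod n)) : ℂ) * x l *
    om (a ⬝ᵥ (S *ᵥ l))

theorem exactBin_sub (b : ℕ) (S : Matrix (Fin d) (Fin d) (ZMod n)) (q a : Idx d n)
    (x y : Idx d n → ℂ) (j : Fin d → ℕ) :
    exactBin b S q a (x - y) j = exactBin b S q a x j - exactBin b S q a y j := by
  simp only [exactBin, Pi.sub_apply, mul_sub, sub_mul, Finset.sum_sub_distrib]

/-- Permuting the spectrum by `Sᵀ` permutes the signal by `S`: the entry at `l` is seen at `π(l)`,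
and the shift `a` turns into the phase `ω ^ (aᵀ Σ l)`. -/
theorem dft_permuted (S : Matrix (Fin d) (Fin d) (ZMod n)) (q a f : Idx d n) (x : Idx d n → ℂ) :
    dft x (Sᵀ *ᵥ (f - a)) * om (f ⬝ᵥ (S *ᵥ q)) =
      ((1 / √(len d n) : ℝ) : ℂ) * ∑ l, x l * om (a ⬝ᵥ (S *ᵥ l)) * om (-(f ⬝ᵥ perm S q l)) := by
  rw [dft, mul_assoc, Finset.sum_mul]
  congr 1
  refine Finset.sum_congr rfl fun l _ => ?_
  rw [mul_right_comm, ← om_add, mul_assoc, ← om_add, mul_comm]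
  congr 2
  rw [Matrix.mulVec_transpose, dotProduct_comm, ← Matrix.dotProduct_mulVec, perm, Matrix.mulVec_sub,
    dotProduct_sub, sub_dotProduct]
  ring

/-- The oversampled grid has side at least `4 F b`, while the frequencies of the filter are at most
`F b`; they all lie in the flat range of the window. -/
theorem filterRadius_lt {b h : ℕ} (hb : b = 2 * h + 2) {i : Fin d → ℤ}
    (hi : i ∈ freqBox d (filterRadius d b)) (s : Fin d) :
    4 * |i s| ≤ 2 ^ Nat.clog 2 (4 * sharp d * b) := by
  have h1 : 4 * sharp d * b ≤ 2 ^ Nat.clog 2 (4 * sharp d * b) := Nat.le_pow_clog (by norm_num) _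
  have h2 := (Fintype.mem_piFinset.1 hi) s
  rw [Finset.mem_Icc, ← abs_le] at h2
  have h3 : filterRadius d b ≤ sharp d * b := by
    rw [filterRadius]; exact Nat.mul_le_mul_left _ (by omega)
  have h4 : (4 * (filterRadius d b : ℤ)) ≤ 2 ^ Nat.clog 2 (4 * sharp d * b) := by
    have : 4 * filterRadius d b ≤ 2 ^ Nat.clog 2 (4 * sharp d * b) := by
      refine le_trans ?_ h1
      rw [mul_assoc]
      exact Nat.mul_le_mul_left 4 h3
    exact_mod_cast this
  omega

/-- Apart from the approximation of the transform of `χ`, the program is exact: the filter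
coefficients transform to `filterG`, whose argument is shifted to the bucket by the last FFT. The
approximation errs by at most `semiErr · ‖χ‖₁ / √N` at each frequency; the factor `√N` cancels, and
the filter averages the errors with total weight one. -/
theorem hashToBins_error {c : ℕ} (hc : 1 ≤ windowWidth d n c) (read : Idx d n → Cost ℂ)
    (x χ : Idx d n → ℂ) (hread : ∀ t, (read t).val = dft x t) {β h : ℕ}
    (hb : 2 ^ β = 2 * h + 2) (hbn : 2 ^ β ∣ n) (S : Matrix (Fin d) (Fin d) (ZMod n))
    (q a : Idx d n) (j : Fin d → ℕ) (hj : ∀ s, j s < 2 ^ β) :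
    ‖(hashToBins c read χ β S q a).val j - exactBin (2 ^ β) S q a (x - χ) j‖ ≤
      semiErr d (windowWidth d n c) * ∑ l, ‖χ l‖ := by
  set R := filterRadius d (2 ^ β) with hR
  set M := Nat.clog 2 (4 * sharp d * 2 ^ β) with hM
  set g := (filterTable d (2 ^ β)).val with hg
  set entries : List (Idx d n × ℂ) :=
    ((supp χ).toList.map fun l => (perm S q l, χ l * om (a ⬝ᵥ (S *ᵥ l)))).reverse with hE
  set z := (semiEquispaced (windowWidth d n c) M entries).val with hz
  set F : (Fin d → ℤ) → Idx d n := fun i s => ((i s : ℤ) : ZMod n) with hF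
  set V : (Fin d → ℤ) → ℂ := fun i => ((√(len d n) * ∏ s, g (i s) : ℝ) : ℂ) *
    (dft x (Sᵀ *ᵥ (F i - a)) * om (F i ⬝ᵥ (S *ᵥ q)) - z (cell (2 ^ M) i)) with hV
  set J : Idx d n := fun s => ((n / 2 ^ β * j s : ℕ) : ZMod n) with hJ
  have hlen := Real.sqrt_pos.2 (len_pos d n)
  have hval : (hashToBins c read χ β S q a).val j = ∑ i ∈ freqBox d R, V i * om (F i ⬝ᵥ J) := by
    have h1 : (hashToBins c read χ β S q a).val j =
        (fft (2 * π) β ((freqBox d R).toList.foldl (fun (y : Arr d) i =>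
          Function.update y (cell (2 ^ β) i) (y (cell (2 ^ β) i) + V i)) fun _ => 0)).val j := by
      rw [hashToBins]
      simp only [bind_val, op_val, loop_val, hread, foldl_cons_map, List.append_nil]
      rfl
    have h2 : (2 * π : ℝ) = ((1 : ℤ) : ℝ) * (2 * π) := by push_cast; ring
    have h3 : j = cell (2 ^ β) fun s => (j s : ℤ) := by
      funext s
      rw [cell, Int.emod_eq_of_lt (by positivity) (by exact_mod_cast hj s), Int.toNat_natCast]
    rw [h1, h2]
    conv_lhs => rw [h3]
    rw [fft_accumulate 1 β (freqBox d R).toList (fun i => i) V]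
    · rw [Finset.sum_map_toList]
      refine Finset.sum_congr rfl fun i _ => ?_
      congr 1
      rw [om_dotProduct]
      refine Finset.prod_congr rfl fun s _ => ?_
      -- Frequencies have been folded modulo `b`. This is harmless at the multiples of `n / b`,
      -- where the phase in question is a `b`-th root of unity.
      have h4 : F i s * J s = ((i s * (n / 2 ^ β * j s : ℕ) : ℤ) : ZMod n) := by
        simp only [hF, hJ, Int.cast_mul, Int.cast_natCast]
      rw [h4, om_intCast]
      congr 1
      obtain ⟨r, hr⟩ := hbn
      have hn0 : n ≠ 0 := NeZero.ne n
      have hr0 : r ≠ 0 := by rintro rfl; simp at hr; exact hn0 hr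
      have h5 : n / 2 ^ β = r := by rw [hr]; exact Nat.mul_div_cancel_left _ (by positivity)
      rw [h5]
      have h6 : (n : ℂ) = 2 ^ β * r := by rw [hr]; push_cast; ring
      have h7 : (r : ℂ) ≠ 0 := by exact_mod_cast hr0
      rw [h6]
      push_cast
      field_simp
    · intro t
      have := foldl_update_add (freqBox d R).toList (fun _ => (0 : ℂ)) (fun i => cell (2 ^ β) i) V t
      rw [this, zero_add]
  set Z : (Fin d → ℤ) → ℂ := fun i => ((1 / √(len d n) : ℝ) : ℂ) *
    ∑ l, χ l * om (a ⬝ᵥ (S *ᵥ l)) * om (-(F i ⬝ᵥ perm S q l)) with hZ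
  have hZz : ∀ i ∈ freqBox d R, ‖z (cell (2 ^ M) i) - Z i‖ ≤
      semiErr d (windowWidth d n c) * (∑ l, ‖χ l‖) * (1 / √(len d n)) := by
    intro i hi
    have h1 := semiEquispaced_error hc M entries i (filterRadius_lt hb hi)
    have h2 : (entries.map fun e => e.2 * om (-((fun s => ((i s : ℤ) : ZMod n)) ⬝ᵥ e.1))).sum =
        ∑ l, χ l * om (a ⬝ᵥ (S *ᵥ l)) * om (-(F i ⬝ᵥ perm S q l)) := by
      rw [hE, List.map_reverse, List.sum_reverse, List.map_map, Finset.sum_map_toList]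
      refine Finset.sum_subset (Finset.subset_univ _) fun l _ hl => ?_
      have : χ l = 0 := by simpa [supp] using hl
      simp [this]
    have h3 : (entries.map fun e => ‖e.2‖).sum = ∑ l, ‖χ l‖ := by
      rw [hE, List.map_reverse, List.sum_reverse, List.map_map, Finset.sum_map_toList]
      simp only [Function.comp_apply, norm_mul, norm_om, mul_one]
      refine Finset.sum_subset (Finset.subset_univ _) fun l _ hl => ?_
      have : χ l = 0 := by simpa [supp] using hl
      simp [this]
    rw [h2, h3] at h1
    rw [hZ]
    simp only
    rw [mul_comm ((1 / √(len d n) : ℝ) : ℂ)]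
    exact h1
  have hexact : exactBin (2 ^ β) S q a (x - χ) j =
      ∑ i ∈ freqBox d R, ((√(len d n) * ∏ s, g (i s) : ℝ) : ℂ) *
        (dft x (Sᵀ *ᵥ (F i - a)) * om (F i ⬝ᵥ (S *ᵥ q)) - Z i) * om (F i ⬝ᵥ J) := by
    have h1 : ∀ i, ((√(len d n) * ∏ s, g (i s) : ℝ) : ℂ) *
        (dft x (Sᵀ *ᵥ (F i - a)) * om (F i ⬝ᵥ (S *ᵥ q)) - Z i) * om (F i ⬝ᵥ J) =
        ∑ l, ((∏ s, g (i s) : ℝ) : ℂ) * om (-(F i ⬝ᵥ (perm S q l - J))) *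
          ((x - χ) l * om (a ⬝ᵥ (S *ᵥ l))) := by
      intro i
      have h2 : ((√(len d n) : ℝ) : ℂ) * ((1 / √(len d n) : ℝ) : ℂ) = 1 := by
        rw [← Complex.ofReal_mul, mul_one_div_cancel hlen.ne', Complex.ofReal_one]
      rw [dft_permuted, hZ]
      simp only
      rw [← mul_sub, ← Finset.sum_sub_distrib, Complex.ofReal_mul]
      calc _ = (((√(len d n) : ℝ) : ℂ) * ((1 / √(len d n) : ℝ) : ℂ)) * ((∏ s, g (i s) : ℝ) : ℂ) *
            (∑ l, (x l * om (a ⬝ᵥ (S *ᵥ l)) * om (-(F i ⬝ᵥ perm S q l)) -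
              χ l * om (a ⬝ᵥ (S *ᵥ l)) * om (-(F i ⬝ᵥ perm S q l)))) * om (F i ⬝ᵥ J) := by ring
        _ = _ := by
          rw [h2, one_mul, mul_assoc, Finset.sum_mul, Finset.mul_sum]
          refine Finset.sum_congr rfl fun l _ => ?_
          have h3 : om (-(F i ⬝ᵥ (perm S q l - J))) = om (-(F i ⬝ᵥ perm S q l)) * om (F i ⬝ᵥ J) := by
            rw [← om_add, dotProduct_sub]; congr 1; ring
          rw [h3, Pi.sub_apply]
          ring
    simp only [h1]
    rw [Finset.sum_comm, exactBin]
    refine Finset.sum_congr rfl fun l _ => ?_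
    rw [← Finset.sum_mul, sum_filterTable_mul_om hb]
    rw [mul_assoc]
    rfl
  rw [hval, hexact, ← Finset.sum_sub_distrib]
  have hgs := sum_filterTable_prod d hb
  calc _ ≤ ∑ i ∈ freqBox d R, (∏ s, g (i s)) *
        (semiErr d (windowWidth d n c) * (∑ l, ‖χ l‖)) := by
        refine (norm_sum_le _ _).trans (Finset.sum_le_sum fun i hi => ?_)
        have hgi : 0 ≤ ∏ s, g (i s) := filterTable_prod_nonneg d hb i
        rw [hV, ← sub_mul, norm_mul, norm_om, mul_one, ← mul_sub, sub_sub_sub_cancel_left, norm_mul,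
          Complex.norm_real, Real.norm_eq_abs, abs_of_nonneg (by positivity), norm_sub_rev]
        calc _ ≤ √(len d n) * (∏ s, g (i s)) *
              (semiErr d (windowWidth d n c) * (∑ l, ‖χ l‖) * (1 / √(len d n))) := by
              gcongr; exact hZz i hi
          _ = _ := by field_simp
    _ = _ := by rw [← Finset.sum_mul, hgs, one_mul]

theorem dft_zero (t : Idx d n) : dft (0 : Idx d n → ℂ) t = 0 := by simp [dft]

end HashValue

end SparseFT

namespace SparseFT

/-! ## Averages over finite probability spaces -/

section Probability

/-- The expectation under the uniform distribution. -/
noncomputable def avg {Ω : Type} [Fintype Ω] (f : Ω → ℝ) : ℝ := (∑ ω, f ω) / (Fintype.card Ω : ℝ)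

variable {Ω Ω' ι : Type} [Fintype Ω] [Fintype Ω']

theorem prob_eq_card (P : Ω → Prop) [DecidablePred P] :
    prob P = ((Finset.univ.filter P).card : ℝ) / (Fintype.card Ω : ℝ) := by
  rw [prob]
  congr!

theorem prob_eq_avg (P : Ω → Prop) [DecidablePred P] :
    prob P = avg fun ω => if P ω then (1 : ℝ) else 0 := by
  rw [prob_eq_card, avg, Finset.sum_boole]

theorem avg_nonneg {f : Ω → ℝ} (hf : ∀ ω, 0 ≤ f ω) : 0 ≤ avg f :=
  div_nonneg (Finset.sum_nonneg fun ω _ => hf ω) (Nat.cast_nonneg _)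

theorem avg_mono {f g : Ω → ℝ} (h : ∀ ω, f ω ≤ g ω) : avg f ≤ avg g :=
  div_le_div_of_nonneg_right (Finset.sum_le_sum fun ω _ => h ω) (Nat.cast_nonneg _)

theorem avg_const [Nonempty Ω] (c : ℝ) : avg (fun _ : Ω => c) = c := by
  have : (Fintype.card Ω : ℝ) ≠ 0 := by exact_mod_cast Fintype.card_ne_zero
  rw [avg, Finset.sum_const, Finset.card_univ, nsmul_eq_mul, mul_div_cancel_left₀ _ this]

theorem avg_le_of_le {f : Ω → ℝ} {c : ℝ} (hc : 0 ≤ c) (h : ∀ ω, f ω ≤ c) : avg f ≤ c := by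
  rcases isEmpty_or_nonempty Ω with hΩ | hΩ
  · simpa [avg] using hc
  · exact (avg_mono h).trans (avg_const c).le

theorem avg_sum (s : Finset ι) (f : ι → Ω → ℝ) :
    avg (fun ω => ∑ i ∈ s, f i ω) = ∑ i ∈ s, avg (f i) := by
  simp only [avg]
  rw [Finset.sum_comm, Finset.sum_div]

theorem avg_mul_const (f : Ω → ℝ) (c : ℝ) : avg (fun ω => f ω * c) = avg f * c := by
  simp only [avg]
  rw [← Finset.sum_mul]
  ring

theorem avg_const_mul (c : ℝ) (f : Ω → ℝ) : avg (fun ω => c * f ω) = c * avg f := by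
  simp only [avg]
  rw [← Finset.mul_sum]
  ring

theorem avg_add (f g : Ω → ℝ) : avg (fun ω => f ω + g ω) = avg f + avg g := by
  simp only [avg]
  rw [Finset.sum_add_distrib, add_div]

theorem avg_prod (f : Ω × Ω' → ℝ) : avg f = avg fun a => avg fun b => f (a, b) := by
  simp only [avg]
  rw [← Finset.sum_div, Fintype.sum_prod_type, Fintype.card_prod]
  push_cast
  rw [div_div, mul_comm]

theorem avg_prod' (f : Ω × Ω' → ℝ) : avg f = avg fun b => avg fun a => f (a, b) := by
  simp only [avg]
  rw [← Finset.sum_div, Fintype.sum_prod_type_right, Fintype.card_prod]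
  push_cast
  rw [div_div]

theorem avg_equiv (e : Ω ≃ Ω') (f : Ω' → ℝ) : avg (fun a => f (e a)) = avg f := by
  simp only [avg]
  rw [e.sum_comp f, Fintype.card_congr e]

theorem avg_pi_prod (r : ℕ) (g : Ω → ℝ) :
    avg (fun ω : Fin r → Ω => ∏ t, g (ω t)) = avg g ^ r := by
  simp only [avg]
  rw [div_pow, Fintype.sum_pow, Fintype.card_fun, Fintype.card_fin]
  push_cast
  rfl

theorem prob_nonneg (P : Ω → Prop) : 0 ≤ prob P := by
  rw [prob]; positivity

theorem prob_le_one (P : Ω → Prop) : prob P ≤ 1 := by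
  rw [prob_eq_avg]
  refine avg_le_of_le zero_le_one fun ω => ?_
  split_ifs <;> norm_num

theorem prob_mono {P Q : Ω → Prop} (h : ∀ ω, P ω → Q ω) : prob P ≤ prob Q := by
  rw [prob_eq_avg, prob_eq_avg]
  refine avg_mono fun ω => ?_
  by_cases hP : P ω
  · simp [hP, h ω hP]
  · simp only [hP, if_false]; split_ifs <;> norm_num

theorem prob_or_le (P Q : Ω → Prop) : prob (fun ω => P ω ∨ Q ω) ≤ prob P + prob Q := by
  rw [prob_eq_avg, prob_eq_avg, prob_eq_avg, ← avg_add]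
  refine avg_mono fun ω => ?_
  by_cases hP : P ω <;> by_cases hQ : Q ω <;> simp [hP, hQ]

theorem prob_exists_le (s : Finset ι) (P : ι → Ω → Prop) :
    prob (fun ω => ∃ i ∈ s, P i ω) ≤ ∑ i ∈ s, prob (P i) := by
  induction s using Finset.induction_on with
  | empty => simp [prob]
  | insert i s hi ih =>
    rw [Finset.sum_insert hi]
    refine (prob_mono fun ω h => ?_).trans ((prob_or_le (P i) fun ω => ∃ i ∈ s, P i ω).trans (by linarith))
    simpa using h

theorem prob_not [Nonempty Ω] (P : Ω → Prop) : prob P = 1 - prob fun ω => ¬ P ω := by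
  have h : prob P + prob (fun ω => ¬ P ω) = 1 := by
    rw [prob_eq_avg, prob_eq_avg, ← avg_add]
    refine Eq.trans ?_ (avg_const (Ω := Ω) 1)
    congr 1
    funext ω
    by_cases hP : P ω <;> simp [hP]
  linarith

/-- Markov's inequality. -/
theorem prob_le_of_avg_le {f : Ω → ℝ} (hf : ∀ ω, 0 ≤ f ω) {t A : ℝ} (ht : 0 < t) (hA : avg f ≤ A) :
    prob (fun ω => t ≤ f ω) ≤ A / t := by
  rw [le_div_iff₀ ht, prob_eq_avg, ← avg_mul_const]
  refine le_trans (avg_mono fun ω => ?_) hA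
  split_ifs with h
  · simpa using h
  · simpa using hf ω

theorem prob_fst_le (P : Ω → Prop) : prob (fun ω : Ω × Ω' => P ω.1) ≤ prob P := by
  rw [prob_eq_avg, prob_eq_avg, avg_prod]
  refine avg_mono fun a => avg_le_of_le ?_ fun b => le_rfl
  split_ifs <;> norm_num

theorem prob_snd_le (P : Ω' → Prop) : prob (fun ω : Ω × Ω' => P ω.2) ≤ prob P := by
  rw [prob_eq_avg, prob_eq_avg, avg_prod']
  refine avg_mono fun a => avg_le_of_le ?_ fun b => le_rfl
  split_ifs <;> norm_num

/-- The number of coordinates at which `P` holds. -/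
noncomputable def countOf {r : ℕ} (P : Ω → Prop) (ω : Fin r → Ω) : ℕ :=
  (Finset.univ.filter fun t => P (ω t)).card

/-- Chernoff's bound for independent events of probability at most `p`. -/
theorem prob_countOf_le [Nonempty Ω] {r : ℕ} (P : Ω → Prop) {p z : ℝ} (hp : prob P ≤ p) (hz : 1 ≤ z)
    (m : ℕ) : prob (fun ω : Fin r → Ω => m ≤ countOf P ω) ≤ (1 + (z - 1) * p) ^ r / z ^ m := by
  set g : Ω → ℝ := fun a => if P a then z else 1 with hg
  have h1 : ∀ ω : Fin r → Ω, z ^ countOf P ω = ∏ t, g (ω t) := by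
    intro ω
    rw [countOf, hg, Finset.prod_ite]
    simp
  have h2 : avg g ≤ 1 + (z - 1) * p := by
    have : g = fun a => 1 + (z - 1) * (if P a then (1 : ℝ) else 0) := by
      funext a; rw [hg]; by_cases h : P a <;> simp [h]
    rw [this, avg_add, avg_const_mul, avg_const, ← prob_eq_avg]
    have : 0 ≤ z - 1 := by linarith
    gcongr
  have hg0 : ∀ a, 0 ≤ g a := fun a => by rw [hg]; dsimp only; split_ifs <;> linarith
  have h3 : avg (fun ω : Fin r → Ω => z ^ countOf P ω) ≤ (1 + (z - 1) * p) ^ r := by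
    simp only [h1]
    rw [avg_pi_prod]
    exact pow_le_pow_left₀ (avg_nonneg hg0) h2 r
  have hz0 : 0 < z := by linarith
  refine le_trans (prob_mono fun ω h => ?_) (prob_le_of_avg_le (fun ω => by positivity)
    (pow_pos hz0 m) h3)
  exact pow_le_pow_right₀ hz h

/-- Chernoff's bound with `z = 1 / p`, where the base `1 + (z - 1) p` stays below `2`. The power `p
^ m` is what makes rare events very unlikely to happen often. For `p = 0` or `p ≥ 1` this `z` is not
available and the bound is checked directly. -/
theorem prob_countOf_le_two_pow [Nonempty Ω] {r : ℕ} (P : Ω → Prop) {p : ℝ} (hp : prob P ≤ p)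
    (m : ℕ) (hm : 1 ≤ m) :
    prob (fun ω : Fin r → Ω => m ≤ countOf P ω) ≤ 2 ^ r * p ^ m := by
  have hp0 : 0 ≤ p := (prob_nonneg P).trans hp
  rcases le_or_gt 1 p with h1 | h1
  · refine (prob_le_one _).trans ?_
    exact one_le_mul_of_one_le_of_one_le (one_le_pow₀ (by norm_num)) (one_le_pow₀ h1)
  rcases hp0.eq_or_lt with h0 | h0
  · rw [← h0, zero_pow (by omega), mul_zero]
    have hP : ∀ a, ¬ P a := by
      intro a ha
      have : 0 < prob P := by
        rw [prob]
        refine div_pos ?_ (by exact_mod_cast Fintype.card_pos)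
        exact_mod_cast Finset.card_pos.2 ⟨a, by simp [ha]⟩
      linarith
    refine le_trans (prob_mono (Q := fun _ => False) fun ω h => ?_) (by simp [prob])
    simp [countOf, hP] at h
    omega
  · have := prob_countOf_le (r := r) P hp (z := 1 / p) (by rw [le_div_iff₀ h0]; linarith) m
    refine this.trans ?_
    have h2 : (1 / p - 1) * p = 1 - p := by field_simp
    rw [h2, one_div, inv_pow, div_inv_eq_mul]
    refine mul_le_mul_of_nonneg_right (pow_le_pow_left₀ (by linarith) (by linarith) _) (by positivity)

end Probability

end SparseFT

namespace SparseFT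

/-! ## Random matrices with odd determinant -/

section RandomMatrix

variable {d n : ℕ} [NeZero n]

theorem odd_val_iff_isUnit {m : ℕ} (hm : 1 ≤ m) (hn : n = 2 ^ m) (x : ZMod n) :
    Odd x.val ↔ IsUnit x := by
  have key : ∀ k : ℕ, Nat.Coprime k n ↔ Odd k := fun k => by
    rw [hn, Nat.coprime_pow_right_iff (by omega), Nat.coprime_two_right]
  conv_rhs => rw [← ZMod.natCast_zmod_val x]
  rw [ZMod.isUnit_iff_coprime, key]

/-- A vector with a unit among its coordinates. -/
def Unimodular (y : Idx d n) : Prop := ∃ s, IsUnit (y s)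

/-- The identity matrix with column `s` replaced by `y` has determinant `y s`, by Cramer's rule. -/
theorem exists_matrix_single (y : Idx d n) (s : Fin d) (hs : IsUnit (y s)) :
    ∃ T : Matrix (Fin d) (Fin d) (ZMod n), IsUnit T.det ∧ T *ᵥ Pi.single s 1 = y := by
  refine ⟨(1 : Matrix _ _ _).updateCol s y, ?_, ?_⟩
  · rw [← Matrix.cramer_apply, Matrix.cramer_one]; exact hs
  · rw [Matrix.mulVec_single_one]
    funext r
    simp [Matrix.col]

/-- Invertible matrices act transitively: each unimodular vector is the image of a basis vector, and
two basis vectors are connected through their sum, which has a unit in both places. -/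
theorem exists_matrix_unimodular {y z : Idx d n} (hy : Unimodular y) (hz : Unimodular z) :
    ∃ T : Matrix (Fin d) (Fin d) (ZMod n), IsUnit T.det ∧ T *ᵥ y = z := by
  have inv : ∀ (T : Matrix (Fin d) (Fin d) (ZMod n)) (u v : Idx d n), IsUnit T.det → T *ᵥ u = v →
      ∃ T' : Matrix (Fin d) (Fin d) (ZMod n), IsUnit T'.det ∧ T' *ᵥ v = u := by
    intro T u v hT h
    refine ⟨T⁻¹, Matrix.isUnit_nonsing_inv_det T hT, ?_⟩
    rw [← h, Matrix.mulVec_mulVec, Matrix.nonsing_inv_mul T hT, Matrix.one_mulVec]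
  have trans : ∀ u v w : Idx d n,
      (∃ T : Matrix (Fin d) (Fin d) (ZMod n), IsUnit T.det ∧ T *ᵥ u = v) →
      (∃ T : Matrix (Fin d) (Fin d) (ZMod n), IsUnit T.det ∧ T *ᵥ v = w) →
      ∃ T : Matrix (Fin d) (Fin d) (ZMod n), IsUnit T.det ∧ T *ᵥ u = w := by
    rintro u v w ⟨T, hT, h⟩ ⟨T', hT', h'⟩
    refine ⟨T' * T, by rw [Matrix.det_mul]; exact hT'.mul hT, ?_⟩
    rw [← Matrix.mulVec_mulVec, h, h']
  obtain ⟨s, hs⟩ := hy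
  obtain ⟨r, hr⟩ := hz
  obtain ⟨T, hT, hTy⟩ := exists_matrix_single y s hs
  refine trans _ (Pi.single s 1) _ (inv T _ _ hT hTy) (trans _ (Pi.single r 1) _ ?_
    (exists_matrix_single z r hr))
  by_cases hsr : s = r
  · subst hsr; exact ⟨1, by simp, Matrix.one_mulVec _⟩
  · set w : Idx d n := Pi.single s 1 + Pi.single r 1 with hw
    have h1 : w s = 1 := by simp [hw, hsr]
    have h2 : w r = 1 := by simp [hw, Ne.symm hsr]
    obtain ⟨T', hT', hTw⟩ := exists_matrix_single w r (by rw [h2]; exact isUnit_one)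
    exact trans _ w _ (exists_matrix_single w s (by rw [h1]; exact isUnit_one)) (inv T' _ _ hT' hTw)

theorem oddMat_isUnit {m : ℕ} (hm : 1 ≤ m) (hn : n = 2 ^ m) (S : OddMat d n) : IsUnit S.1.det :=
  (odd_val_iff_isUnit hm hn _).1 S.2

/-- The nonunits modulo `2 ^ m` are the even residues. If all coordinates of `S u` were even, so
would be those of `S⁻¹ (S u) = u`. -/
theorem oddMat_mulVec_unimodular {m : ℕ} (hm : 1 ≤ m) (hn : n = 2 ^ m) (S : OddMat d n)
    {u : Idx d n} (hu : Unimodular u) : Unimodular (S.1 *ᵥ u) := by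
  by_contra hcon
  simp only [Unimodular, not_exists] at hcon
  obtain ⟨s, hs⟩ := hu
  have h1 : S.1⁻¹ *ᵥ (S.1 *ᵥ u) = u := by
    rw [Matrix.mulVec_mulVec, Matrix.nonsing_inv_mul _ (oddMat_isUnit hm hn S), Matrix.one_mulVec]
  have heven : ∀ x : ZMod n, ¬ IsUnit x ↔ (2 : ZMod n) ∣ x := by
    intro x
    rw [← odd_val_iff_isUnit hm hn, Nat.not_odd_iff_even]
    constructor
    · rintro ⟨r, hr⟩
      refine ⟨r, ?_⟩
      rw [← ZMod.natCast_zmod_val x, hr]; push_cast; ring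
    · rintro ⟨r, hr⟩
      by_contra hodd
      rw [Nat.not_even_iff_odd, odd_val_iff_isUnit hm hn, hr] at hodd
      have h2 := isUnit_of_mul_isUnit_left hodd
      have h3 : ((2 : ℕ) : ZMod n) = 2 := by norm_num
      rw [← h3, ZMod.isUnit_iff_coprime, hn, Nat.coprime_pow_right_iff (by omega)] at h2
      norm_num at h2
  refine (heven (u s)).2 ?_ hs
  rw [← h1]
  change (2 : ZMod n) ∣ ∑ r, S.1⁻¹ s r * (S.1 *ᵥ u) r
  exact Finset.dvd_sum fun r _ => Dvd.dvd.mul_left ((heven _).1 (hcon r)) _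

theorem oddMat_nonempty {m : ℕ} (hm : 1 ≤ m) (hn : n = 2 ^ m) : Nonempty (OddMat d n) :=
  ⟨⟨1, (odd_val_iff_isUnit hm hn _).2 (by simp)⟩⟩

/-- The image of a unimodular vector is uniform over the unimodular vectors. -/
theorem card_mulVec_eq {m : ℕ} (hm : 1 ≤ m) (hn : n = 2 ^ m) {u : Idx d n} {y z : Idx d n}
    (hy : Unimodular y) (hz : Unimodular z) :
    (Finset.univ.filter fun S : OddMat d n => S.1 *ᵥ u = y).card ≤
      (Finset.univ.filter fun S : OddMat d n => S.1 *ᵥ u = z).card := by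
  obtain ⟨T, hT, hTy⟩ := exists_matrix_unimodular hy hz
  refine Finset.card_le_card_of_injOn (fun S => ⟨T * S.1, ?_⟩) ?_ ?_
  · rw [odd_val_iff_isUnit hm hn, Matrix.det_mul]; exact hT.mul (oddMat_isUnit hm hn S)
  · intro S hS
    simp only [Finset.coe_filter, Finset.mem_univ, true_and, Set.mem_ofPred_eq] at hS ⊢
    rw [← Matrix.mulVec_mulVec, hS, hTy]
  · intro S _ S' _ h
    have h1 : T * S.1 = T * S'.1 := congrArg Subtype.val h
    have h2 : T⁻¹ * (T * S.1) = T⁻¹ * (T * S'.1) := by rw [h1]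
    rw [← mul_assoc, ← mul_assoc, Matrix.nonsing_inv_mul T hT, one_mul, one_mul] at h2
    exact Subtype.ext h2

/-- Adding a basis vector to a vector with only even coordinates makes one of them odd. This injects
the complement into the unimodular vectors, which are therefore at least half of all. -/
theorem card_unimodular {m : ℕ} (hm : 1 ≤ m) (hn : n = 2 ^ m) (hd : 1 ≤ d) :
    n ^ d ≤ 2 * (Finset.univ.filter fun y : Idx d n => Unimodular y).card := by
  have hs : 0 < d := hd
  set s : Fin d := ⟨0, hs⟩
  have h2n : 2 ∣ n := by rw [hn]; exact dvd_pow_self 2 (by omega)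
  set U := Finset.univ.filter fun y : Idx d n => Unimodular y
  set E := Finset.univ.filter fun y : Idx d n => ¬ Unimodular y
  have h1 : U.card + E.card = n ^ d := by
    rw [Finset.card_filter_add_card_filter_not, Finset.card_univ, Fintype.card_fun, ZMod.card, Fintype.card_fin]
  have h2 : E.card ≤ U.card := by
    refine Finset.card_le_card_of_injOn (fun y => y + Pi.single s 1) (fun y hy => ?_) fun y _ z _ h => ?_
    · simp only [E, U, Finset.coe_filter, Finset.mem_univ, true_and, Set.mem_ofPred_eq] at hy ⊢
      simp only [Unimodular, not_exists] at hy
      refine ⟨s, ?_⟩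
      have := hy s
      rw [← odd_val_iff_isUnit hm hn, Nat.not_odd_iff_even] at this
      rw [← odd_val_iff_isUnit hm hn, Pi.add_apply, Pi.single_eq_same, ZMod.val_add]
      have hone : (1 : ZMod n).val = 1 := ZMod.val_one'' (by rintro rfl; omega)
      rw [hone]
      obtain ⟨r, hr⟩ := this
      obtain ⟨k, hk⟩ := h2n
      rw [Nat.odd_iff, Nat.mod_mod_of_dvd _ ⟨k, hk⟩]
      omega
    · simpa using h
  omega

/-- The image of `u` is uniform over the unimodular vectors; as these are at least half of the
space, the comparison with the uniform distribution on the whole space costs a factor `2`. -/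
theorem prob_mulVec_mem_le {m : ℕ} (hm : 1 ≤ m) (hn : n = 2 ^ m) (hd : 1 ≤ d) {u : Idx d n}
    (hu : Unimodular u) (Y : Finset (Idx d n)) :
    prob (fun S : OddMat d n => S.1 *ᵥ u ∈ Y) ≤ 2 * Y.card / (n : ℝ) ^ d := by
  set N : Idx d n → ℕ := fun y => (Finset.univ.filter fun S : OddMat d n => S.1 *ᵥ u = y).card with hN
  set U := Finset.univ.filter fun y : Idx d n => Unimodular y with hU
  have htot : ∑ y ∈ U, N y = Fintype.card (OddMat d n) := by
    rw [hN, ← Finset.card_univ]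
    refine (Finset.card_eq_sum_card_fiberwise fun S _ => ?_).symm
    simpa [hU] using oddMat_mulVec_unimodular hm hn S hu
  have hY : (Finset.univ.filter fun S : OddMat d n => S.1 *ᵥ u ∈ Y).card ≤ ∑ y ∈ Y ∩ U, N y := by
    rw [Finset.card_eq_sum_card_fiberwise (t := Y ∩ U) (f := fun S : OddMat d n => S.1 *ᵥ u)]
    · refine Finset.sum_le_sum fun y _ => Finset.card_le_card fun S hS => ?_
      simp only [Finset.mem_filter, Finset.mem_univ, true_and] at hS ⊢
      exact hS.2
    · intro S hS
      simp only [Finset.coe_filter, Finset.mem_univ, true_and, Set.mem_ofPred_eq] at hS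
      simp only [Finset.coe_inter, Set.mem_inter_iff, Finset.mem_coe]
      exact ⟨hS, by simpa [hU] using oddMat_mulVec_unimodular hm hn S hu⟩
  have hmul : (∑ y ∈ Y ∩ U, N y) * U.card ≤ Y.card * Fintype.card (OddMat d n) := by
    rw [Finset.sum_mul]
    calc _ ≤ ∑ y ∈ Y ∩ U, Fintype.card (OddMat d n) := by
          refine Finset.sum_le_sum fun y hy => ?_
          rw [← htot, mul_comm, ← smul_eq_mul, ← Finset.sum_const]
          refine Finset.sum_le_sum fun z hz => card_mulVec_eq hm hn ?_ ?_
          · simpa [hU] using (Finset.mem_inter.1 hy).2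
          · simpa [hU] using hz
      _ ≤ _ := by
          rw [Finset.sum_const, smul_eq_mul]
          exact Nat.mul_le_mul_right _ (Finset.card_le_card Finset.inter_subset_left)
  have hU2 : n ^ d ≤ 2 * U.card := card_unimodular hm hn hd
  have hne := oddMat_nonempty (d := d) hm hn
  have hT : (0 : ℝ) < Fintype.card (OddMat d n) := by exact_mod_cast Fintype.card_pos
  have hn0 : (0 : ℝ) < (n : ℝ) ^ d := len_pos d n
  rw [prob_eq_card, div_le_div_iff₀ hT hn0]
  have key : (Finset.univ.filter fun S : OddMat d n => S.1 *ᵥ u ∈ Y).card * n ^ d ≤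
      2 * Y.card * Fintype.card (OddMat d n) := by
    calc _ ≤ (∑ y ∈ Y ∩ U, N y) * (2 * U.card) := Nat.mul_le_mul hY hU2
      _ = 2 * ((∑ y ∈ Y ∩ U, N y) * U.card) := by ring
      _ ≤ 2 * (Y.card * Fintype.card (OddMat d n)) := Nat.mul_le_mul_left 2 hmul
      _ = _ := by ring
  exact_mod_cast key

/-- The distance of a residue from zero. -/
def zabs (z : ZMod n) : ℕ := z.valMinAbs.natAbs

theorem zabs_le_of_intCast {z : ZMod n} {y : ℤ} (h : (y : ZMod n) = z) : zabs z ≤ y.natAbs :=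
  ZMod.natAbs_min_of_le_div_two n _ _ (by rw [ZMod.coe_valMinAbs, h]) (ZMod.natAbs_valMinAbs_le z)

theorem zabs_add_le (y z : ZMod n) : zabs (y + z) ≤ zabs y + zabs z :=
  (ZMod.natAbs_valMinAbs_add_le y z).trans (Int.natAbs_add_le _ _)

theorem zabs_neg (z : ZMod n) : zabs (-z) = zabs z := ZMod.natAbs_valMinAbs_neg z

theorem zabs_two_pow_mul {m t : ℕ} (ht : t < m) (hn : n = 2 ^ m) (z : ZMod n) :
    zabs ((2 : ZMod n) ^ t * z) =
      2 ^ t * min (z.val % 2 ^ (m - t)) (2 ^ (m - t) - z.val % 2 ^ (m - t)) := by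
  have hn' : n = 2 ^ t * 2 ^ (m - t) := by rw [hn, ← pow_add]; congr 1; omega
  have key : ∀ k, 2 ^ t * k % n = 2 ^ t * (k % 2 ^ (m - t)) := fun k => by
    rw [hn', Nat.mul_mod_mul_left]
  have key2 : ∀ k, min (2 ^ t * k) (n - 2 ^ t * k) = 2 ^ t * min k (2 ^ (m - t) - k) := fun k => by
    rw [hn', ← Nat.mul_sub, Nat.mul_min_mul_left]
  have h1 : ((2 : ZMod n) ^ t * z).val = 2 ^ t * (z.val % 2 ^ (m - t)) := by
    have : (2 : ZMod n) ^ t * z = ((2 ^ t * z.val : ℕ) : ZMod n) := by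
      push_cast; rw [ZMod.natCast_zmod_val]
    rw [this, ZMod.val_natCast, key]
  rw [zabs, ZMod.valMinAbs_natAbs_eq_min, h1, key2]

/-- The size of `2 ^ t z` depends only on `z` modulo `2 ^ (m - t)`, which has to be within `R / 2 ^
t` of zero. There are at most `2 R / 2 ^ t + 1` such residues with `2 ^ t` lifts each, and `2 ^ t ≤
R` absorbs the last summand. -/
theorem card_zabs_two_pow_mul_le {m t R : ℕ} (ht : t < m) (hn : n = 2 ^ m) (hR : 2 ^ t ≤ R) :
    (Finset.univ.filter fun z : ZMod n => zabs ((2 : ZMod n) ^ t * z) ≤ R).card ≤ 3 * R := by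
  set r := 2 ^ (m - t) with hr
  have hr0 : 0 < r := by positivity
  have hn' : n = 2 ^ t * r := by rw [hn, hr, ← pow_add]; congr 1; omega
  set k := R / 2 ^ t with hk
  have hcard : (Finset.univ.filter fun z : ZMod n => zabs ((2 : ZMod n) ^ t * z) ≤ R).card ≤
      (Finset.range (2 ^ t) ×ˢ (Finset.range (k + 1) ∪ Finset.Ico (r - k) r)).card := by
    refine Finset.card_le_card_of_injOn (fun z => (z.val / r, z.val % r)) (fun z hz => ?_)
      fun y _ z _ h => ?_
    · simp only [Finset.coe_filter, Finset.mem_univ, true_and, Set.mem_ofPred_eq] at hz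
      rw [zabs_two_pow_mul ht hn] at hz
      have h1 : min (z.val % r) (r - z.val % r) ≤ k :=
        (Nat.le_div_iff_mul_le (by positivity)).2 (by rw [mul_comm]; exact hz)
      have h2 := Nat.mod_lt z.val hr0
      simp only [Finset.coe_product, Set.mem_prod, Finset.mem_coe, Finset.mem_range, Finset.mem_union,
        Finset.mem_Ico]
      refine ⟨?_, by omega⟩
      rw [Nat.div_lt_iff_lt_mul hr0, ← hn']
      exact ZMod.val_lt z
    · simp only [Prod.mk.injEq] at h
      apply ZMod.val_injective n
      rw [← Nat.div_add_mod y.val r, ← Nat.div_add_mod z.val r, h.1, h.2]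
  refine hcard.trans ?_
  rw [Finset.card_product, Finset.card_range]
  have h1 : (Finset.range (k + 1) ∪ Finset.Ico (r - k) r).card ≤ 2 * k + 1 := by
    refine (Finset.card_union_le _ _).trans ?_
    rw [Finset.card_range, Nat.card_Ico]
    omega
  have h2 : 2 ^ t * k ≤ R := Nat.mul_div_le R (2 ^ t)
  calc _ ≤ 2 ^ t * (2 * k + 1) := Nat.mul_le_mul_left _ h1
    _ = 2 * (2 ^ t * k) + 2 ^ t := by ring
    _ ≤ _ := by omega

/-- Factors of two are removed until a coordinate is odd. This happens before `m` steps, since `2 ^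
m = 0` and `v ≠ 0`. -/
theorem exists_unimodular_factor {m : ℕ} (hm : 1 ≤ m) (hn : n = 2 ^ m) {v : Idx d n} (hv : v ≠ 0) :
    ∃ t < m, ∃ u : Idx d n, Unimodular u ∧ v = fun s => (2 : ZMod n) ^ t * u s := by
  by_contra hcon
  push Not at hcon
  have key : ∀ t ≤ m, ∃ u : Idx d n, v = fun s => (2 : ZMod n) ^ t * u s := by
    intro t
    induction t with
    | zero => exact fun _ => ⟨v, by simp⟩
    | succ t ih =>
      intro ht
      obtain ⟨u, hu⟩ := ih (by omega)
      have hnu : ¬ Unimodular u := fun h => hcon t (by omega) u h hu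
      simp only [Unimodular, not_exists] at hnu
      refine ⟨fun s => ((u s).val / 2 : ℕ), ?_⟩
      rw [hu]
      funext s
      have h1 := hnu s
      rw [← odd_val_iff_isUnit hm hn, Nat.not_odd_iff_even] at h1
      have h2 : (2 : ZMod n) * ((u s).val / 2 : ℕ) = u s := by
        have : ((2 * ((u s).val / 2) : ℕ) : ZMod n) = u s := by
          rw [Nat.two_mul_div_two_of_even h1, ZMod.natCast_zmod_val]
        exact_mod_cast this
      conv_lhs => rw [← h2]
      rw [pow_succ]
      ring
  obtain ⟨u, hu⟩ := key m le_rfl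
  refine hv ?_
  rw [hu]
  funext s
  have : (2 : ZMod n) ^ m = 0 := by
    have : ((2 ^ m : ℕ) : ZMod n) = 0 := by rw [← hn]; simp
    rw [← this]; push_cast; rfl
  simp [this]

/-- A random matrix maps a fixed nonzero vector into a small box with small probability. -/
theorem prob_mulVec_small {m : ℕ} (hm : 1 ≤ m) (hn : n = 2 ^ m) {v : Idx d n} (hv : v ≠ 0) (R : ℕ) :
    prob (fun S : OddMat d n => ∀ s, zabs ((S.1 *ᵥ v) s) ≤ R) ≤ 2 * (3 * R / n) ^ d := by
  have hd : 1 ≤ d := by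
    rcases Nat.eq_zero_or_pos d with rfl | h
    · exact absurd (Subsingleton.elim v 0) hv
    · exact h
  obtain ⟨t, ht, u, hu, rfl⟩ := exists_unimodular_factor hm hn hv
  have hSv : ∀ S : OddMat d n, S.1 *ᵥ (fun s => (2 : ZMod n) ^ t * u s) =
      fun s => (2 : ZMod n) ^ t * (S.1 *ᵥ u) s := fun S => Matrix.mulVec_smul S.1 ((2 : ZMod n) ^ t) u
  simp only [hSv]
  have hn0 : (0 : ℝ) < n := by exact_mod_cast NeZero.pos n
  -- For `R < 2 ^ t` the event is empty: an odd coordinate of `S u` becomes a nonzero multiple of `2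
  -- ^ t`, whose size is at least `2 ^ t`.
  rcases lt_or_ge R (2 ^ t) with hR | hR
  · refine le_trans (prob_mono (Q := fun _ => False) fun S h => ?_) (by
      have : prob (fun _ : OddMat d n => False) = 0 := by simp [prob]
      rw [this]; positivity)
    obtain ⟨s, hs⟩ := oddMat_mulVec_unimodular hm hn S hu
    have h1 := h s
    rw [zabs_two_pow_mul ht hn] at h1
    rw [← odd_val_iff_isUnit hm hn, Nat.odd_iff] at hs
    have h2 : (2 : ℕ) ∣ 2 ^ (m - t) := dvd_pow_self 2 (by omega)
    have h3 : ((S.1 *ᵥ u) s).val % 2 ^ (m - t) % 2 = 1 := by rw [Nat.mod_mod_of_dvd _ h2]; exact hs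
    have h4 := Nat.mod_lt ((S.1 *ᵥ u) s).val (by positivity : 0 < 2 ^ (m - t))
    have h5 : 1 ≤ min (((S.1 *ᵥ u) s).val % 2 ^ (m - t)) (2 ^ (m - t) - ((S.1 *ᵥ u) s).val % 2 ^ (m - t)) := by
      omega
    have h6 := Nat.mul_le_mul_left (2 ^ t) h5
    omega
  · set Z := Finset.univ.filter fun z : ZMod n => zabs ((2 : ZMod n) ^ t * z) ≤ R with hZ
    have h1 := prob_mulVec_mem_le hm hn hd hu (Fintype.piFinset fun _ => Z)
    refine le_trans (le_of_eq ?_) (h1.trans ?_)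
    · congr 1
      funext S
      simp [hZ, Fintype.mem_piFinset]
    · rw [Fintype.card_piFinset_const, div_pow, mul_div_assoc]
      have hZc : Z.card ≤ 3 * R := card_zabs_two_pow_mul_le ht hn hR
      have h2 : (Z.card : ℝ) ≤ 3 * R := by exact_mod_cast hZc
      push_cast
      gcongr

end RandomMatrix

/-! ## The filter at a random offset -/

section RandomOffset

variable {d n : ℕ} [NeZero n]

theorem abs_valMinAbs_eq_zabs (z : ZMod n) : |(z.valMinAbs : ℝ)| = zabs z := by
  rw [zabs, Nat.cast_natAbs, Int.cast_abs]

/-- The shift `q` and the bucket cancel in the difference, so the matrix alone decides how far `j`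
falls from `i`. -/
theorem offset_sub (b : ℕ) (S : Matrix (Fin d) (Fin d) (ZMod n)) (q i j : Idx d n) :
    (S *ᵥ (j - i)) = offset b S q i j - offset b S q i i := by
  funext s
  have : j - i = (j - q) - (i - q) := by abel
  rw [this, Matrix.mulVec_sub]
  simp [offset, perm]

/-- Rounding to the nearest multiple of the bucket width `r` moves a point by at most `r / 2`. The
half width is an integer quotient in the program, hence the distinction between even `r` and `r =
1`, where nothing is rounded. -/
theorem zabs_offset_self_le {b r : ℕ} (hb : 1 ≤ b) (hr : n = b * r)
    (hr2 : r = 1 ∨ 2 ∣ r) (S : Matrix (Fin d) (Fin d) (ZMod n)) (q i : Idx d n) (s : Fin d) :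
    zabs (offset b S q i i s) * 2 ≤ r := by
  have hn0 := NeZero.pos n
  have hr0 : 0 < r := by
    rcases Nat.eq_zero_or_pos r with h | h
    · rw [h] at hr; omega
    · exact h
  have h1 : n / b = r := by rw [hr]; exact Nat.mul_div_cancel_left _ hb
  have h2 : n / (2 * b) = r / 2 := by rw [mul_comm, ← Nat.div_div_eq_div_mul, h1]
  set P := (perm S q i s).val with hP
  set k := (P + r / 2) / r with hk
  have hkr : r * k + (P + r / 2) % r = P + r / 2 := Nat.div_add_mod _ _
  have hmod := Nat.mod_lt (P + r / 2) hr0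
  have hrep : (((P : ℤ) - r * k : ℤ) : ZMod n) = offset b S q i i s := by
    rw [offset, bucket, h1, h2, ← hP, ← hk]
    have e1 : ((P : ℤ) : ZMod n) = perm S q i s := by
      rw [Int.cast_natCast, hP, ZMod.natCast_zmod_val]
    have e2 : ((r * (k % b) : ℕ) : ZMod n) = ((r * k : ℕ) : ZMod n) := by
      rw [ZMod.natCast_eq_natCast_iff, hr, mul_comm b r]
      exact (Nat.mod_modEq k b).mul_left' r
    rw [Int.cast_sub, e1, e2]
    push_cast
    rfl
  have h3 := zabs_le_of_intCast hrep
  have h4 : ((P : ℤ) - r * k).natAbs * 2 ≤ r := by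
    rcases hr2 with h | ⟨w, hw⟩
    · have : (P : ℤ) - r * k = 0 := by
        have : k = P := by rw [hk, h]; simp
        rw [h, this]
        simp
      rw [this]; simp
    · have hw2 : r / 2 = w := by omega
      rw [hw2] at hkr hmod
      zify at hkr hmod hw
      generalize hx : ((P : ℤ) + w) % r = x at *
      have hx0 : 0 ≤ x := by rw [← hx]; exact Int.emod_nonneg _ (by positivity)
      have : (P : ℤ) - r * k = x - w := by linarith
      rw [this]
      omega
  omega

theorem abs_filterG_le_one {b h : ℕ} (hb : b = 2 * h + 2) (z : Idx d n) : |filterG b z| ≤ 1 := by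
  rw [filterG, Finset.abs_prod]
  refine Finset.prod_le_one (fun _ _ => abs_nonneg _) fun s _ => ?_
  rw [abs_pow]
  exact pow_le_one₀ (abs_nonneg _) (abs_dirichlet_le_one hb _)

/-- A single far coordinate already makes the product small, as all other factors are at most `1`.
-/
theorem abs_filterG_le_pow {b h : ℕ} (hb : b = 2 * h + 2) (z : Idx d n) (s : Fin d) {θ : ℝ}
    (hθ : |dirichlet b (z s)| ≤ θ) : |filterG b z| ≤ θ ^ (2 * d) := by
  rw [filterG, Finset.abs_prod, ← Finset.mul_prod_erase _ _ (Finset.mem_univ s), abs_pow]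
  refine (mul_le_mul (pow_le_pow_left₀ (abs_nonneg _) hθ _) ?_
    (Finset.prod_nonneg fun _ _ => abs_nonneg _) (pow_nonneg ((abs_nonneg _).trans hθ) _)).trans_eq
    (mul_one _)
  refine Finset.prod_le_one (fun _ _ => abs_nonneg _) fun r _ => ?_
  rw [abs_pow]
  exact pow_le_one₀ (abs_nonneg _) (abs_dirichlet_le_one hb _)

/-- The filter is bounded below on the bucket of `i`. -/
theorem filterG_offset_self_ge {b h r : ℕ} (hb : b = 2 * h + 2) (hr : n = b * r)
    (hr2 : r = 1 ∨ 2 ∣ r) (S : Matrix (Fin d) (Fin d) (ZMod n)) (q i : Idx d n) :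
    (2 / π) ^ (2 * d ^ 2) ≤ filterG b (offset b S q i i) := by
  have e : (2 / π) ^ (2 * d ^ 2) = ∏ _s : Fin d, (2 / π) ^ sharp d := by
    rw [Finset.prod_const, Finset.card_univ, Fintype.card_fin, sharp, ← pow_mul]; ring_nf
  rw [e, filterG]
  refine Finset.prod_le_prod (fun _ _ => by positivity) fun s _ => pow_le_pow_left₀ (by positivity) ?_ _
  refine two_div_pi_le_dirichlet hb ?_
  rw [abs_valMinAbs_eq_zabs]
  have h1 := zabs_offset_self_le (by omega) hr hr2 S q i s
  have h2 : (zabs (offset b S q i i s) : ℝ) * 2 ≤ r := by exact_mod_cast h1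
  have h3 : (n : ℝ) = b * r := by exact_mod_cast hr
  have h4 : (0 : ℝ) ≤ b := by positivity
  rw [h3]
  nlinarith

/-- Dyadic bound for the filter in terms of the distance of the images. -/
theorem abs_filterG_offset_le {b h r β : ℕ} (hb : b = 2 * h + 2) (hbβ : b = 2 ^ β) (hr : n = b * r)
    (hr2 : r = 1 ∨ 2 ∣ r) (S : Matrix (Fin d) (Fin d) (ZMod n)) (q i j : Idx d n) :
    |filterG b (offset b S q i j)| ≤ ∑ g ∈ Finset.range (β + 1),
      (if ∀ s, zabs ((S *ᵥ (j - i)) s) ≤ 2 ^ g * r then (16 : ℝ) ^ d * (1 / 4) ^ (g * d) else 0) := by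
  have hr0 : 0 < r := by
    rcases Nat.eq_zero_or_pos r with h | h
    · rw [h] at hr; exact absurd hr (NeZero.ne n)
    · exact h
  have hex : ∃ g, ∀ s, zabs ((S *ᵥ (j - i)) s) ≤ 2 ^ g * r := by
    refine ⟨β, fun s => ?_⟩
    rw [← hbβ, ← hr]
    exact (ZMod.natAbs_valMinAbs_le _).trans (Nat.div_le_self n 2)
  -- The least dyadic scale, in bucket widths, at which the image of `j - i` fits into the box. The
  -- term of this index in the sum dominates the filter.
  set g := Nat.find hex with hg
  have hgβ : g ≤ β := Nat.find_min' hex fun s => by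
    rw [← hbβ, ← hr]
    exact (ZMod.natAbs_valMinAbs_le _).trans (Nat.div_le_self n 2)
  have hterm : |filterG b (offset b S q i j)| ≤ (16 : ℝ) ^ d * (1 / 4) ^ (g * d) := by
    rcases Nat.eq_zero_or_pos g with h0 | h0
    · refine (abs_filterG_le_one hb _).trans ?_
      rw [h0, zero_mul, pow_zero, mul_one]
      exact one_le_pow₀ (by norm_num)
    · have hmin := Nat.find_min hex (m := g - 1) (by omega)
      push Not at hmin
      obtain ⟨s, hs⟩ := hmin
      have e1 : (S *ᵥ (j - i)) s = offset b S q i j s + -(offset b S q i i s) := by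
        rw [offset_sub b S q]; simp [sub_eq_add_neg]
      rw [e1] at hs
      have h1 := zabs_add_le (offset b S q i j s) (-(offset b S q i i s))
      rw [zabs_neg] at h1
      have h2 := zabs_offset_self_le (by omega) hr hr2 S q i s
      have h3 : 2 ^ (g - 1) * r < zabs (offset b S q i j s) + zabs (offset b S q i i s) :=
        lt_of_lt_of_le hs h1
      have h4 : 2 ^ g * r ≤ 4 * zabs (offset b S q i j s) := by
        have h5 : 2 ^ g = 2 * 2 ^ (g - 1) := by
          conv_lhs => rw [show g = (g - 1) + 1 by omega, pow_succ]
          ring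
        have h6 : r ≤ 2 ^ (g - 1) * r := Nat.le_mul_of_pos_left r (by positivity)
        have h7 : 2 ^ g * r = 2 * (2 ^ (g - 1) * r) := by rw [h5]; ring
        omega
      have h5 := abs_dirichlet_mul_le hb (offset b S q i j s)
      rw [abs_valMinAbs_eq_zabs] at h5
      have h6 : |dirichlet b (offset b S q i j s)| ≤ 4 * (1 / 2) ^ g := by
        have hb0 : (0 : ℝ) < b := by rw [hbβ]; positivity
        have hr0' : (0 : ℝ) < r := by exact_mod_cast hr0
        have h7 : (2 : ℝ) ^ g * r ≤ 4 * zabs (offset b S q i j s) := by exact_mod_cast h4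
        have h8 : (n : ℝ) = b * r := by exact_mod_cast hr
        rw [one_div, inv_pow, ← div_eq_mul_inv, le_div_iff₀ (by positivity)]
        set D := |dirichlet b (offset b S q i j s)| with hD
        have hD0 : 0 ≤ D := abs_nonneg _
        have h9 : D * (b * (2 ^ g * r)) ≤ 4 * (b * r) := by
          calc D * (b * (2 ^ g * r)) ≤ D * (b * (4 * zabs (offset b S q i j s))) := by gcongr
            _ = 4 * (D * (b * zabs (offset b S q i j s))) := by ring
            _ ≤ _ := by rw [← h8]; linarith
        have h10 : (D * 2 ^ g) * (b * r) ≤ 4 * (b * r) := by linarith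
        exact le_of_mul_le_mul_right h10 (by positivity)
      refine (abs_filterG_le_pow hb _ s h6).trans (le_of_eq ?_)
      rw [mul_pow, ← pow_mul, pow_mul (4 : ℝ) 2 d, show g * (2 * d) = 2 * (g * d) by ring,
        pow_mul (1 / 2 : ℝ) 2]
      norm_num
  refine hterm.trans ?_
  have := Finset.single_le_sum (f := fun g => if ∀ s, zabs ((S *ᵥ (j - i)) s) ≤ 2 ^ g * r then
    (16 : ℝ) ^ d * (1 / 4) ^ (g * d) else 0) (fun g _ => by split_ifs <;> positivity)
    (Finset.mem_range.2 (Nat.lt_succ_of_le hgβ))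
  refine le_trans (le_of_eq ?_) this
  rw [if_pos (Nat.find_spec hex)]

/-- The filter at the offset of another element is small on average. -/
theorem avg_abs_filterG_offset_le {m β h r : ℕ} (hm : 1 ≤ m) (hn : n = 2 ^ m) (hb : 2 ^ β = 2 * h + 2)
    (hr : n = 2 ^ β * r) (hr2 : r = 1 ∨ 2 ∣ r) (q : Idx d n) {i j : Idx d n} (hij : j ≠ i) :
    avg (fun S : OddMat d n => |filterG (2 ^ β) (offset (2 ^ β) S.1 q i j)|) ≤
      4 * 48 ^ d / (2 ^ β) ^ d := by
  have hd : 1 ≤ d := by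
    rcases Nat.eq_zero_or_pos d with rfl | h
    · exact absurd (Subsingleton.elim j i) hij
    · exact h
  have hv : j - i ≠ 0 := sub_ne_zero.2 hij
  have hpt : ∀ S : OddMat d n, |filterG (2 ^ β) (offset (2 ^ β) S.1 q i j)| ≤
      ∑ g ∈ Finset.range (β + 1), (if ∀ s, zabs ((S.1 *ᵥ (j - i)) s) ≤ 2 ^ g * r then
        (16 : ℝ) ^ d * (1 / 4) ^ (g * d) else 0) :=
    fun S => abs_filterG_offset_le (b := 2 ^ β) (β := β) hb (Eq.refl _) hr hr2 S.1 q i j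
  refine (avg_mono hpt).trans ?_
  rw [avg_sum]
  -- The box of scale `g` is hit with probability at most `2 (3 · 2 ^ g / 2 ^ β) ^ d`. The filter
  -- bound `16 ^ d 4 ^ (-g d)` beats the growth `2 ^ (g d)` of the volume and leaves a geometric
  -- series; this is the purpose of the sharpness `2 d`.
  have hterm : ∀ g : ℕ, avg (fun S : OddMat d n => if ∀ s, zabs ((S.1 *ᵥ (j - i)) s) ≤ 2 ^ g * r then
      (16 : ℝ) ^ d * (1 / 4) ^ (g * d) else 0) ≤ 2 * 48 ^ d / (2 ^ β) ^ d * (1 / 2) ^ g := by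
    intro g
    have e : (fun S : OddMat d n => if ∀ s, zabs ((S.1 *ᵥ (j - i)) s) ≤ 2 ^ g * r then
      (16 : ℝ) ^ d * (1 / 4) ^ (g * d) else 0) = fun S => (16 : ℝ) ^ d * (1 / 4) ^ (g * d) *
        (if ∀ s, zabs ((S.1 *ᵥ (j - i)) s) ≤ 2 ^ g * r then (1 : ℝ) else 0) := by
      funext S; split_ifs <;> simp
    rw [e, avg_const_mul, ← prob_eq_avg]
    have h1 := prob_mulVec_small hm hn hv (2 ^ g * r)
    have hn' : (n : ℝ) = 2 ^ β * r := by exact_mod_cast hr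
    have hr0 : (r : ℝ) ≠ 0 := by
      rintro h0; rw [h0, mul_zero] at hn'; exact NeZero.ne n (by exact_mod_cast hn')
    have h2 : (3 * ((2 ^ g * r : ℕ) : ℝ) / n) = 3 * 2 ^ g / 2 ^ β := by
      rw [hn']; push_cast; field_simp
    rw [h2] at h1
    calc _ ≤ (16 : ℝ) ^ d * (1 / 4) ^ (g * d) * (2 * (3 * 2 ^ g / 2 ^ β) ^ d) := by gcongr
      _ = 2 * (16 * 3) ^ d / (2 ^ β) ^ d * ((1 / 4) ^ g * 2 ^ g) ^ d := by
          rw [div_pow (3 * 2 ^ g : ℝ), mul_pow (3 : ℝ), mul_pow (16 : ℝ), mul_pow ((1 / 4 : ℝ) ^ g), ← pow_mul (1 / 4 : ℝ)]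
          ring
      _ ≤ 2 * 48 ^ d / (2 ^ β) ^ d * (1 / 2) ^ g := by
          rw [← mul_pow]
          norm_num
          gcongr
          exact pow_le_of_le_one (by positivity) (pow_le_one₀ (by norm_num) (by norm_num)) (by omega)
  refine (Finset.sum_le_sum fun g _ => hterm g).trans ?_
  rw [← Finset.mul_sum]
  have hs : ∑ g ∈ Finset.range (β + 1), (1 / 2 : ℝ) ^ g ≤ 2 := by
    rw [geom_sum_eq (by norm_num)]
    have : (0 : ℝ) ≤ (1 / 2) ^ (β + 1) := by positivity
    rw [div_le_iff_of_neg (by norm_num)]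
    linarith
  calc _ ≤ 2 * 48 ^ d / (2 ^ β) ^ d * (2 : ℝ) := by gcongr
    _ = _ := by ring

end RandomOffset

end SparseFT

namespace SparseFT

/-- Markov's inequality for a strict excess. -/
theorem prob_lt_le {Ω : Type} [Fintype Ω] {f : Ω → ℝ} (hf : ∀ ω, 0 ≤ f ω) {t p : ℝ} (ht : 0 ≤ t)
    (hp : 0 ≤ p) (h : avg f ≤ p * t) : prob (fun ω => t < f ω) ≤ p := by
  -- For `t = 0` the mean vanishes, so `f` is zero everywhere. This case occurs when the noise level
  -- is zero.
  rcases ht.eq_or_lt with h0 | h0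
  · refine le_trans (le_of_eq ?_) hp
    rw [← h0, mul_zero] at h
    rw [← h0, prob_eq_avg]
    have : ∀ ω, ¬ 0 < f ω := by
      intro ω hω
      have hpos : 0 < avg f := by
        refine div_pos (Finset.sum_pos' (fun ω _ => hf ω) ⟨ω, Finset.mem_univ _, hω⟩) ?_
        exact_mod_cast Fintype.card_pos_iff.2 ⟨ω⟩
      linarith
    simp [this, avg]
  · refine (prob_mono fun ω hω => le_of_lt hω).trans ((prob_le_of_avg_le hf h0 h).trans ?_)
    rw [mul_div_cancel_right₀ _ h0.ne']

/-! ## Noise in a bucket -/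

section Noise

variable {d n : ℕ} [NeZero n]

/-- The loss from the filter on the central bucket. -/
noncomputable def centralLoss (d : ℕ) : ℝ := (π / 2) ^ (2 * d ^ 2)

/-- The constant in the collision bound. -/
noncomputable def collisionConst (d : ℕ) : ℝ := 4 * 48 ^ d

theorem centralLoss_pos (d : ℕ) : 0 < centralLoss d := by
  rw [centralLoss]; positivity

theorem one_le_centralLoss (d : ℕ) : 1 ≤ centralLoss d :=
  one_le_pow₀ (by rw [le_div_iff₀ two_pos]; linarith [Real.pi_gt_three])

theorem collisionConst_pos (d : ℕ) : 0 < collisionConst d := by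
  rw [collisionConst]; positivity

/-- The factor `(2 π) ^ (4 d F)` in the number of buckets pays for the squared loss of the filter
and for the collision constant. As `4 d F = 8 d ^ 2`, it suffices to compare bases: `16 · 192 = 3072
≤ (2 π) ^ 8`. -/
theorem centralLoss_sq_mul_le {d : ℕ} (hd : 1 ≤ d) :
    centralLoss d ^ 2 * collisionConst d ≤ (2 * π) ^ (4 * d * sharp d) := by
  have hdd : d ≤ d ^ 2 := Nat.le_self_pow two_ne_zero d
  have h1 : centralLoss d ^ 2 ≤ 16 ^ (d ^ 2) := by
    rw [centralLoss, ← pow_mul, show 2 * d ^ 2 * 2 = 4 * d ^ 2 by ring, pow_mul]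
    refine pow_le_pow_left₀ (by positivity) ?_ _
    have : π / 2 ≤ 2 := by linarith [Real.pi_lt_four]
    calc (π / 2) ^ 4 ≤ 2 ^ 4 := pow_le_pow_left₀ (by positivity) this 4
      _ = 16 := by norm_num
  have h2 : collisionConst d ≤ 192 ^ (d ^ 2) := by
    rw [collisionConst]
    calc (4 : ℝ) * 48 ^ d ≤ 4 ^ d * 48 ^ d := by
          gcongr; exact le_self_pow₀ (by norm_num) (by omega)
      _ = 192 ^ d := by rw [← mul_pow]; norm_num
      _ ≤ _ := pow_le_pow_right₀ (by norm_num) hdd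
  calc _ ≤ (16 : ℝ) ^ (d ^ 2) * 192 ^ (d ^ 2) := mul_le_mul h1 h2 (collisionConst_pos d).le (by positivity)
    _ = 3072 ^ (d ^ 2) := by rw [← mul_pow]; norm_num
    _ ≤ ((2 * π) ^ 8) ^ (d ^ 2) := by
        refine pow_le_pow_left₀ (by norm_num) ?_ _
        calc (3072 : ℝ) ≤ (2 * 3) ^ 8 := by norm_num
          _ ≤ (2 * π) ^ 8 := by gcongr; exact Real.pi_gt_three.le
    _ = _ := by rw [← pow_mul, sharp]; ring_nf

/-- The contribution of the other elements of `Q` to the bucket of `i`. -/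
noncomputable def noiseHead (b : ℕ) (S : Matrix (Fin d) (Fin d) (ZMod n)) (q : Idx d n)
    (Q : Finset (Idx d n)) (x : Idx d n → ℂ) (i : Idx d n) : ℝ :=
  ∑ j ∈ Q.erase i, |filterG b (offset b S q i j)| * ‖x j‖

/-- The contribution of the elements outside `Q` to the bucket of `i`. -/
noncomputable def noiseTail (b : ℕ) (S : Matrix (Fin d) (Fin d) (ZMod n)) (q : Idx d n)
    (Q : Finset (Idx d n)) (x : Idx d n → ℂ) (i a : Idx d n) : ℂ :=
  ∑ j ∈ Qᶜ.erase i, (filterG b (offset b S q i j) : ℂ) * x j * om (a ⬝ᵥ (S *ᵥ j))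

/-- The mean square of `noiseTail`. -/
noncomputable def tailVar (b : ℕ) (S : Matrix (Fin d) (Fin d) (ZMod n)) (q : Idx d n)
    (Q : Finset (Idx d n)) (x : Idx d n → ℂ) (i : Idx d n) : ℝ :=
  ∑ j ∈ Qᶜ.erase i, filterG b (offset b S q i j) ^ 2 * ‖x j‖ ^ 2

theorem noiseHead_nonneg (b : ℕ) (S : Matrix (Fin d) (Fin d) (ZMod n)) (q : Idx d n)
    (Q : Finset (Idx d n)) (x : Idx d n → ℂ) (i : Idx d n) : 0 ≤ noiseHead b S q Q x i :=
  Finset.sum_nonneg fun _ _ => by positivity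

theorem tailVar_nonneg (b : ℕ) (S : Matrix (Fin d) (Fin d) (ZMod n)) (q : Idx d n)
    (Q : Finset (Idx d n)) (x : Idx d n → ℂ) (i : Idx d n) : 0 ≤ tailVar b S q Q x i :=
  Finset.sum_nonneg fun _ _ => by positivity

theorem exactBin_bucket_sub_le (b : ℕ) (S : Matrix (Fin d) (Fin d) (ZMod n)) (q a : Idx d n)
    (Q : Finset (Idx d n)) (x : Idx d n → ℂ) (i : Idx d n) :
    ‖exactBin b S q a x (bucket b S q i) -
      (filterG b (offset b S q i i) : ℂ) * x i * om (a ⬝ᵥ (S *ᵥ i))‖ ≤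
      noiseHead b S q Q x i + ‖noiseTail b S q Q x i a‖ := by
  have h1 : exactBin b S q a x (bucket b S q i) =
      ∑ l, (filterG b (offset b S q i l) : ℂ) * x l * om (a ⬝ᵥ (S *ᵥ l)) := rfl
  have h2 : (Finset.univ : Finset (Idx d n)).erase i = Q.erase i ∪ Qᶜ.erase i := by
    ext j
    simp only [Finset.mem_erase, Finset.mem_union, Finset.mem_compl, Finset.mem_univ]
    tauto
  have h3 : Disjoint (Q.erase i) (Qᶜ.erase i) :=
    (disjoint_compl_right (a := Q)).mono (Finset.erase_subset _ _) (Finset.erase_subset _ _)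
  rw [h1, ← Finset.add_sum_erase _ _ (Finset.mem_univ i), add_sub_cancel_left, h2,
    Finset.sum_union h3]
  refine (norm_add_le _ _).trans (add_le_add ?_ le_rfl)
  refine (norm_sum_le _ _).trans (le_of_eq ?_)
  refine Finset.sum_congr rfl fun j _ => ?_
  rw [norm_mul, norm_mul, norm_om, mul_one, Complex.norm_real, Real.norm_eq_abs]

theorem card_idx : (Fintype.card (Idx d n) : ℝ) = (n : ℝ) ^ d := by
  rw [Fintype.card_fun, ZMod.card, Fintype.card_fin]; push_cast; rfl

theorem mulVec_injective_of_isUnit {S : Matrix (Fin d) (Fin d) (ZMod n)} (hS : IsUnit S.det) :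
    Function.Injective fun j : Idx d n => S *ᵥ j := by
  intro j l h
  have h1 : S⁻¹ *ᵥ (S *ᵥ j) = S⁻¹ *ᵥ (S *ᵥ l) := congrArg (fun v => S⁻¹ *ᵥ v) h
  rwa [Matrix.mulVec_mulVec, Matrix.mulVec_mulVec, Matrix.nonsing_inv_mul S hS, Matrix.one_mulVec,
    Matrix.one_mulVec] at h1

/-- An invertible `S` gives distinct positions distinct characters of `a`, so Parseval's identity
removes the cross terms. Thus the tail enters through its energy only. -/
theorem avg_noiseTail_sq (b : ℕ) {S : Matrix (Fin d) (Fin d) (ZMod n)} (hS : IsUnit S.det)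
    (q : Idx d n) (Q : Finset (Idx d n)) (x : Idx d n → ℂ) (i : Idx d n) :
    avg (fun a => ‖noiseTail b S q Q x i a‖ ^ 2) = tailVar b S q Q x i := by
  have h := sum_norm_sq_characters (Qᶜ.erase i) (fun j => S *ᵥ j)
    (mulVec_injective_of_isUnit hS).injOn
    (fun j => (filterG b (offset b S q i j) : ℂ) * x j)
  have hn : (n : ℝ) ^ d ≠ 0 := (len_pos d n).ne'
  rw [avg, card_idx]
  simp only [noiseTail]
  rw [h, mul_div_cancel_left₀ _ hn]
  refine Finset.sum_congr rfl fun j _ => ?_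
  rw [norm_mul, Complex.norm_real, Real.norm_eq_abs, mul_pow, sq_abs]

/-- The conditions on the side `2 ^ β` of the hash table. -/
structure GoodSide (n m β : ℕ) : Prop where
  n_eq : n = 2 ^ m
  one_le : 1 ≤ β
  le : β ≤ m

namespace GoodSide

variable {m β : ℕ}

theorem side_eq (H : GoodSide n m β) : 2 ^ β = 2 * (2 ^ (β - 1) - 1) + 2 := by
  have h1 : 2 ^ β = 2 * 2 ^ (β - 1) := by
    conv_lhs => rw [show β = (β - 1) + 1 by have := H.one_le; omega, pow_succ]
    ring
  have h2 : 0 < 2 ^ (β - 1) := by positivity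
  omega

theorem n_eq_mul (H : GoodSide n m β) : n = 2 ^ β * 2 ^ (m - β) := by
  rw [← pow_add, H.n_eq]; congr 1; have := H.le; omega

theorem quot (H : GoodSide n m β) : 2 ^ (m - β) = 1 ∨ 2 ∣ 2 ^ (m - β) := by
  rcases Nat.eq_zero_or_pos (m - β) with h | h
  · left; rw [h, pow_zero]
  · right; exact dvd_pow_self 2 (by omega)

theorem one_le_m (H : GoodSide n m β) : 1 ≤ m := H.one_le.trans H.le

theorem isUnit (H : GoodSide n m β) (S : OddMat d n) : IsUnit S.1.det :=
  oddMat_isUnit H.one_le_m H.n_eq S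

theorem filterG_ge (H : GoodSide n m β) (S : Matrix (Fin d) (Fin d) (ZMod n)) (q i : Idx d n) :
    (centralLoss d)⁻¹ ≤ filterG (2 ^ β) (offset (2 ^ β) S q i i) := by
  have := filterG_offset_self_ge H.side_eq H.n_eq_mul H.quot S q i
  rwa [centralLoss, ← inv_pow, inv_div]

theorem avg_filterG (H : GoodSide n m β) (q : Idx d n) {i j : Idx d n} (hij : j ≠ i) :
    avg (fun S : OddMat d n => |filterG (2 ^ β) (offset (2 ^ β) S.1 q i j)|) ≤
      collisionConst d / (2 ^ β) ^ d :=
  avg_abs_filterG_offset_le H.one_le_m H.n_eq H.side_eq H.n_eq_mul H.quot q hij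

theorem avg_noiseHead (H : GoodSide n m β) (q : Idx d n) (Q : Finset (Idx d n))
    (x : Idx d n → ℂ) (i : Idx d n) :
    avg (fun S : OddMat d n => noiseHead (2 ^ β) S.1 q Q x i) ≤
      collisionConst d / (2 ^ β) ^ d * ∑ j ∈ Q, ‖x j‖ := by
  have hpos : 0 ≤ collisionConst d / (2 ^ β) ^ d := div_nonneg (collisionConst_pos d).le (by positivity)
  simp only [noiseHead]
  rw [avg_sum, Finset.mul_sum]
  refine (Finset.sum_le_sum (g := fun j => collisionConst d / (2 ^ β) ^ d * ‖x j‖) fun j hj => ?_).trans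
    (Finset.sum_le_sum_of_subset_of_nonneg (Finset.erase_subset _ _) fun j _ _ => by positivity)
  rw [avg_mul_const]
  exact mul_le_mul_of_nonneg_right (H.avg_filterG q (Finset.ne_of_mem_erase hj)) (norm_nonneg _)

/-- The filter is at most `1` in size, so `G ^ 2 ≤ |G|` and the bound for the first moment suffices.
-/
theorem avg_tailVar (H : GoodSide n m β) (q : Idx d n) (Q : Finset (Idx d n))
    (x : Idx d n → ℂ) (i : Idx d n) :
    avg (fun S : OddMat d n => tailVar (2 ^ β) S.1 q Q x i) ≤
      collisionConst d / (2 ^ β) ^ d * ∑ j ∈ Qᶜ, ‖x j‖ ^ 2 := by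
  have hpos : 0 ≤ collisionConst d / (2 ^ β) ^ d := div_nonneg (collisionConst_pos d).le (by positivity)
  simp only [tailVar]
  rw [avg_sum, Finset.mul_sum]
  refine (Finset.sum_le_sum (g := fun j => collisionConst d / (2 ^ β) ^ d * ‖x j‖ ^ 2)
    fun j hj => ?_).trans
    (Finset.sum_le_sum_of_subset_of_nonneg (Finset.erase_subset _ _) fun j _ _ => by positivity)
  rw [avg_mul_const]
  refine mul_le_mul_of_nonneg_right (le_trans (avg_mono fun S => ?_)
    (H.avg_filterG q (Finset.ne_of_mem_erase hj))) (by positivity)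
  rw [← sq_abs]
  exact pow_le_of_le_one (abs_nonneg _) (abs_filterG_le_one H.side_eq _) two_ne_zero

/-- The relation between a hashed measurement and the element hashed to the bucket. -/
theorem bucket_error {β c : ℕ} (x χ : Idx d n → ℂ) (S : Matrix (Fin d) (Fin d) (ZMod n)) (q a : Idx d n)
    (Q : Finset (Idx d n)) (i : Idx d n) {ν : ℝ}
    (hν : semiErr d (windowWidth d n c) * ∑ l, ‖χ l‖ ≤ ν) (u : ℂ)
    (hu : ‖u - exactBin (2 ^ β) S q a (x - χ) (bucket (2 ^ β) S q i)‖ ≤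
      semiErr d (windowWidth d n c) * ∑ l, ‖χ l‖) :
    ‖u - (filterG (2 ^ β) (offset (2 ^ β) S q i i) : ℂ) * (x - χ) i * om (a ⬝ᵥ (S *ᵥ i))‖ ≤
      noiseHead (2 ^ β) S q Q (x - χ) i + ‖noiseTail (2 ^ β) S q Q (x - χ) i a‖ + ν := by
  have h1 := exactBin_bucket_sub_le (2 ^ β) S q a Q (x - χ) i
  have h2 := norm_add_le (u - exactBin (2 ^ β) S q a (x - χ) (bucket (2 ^ β) S q i))
    (exactBin (2 ^ β) S q a (x - χ) (bucket (2 ^ β) S q i) -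
      (filterG (2 ^ β) (offset (2 ^ β) S q i i) : ℂ) * (x - χ) i * om (a ⬝ᵥ (S *ᵥ i)))
  rw [sub_add_sub_cancel] at h2
  linarith

end GoodSide

theorem bucket_lt {b : ℕ} (hb : 0 < b) (S : Matrix (Fin d) (Fin d) (ZMod n)) (q i : Idx d n)
    (s : Fin d) : bucket b S q i s < b := Nat.mod_lt _ hb

/-! ## A single estimate -/

/-- The estimate of `(x - χ) i` from one hashing. -/
noncomputable def singleEst (β c : ℕ) (x χ : Idx d n → ℂ) (i : Idx d n)
    (ρ : OddMat d n × Idx d n × Idx d n) : ℂ :=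
  (hashToBins c (sample (dft x)) χ β ρ.1.1 ρ.2.1 ρ.2.2).val (bucket (2 ^ β) ρ.1.1 ρ.2.1 i) *
    (((filterG (2 ^ β) (offset (2 ^ β) ρ.1.1 ρ.2.1 i i))⁻¹ : ℝ) : ℂ) *
      om (-(ρ.2.2 ⬝ᵥ (ρ.1.1 *ᵥ i)))

/-- Removing the phase preserves the error, and dividing by the filter on the central bucket
amplifies it by at most `centralLoss`. -/
theorem singleEst_error {m β : ℕ} (H : GoodSide n m β) {c : ℕ} (hc : 1 ≤ windowWidth d n c)
    (x χ : Idx d n → ℂ) (Q : Finset (Idx d n)) (i : Idx d n) {ν : ℝ}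
    (hν : semiErr d (windowWidth d n c) * ∑ l, ‖χ l‖ ≤ ν) (ρ : OddMat d n × Idx d n × Idx d n) :
    ‖singleEst β c x χ i ρ - (x - χ) i‖ ≤ centralLoss d *
      (noiseHead (2 ^ β) ρ.1.1 ρ.2.1 Q (x - χ) i +
        ‖noiseTail (2 ^ β) ρ.1.1 ρ.2.1 Q (x - χ) i ρ.2.2‖ + ν) := by
  obtain ⟨S, q, z⟩ := ρ
  have h1 := GoodSide.bucket_error x χ S.1 q z Q i hν _
    (hashToBins_error hc (sample (dft x)) x χ (fun t => rfl) H.side_eq ⟨_, H.n_eq_mul⟩ S.1 q z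
      (bucket (2 ^ β) S.1 q i) (bucket_lt (by positivity) S.1 q i))
  set u := (hashToBins c (sample (dft x)) χ β S.1 q z).val (bucket (2 ^ β) S.1 q i) with hu
  have hG := H.filterG_ge S.1 q i
  set G := filterG (2 ^ β) (offset (2 ^ β) S.1 q i i) with hGdef
  have hG0 : 0 < G := lt_of_lt_of_le (inv_pos.2 (centralLoss_pos d)) hG
  have hGC : (G : ℂ) ≠ 0 := by exact_mod_cast hG0.ne'
  have h2 : singleEst β c x χ i (S, q, z) - (x - χ) i =
      (u - (G : ℂ) * (x - χ) i * om (z ⬝ᵥ (S.1 *ᵥ i))) * ((G⁻¹ : ℝ) : ℂ) * om (-(z ⬝ᵥ (S.1 *ᵥ i))) := by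
    have h3 : om (z ⬝ᵥ (S.1 *ᵥ i)) * om (-(z ⬝ᵥ (S.1 *ᵥ i))) = 1 := by
      rw [mul_comm]; exact om_neg_mul _
    have h4 : (G : ℂ) * ((G⁻¹ : ℝ) : ℂ) = 1 := by push_cast; exact mul_inv_cancel₀ hGC
    change u * ((G⁻¹ : ℝ) : ℂ) * om (-(z ⬝ᵥ (S.1 *ᵥ i))) - (x - χ) i = _
    linear_combination ((x - χ) i) * h3 * (G : ℂ) * ((G⁻¹ : ℝ) : ℂ) + ((x - χ) i) * h4
  rw [h2, norm_mul, norm_om, mul_one, norm_mul, Complex.norm_real, Real.norm_eq_abs,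
    abs_of_pos (inv_pos.2 hG0), mul_comm]
  have h5 : G⁻¹ ≤ centralLoss d := (inv_le_comm₀ (centralLoss_pos d) hG0).1 hG
  exact mul_le_mul h5 h1 (norm_nonneg _) (centralLoss_pos d).le

/-- A single estimate is accurate with probability `99/100`. -/
theorem prob_singleEst {m β : ℕ} (H : GoodSide n m β) {c : ℕ} (hc : 1 ≤ windowWidth d n c)
    (x χ : Idx d n → ℂ) (Q : Finset (Idx d n)) (i : Idx d n) {δ : ℝ} (hδ : 0 ≤ δ)
    (hν : centralLoss d * (semiErr d (windowWidth d n c) * ∑ l, ‖χ l‖) ≤ δ / 3)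
    (hhead : centralLoss d * (collisionConst d / (2 ^ β) ^ d * ∑ j ∈ Q, ‖(x - χ) j‖) ≤
      1 / 200 * (δ / 3))
    (htail : centralLoss d ^ 2 * (collisionConst d / (2 ^ β) ^ d * ∑ j ∈ Qᶜ, ‖(x - χ) j‖ ^ 2) ≤
      1 / 200 * (δ / 3) ^ 2) :
    prob (fun ρ : OddMat d n × Idx d n × Idx d n => δ < ‖singleEst β c x χ i ρ - (x - χ) i‖) ≤
      1 / 100 := by
  set y := x - χ with hy
  have hΓ := centralLoss_pos d
  -- The error has three parts with an allowance of `δ / 3` each: the head by Markov's inequality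
  -- and the tail by Chebyshev's, each failing with probability at most `1/200`, and the
  -- deterministic numerical error.
  have hA : prob (fun ρ : OddMat d n × Idx d n × Idx d n =>
      δ / 3 < centralLoss d * noiseHead (2 ^ β) ρ.1.1 ρ.2.1 Q y i) ≤ 1 / 200 := by
    refine prob_lt_le (fun ρ => mul_nonneg hΓ.le (noiseHead_nonneg _ _ _ _ _ _)) (by positivity)
      (by norm_num) (le_trans ?_ hhead)
    rw [avg_const_mul, avg_prod']
    refine mul_le_mul_of_nonneg_left ?_ hΓ.le
    refine avg_le_of_le ?_ fun qz => H.avg_noiseHead qz.1 Q y i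
    exact mul_nonneg (div_nonneg (collisionConst_pos d).le (by positivity))
      (Finset.sum_nonneg fun _ _ => norm_nonneg _)
  have hB : prob (fun ρ : OddMat d n × Idx d n × Idx d n =>
      (δ / 3) ^ 2 < centralLoss d ^ 2 * ‖noiseTail (2 ^ β) ρ.1.1 ρ.2.1 Q y i ρ.2.2‖ ^ 2) ≤ 1 / 200 := by
    refine prob_lt_le (fun ρ => by positivity) (by positivity)
      (by norm_num) (le_trans ?_ htail)
    rw [avg_const_mul, avg_prod]
    refine mul_le_mul_of_nonneg_left ?_ (by positivity)
    have h1 : ∀ S : OddMat d n, avg (fun qz : Idx d n × Idx d n =>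
        ‖noiseTail (2 ^ β) S.1 qz.1 Q y i qz.2‖ ^ 2) = avg fun q => tailVar (2 ^ β) S.1 q Q y i := by
      intro S
      rw [avg_prod]
      congr 1
      funext q
      exact avg_noiseTail_sq (2 ^ β) (H.isUnit S) q Q y i
    calc _ = avg (fun S : OddMat d n => avg fun q => tailVar (2 ^ β) S.1 q Q y i) := by
          congr 1; funext S; exact h1 S
      _ = avg (fun Sq : OddMat d n × Idx d n => tailVar (2 ^ β) Sq.1.1 Sq.2 Q y i) := by
          rw [avg_prod]
      _ ≤ _ := by
          rw [avg_prod']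
          refine avg_le_of_le ?_ fun q => H.avg_tailVar q Q y i
          exact mul_nonneg (div_nonneg (collisionConst_pos d).le (by positivity))
            (Finset.sum_nonneg fun _ _ => by positivity)
  have hor := prob_or_le (fun ρ : OddMat d n × Idx d n × Idx d n =>
      δ / 3 < centralLoss d * noiseHead (2 ^ β) ρ.1.1 ρ.2.1 Q y i)
    (fun ρ => (δ / 3) ^ 2 < centralLoss d ^ 2 * ‖noiseTail (2 ^ β) ρ.1.1 ρ.2.1 Q y i ρ.2.2‖ ^ 2)
  refine (prob_mono fun ρ hρ => ?_).trans (hor.trans (by linarith [hA, hB]))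
  by_contra hcon
  rw [not_or, not_lt, not_lt] at hcon
  have h1 := singleEst_error H hc x χ Q i le_rfl ρ
  have h2 : centralLoss d * ‖noiseTail (2 ^ β) ρ.1.1 ρ.2.1 Q y i ρ.2.2‖ ≤ δ / 3 := by
    have := hcon.2
    rw [← mul_pow] at this
    exact (le_abs_self _).trans (abs_le_of_sq_le_sq this (by positivity))
  rw [← hy] at h1
  rw [mul_add, mul_add] at h1
  linarith [hcon.1]

end Noise

end SparseFT

namespace SparseFT

/-! ## Estimation -/

section Estimation

variable {d n : ℕ} [NeZero n]

/-- The coordinatewise median of the estimates of `(x - χ) i`. -/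
noncomputable def medEst (β c : ℕ) (x χ : Idx d n → ℂ) {r : ℕ}
    (ρ : Fin r → OddMat d n × Idx d n × Idx d n) (i : Idx d n) : ℂ :=
  let ws := ((List.finRange r).map fun t => singleEst β c x χ i (ρ t)).reverse
  ⟨(median (ws.map Complex.re)).val, (median (ws.map Complex.im)).val⟩

theorem foldl_select (E : Idx d n → ℂ) (l : List (Idx d n))
    (st : Finset (Idx d n) × (Idx d n → ℂ)) :
    l.foldl (fun st f => if 0 < ‖E f‖ then (insert f st.1, Function.update st.2 f (E f)) else st) st
      = (st.1 ∪ (l.toFinset.filter fun f => 0 < ‖E f‖),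
        fun f => if f ∈ l ∧ 0 < ‖E f‖ then E f else st.2 f) := by
  induction l generalizing st with
  | nil => simp
  | cons a l ih =>
    rw [List.foldl_cons, ih]
    by_cases h : 0 < ‖E a‖
    · rw [if_pos h]
      refine Prod.ext ?_ ?_
      · ext f
        simp only [Finset.mem_union, Finset.mem_insert, Finset.mem_filter, List.mem_toFinset,
          List.mem_cons]
        constructor
        · rintro ((rfl | h1) | h1)
          · exact Or.inr ⟨Or.inl rfl, h⟩
          · exact Or.inl h1
          · exact Or.inr ⟨Or.inr h1.1, h1.2⟩
        · rintro (h1 | ⟨rfl | h1, h2⟩)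
          · exact Or.inl (Or.inr h1)
          · exact Or.inl (Or.inl rfl)
          · exact Or.inr ⟨h1, h2⟩
      · funext f
        simp only [List.mem_cons]
        by_cases hf : f = a
        · subst hf; simp [h]
        · simp [hf]
    · rw [if_neg h]
      refine Prod.ext ?_ ?_
      · ext f
        simp only [Finset.mem_union, Finset.mem_filter, List.mem_toFinset, List.mem_cons]
        constructor
        · rintro (h1 | h1)
          · exact Or.inl h1
          · exact Or.inr ⟨Or.inr h1.1, h1.2⟩
        · rintro (h1 | ⟨rfl | h1, h2⟩)
          · exact Or.inl h1
          · exact absurd h2 h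
          · exact Or.inr ⟨h1, h2⟩
      · funext f
        simp only [List.mem_cons]
        by_cases hf : f = a
        · subst hf; simp [h]
        · simp [hf]

theorem estimateValues_val (α : ℝ) (c : ℕ) (x χ : Idx d n → ℂ) (L : Finset (Idx d n)) (k : ℕ)
    (ε : ℝ) {r : ℕ} (ρ : Fin r → OddMat d n × Idx d n × Idx d n) :
    (estimateValues α c (dft x) χ L k ε 0 ρ).val =
      (L.filter fun f => 0 < ‖medEst (bucketExp d (estBuckets d α k ε)) c x χ ρ f‖,
        fun f => if f ∈ L then medEst (bucketExp d (estBuckets d α k ε)) c x χ ρ f else 0) := by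
  set β := bucketExp d (estBuckets d α k ε) with hβ
  have hu : ∀ t : Fin r, (tabulate (List.finRange r) fun t => do
      let ρt ← op (8 * d ^ 3 + 2 * d) (ρ t)
      hashToBins c (sample (dft x)) χ β ρt.1.1 ρt.2.1 ρt.2.2).val t =
      (hashToBins c (sample (dft x)) χ β (ρ t).1.1 (ρ t).2.1 (ρ t).2.2).val := fun t => by
    rw [tabulate_val _ _ _ (List.mem_finRange t)]; simp
  simp only [estimateValues, bind_val, loop_val, op_val, ← hβ]
  have hws : ∀ f : Idx d n, ((List.finRange r).foldl (fun (ws : List ℂ) t =>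
      ((tabulate (List.finRange r) fun t => do
        let ρt ← op (8 * d ^ 3 + 2 * d) (ρ t)
        hashToBins c (sample (dft x)) χ β ρt.1.1 ρt.2.1 ρt.2.2).val t
        (bucket (2 ^ β) (ρ t).1.1 (ρ t).2.1 f) *
        (((filterG (2 ^ β) (offset (2 ^ β) (ρ t).1.1 (ρ t).2.1 f f))⁻¹ : ℝ) : ℂ) *
          om (-((ρ t).2.2 ⬝ᵥ ((ρ t).1.1 *ᵥ f)))) :: ws) []) =
      ((List.finRange r).map fun t => singleEst β c x χ f (ρ t)).reverse := by
    intro f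
    rw [← List.append_nil (List.reverse _), ← foldl_cons_map]
    simp only [hu]
    rfl
  have key := foldl_select (fun f => medEst β c x χ ρ f) L.toList (∅, fun _ => 0)
  refine Eq.trans ?_ (key.trans ?_)
  · congr 1
    funext st f
    have := hws f
    simp only [medEst, ← this]
  · refine Prod.ext ?_ ?_
    · simp
    · funext f
      simp only [Finset.mem_toList]
      by_cases hf : f ∈ L
      · by_cases h0 : 0 < ‖medEst β c x χ ρ f‖
        · simp [hf, h0]
        · have : medEst β c x χ ρ f = 0 := by simpa using h0
          simp [this]
      · simp [hf]

/-- A complex estimate within `δ` is within `δ` in both coordinates. If more than half are, so are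
the two medians, and the coordinates add up to `2 δ`. -/
theorem medEst_error (β c : ℕ) (x χ : Idx d n → ℂ) {r : ℕ}
    (ρ : Fin r → OddMat d n × Idx d n × Idx d n) (i : Idx d n) {δ : ℝ}
    (h : 2 * countOf (fun σ => δ < ‖singleEst β c x χ i σ - (x - χ) i‖) ρ < r) :
    ‖medEst β c x χ ρ i - (x - χ) i‖ ≤ 2 * δ := by
  set y := (x - χ) i
  set E := fun t : Fin r => singleEst β c x χ i (ρ t) with hE
  set ws := ((List.finRange r).map E).reverse with hws
  have hlen : ws.length = r := by simp [hws]
  have hgood : r < 2 * (Finset.univ.filter fun t : Fin r => ‖E t - y‖ ≤ δ).card := by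
    have h1 := Finset.card_filter_add_card_filter_not (s := (Finset.univ : Finset (Fin r)))
      (fun t : Fin r => ‖E t - y‖ ≤ δ)
    rw [Finset.card_univ, Fintype.card_fin] at h1
    simp only [not_le] at h1
    rw [countOf] at h
    change 2 * (Finset.univ.filter fun t : Fin r => δ < ‖E t - y‖).card < r at h
    omega
  have hcount : ∀ (g : ℂ → ℝ), (∀ z w, |g z - g w| ≤ ‖z - w‖) →
      r < 2 * (ws.map g).countP fun v => decide (|v - g y| ≤ δ) := by
    intro g hg
    refine hgood.trans_le (Nat.mul_le_mul_left 2 ?_)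
    rw [List.countP_map, hws, List.countP_reverse, List.countP_map]
    have h2 : (Finset.univ.filter fun t : Fin r => ‖E t - y‖ ≤ δ) =
        ((List.finRange r).filter fun t => decide (‖E t - y‖ ≤ δ)).toFinset := by
      ext t; simp
    rw [h2, List.toFinset_card_of_nodup ((List.nodup_finRange r).filter _),
      ← List.countP_eq_length_filter]
    refine List.countP_mono_left fun t _ ht => ?_
    simp only [Function.comp_apply, decide_eq_true_eq] at ht ⊢
    exact (hg _ _).trans ht
  have hre := median_near (ws.map Complex.re) y.re δ (by
    rw [List.length_map, hlen]
    exact hcount Complex.re fun z w => by rw [← Complex.sub_re]; exact Complex.abs_re_le_norm _)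
  have him := median_near (ws.map Complex.im) y.im δ (by
    rw [List.length_map, hlen]
    exact hcount Complex.im fun z w => by rw [← Complex.sub_im]; exact Complex.abs_im_le_norm _)
  refine (Complex.norm_le_abs_re_add_abs_im _).trans ?_
  rw [Complex.sub_re, Complex.sub_im, two_mul]
  exact add_le_add hre him

/-- All estimates are accurate with high probability. -/
theorem prob_medEst {m β : ℕ} (H : GoodSide n m β) {c : ℕ} (hc : 1 ≤ windowWidth d n c)
    (x χ : Idx d n → ℂ) (Q : Finset (Idx d n)) {δ : ℝ} (hδ : 0 ≤ δ)
    (hν : centralLoss d * (semiErr d (windowWidth d n c) * ∑ l, ‖χ l‖) ≤ δ / 3)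
    (hhead : centralLoss d * (collisionConst d / (2 ^ β) ^ d * ∑ j ∈ Q, ‖(x - χ) j‖) ≤
      1 / 200 * (δ / 3))
    (htail : centralLoss d ^ 2 * (collisionConst d / (2 ^ β) ^ d * ∑ j ∈ Qᶜ, ‖(x - χ) j‖ ^ 2) ≤
      1 / 200 * (δ / 3) ^ 2) {r : ℕ} (hr1 : 1 ≤ r) (hr : 2 * Real.log (len d n) ≤ r) :
    prob (fun ρ : Fin r → OddMat d n × Idx d n × Idx d n =>
      ∃ i, 2 * δ < ‖medEst β c x χ ρ i - (x - χ) i‖) ≤ (len d n)⁻¹ := by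
  have : Nonempty (OddMat d n) := oddMat_nonempty H.one_le_m H.n_eq
  have hN : 0 < len d n := len_pos d n
  have h1 : ∀ i : Idx d n, prob (fun ρ : Fin r → OddMat d n × Idx d n × Idx d n =>
      2 * δ < ‖medEst β c x χ ρ i - (x - χ) i‖) ≤ (len d n)⁻¹ ^ 2 := by
    intro i
    have h2 := prob_singleEst H hc x χ Q i hδ hν hhead htail
    have h3 := prob_countOf_le_two_pow (r := r) _ h2 ((r + 1) / 2) (by omega)
    refine (prob_mono fun ρ hρ => ?_).trans (h3.trans ?_)
    · by_contra hcon
      rw [not_le] at hcon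
      exact absurd (medEst_error β c x χ ρ i (by omega)) (not_le.2 hρ)
    -- A wrong median needs half of the hashings to fail. Chernoff's bound is `2 ^ r 100 ^ (-r / 2)
    -- = 5 ^ (-r) ≤ e ^ (-r) ≤ N ^ (-2)`, which leaves `1 / N` after the union over all `N`
    -- positions.
    · have h4 : ((1 : ℝ) / 100) ^ ((r + 1) / 2) ≤ (1 / 10) ^ r := by
        calc ((1 : ℝ) / 100) ^ ((r + 1) / 2) = (1 / 10) ^ (2 * ((r + 1) / 2)) := by
              rw [pow_mul]; norm_num
          _ ≤ _ := pow_le_pow_of_le_one (by norm_num) (by norm_num) (by omega)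
      calc (2 : ℝ) ^ r * (1 / 100) ^ ((r + 1) / 2) ≤ 2 ^ r * (1 / 10) ^ r := by gcongr
        _ = (1 / 5) ^ r := by rw [← mul_pow]; norm_num
        _ ≤ (Real.exp (-1)) ^ r := by
            refine pow_le_pow_left₀ (by norm_num) ?_ _
            rw [Real.exp_neg, one_div]
            exact inv_anti₀ (Real.exp_pos _) (by linarith [Real.exp_one_lt_d9])
        _ = Real.exp (-r) := by rw [← Real.exp_nat_mul]; ring_nf
        _ ≤ Real.exp (-(2 * Real.log (len d n))) := Real.exp_le_exp.2 (by linarith)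
        _ = _ := by
            rw [show -(2 * Real.log (len d n)) = (2 : ℕ) * -Real.log (len d n) by push_cast; ring,
              Real.exp_nat_mul, Real.exp_neg, Real.exp_log hN]
  have h5 := prob_exists_le Finset.univ fun (i : Idx d n)
    (ρ : Fin r → OddMat d n × Idx d n × Idx d n) => 2 * δ < ‖medEst β c x χ ρ i - (x - χ) i‖
  refine (prob_mono fun ρ hρ => ?_).trans (h5.trans ?_)
  · obtain ⟨i, hi⟩ := hρ
    exact ⟨i, Finset.mem_univ i, hi⟩
  · refine (Finset.sum_le_sum fun i _ => h1 i).trans ?_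
    rw [Finset.sum_const, nsmul_eq_mul, Finset.card_univ, card_idx, ← len, sq, ← mul_assoc,
      mul_inv_cancel₀ hN.ne', one_mul]

end Estimation

end SparseFT

namespace SparseFT

/-! ## Decoding a position -/

section Decoding

theorem foldl_count {ι : Type} (P : ι → Prop) [DecidablePred P] (l : List ι) (c : ℕ) :
    l.foldl (fun cnt a => if P a then cnt + 1 else cnt) c = c + l.countP fun a => decide (P a) := by
  induction l generalizing c with
  | nil => simp
  | cons a l ih =>
    rw [List.foldl_cons, ih, List.countP_cons]
    by_cases h : P a
    · simp [h]; omega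
    · simp [h]

theorem foldl_filter_cons {ι : Type} (P : ι → Prop) [DecidablePred P] (l acc : List ι) :
    l.foldl (fun acc r => if P r then r :: acc else acc) acc =
      (l.filter fun r => decide (P r)).reverse ++ acc := by
  induction l generalizing acc with
  | nil => simp
  | cons a l ih =>
    rw [List.foldl_cons, ih]
    by_cases h : P a <;> simp [h]

theorem filter_range_eq_singleton {P : ℕ → Prop} [DecidablePred P] {R r₀ : ℕ} (hr : r₀ < R)
    (h : ∀ r, r < R → (P r ↔ r = r₀)) : ((List.range R).filter fun r => decide (P r)) = [r₀] := by
  have h1 : ((List.range R).filter fun r => decide (P r)) = (List.range R).filter (· == r₀) := by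
    refine List.filter_congr fun r hr' => ?_
    rw [List.mem_range] at hr'
    by_cases hh : r = r₀
    · simp [hh, (h r₀ hr).2 rfl]
    · have : ¬ P r := fun hp => hh ((h r hr').1 hp)
      simp [hh, this]
  rw [h1, List.filter_beq, List.count_eq_one_of_mem List.nodup_range (List.mem_range.2 hr)]
  rfl

theorem card_filter_univ_fin {r : ℕ} (P : Fin r → Prop) [DecidablePred P] :
    (Finset.univ.filter P).card = (List.finRange r).countP fun t => decide (P t) := by
  have h2 : Finset.univ.filter P = ((List.finRange r).filter fun t => decide (P t)).toFinset := by
    ext t; simp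
  rw [h2, List.toFinset_card_of_nodup ((List.nodup_finRange r).filter _),
    ← List.countP_eq_length_filter]

variable {d n : ℕ} [NeZero n]

/-- The pairs of evaluation points that support the digit `r`. -/
noncomputable def hits {cA : ℕ} (A : Fin cA → Idx d n × Idx d n) (mm : Fin cA × Idx d n → Arr d)
    (j : Fin d → ℕ) (f : Fin d → ℕ) (s : Fin d) (g r : ℕ) : Finset (Fin cA) :=
  Finset.univ.filter fun a =>
    ‖om (-(((digitStep n g * (f s + base n ^ (g - 1) * r) : ℕ) : ZMod n) * (A a).2 s)) *
      (mm (a, digitShift s g) j / mm (a, 0) j) - 1‖ < 1 / 3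

/-- One round of `decodeBucket`. -/
noncomputable def decodeRound {cA : ℕ} (A : Fin cA → Idx d n × Idx d n)
    (mm : Fin cA × Idx d n → Arr d) (j : Fin d → ℕ) (p : Fin d × ℕ)
    (st : Option (Fin d → ℕ)) : Option (Fin d → ℕ) :=
  match st with
  | none => none
  | some f =>
      match ((List.range (digitRange n p.2)).filter fun r =>
        decide (3 * cA ≤ 5 * (hits A mm j f p.1 p.2 r).card)).reverse with
      | [r] => some (Function.update f p.1 (f p.1 + base n ^ (p.2 - 1) * r))
      | _ => none

theorem decodeBucket_val {cA : ℕ} (A : Fin cA → Idx d n × Idx d n)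
    (mm : Fin cA × Idx d n → Arr d) (j : Fin d → ℕ) :
    (decodeBucket A mm j).val =
      (digits d n).foldl (fun st p => decodeRound A mm j p st) (some fun _ => 0) := by
  rw [decodeBucket, loop_val]
  congr 1
  funext st p
  cases st with
  | none => rfl
  | some f =>
    have h : (loop (List.range (digitRange n p.2)) ([] : List ℕ) fun r acc => do
          let cnt ← loop (List.finRange cA) (0 : ℕ) fun a cnt =>
            op (2 * d + 16) (if
              ‖om (-(((digitStep n p.2 * (f p.1 + base n ^ (p.2 - 1) * r) : ℕ) : ZMod n) *
                (A a).2 p.1)) * (mm (a, digitShift p.1 p.2) j / mm (a, 0) j) - 1‖ < 1 / 3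
              then cnt + 1 else cnt)
          op 4 (if 3 * cA ≤ 5 * cnt then r :: acc else acc)).val =
        ((List.range (digitRange n p.2)).filter fun r =>
          decide (3 * cA ≤ 5 * (hits A mm j f p.1 p.2 r).card)).reverse := by
      rw [loop_val]
      simp only [bind_val, op_val, loop_val]
      simp only [foldl_count, zero_add, hits, card_filter_univ_fin]
      rw [foldl_filter_cons, List.append_nil]
    simp only [decodeRound, bind_val]
    rw [h]
    generalize ((List.range (digitRange n p.2)).filter fun r =>
      decide (3 * cA ≤ 5 * (hits A mm j f p.1 p.2 r).card)).reverse = good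
    rcases good with _ | ⟨a, _ | ⟨b, t⟩⟩ <;> rfl

theorem decodeRound_some {cA : ℕ} {A : Fin cA → Idx d n × Idx d n}
    {mm : Fin cA × Idx d n → Arr d} {j : Fin d → ℕ} {s : Fin d} {g r₀ : ℕ} {f : Fin d → ℕ}
    (hr : r₀ < digitRange n g)
    (h : ∀ r, r < digitRange n g → (3 * cA ≤ 5 * (hits A mm j f s g r).card ↔ r = r₀)) :
    decodeRound A mm j (s, g) (some f) =
      some (Function.update f s (f s + base n ^ (g - 1) * r₀)) := by
  simp only [decodeRound]
  rw [filter_range_eq_singleton hr h]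
  rfl

/-- Decoding succeeds if every digit is the only one with enough support. -/
theorem decodeBucket_eq_some {cA : ℕ} {A : Fin cA → Idx d n × Idx d n}
    {mm : Fin cA × Idx d n → Arr d} {j : Fin d → ℕ} (f₀ : Fin d → ℕ)
    (hlt : ∀ s, f₀ s < base n ^ numDigits n)
    (hr : ∀ s g, g < numDigits n → f₀ s / base n ^ g % base n < digitRange n (g + 1))
    (h : ∀ s g, g < numDigits n → ∀ f : Fin d → ℕ, f s = f₀ s % base n ^ g →
      ∀ r, r < digitRange n (g + 1) →
        (3 * cA ≤ 5 * (hits A mm j f s (g + 1) r).card ↔ r = f₀ s / base n ^ g % base n)) :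
    (decodeBucket A mm j).val = some f₀ := by
  -- Invariant: after `t` digits of axis `s` the decoded coordinate is `f₀ s` modulo `Δ ^ t`.
  have hin : ∀ (s : Fin d) (t : ℕ) (f : Fin d → ℕ), t ≤ numDigits n → f s = 0 →
      ((List.range t).map fun g => (s, g + 1)).foldl (fun st p => decodeRound A mm j p st) (some f) =
        some (Function.update f s (f₀ s % base n ^ t)) := by
    intro s t f ht hf
    induction t with
    | zero =>
      have : Function.update f s (f₀ s % base n ^ 0) = f := by
        rw [pow_zero, Nat.mod_one]
        exact Function.update_eq_self_iff.2 hf.symm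
      rw [this]
      rfl
    | succ t ih =>
      rw [List.range_succ, List.map_append, List.foldl_append, ih (by omega)]
      simp only [List.map_cons, List.map_nil, List.foldl_cons, List.foldl_nil]
      have hu : (Function.update f s (f₀ s % base n ^ t)) s = f₀ s % base n ^ t := by simp
      rw [decodeRound_some (hr s t (by omega)) (h s t (by omega) _ hu)]
      rw [hu, Function.update_idem, Nat.add_sub_cancel, pow_succ, Nat.mod_mul]
  have hout : ∀ (l : List (Fin d)) (f : Fin d → ℕ), l.Nodup → (∀ s ∈ l, f s = 0) →
      (l.flatMap fun s => (List.range (numDigits n)).map fun g => (s, g + 1)).foldl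
        (fun st p => decodeRound A mm j p st) (some f) = some fun s => if s ∈ l then f₀ s else f s := by
    intro l
    induction l with
    | nil => intro f _ _; simp
    | cons s l ih =>
      intro f hl hf
      rw [List.nodup_cons] at hl
      rw [List.flatMap_cons, List.foldl_append, hin s _ f le_rfl (hf s (by simp)),
        Nat.mod_eq_of_lt (hlt s), ih _ hl.2]
      · congr 1
        funext t
        by_cases h1 : t = s
        · subst h1; simp [hl.1]
        · simp [h1]
      · intro t ht
        have : t ≠ s := fun hh => hl.1 (hh ▸ ht)
        rw [Function.update_of_ne this]
        exact hf t (by simp [ht])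
  rw [decodeBucket_val, digits, hout _ _ (List.nodup_finRange d) fun _ _ => rfl]
  simp

end Decoding

end SparseFT

namespace SparseFT

/-! ### Arithmetic of digits in base `Δ` -/

section Digits

variable {n m : ℕ}

/-- There are at most `Δ ^ 2` pairs of values of a digit, so the union over confusable pairs costs
one logarithm, and so does, a fortiori, trying all values of a digit. -/
theorem base_sq_le (hn : n = 2 ^ m) (hm : 4 ≤ m) : base n ^ 2 ≤ m := by
  rw [base, hn, Nat.log_pow (by norm_num), ← pow_mul]
  calc 2 ^ (Nat.log 2 m / 2 * 2) ≤ 2 ^ Nat.log 2 m :=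
        Nat.pow_le_pow_right (by norm_num) (Nat.div_mul_le_self _ _)
    _ ≤ m := Nat.pow_log_le_self 2 (by omega)

theorem base_exponent (hn : n = 2 ^ m) (hm : 4 ≤ m) : ∃ e, 1 ≤ e ∧ base n = 2 ^ e := by
  refine ⟨_, ?_, rfl⟩
  rw [hn, Nat.log_pow (by norm_num)]
  have : 2 ≤ Nat.log 2 m := Nat.le_log_of_pow_le (by norm_num) (by omega)
  omega

theorem two_le_base (hn : n = 2 ^ m) (hm : 4 ≤ m) : 2 ≤ base n := by
  obtain ⟨e, he, hb⟩ := base_exponent hn hm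
  rw [hb]
  calc 2 = 2 ^ 1 := by norm_num
    _ ≤ 2 ^ e := Nat.pow_le_pow_right (by norm_num) he

theorem le_base_pow_numDigits (hn : n = 2 ^ m) (hm : 4 ≤ m) : n ≤ base n ^ numDigits n :=
  Nat.le_pow_clog (two_le_base hn hm) n

theorem numDigits_le (hn : n = 2 ^ m) (hm : 4 ≤ m) : numDigits n ≤ m := by
  refine Nat.clog_le_of_le_pow ?_
  conv_lhs => rw [hn]
  exact Nat.pow_le_pow_left (two_le_base hn hm) m

/-- The last digit may be incomplete. -/
theorem digit_cases (hn : n = 2 ^ m) {e : ℕ} (hb : base n = 2 ^ e) {g : ℕ}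
    (hg : g < numDigits n) : e * g < m ∧
      ((e * (g + 1) ≤ m ∧ digitStep n (g + 1) = 2 ^ (m - e * (g + 1)) ∧
          digitRange n (g + 1) = 2 ^ e) ∨
        (m < e * (g + 1) ∧ digitStep n (g + 1) = 1 ∧ digitRange n (g + 1) = 2 ^ (m - e * g))) := by
  have h1 : base n ^ g < n := Nat.pow_lt_of_lt_clog hg
  rw [hb, ← pow_mul] at h1
  conv_rhs at h1 => rw [hn]
  have h2 : e * g < m := (Nat.pow_lt_pow_iff_right (by norm_num)).1 h1
  refine ⟨h2, ?_⟩
  have h3 : n / base n ^ g = 2 ^ (m - e * g) := by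
    rw [hb, ← pow_mul]
    conv_lhs => rw [hn]
    exact Nat.pow_div h2.le (by norm_num)
  rcases le_or_gt (e * (g + 1)) m with h | h
  · left
    refine ⟨h, ?_, ?_⟩
    · rw [digitStep, hb, ← pow_mul]
      conv_lhs => rw [hn]
      rw [Nat.pow_div h (by norm_num)]
      exact max_eq_right Nat.one_le_two_pow
    · rw [digitRange, Nat.add_sub_cancel, h3, hb]
      refine min_eq_left (Nat.pow_le_pow_right (by norm_num) ?_)
      rw [mul_add, mul_one] at h
      omega
  · right
    refine ⟨h, ?_, ?_⟩
    · rw [digitStep, hb, ← pow_mul]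
      have : n / 2 ^ (e * (g + 1)) = 0 := by
        rw [Nat.div_eq_zero_iff]
        right
        conv_lhs => rw [hn]
        exact Nat.pow_lt_pow_right (by norm_num) h
      rw [this]
      rfl
    · rw [digitRange, Nat.add_sub_cancel, h3, hb]
      refine min_eq_right (Nat.pow_le_pow_right (by norm_num) ?_)
      rw [mul_add, mul_one] at h
      omega

/-- The digits above the current one do not enter its phase. For an incomplete last digit the step
is `1`, and `Δ ^ (g + 1)` itself is a multiple of `n`. -/
theorem dvd_digitStep_mul (hn : n = 2 ^ m) (hm : 4 ≤ m) {g : ℕ} (hg : g < numDigits n) :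
    n ∣ digitStep n (g + 1) * base n ^ (g + 1) := by
  obtain ⟨e, -, hb⟩ := base_exponent hn hm
  obtain ⟨-, ⟨h, h1, -⟩ | ⟨h, h1, -⟩⟩ := digit_cases hn hb hg
  · rw [h1, hb, ← pow_mul, ← pow_add, Nat.sub_add_cancel h, ← hn]
  · rw [h1, hb, ← pow_mul, one_mul]
    conv_lhs => rw [hn]
    exact pow_dvd_pow 2 h.le

theorem digitStep_mul_digitRange (hn : n = 2 ^ m) (hm : 4 ≤ m) {g : ℕ} (hg : g < numDigits n) :
    digitStep n (g + 1) * base n ^ g * digitRange n (g + 1) = n := by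
  obtain ⟨e, -, hb⟩ := base_exponent hn hm
  obtain ⟨h0, ⟨h, h1, h2⟩ | ⟨h, h1, h2⟩⟩ := digit_cases hn hb hg
  · rw [h1, h2, hb, ← pow_mul, ← pow_add, ← pow_add]
    conv_rhs => rw [hn]
    congr 1
    rw [mul_add, mul_one] at h ⊢
    omega
  · rw [h1, h2, hb, ← pow_mul, one_mul, ← pow_add]
    conv_rhs => rw [hn]
    congr 1
    omega

theorem digit_lt_digitRange (hn : n = 2 ^ m) (hm : 4 ≤ m) {g : ℕ} (hg : g < numDigits n) {f : ℕ}
    (hf : f < n) : f / base n ^ g % base n < digitRange n (g + 1) := by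
  obtain ⟨e, -, hb⟩ := base_exponent hn hm
  obtain ⟨h0, ⟨h, h1, h2⟩ | ⟨h, h1, h2⟩⟩ := digit_cases hn hb hg
  · rw [h2, hb]
    exact Nat.mod_lt _ (by positivity)
  · rw [h2, hb, ← pow_mul]
    refine (Nat.mod_le _ _).trans_lt (Nat.div_lt_of_lt_mul ?_)
    rw [← pow_add, show e * g + (m - e * g) = m by omega, ← hn]
    exact hf

theorem digitRange_le_base (n g : ℕ) : digitRange n g ≤ base n := min_le_left _ _

/-- The coefficient of the `g + 1`-st digit in the phase of the shift that reveals it. -/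
def digitUnit (n g : ℕ) : ZMod n := ((digitStep n (g + 1) * base n ^ g : ℕ) : ZMod n)

/-- The unit times the range of the digit is exactly `n`, so distinct values have distinct phases.
The resulting nonzero multiplier of `β` is a nontrivial character, which is what exposes a wrong
digit. -/
theorem digitUnit_mul_sub_ne_zero [NeZero n] (hn : n = 2 ^ m) (hm : 4 ≤ m) {g : ℕ}
    (hg : g < numDigits n) {r r' : ℕ} (hr : r < digitRange n (g + 1))
    (hr' : r' < digitRange n (g + 1)) (hne : r ≠ r') :
    digitUnit n g * ((r : ZMod n) - r') ≠ 0 := by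
  have key : ∀ a b : ℕ, a < digitRange n (g + 1) → b < a →
      digitUnit n g * ((a : ZMod n) - b) ≠ 0 := by
    intro a b ha hba h0
    have h1 : digitUnit n g * ((a : ZMod n) - b) =
        ((digitStep n (g + 1) * base n ^ g * (a - b) : ℕ) : ZMod n) := by
      rw [digitUnit, Nat.cast_mul _ (a - b), Nat.cast_sub hba.le]
    rw [h1, ZMod.natCast_eq_zero_iff] at h0
    have h2 := digitStep_mul_digitRange hn hm hg
    have hpos : 0 < digitStep n (g + 1) * base n ^ g := by
      rcases Nat.eq_zero_or_pos (digitStep n (g + 1) * base n ^ g) with h | h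
      · rw [h, zero_mul] at h2
        exact absurd h2.symm (NeZero.ne n)
      · exact h
    have h3 : digitStep n (g + 1) * base n ^ g * (a - b) < n := by
      conv_rhs => rw [← h2]
      exact Nat.mul_lt_mul_of_pos_left (by omega) hpos
    exact absurd (Nat.le_of_dvd (Nat.mul_pos hpos (by omega)) h0) (not_le.2 h3)
  rcases lt_or_gt_of_ne hne with h | h
  · have := key r' r hr' h
    intro h0
    apply this
    rw [← neg_sub, mul_neg, h0, neg_zero]
  · exact key r r' hr h

/-- The known lower digits are subtracted and the higher ones vanish modulo `n`; what remains is the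
difference between the true digit and the candidate. -/
theorem digitStep_mul_eq [NeZero n] (hn : n = 2 ^ m) (hm : 4 ≤ m) {g : ℕ} (hg : g < numDigits n)
    (f r : ℕ) :
    (digitStep n (g + 1) : ZMod n) * f -
      ((digitStep n (g + 1) * (f % base n ^ g + base n ^ g * r) : ℕ) : ZMod n) =
      digitUnit n g * (((f / base n ^ g % base n : ℕ) : ZMod n) - r) := by
  have h1 : f = f % base n ^ g + base n ^ g * (f / base n ^ g % base n) +
      base n ^ (g + 1) * (f / base n ^ (g + 1)) := by
    rw [← Nat.mod_mul, ← pow_succ, Nat.mod_add_div]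
  have h2 : (digitStep n (g + 1) : ZMod n) * (base n : ZMod n) ^ (g + 1) = 0 := by
    have := (ZMod.natCast_eq_zero_iff _ n).2 (dvd_digitStep_mul hn hm hg)
    push_cast at this
    exact this
  have h3 : (f : ZMod n) = ((f % base n ^ g : ℕ) : ZMod n) +
      (base n : ZMod n) ^ g * ((f / base n ^ g % base n : ℕ) : ZMod n) +
      (base n : ZMod n) ^ (g + 1) * ((f / base n ^ (g + 1) : ℕ) : ZMod n) := by
    conv_lhs => rw [h1]
    push_cast
    ring
  rw [digitUnit]
  push_cast
  rw [h3]
  linear_combination (((f / base n ^ (g + 1) : ℕ) : ZMod n)) * h2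

end Digits

/-! ## Decoding from noisy measurements -/

section Noisy

variable {d n : ℕ} [NeZero n]

/-- No two values of a digit are confused by too many of the evaluation points. -/
def Balanced {cA : ℕ} (A : Fin cA → Idx d n × Idx d n) : Prop :=
  ∀ s : Fin d, ∀ g < numDigits n, ∀ r < digitRange n (g + 1), ∀ r' < digitRange n (g + 1), r ≠ r' →
    50 * countOf (fun a : Idx d n × Idx d n =>
      ‖om (digitUnit n g * ((r : ZMod n) - (r' : ZMod n)) * a.2 s) - 1‖ < 1 / 2) A ≤ 29 * cA

/-- By `v p = u q` the deviation is made of the two errors `‖y‖ / 50`, divided by `‖b‖ ≥ (49/50)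
‖y‖`: at most `2/49 ≤ 1/20`. -/
theorem norm_ratio_sub_le {a b y p q u v : ℂ} (hy : y ≠ 0) (hq : ‖q‖ = 1)
    (hu : ‖u‖ = 1) (hv : ‖v‖ = 1) (h : v * p = u * q) (ha : ‖a - y * p‖ ≤ ‖y‖ / 50)
    (hb : ‖b - y * q‖ ≤ ‖y‖ / 50) : ‖v * (a / b) - u‖ ≤ 1 / 20 := by
  have hy0 : 0 < ‖y‖ := norm_pos_iff.2 hy
  have h1 : ‖y‖ * (49 / 50) ≤ ‖b‖ := by
    have h2 : ‖y * q‖ ≤ ‖b‖ + ‖b - y * q‖ := by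
      have := norm_sub_le b (b - y * q)
      rwa [sub_sub_cancel] at this
    rw [norm_mul, hq, mul_one] at h2
    linarith
  have hb0 : 0 < ‖b‖ := lt_of_lt_of_le (by positivity) h1
  have hb1 : b ≠ 0 := norm_pos_iff.1 hb0
  have h2 : v * (a / b) - u = (v * (a - y * p) - u * (b - y * q)) / b := by
    field_simp
    linear_combination y * h
  rw [h2, norm_div, div_le_iff₀ hb0]
  refine (norm_sub_le _ _).trans ?_
  rw [norm_mul, norm_mul, hu, hv, one_mul, one_mul]
  linarith

/-- A pair that is accurate for both shifts shows the phase up to `1/20`. For the true digit the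
phase is `1`, and at least `99/100` of the pairs vote for it. A vote for a wrong digit needs a phase
within `1/3 + 1/20 < 1/2` of `1`, so it gets at most `29/50 + 2/200 = 59/100` of the votes, below
the threshold `3/5`. -/
theorem decodeBucket_of_balanced {m : ℕ} (hn : n = 2 ^ m) (hm : 4 ≤ m) {cA : ℕ} (hcA : 0 < cA)
    {A : Fin cA → Idx d n × Idx d n} (hbal : Balanced A) (mm : Fin cA × Idx d n → Arr d)
    (j : Fin d → ℕ) (F : Idx d n) {y : ℂ} (hy : y ≠ 0)
    (hbad : ∀ w ∈ shifts d n, 200 * (Finset.univ.filter fun t : Fin cA =>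
      ‖y‖ / 50 < ‖mm (t, w) j - y * om (star (A t) w ⬝ᵥ F)‖).card ≤ cA) :
    (decodeBucket A mm j).val = some fun s => (F s).val := by
  refine decodeBucket_eq_some _ (fun s => (ZMod.val_lt _).trans_le (le_base_pow_numDigits hn hm))
    (fun s g hg => digit_lt_digitRange hn hm hg (ZMod.val_lt _)) ?_
  intro s g hg f hf r hr
  set r₀ := (F s).val / base n ^ g % base n with hr₀
  have hr₀lt : r₀ < digitRange n (g + 1) := digit_lt_digitRange hn hm hg (ZMod.val_lt _)
  set w : Idx d n := digitShift s (g + 1) with hw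
  have hwmem : w ∈ shifts d n := by
    rw [shifts, List.mem_cons]
    right
    refine List.mem_map.2 ⟨(s, g + 1), ?_, rfl⟩
    rw [digits, List.mem_flatMap]
    exact ⟨s, List.mem_finRange s, List.mem_map.2 ⟨g, List.mem_range.2 hg, rfl⟩⟩
  have h0mem : (0 : Idx d n) ∈ shifts d n := List.mem_cons_self
  set B₀ := Finset.univ.filter fun t : Fin cA =>
      ‖y‖ / 50 < ‖mm (t, 0) j - y * om (star (A t) 0 ⬝ᵥ F)‖ with hB₀
  set B₁ := Finset.univ.filter fun t : Fin cA =>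
      ‖y‖ / 50 < ‖mm (t, w) j - y * om (star (A t) w ⬝ᵥ F)‖ with hB₁
  have hB₀c : 200 * B₀.card ≤ cA := hbad 0 h0mem
  have hB₁c : 200 * B₁.card ≤ cA := hbad w hwmem
  have hstar : ∀ t, star (A t) w ⬝ᵥ F =
      star (A t) 0 ⬝ᵥ F + digitStep n (g + 1) * F s * (A t).2 s := by
    intro t
    have h1 : star (A t) w = star (A t) 0 + Pi.single s ((A t).2 s * digitStep n (g + 1)) := by
      funext u
      simp only [star, hw, digitShift, Pi.add_apply, Pi.zero_apply, mul_zero, add_zero]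
      by_cases hu : u = s
      · subst hu; simp
      · simp [hu]
    rw [h1, add_dotProduct, single_dotProduct]
    ring
  have hFs : ((F s).val : ZMod n) = F s := ZMod.natCast_zmod_val _
  have hkey : ∀ t, t ∉ B₀ → t ∉ B₁ →
      ‖om (-(((digitStep n (g + 1) * (f s + base n ^ (g + 1 - 1) * r) : ℕ) : ZMod n) * (A t).2 s)) *
        (mm (t, w) j / mm (t, 0) j) - om (digitUnit n g * ((r₀ : ZMod n) - (r : ZMod n)) * (A t).2 s)‖
        ≤ 1 / 20 := by
    intro t ht0 ht1
    have ht0' : ‖mm (t, 0) j - y * om (star (A t) 0 ⬝ᵥ F)‖ ≤ ‖y‖ / 50 := by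
      simpa [hB₀] using ht0
    have ht1' : ‖mm (t, w) j - y * om (star (A t) w ⬝ᵥ F)‖ ≤ ‖y‖ / 50 := by
      simpa [hB₁] using ht1
    refine norm_ratio_sub_le hy (norm_om _) (norm_om _) (norm_om _) ?_ ht1' ht0'
    rw [← om_add, ← om_add]
    congr 1
    have h1 := digitStep_mul_eq hn hm hg (F s).val r
    rw [hFs, ← hr₀, ← hf] at h1
    rw [hstar, ← h1, Nat.add_sub_cancel]
    ring
  have hcard : ∀ X : Finset (Fin cA), X.card ≤ cA := fun X => by
    simpa using Finset.card_le_univ X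
  constructor
  · intro hhits
    by_contra hne
    have h1 := hbal s g hg r₀ hr₀lt r hr (Ne.symm hne)
    rw [countOf] at h1
    set D := Finset.univ.filter fun t : Fin cA =>
      ‖om (digitUnit n g * ((r₀ : ZMod n) - (r : ZMod n)) * (A t).2 s) - 1‖ < 1 / 2 with hD
    have h2 : hits A mm j f s (g + 1) r ⊆ B₀ ∪ B₁ ∪ D := by
      intro t ht
      by_contra hcon
      simp only [Finset.mem_union, not_or] at hcon
      have h3 := hkey t hcon.1.1 hcon.1.2
      have h4 : ¬ ‖om (digitUnit n g * ((r₀ : ZMod n) - (r : ZMod n)) * (A t).2 s) - 1‖ < 1 / 2 := by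
        simpa [hD] using hcon.2
      simp only [hits, Finset.mem_filter, Finset.mem_univ, true_and] at ht
      apply h4
      have h5 := norm_sub_le_norm_sub_add_norm_sub
        (om (digitUnit n g * ((r₀ : ZMod n) - (r : ZMod n)) * (A t).2 s))
        (om (-(((digitStep n (g + 1) * (f s + base n ^ (g + 1 - 1) * r) : ℕ) : ZMod n) *
          (A t).2 s)) * (mm (t, w) j / mm (t, 0) j)) 1
      rw [norm_sub_rev] at h3
      linarith
    have h3 := (Finset.card_le_card h2).trans (Finset.card_union_le _ _)
    have h4 := Finset.card_union_le B₀ B₁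
    omega
  · intro hrr
    have h2 : (B₀ ∪ B₁)ᶜ ⊆ hits A mm j f s (g + 1) r := by
      intro t ht
      rw [Finset.mem_compl, Finset.mem_union, not_or] at ht
      have h3 := hkey t ht.1 ht.2
      simp only [hits, Finset.mem_filter, Finset.mem_univ, true_and]
      rw [hrr, sub_self, mul_zero, zero_mul, om_zero] at h3
      rw [hrr]
      linarith
    have h3 := Finset.card_le_card h2
    rw [Finset.card_compl, Fintype.card_fin] at h3
    have h4 := Finset.card_union_le B₀ B₁
    omega

end Noisy

end SparseFT

namespace SparseFT

/-! ## Location -/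

section Location

variable {d n : ℕ} [NeZero n]

/-- The set of positions found in the location step. -/
noncomputable def located {cA : ℕ} (c : ℕ) (x χ : Idx d n → ℂ) (β : ℕ)
    (ω : (OddMat d n × Idx d n) × (Fin cA → Idx d n × Idx d n)) : Finset (Idx d n) :=
  (locateSignal c χ β ω.1.1.1 ω.1.2 ω.2
    (tabulate (List.product (List.finRange cA) (shifts d n)) fun p =>
      hashToBins c (sample (dft x)) 0 β ω.1.1.1 ω.1.2 (star (ω.2 p.1) p.2)).val).val

/-- The updated measurements of the residual signal. -/
noncomputable def residualMeas {cA : ℕ} (c : ℕ) (x χ : Idx d n → ℂ) (β : ℕ)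
    (ω : (OddMat d n × Idx d n) × (Fin cA → Idx d n × Idx d n)) (p : Fin cA × Idx d n) : Arr d :=
  (hashToBins c (sample (dft x)) 0 β ω.1.1.1 ω.1.2 (star (ω.2 p.1) p.2)).val +
    (hashToBins c zeroSignal χ β ω.1.1.1 ω.1.2 (star (ω.2 p.1) p.2)).val

/-- Hashing is linear: `x` is hashed with `χ = 0`, which has no numerical error, and the zero signal
is hashed with `χ`. Only the second summand is inexact. -/
theorem residualMeas_error {m β : ℕ} (H : GoodSide n m β) {c : ℕ} (hc : 1 ≤ windowWidth d n c)
    (x χ : Idx d n → ℂ) {cA : ℕ}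
    (ω : (OddMat d n × Idx d n) × (Fin cA → Idx d n × Idx d n)) (p : Fin cA × Idx d n)
    (j : Fin d → ℕ) (hj : ∀ s, j s < 2 ^ β) :
    ‖residualMeas c x χ β ω p j -
      exactBin (2 ^ β) ω.1.1.1 ω.1.2 (star (ω.2 p.1) p.2) (x - χ) j‖ ≤
      semiErr d (windowWidth d n c) * ∑ l, ‖χ l‖ := by
  have h1 := hashToBins_error hc (sample (dft x)) x 0 (fun t => rfl) H.side_eq ⟨_, H.n_eq_mul⟩
    ω.1.1.1 ω.1.2 (star (ω.2 p.1) p.2) j hj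
  have h2 := hashToBins_error hc zeroSignal 0 χ (fun t => (dft_zero t).symm) H.side_eq
    ⟨_, H.n_eq_mul⟩ ω.1.1.1 ω.1.2 (star (ω.2 p.1) p.2) j hj
  simp only [Pi.zero_apply, norm_zero, Finset.sum_const_zero, mul_zero] at h1
  have h3 : exactBin (2 ^ β) ω.1.1.1 ω.1.2 (star (ω.2 p.1) p.2) (x - χ) j =
      exactBin (2 ^ β) ω.1.1.1 ω.1.2 (star (ω.2 p.1) p.2) (x - 0) j +
        exactBin (2 ^ β) ω.1.1.1 ω.1.2 (star (ω.2 p.1) p.2) (0 - χ) j := by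
    simp only [exactBin_sub]
    simp [exactBin]
    ring
  rw [h3, residualMeas, Pi.add_apply, add_sub_add_comm]
  exact (norm_add_le _ _).trans (by linarith)

theorem mem_foldl_of_mem {ι κ : Type} {step : Finset κ → ι → Finset κ} {i : κ} {j : ι}
    (hmono : ∀ L j, i ∈ L → i ∈ step L j) (hadd : ∀ L, i ∈ step L j) (l : List ι) (hj : j ∈ l)
    (L : Finset κ) : i ∈ l.foldl step L := by
  have hkeep : ∀ (l : List ι) (L : Finset κ), i ∈ L → i ∈ l.foldl step L := by
    intro l
    induction l with
    | nil => exact fun _ h => h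
    | cons a l ih => exact fun L h => ih _ (hmono L a h)
  induction l generalizing L with
  | nil => simp at hj
  | cons a l ih =>
    rw [List.foldl_cons]
    rcases List.mem_cons.1 hj with rfl | h
    · exact hkeep l _ (hadd L)
    · exact ih h _

theorem mem_product_shifts {cA : ℕ} (t : Fin cA) {w : Idx d n} (hw : w ∈ shifts d n) :
    (t, w) ∈ List.product (List.finRange cA) (shifts d n) :=
  List.mem_product.2 ⟨List.mem_finRange t, hw⟩

/-- The bucket of `i` holds `y = G x'_i`. Numerical error, head and, for most pairs, tail are at
most `θ` each, and the decoder tolerates `‖y‖ / 50`; this explains the factor `150 = 3 · 50`. The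
decoded vector is `Σ i`, which `Σ⁻¹` takes back to `i`. -/
theorem mem_located {m β : ℕ} (H : GoodSide n m β) (hm : 4 ≤ m) {c : ℕ}
    (hc : 1 ≤ windowWidth d n c) (x χ : Idx d n → ℂ) (Q : Finset (Idx d n)) {cA : ℕ} (hcA : 0 < cA)
    (ω : (OddMat d n × Idx d n) × (Fin cA → Idx d n × Idx d n)) (hbal : Balanced ω.2) (i : Idx d n)
    (hi : (x - χ) i ≠ 0) {θ : ℝ} (hθ : centralLoss d * (150 * θ) ≤ ‖(x - χ) i‖)
    (hν : semiErr d (windowWidth d n c) * ∑ l, ‖χ l‖ ≤ θ)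
    (hhead : noiseHead (2 ^ β) ω.1.1.1 ω.1.2 Q (x - χ) i ≤ θ)
    (htail : ∀ w ∈ shifts d n, 200 * countOf (fun a : Idx d n × Idx d n =>
      θ < ‖noiseTail (2 ^ β) ω.1.1.1 ω.1.2 Q (x - χ) i (star a w)‖) ω.2 ≤ cA) :
    i ∈ located c x χ β ω := by
  obtain ⟨⟨S, q⟩, A⟩ := ω
  set G := filterG (2 ^ β) (offset (2 ^ β) S.1 q i i) with hG
  set y : ℂ := (G : ℂ) * (x - χ) i with hy
  have hGge : (centralLoss d)⁻¹ ≤ G := H.filterG_ge S.1 q i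
  have hG0 : 0 < G := lt_of_lt_of_le (inv_pos.2 (centralLoss_pos d)) hGge
  have hy0 : y ≠ 0 := mul_ne_zero (by exact_mod_cast hG0.ne') hi
  have hynorm : 3 * θ ≤ ‖y‖ / 50 := by
    have h1 : (centralLoss d)⁻¹ * ‖(x - χ) i‖ ≤ ‖y‖ := by
      rw [hy, norm_mul, Complex.norm_real, Real.norm_eq_abs, abs_of_pos hG0]
      exact mul_le_mul_of_nonneg_right hGge (norm_nonneg _)
    have h2 : 150 * θ ≤ (centralLoss d)⁻¹ * ‖(x - χ) i‖ := by
      rw [inv_mul_eq_div, le_div_iff₀ (centralLoss_pos d), mul_comm]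
      exact hθ
    linarith
  set mm := (tabulate (List.product (List.finRange cA) (shifts d n)) fun p => do
      let v ← hashToBins c zeroSignal χ β S.1 q (star (A p.1) p.2)
      op (3 * d + (2 ^ β) ^ d) ((tabulate (List.product (List.finRange cA) (shifts d n)) fun p =>
        hashToBins c (sample (dft x)) 0 β S.1 q (star (A p.1) p.2)).val p + v)).val with hmm
  have hmmval : ∀ (t : Fin cA) (w : Idx d n), w ∈ shifts d n →
      mm (t, w) = residualMeas c x χ β ((S, q), A) (t, w) := by
    intro t w hw
    rw [hmm, tabulate_val _ _ _ (mem_product_shifts t hw)]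
    simp only [bind_val, op_val]
    rw [tabulate_val _ _ _ (mem_product_shifts t hw)]
    rfl
  set j := bucket (2 ^ β) S.1 q i with hj
  have hjlt : ∀ s, j s < 2 ^ β := bucket_lt (by positivity) S.1 q i
  have hdec : (decodeBucket A mm j).val = some fun s => ((S.1 *ᵥ i) s).val := by
    refine decodeBucket_of_balanced H.n_eq hm hcA hbal mm j (S.1 *ᵥ i) hy0 fun w hw => ?_
    refine le_trans (Nat.mul_le_mul_left 200 (Finset.card_le_card ?_)) (htail w hw)
    intro t ht
    simp only [Finset.mem_filter, Finset.mem_univ, true_and] at ht ⊢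
    rw [hmmval t w hw] at ht
    have h1 := GoodSide.bucket_error x χ S.1 q (star (A t) w) Q i hν
      (residualMeas c x χ β ((S, q), A) (t, w) j)
      (residualMeas_error H hc x χ ((S, q), A) (t, w) j hjlt)
    by_contra hcon
    rw [not_lt] at hcon
    have hhead' : noiseHead (2 ^ β) S.1 q Q (x - χ) i ≤ θ := hhead
    linarith
  have hinv : (S.1⁻¹ *ᵥ fun s => ((((S.1 *ᵥ i) s).val : ℕ) : ZMod n)) = i := by
    have h1 : (fun s => ((((S.1 *ᵥ i) s).val : ℕ) : ZMod n)) = S.1 *ᵥ i := by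
      funext s
      exact ZMod.natCast_zmod_val _
    rw [h1, Matrix.mulVec_mulVec, Matrix.nonsing_inv_mul _ (H.isUnit S), Matrix.one_mulVec]
  rw [located, locateSignal]
  simp only [bind_val, op_val, loop_val]
  refine mem_foldl_of_mem (j := j) ?_ ?_ _ ?_ _
  · intro L j' hL
    rcases (decodeBucket A mm j').val with _ | f
    · exact hL
    · exact Finset.mem_insert_of_mem hL
  · intro L
    rw [← hmm, hdec]
    simp only [op_val, hinv]
    exact Finset.mem_insert_self _ _
  · rw [Finset.mem_toList, Fintype.mem_piFinset]
    exact fun s => Finset.mem_range.2 (hjlt s)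

/-! ### Probabilities -/

/-- For each fixed `β` the point `γ + β w` is uniform, so every shift sees a tail of mean square
`tailVar`, and Chebyshev's inequality applies. -/
theorem prob_noiseTail_star {S : Matrix (Fin d) (Fin d) (ZMod n)} (hS : IsUnit S.det) (b : ℕ)
    (q : Idx d n) (Q : Finset (Idx d n)) (y : Idx d n → ℂ) (i w : Idx d n) {θ : ℝ} (hθ : 0 < θ) :
    prob (fun a : Idx d n × Idx d n => θ < ‖noiseTail b S q Q y i (star a w)‖) ≤
      tailVar b S q Q y i / θ ^ 2 := by
  have h1 : avg (fun a : Idx d n × Idx d n => ‖noiseTail b S q Q y i (star a w)‖ ^ 2) =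
      tailVar b S q Q y i := by
    rw [avg_prod']
    have h2 : ∀ β : Idx d n, avg (fun γ : Idx d n =>
        ‖noiseTail b S q Q y i (star (γ, β) w)‖ ^ 2) = tailVar b S q Q y i := fun β => by
      rw [← avg_noiseTail_sq b hS q Q y i]
      exact avg_equiv (Equiv.addRight (fun s => β s * w s))
        (fun a => ‖noiseTail b S q Q y i a‖ ^ 2)
    simp only [h2]
    exact avg_const _
  refine (prob_mono fun a ha => ?_).trans
    (prob_le_of_avg_le (fun a => by positivity) (pow_pos hθ 2) h1.le)
  exact pow_le_pow_left₀ hθ.le ha.le 2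

/-- The constant in the bound for the failure of a position to be located. -/
noncomputable def shiftLoss : ℝ := 4 * 2 ^ 200

theorem shiftLoss_pos : 0 < shiftLoss := by rw [shiftLoss]; positivity

/-- The bound has to be linear in `p`, as it is going to be weighted with squared entries. More than
`cA / 200` pairs must fail, which has probability at most `(2 ^ 200 p) ^ m'`. A factor `e ^ (-m')`
is split off to pay for the union over the shifts, and a single factor `2 ^ 200 p e` is kept of the
rest; if that factor is at least `1`, the claim is trivial. -/
theorem prob_tail_fails {cA : ℕ} {ι : Type} (W : Finset ι) (P : ι → Idx d n × Idx d n → Prop)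
    {p : ℝ} (hp : ∀ w, prob (P w) ≤ p) (hp0 : 0 ≤ p)
    (hW : (W.card : ℝ) ≤ Real.exp ((cA : ℝ) / 200)) :
    prob (fun A : Fin cA → Idx d n × Idx d n => ∃ w ∈ W, cA < 200 * countOf (P w) A) ≤
      shiftLoss * p := by
  obtain ⟨z, hz⟩ : ∃ z : ℝ, z = 2 ^ 200 := ⟨_, rfl⟩
  have hz0 : 0 < z := hz ▸ by positivity
  rw [shiftLoss, ← hz]
  set m' := cA / 200 + 1 with hm'
  have hm1 : cA < 200 * m' := by omega
  have hexp : 0 ≤ z * p := by positivity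
  have he : Real.exp 1 ≤ 4 := by linarith [Real.exp_one_lt_d9]
  rcases le_or_gt 1 (z * p * Real.exp 1) with h1 | h1
  · refine (prob_le_one _).trans (h1.trans ?_)
    calc z * p * Real.exp 1 ≤ z * p * 4 := by gcongr
      _ = _ := by ring
  · have h2 : ∀ w, prob (fun A : Fin cA → Idx d n × Idx d n => m' ≤ countOf (P w) A) ≤
        Real.exp (-m') * (z * p * Real.exp 1) := by
      intro w
      refine (prob_countOf_le_two_pow _ (hp w) m' (by omega)).trans ?_
      calc (2 : ℝ) ^ cA * p ^ m' ≤ z ^ m' * p ^ m' := by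
            rw [hz, ← pow_mul]
            gcongr
            · norm_num
        _ = (z * p) ^ m' := by rw [mul_pow]
        _ = Real.exp (-m') * (z * p * Real.exp 1) ^ m' := by
            rw [mul_pow _ (Real.exp 1), ← Real.exp_nat_mul, mul_one, mul_left_comm, ← Real.exp_add,
              neg_add_cancel, Real.exp_zero, mul_one]
        _ ≤ _ := by
            refine mul_le_mul_of_nonneg_left ?_ (Real.exp_pos _).le
            exact pow_le_of_le_one (by positivity) h1.le (by omega)
    have h3 := prob_exists_le W fun w (A : Fin cA → Idx d n × Idx d n) => m' ≤ countOf (P w) A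
    refine (prob_mono fun A hA => ?_).trans (h3.trans ?_)
    · obtain ⟨w, hw, hwA⟩ := hA
      exact ⟨w, hw, by omega⟩
    · refine (Finset.sum_le_sum fun w _ => h2 w).trans ?_
      rw [Finset.sum_const, nsmul_eq_mul, ← mul_assoc]
      have h4 : (W.card : ℝ) * Real.exp (-m') ≤ 1 := by
        rw [Real.exp_neg, ← div_eq_mul_inv, div_le_one (Real.exp_pos _)]
        refine hW.trans (Real.exp_le_exp.2 ?_)
        have : (cA : ℝ) < 200 * m' := by exact_mod_cast hm1
        linarith
      calc (W.card : ℝ) * Real.exp (-m') * (z * p * Real.exp 1)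
          ≤ 1 * (z * p * 4) := by gcongr
        _ = _ := by ring

/-- A nontrivial character has mean zero. Its real part is never below `-1` and is above `7/8`
within distance `1/2` of `1`, so Markov's inequality for `1 + Re` gives `8/15`. -/
theorem prob_om_near_one (s : Fin d) {z : ZMod n} (hz : z ≠ 0) :
    prob (fun a : Idx d n × Idx d n => ‖om (z * a.2 s) - 1‖ < 1 / 2) ≤ 8 / 15 := by
  refine (prob_snd_le fun a : Idx d n => ‖om (z * a s) - 1‖ < 1 / 2).trans ?_
  have h1 : avg (fun a : Idx d n => (om (z * a s)).re) = 0 := by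
    have h2 := sum_om_dotProduct (Pi.single s z : Idx d n)
    rw [if_neg (by simpa using hz)] at h2
    have h3 : ∑ a : Idx d n, (om (z * a s)).re = 0 := by
      rw [← Complex.re_sum, ← Complex.zero_re, ← h2]
      congr 1
      refine Finset.sum_congr rfl fun a _ => ?_
      rw [dotProduct_single, mul_comm]
    rw [avg, h3, zero_div]
  have h4 : avg (fun a : Idx d n => (15 / 8 : ℝ) * (if ‖om (z * a s) - 1‖ < 1 / 2 then 1 else 0)) ≤
      avg (fun a : Idx d n => (om (z * a s)).re + 1) := by
    refine avg_mono fun a => ?_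
    set u := om (z * a s) with hu
    have hn1 : u.re ^ 2 + u.im ^ 2 = 1 := by
      have h5 := Complex.normSq_eq_norm_sq u
      rw [hu, norm_om, ← hu, Complex.normSq_apply] at h5
      nlinarith
    split_ifs with h
    · have h6 : ‖u - 1‖ ^ 2 < (1 / 2) ^ 2 := pow_lt_pow_left₀ h (norm_nonneg _) two_ne_zero
      rw [← Complex.normSq_eq_norm_sq, Complex.normSq_apply] at h6
      simp only [Complex.sub_re, Complex.one_re, Complex.sub_im, Complex.one_im] at h6
      nlinarith
    · nlinarith [sq_nonneg u.im]
  rw [avg_const_mul, ← prob_eq_avg, avg_add, h1, avg_const] at h4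
  linarith

/-- Chernoff's bound with `z = 6/5` has base `83/75`. As `(83/75) ^ 50 ≤ (6/5) ^ 28`, the gap
between `28/50` and the threshold `29/50` remains, worth `log (6/5) / 50 ≥ 1/300` per pair. -/
theorem prob_near_count {cA : ℕ} (P : Idx d n × Idx d n → Prop) (hp : prob P ≤ 8 / 15) :
    prob (fun A : Fin cA → Idx d n × Idx d n => 29 * cA < 50 * countOf P A) ≤
      Real.exp (-((cA : ℝ) / 300)) := by
  set m' := (29 * cA) / 50 + 1 with hm'
  have hm1 : 29 * cA < 50 * m' := by omega
  have hm2 : (29 : ℝ) / 50 * cA ≤ m' := by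
    have : (29 * cA : ℝ) < 50 * m' := by exact_mod_cast hm1
    linarith
  refine (prob_mono fun A hA => ?_).trans ((prob_countOf_le (z := 6 / 5) P hp (by norm_num) m').trans ?_)
  · omega
  have hlog : (1 : ℝ) / 6 ≤ Real.log (6 / 5) := by
    have := Real.one_sub_inv_le_log_of_pos (x := 6 / 5) (by norm_num)
    norm_num at this ⊢
    exact this
  have hlog2 : 50 * Real.log (83 / 75) ≤ 28 * Real.log (6 / 5) := by
    have h1 : Real.log ((83 / 75) ^ 50) ≤ Real.log ((6 / 5) ^ 28) :=
      Real.log_le_log (by positivity) (by norm_num)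
    rw [Real.log_pow, Real.log_pow] at h1
    exact_mod_cast h1
  rw [show (1 + (6 / 5 - 1) * (8 / 15) : ℝ) = 83 / 75 by norm_num,
    ← Real.exp_log (show (0 : ℝ) < 83 / 75 by norm_num),
    ← Real.exp_log (show (0 : ℝ) < 6 / 5 by norm_num), ← Real.exp_nat_mul, ← Real.exp_nat_mul,
    ← Real.exp_sub, Real.exp_le_exp]
  have hc0 : (0 : ℝ) ≤ cA := Nat.cast_nonneg _
  nlinarith

/-- Union bound over an axis, a digit and two of its values, at most `d · m · Δ ^ 2 ≤ d m ^ 2`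
choices. -/
theorem prob_not_balanced {m : ℕ} (hn : n = 2 ^ m) (hm : 4 ≤ m) (cA : ℕ) :
    prob (fun A : Fin cA → Idx d n × Idx d n => ¬ Balanced A) ≤
      d * m * m * Real.exp (-((cA : ℝ) / 300)) := by
  set Z : Finset (Fin d × ℕ × ℕ × ℕ) := (Finset.univ ×ˢ Finset.range (numDigits n) ×ˢ
    Finset.range (base n) ×ˢ Finset.range (base n)).filter fun v =>
      digitUnit n v.2.1 * ((v.2.2.1 : ZMod n) - (v.2.2.2 : ZMod n)) ≠ 0 with hZ
  have h1 := prob_exists_le Z fun v (A : Fin cA → Idx d n × Idx d n) =>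
    29 * cA < 50 * countOf (fun a : Idx d n × Idx d n =>
      ‖om (digitUnit n v.2.1 * ((v.2.2.1 : ZMod n) - (v.2.2.2 : ZMod n)) * a.2 v.1) - 1‖ < 1 / 2) A
  refine (prob_mono fun A hA => ?_).trans (h1.trans ?_)
  · rw [Balanced] at hA
    push Not at hA
    obtain ⟨s, g, hg, r, hr, r', hr', hne, hlt⟩ := hA
    refine ⟨(s, g, r, r'), ?_, hlt⟩
    simp only [hZ, Finset.mem_filter, Finset.mem_product, Finset.mem_univ, Finset.mem_range, true_and]
    exact ⟨⟨hg, hr.trans_le (digitRange_le_base _ _), hr'.trans_le (digitRange_le_base _ _)⟩,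
      digitUnit_mul_sub_ne_zero hn hm hg hr hr' hne⟩
  · have h3 : ∀ v ∈ Z, prob (fun A : Fin cA → Idx d n × Idx d n =>
        29 * cA < 50 * countOf (fun a : Idx d n × Idx d n =>
          ‖om (digitUnit n v.2.1 * ((v.2.2.1 : ZMod n) - (v.2.2.2 : ZMod n)) * a.2 v.1) - 1‖ <
            1 / 2) A) ≤ Real.exp (-((cA : ℝ) / 300)) := by
      intro v hv
      have hz : digitUnit n v.2.1 * ((v.2.2.1 : ZMod n) - (v.2.2.2 : ZMod n)) ≠ 0 :=
        (Finset.mem_filter.1 hv).2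
      exact prob_near_count (cA := cA) _ (prob_om_near_one v.1 hz)
    refine (Finset.sum_le_sum h3).trans ?_
    rw [Finset.sum_const, nsmul_eq_mul]
    refine mul_le_mul_of_nonneg_right ?_ (Real.exp_pos _).le
    have h2 : Z.card ≤ d * m * m := by
      refine (Finset.card_filter_le _ _).trans ?_
      rw [Finset.card_product, Finset.card_product, Finset.card_product, Finset.card_univ,
        Fintype.card_fin, Finset.card_range, Finset.card_range, ← sq, mul_assoc]
      exact Nat.mul_le_mul_left _ (Nat.mul_le_mul (numDigits_le hn hm) (base_sq_le hn hm))
    exact_mod_cast h2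

end Location

end SparseFT

namespace SparseFT

/-! ### The energy of the positions that are not located -/

section MissedMass

variable {d n : ℕ} [NeZero n]

theorem prob_prod {Ω Ω' : Type} [Fintype Ω] [Fintype Ω'] (P : Ω × Ω' → Prop) :
    prob P = avg fun a => prob fun b => P (a, b) := by
  rw [prob_eq_avg, avg_prod]
  simp only [prob_eq_avg]

/-- A position is missed only if the head noise reaches `θ` or the tail fails for some shift; both
probabilities are linear in the mean noise. Balancedness does not depend on `i`, so it is kept
inside the event and its failure is charged only once. -/
theorem prob_missed {m β : ℕ} (H : GoodSide n m β) (hm : 4 ≤ m) {c : ℕ}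
    (hc : 1 ≤ windowWidth d n c) (x χ : Idx d n → ℂ) (Q : Finset (Idx d n)) {cA : ℕ} (hcA : 0 < cA)
    (hW : (((shifts d n).length : ℕ) : ℝ) ≤ Real.exp ((cA : ℝ) / 200)) (i : Idx d n)
    {θ : ℝ} (hθ0 : 0 < θ) (hθ : centralLoss d * (150 * θ) ≤ ‖(x - χ) i‖)
    (hν : semiErr d (windowWidth d n c) * ∑ l, ‖χ l‖ ≤ θ) :
    prob (fun ω : (OddMat d n × Idx d n) × (Fin cA → Idx d n × Idx d n) =>
      Balanced ω.2 ∧ i ∉ located c x χ β ω) ≤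
      collisionConst d / (2 ^ β) ^ d * ((∑ j ∈ Q, ‖(x - χ) j‖) / θ +
        shiftLoss * (∑ j ∈ Qᶜ, ‖(x - χ) j‖ ^ 2) / θ ^ 2) := by
  set y := x - χ with hy
  have hΓ := centralLoss_pos d
  have hκ : 0 ≤ collisionConst d / (2 ^ β) ^ d := div_nonneg (collisionConst_pos d).le (by positivity)
  have hi : y i ≠ 0 := norm_pos_iff.1 (lt_of_lt_of_le (by positivity) hθ)
  have hA : prob (fun ω : (OddMat d n × Idx d n) × (Fin cA → Idx d n × Idx d n) =>
      θ ≤ noiseHead (2 ^ β) ω.1.1.1 ω.1.2 Q y i) ≤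
      collisionConst d / (2 ^ β) ^ d * (∑ j ∈ Q, ‖y j‖) / θ := by
    refine (prob_fst_le fun Sq : OddMat d n × Idx d n =>
      θ ≤ noiseHead (2 ^ β) Sq.1.1 Sq.2 Q y i).trans ?_
    refine prob_le_of_avg_le (fun Sq => noiseHead_nonneg _ _ _ _ _ _) hθ0 ?_
    rw [avg_prod']
    refine avg_le_of_le ?_ fun q => H.avg_noiseHead q Q y i
    exact mul_nonneg hκ (Finset.sum_nonneg fun _ _ => norm_nonneg _)
  have hB : prob (fun ω : (OddMat d n × Idx d n) × (Fin cA → Idx d n × Idx d n) =>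
      ∃ w ∈ (shifts d n).toFinset, cA < 200 * countOf (fun a : Idx d n × Idx d n =>
        θ < ‖noiseTail (2 ^ β) ω.1.1.1 ω.1.2 Q y i (star a w)‖) ω.2) ≤
      shiftLoss * (collisionConst d / (2 ^ β) ^ d * (∑ j ∈ Qᶜ, ‖y j‖ ^ 2) / θ ^ 2) := by
    rw [prob_prod]
    have h1 : ∀ Sq : OddMat d n × Idx d n, prob (fun A : Fin cA → Idx d n × Idx d n =>
        ∃ w ∈ (shifts d n).toFinset, cA < 200 * countOf (fun a : Idx d n × Idx d n =>
          θ < ‖noiseTail (2 ^ β) Sq.1.1 Sq.2 Q y i (star a w)‖) A) ≤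
        shiftLoss * (tailVar (2 ^ β) Sq.1.1 Sq.2 Q y i * (θ ^ 2)⁻¹) := by
      intro Sq
      rw [← div_eq_mul_inv]
      refine prob_tail_fails (cA := cA) (shifts d n).toFinset (fun w (a : Idx d n × Idx d n) =>
        θ < ‖noiseTail (2 ^ β) Sq.1.1 Sq.2 Q y i (star a w)‖)
        (fun w => prob_noiseTail_star (H.isUnit Sq.1) _ _ _ _ _ _ hθ0)
        (div_nonneg (tailVar_nonneg _ _ _ _ _ _) (by positivity)) (le_trans ?_ hW)
      exact_mod_cast List.toFinset_card_le _
    refine (avg_mono h1).trans ?_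
    rw [avg_const_mul, avg_mul_const, div_eq_mul_inv]
    refine mul_le_mul_of_nonneg_left ?_ shiftLoss_pos.le
    refine mul_le_mul_of_nonneg_right ?_ (by positivity)
    rw [avg_prod']
    refine avg_le_of_le ?_ fun q => H.avg_tailVar q Q y i
    exact mul_nonneg hκ (Finset.sum_nonneg fun _ _ => by positivity)
  have hor := prob_or_le (fun ω : (OddMat d n × Idx d n) × (Fin cA → Idx d n × Idx d n) =>
      θ ≤ noiseHead (2 ^ β) ω.1.1.1 ω.1.2 Q y i)
    (fun ω => ∃ w ∈ (shifts d n).toFinset, cA < 200 * countOf (fun a : Idx d n × Idx d n =>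
        θ < ‖noiseTail (2 ^ β) ω.1.1.1 ω.1.2 Q y i (star a w)‖) ω.2)
  refine (prob_mono fun ω hω => ?_).trans (hor.trans ((add_le_add hA hB).trans (le_of_eq ?_)))
  · by_contra hcon
    rw [not_or, not_le] at hcon
    push Not at hcon
    refine hω.2 (mem_located H hm hc x χ Q hcA ω hω.1 i hi hθ hν hcon.1.le fun w hw => ?_)
    exact hcon.2 w (List.mem_toFinset.2 hw)
  · ring

/-- The elements of `Q` that are not located have little mass. -/
theorem prob_missedMass {m β : ℕ} (H : GoodSide n m β) (hm : 4 ≤ m) {c : ℕ}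
    (hc : 1 ≤ windowWidth d n c) (x χ : Idx d n → ℂ) (Q : Finset (Idx d n)) {cA : ℕ} (hcA : 0 < cA)
    (hW : (((shifts d n).length : ℕ) : ℝ) ≤ Real.exp ((cA : ℝ) / 200)) {τ : ℝ} (hτ : 0 ≤ τ)
    (hν : centralLoss d * (150 * (semiErr d (windowWidth d n c) * ∑ l, ‖χ l‖)) ≤ τ) :
    prob (fun ω : (OddMat d n × Idx d n) × (Fin cA → Idx d n × Idx d n) =>
      Q.card * τ ^ 2 + 1000 * (collisionConst d / (2 ^ β) ^ d *
        (150 * centralLoss d * (∑ j ∈ Q, ‖(x - χ) j‖) ^ 2 +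
          Q.card * (shiftLoss * (150 * centralLoss d) ^ 2 * (∑ j ∈ Qᶜ, ‖(x - χ) j‖ ^ 2)))) <
      ∑ i ∈ Q \ located c x χ β ω, ‖(x - χ) i‖ ^ 2) ≤
      d * m * m * Real.exp (-((cA : ℝ) / 300)) + 1 / 1000 := by
  set y := x - χ with hy
  have hΓ := centralLoss_pos d
  have hκ : 0 ≤ collisionConst d / (2 ^ β) ^ d := div_nonneg (collisionConst_pos d).le (by positivity)
  set a := ∑ j ∈ Q, ‖y j‖ with ha
  set t := ∑ j ∈ Qᶜ, ‖y j‖ ^ 2 with ht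
  have ha0 : 0 ≤ a := Finset.sum_nonneg fun _ _ => norm_nonneg _
  have ht0 : 0 ≤ t := Finset.sum_nonneg fun _ _ => by positivity
  set Mass := collisionConst d / (2 ^ β) ^ d *
    (150 * centralLoss d * a ^ 2 + Q.card * (shiftLoss * (150 * centralLoss d) ^ 2 * t)) with hMass
  have hMass0 : 0 ≤ Mass := by
    have := shiftLoss_pos
    positivity
  -- Only entries above `τ` are charged to the location; the others contribute at most `|Q| τ ^ 2`,
  -- found or not.
  set f : (OddMat d n × Idx d n) × (Fin cA → Idx d n × Idx d n) → ℝ := fun ω =>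
    ∑ i ∈ Q.filter (fun i => τ < ‖y i‖),
      ‖y i‖ ^ 2 * (if Balanced ω.2 ∧ i ∉ located c x χ β ω then 1 else 0) with hf
  have hf0 : ∀ ω, 0 ≤ f ω := fun ω => Finset.sum_nonneg fun i _ => by positivity
  have havg : avg f ≤ Mass := by
    rw [hf, avg_sum]
    have h1 : ∀ i ∈ Q.filter (fun i => τ < ‖y i‖),
        avg (fun ω : (OddMat d n × Idx d n) × (Fin cA → Idx d n × Idx d n) =>
          ‖y i‖ ^ 2 * (if Balanced ω.2 ∧ i ∉ located c x χ β ω then (1 : ℝ) else 0)) ≤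
        collisionConst d / (2 ^ β) ^ d *
          (150 * centralLoss d * a * ‖y i‖ + shiftLoss * (150 * centralLoss d) ^ 2 * t) := by
      intro i hi
      have hi' := (Finset.mem_filter.1 hi).2
      have hyi : 0 < ‖y i‖ := lt_of_le_of_lt hτ hi'
      rw [avg_const_mul, ← prob_eq_avg]
      -- With `θ` proportional to `‖y i‖`, the weight `‖y i‖ ^ 2` turns `1 / θ` and `1 / θ ^ 2` into
      -- `‖y i‖` and a constant. Summation over `Q` yields the squared `ℓ₁` norm of the head and
      -- `|Q|` times the energy of the tail.
      have h2 := prob_missed H hm hc x χ Q hcA hW i (θ := ‖y i‖ / (150 * centralLoss d))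
        (by positivity) (le_of_eq (by field_simp; rfl))
        (by rw [le_div_iff₀ (by positivity)]; linarith)
      refine (mul_le_mul_of_nonneg_left h2 (by positivity)).trans (le_of_eq ?_)
      rw [← hy, ← ha, ← ht]
      field_simp
    refine (Finset.sum_le_sum h1).trans ?_
    rw [← Finset.mul_sum, Finset.sum_add_distrib, ← Finset.mul_sum, Finset.sum_const, nsmul_eq_mul]
    have h3 : ∑ i ∈ Q.filter (fun i => τ < ‖y i‖), ‖y i‖ ≤ a :=
      Finset.sum_le_sum_of_subset_of_nonneg (Finset.filter_subset _ _) fun _ _ _ => norm_nonneg _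
    have h4 : ((Q.filter fun i => τ < ‖y i‖).card : ℝ) ≤ Q.card := by
      exact_mod_cast Finset.card_filter_le _ _
    have hsl := shiftLoss_pos
    rw [hMass, sq a, ← mul_assoc (150 * centralLoss d)]
    gcongr
  have hmarkov := prob_lt_le hf0 (t := 1000 * Mass) (p := 1 / 1000) (by positivity) (by norm_num)
    (havg.trans (le_of_eq (by ring)))
  have hbal := (prob_snd_le (Ω := OddMat d n × Idx d n) fun A : Fin cA → Idx d n × Idx d n =>
    ¬ Balanced A).trans (prob_not_balanced H.n_eq hm cA)
  have hor := prob_or_le (fun ω : (OddMat d n × Idx d n) × (Fin cA → Idx d n × Idx d n) =>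
    ¬ Balanced ω.2) (fun ω => 1000 * Mass < f ω)
  refine (prob_mono fun ω hω => ?_).trans (hor.trans (add_le_add hbal hmarkov))
  by_contra hcon
  rw [not_or, not_not, not_lt] at hcon
  refine absurd hω (not_lt.2 ?_)
  have h1 : ∑ i ∈ Q \ located c x χ β ω, ‖y i‖ ^ 2 ≤ ∑ i ∈ Q, (τ ^ 2 +
      if τ < ‖y i‖ then
        ‖y i‖ ^ 2 * (if Balanced ω.2 ∧ i ∉ located c x χ β ω then 1 else 0) else 0) := by
    rw [← Finset.sum_filter_add_sum_filter_not Q (fun i => i ∉ located c x χ β ω),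
      Finset.filter_notMem_eq_sdiff]
    refine le_add_of_le_of_nonneg (Finset.sum_le_sum fun i hi => ?_)
      (Finset.sum_nonneg fun i _ => by positivity)
    have hi' : i ∉ located c x χ β ω := (Finset.mem_sdiff.1 hi).2
    by_cases h : τ < ‖y i‖
    · rw [if_pos h, if_pos ⟨hcon.1, hi'⟩]
      nlinarith [sq_nonneg τ]
    · rw [if_neg h, add_zero]
      exact pow_le_pow_left₀ (norm_nonneg _) (not_lt.1 h) 2
  refine h1.trans ?_
  rw [Finset.sum_add_distrib, Finset.sum_const, nsmul_eq_mul, ← Finset.sum_filter]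
  exact add_le_add le_rfl hcon.2

end MissedMass

end SparseFT

namespace SparseFT

/-! ## Selection of the largest estimates -/

section Selection

variable {d n : ℕ}

theorem foldl_update_val (v : Idx d n → ℂ) (l : List (Idx d n)) (y : Idx d n → ℂ) (f : Idx d n) :
    l.foldl (fun y i => Function.update y i (v i)) y f = if f ∈ l then v f else y f := by
  induction l generalizing y with
  | nil => simp
  | cons a l ih =>
    rw [List.foldl_cons, ih]
    by_cases h : f = a
    · subst h; simp
    · simp [h]

theorem keepTop_spec (m : ℕ) (w : Finset (Idx d n) × (Idx d n → ℂ)) :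
    ∃ T : Finset (Idx d n), T ⊆ w.1 ∧ T.card = min m w.1.card ∧
      (∀ i ∈ T, ∀ j ∈ w.1, j ∉ T → ‖w.2 j‖ ≤ ‖w.2 i‖) ∧
      (keepTop m w).val = fun f => if f ∈ T then w.2 f else 0 := by
  set le : Idx d n → Idx d n → Prop := fun i j => ‖w.2 j‖ ≤ ‖w.2 i‖ with hle
  set l := (sortList le w.1.toList).val with hl
  have hperm : l.Perm w.1.toList := sortList_perm le _
  have hsorted : l.Pairwise le := sortList_sorted (le := le) (fun a b c h1 h2 => le_trans h2 h1)
    (fun a b => le_total _ _) _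
  have hnodup : l.Nodup := hperm.nodup_iff.2 w.1.nodup_toList
  have hmem : ∀ i, i ∈ l ↔ i ∈ w.1 := fun i => by rw [hperm.mem_iff, Finset.mem_toList]
  refine ⟨(l.take m).toFinset, ?_, ?_, ?_, ?_⟩
  · intro i hi
    exact (hmem i).1 (List.mem_of_mem_take (List.mem_toFinset.1 hi))
  · rw [List.toFinset_card_of_nodup (hnodup.sublist (List.take_sublist _ _)), List.length_take,
      hperm.length_eq, Finset.length_toList]
  · intro i hi j hj hjT
    rw [List.mem_toFinset] at hi hjT
    have h1 : j ∈ l.drop m := by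
      have h2 := (hmem j).2 hj
      rw [← List.take_append_drop m l, List.mem_append] at h2
      exact h2.resolve_left hjT
    have h3 := hsorted
    rw [← List.take_append_drop m l, List.pairwise_append] at h3
    exact h3.2.2 i hi j h1
  · funext f
    rw [keepTop]
    simp only [bind_val, loop_val, op_val]
    rw [foldl_update_val]
    simp only [List.mem_toFinset]
    rfl

/-- If `8 k` positions are kept, at least `6 k` of them lie outside `Q`, three for each of the at
most `2 k` elements of `Q ∩ L` that are dropped, and they have larger estimates: `‖y i‖ ^ 2 ≤ 3 ‖y
j‖ ^ 2 + 6 η ^ 2`. On average the dropped energy is at most that of the kept positions outside `Q`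
plus `12 k η ^ 2`. The latter energy is part of the tail and has left the residual, so the two
cancel and the tail keeps the coefficient `1`. The errors at the kept positions add `8 k η ^ 2`. -/
theorem selection_error [NeZero n] {k : ℕ} (hk : 1 ≤ k) (y E : Idx d n → ℂ) {η : ℝ}
    (hE : ∀ i, ‖E i - y i‖ ≤ η) (L Q : Finset (Idx d n)) (hQ : Q.card = 2 * k) :
    ∑ i, ‖y i - (keepTop (4 * (2 * k)) (L.filter fun f => 0 < ‖E f‖,
      fun f => if f ∈ L then E f else 0)).val i‖ ^ 2 ≤
      ∑ i ∈ Qᶜ, ‖y i‖ ^ 2 + ∑ i ∈ Q \ L, ‖y i‖ ^ 2 + 20 * k * η ^ 2 := by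
  obtain ⟨T, hT1, hT2, hT3, hT4⟩ := keepTop_spec (4 * (2 * k)) (L.filter fun f => 0 < ‖E f‖,
      fun f => if f ∈ L then E f else 0)
  rw [hT4]
  simp only at hT1 hT2 hT3 ⊢
  have hTL : ∀ i ∈ T, i ∈ L := fun i hi => (Finset.mem_filter.1 (hT1 hi)).1
  have hη : 0 ≤ η := (norm_nonneg _).trans (hE 0)
  have hTcard : T.card ≤ 8 * k := by rw [hT2]; exact (min_le_left _ _).trans (by omega)
  set P := (Q ∩ L) \ T with hP
  have hPcard : P.card ≤ 2 * k := by
    rw [← hQ]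
    exact Finset.card_le_card (Finset.sdiff_subset.trans Finset.inter_subset_left)
  have hX : ∑ i ∈ P, ‖y i‖ ^ 2 ≤ ∑ j ∈ T \ Q, ‖y j‖ ^ 2 + 12 * k * η ^ 2 := by
    have hPL : ∀ i ∈ P, i ∈ L ∧ i ∉ T := fun i hi =>
      ⟨(Finset.mem_inter.1 (Finset.mem_sdiff.1 hi).1).2, (Finset.mem_sdiff.1 hi).2⟩
    rcases le_or_gt (4 * (2 * k)) (L.filter fun f => 0 < ‖E f‖).card with hcase | hcase
    · rw [min_eq_left hcase] at hT2
      have hcomp : ∀ i ∈ P, ∀ j ∈ T \ Q, ‖y i‖ ^ 2 ≤ 3 * ‖y j‖ ^ 2 + 6 * η ^ 2 := by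
        intro i hi j hj
        have hjT := (Finset.mem_sdiff.1 hj).1
        have h1 : ‖E i‖ ≤ ‖E j‖ := by
          by_cases h0 : 0 < ‖E i‖
          · have := hT3 j hjT i (Finset.mem_filter.2 ⟨(hPL i hi).1, h0⟩) (hPL i hi).2
            rwa [if_pos (hPL i hi).1, if_pos (hTL j hjT)] at this
          · exact (not_lt.1 h0).trans (norm_nonneg _)
        have h2 : ‖y i‖ ≤ ‖y j‖ + 2 * η := by
          have h3 := norm_sub_norm_le (y i) (E i)
          have h4 := norm_sub_norm_le (E j) (y j)
          rw [norm_sub_rev] at h3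
          linarith [hE i, hE j]
        have h5 : ‖y i‖ ^ 2 ≤ (‖y j‖ + 2 * η) ^ 2 := pow_le_pow_left₀ (norm_nonneg _) h2 2
        nlinarith [sq_nonneg (‖y j‖ - η)]
      have h1 : ((T \ Q).card : ℝ) * ∑ i ∈ P, ‖y i‖ ^ 2 ≤
          P.card * (3 * ∑ j ∈ T \ Q, ‖y j‖ ^ 2 + (T \ Q).card * (6 * η ^ 2)) := by
        have h2 := Finset.sum_le_sum fun i hi => Finset.sum_le_sum fun j hj => hcomp i hi j hj
        simp only [Finset.sum_const, nsmul_eq_mul, Finset.sum_add_distrib, ← Finset.mul_sum] at h2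
        linarith
      have h2 : 6 * k ≤ (T \ Q).card := by
        have h3 := Finset.card_le_card_sdiff_add_card (s := T) (t := Q)
        omega
      have h3 : 3 * (P.card : ℝ) ≤ (T \ Q).card := by
        have : 3 * P.card ≤ (T \ Q).card := by omega
        exact_mod_cast this
      have h4 : (0 : ℝ) < (T \ Q).card := by
        have : 0 < (T \ Q).card := by omega
        exact_mod_cast this
      have h5 : (P.card : ℝ) ≤ 2 * k := by exact_mod_cast hPcard
      have hY : 0 ≤ ∑ j ∈ T \ Q, ‖y j‖ ^ 2 := Finset.sum_nonneg fun _ _ => by positivity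
      refine le_of_mul_le_mul_left (h1.trans ?_) h4
      have h6 := mul_le_mul_of_nonneg_right h3 hY
      have h7 := mul_le_mul_of_nonneg_right h5
        (show 0 ≤ ((T \ Q).card : ℝ) * (6 * η ^ 2) by positivity)
      nlinarith
    -- With fewer than `8 k` nonzero estimates all of them are kept, so a dropped position has
    -- estimate zero and hence `‖y i‖ ≤ η`.
    · rw [min_eq_right hcase.le] at hT2
      have hTeq : T = L.filter fun f => 0 < ‖E f‖ := Finset.eq_of_subset_of_card_le hT1 hT2.ge
      have h1 : ∀ i ∈ P, ‖y i‖ ^ 2 ≤ η ^ 2 := by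
        intro i hi
        have h2 : E i = 0 := by
          by_contra h0
          exact (hPL i hi).2 (hTeq ▸ Finset.mem_filter.2 ⟨(hPL i hi).1, norm_pos_iff.2 h0⟩)
        have h3 := hE i
        rw [h2, zero_sub, norm_neg] at h3
        exact pow_le_pow_left₀ (norm_nonneg _) h3 2
      have h2 := Finset.sum_le_sum h1
      rw [Finset.sum_const, nsmul_eq_mul] at h2
      have h5 : (P.card : ℝ) ≤ 2 * k := by exact_mod_cast hPcard
      have hY : 0 ≤ ∑ j ∈ T \ Q, ‖y j‖ ^ 2 := Finset.sum_nonneg fun _ _ => by positivity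
      have h7 := mul_le_mul_of_nonneg_right h5 (sq_nonneg η)
      have h8 : (0 : ℝ) ≤ k * η ^ 2 := by positivity
      linarith
  have hsplit : ∀ g : Idx d n → ℝ, (∀ i, 0 ≤ g i) → ∑ i ∈ Tᶜ, g i ≤
      ∑ i ∈ Q \ L, g i + ∑ i ∈ P, g i + ∑ i ∈ Qᶜ \ T, g i := by
    intro g hg
    have h1 : Tᶜ ⊆ (Q \ L ∪ P) ∪ (Qᶜ \ T) := by
      intro i hi
      simp only [hP, Finset.mem_union, Finset.mem_sdiff, Finset.mem_inter, Finset.mem_compl] at hi ⊢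
      tauto
    refine (Finset.sum_le_sum_of_subset_of_nonneg h1 fun i _ _ => hg i).trans ?_
    have hu : ∀ A B : Finset (Idx d n), ∑ i ∈ A ∪ B, g i ≤ ∑ i ∈ A, g i + ∑ i ∈ B, g i := by
      intro A B
      rw [← Finset.sum_union_inter]
      exact le_add_of_nonneg_right (Finset.sum_nonneg fun i _ => hg i)
    exact (hu _ _).trans (add_le_add (hu _ _) le_rfl)
  have hin : ∑ i ∈ T, ‖y i - (if i ∈ T then (if i ∈ L then E i else 0) else 0)‖ ^ 2 ≤
      8 * k * η ^ 2 := by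
    have h1 : ∀ i ∈ T, ‖y i - (if i ∈ T then (if i ∈ L then E i else 0) else 0)‖ ^ 2 ≤ η ^ 2 := by
      intro i hi
      rw [if_pos hi, if_pos (hTL i hi), norm_sub_rev]
      exact pow_le_pow_left₀ (norm_nonneg _) (hE i) 2
    refine (Finset.sum_le_sum h1).trans ?_
    rw [Finset.sum_const, nsmul_eq_mul]
    have : (T.card : ℝ) ≤ 8 * k := by exact_mod_cast hTcard
    exact mul_le_mul_of_nonneg_right this (sq_nonneg η)
  have hout : ∑ i ∈ Tᶜ, ‖y i - (if i ∈ T then (if i ∈ L then E i else 0) else 0)‖ ^ 2 =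
      ∑ i ∈ Tᶜ, ‖y i‖ ^ 2 :=
    Finset.sum_congr rfl fun i hi => by rw [if_neg (Finset.mem_compl.1 hi), sub_zero]
  have hcompl : ∑ i ∈ T \ Q, ‖y i‖ ^ 2 + ∑ i ∈ Qᶜ \ T, ‖y i‖ ^ 2 = ∑ i ∈ Qᶜ, ‖y i‖ ^ 2 := by
    rw [← Finset.sum_inter_add_sum_sdiff Qᶜ T]
    congr 2
    ext i
    simp only [Finset.mem_sdiff, Finset.mem_inter, Finset.mem_compl]
    tauto
  rw [← Finset.sum_add_sum_compl T, hout]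
  have := hsplit (fun i => ‖y i‖ ^ 2) fun i => by positivity
  linarith

theorem recoverAtConstantSNR_val [NeZero n] (α C : ℝ) (c : ℕ) (x χ : Idx d n → ℂ) (k : ℕ) (ε : ℝ)
    (ρ : Coins C d n) :
    (recoverAtConstantSNR α C c (dft x) χ k ε ρ).val =
      (keepTop (4 * k) ((located c x χ (bucketExp d (locBuckets d α k ε)) (ρ.1, ρ.2.1)).filter
        fun f => 0 < ‖medEst (bucketExp d (estBuckets d α (2 * k) ε)) c x χ ρ.2.2 f‖,
        fun f => if f ∈ located c x χ (bucketExp d (locBuckets d α k ε)) (ρ.1, ρ.2.1) then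
          medEst (bucketExp d (estBuckets d α (2 * k) ε)) c x χ ρ.2.2 f else 0)).val := by
  rw [← estimateValues_val]
  rfl

end Selection

end SparseFT

namespace SparseFT

/-! ## The sizes of the hash tables -/

section Sizes

theorem le_bucketExp {d : ℕ} (hd : 1 ≤ d) (T : ℝ) : T ≤ ((2 : ℝ) ^ bucketExp d T) ^ d := by
  have hne : {β : ℕ | T ≤ ((2 : ℝ) ^ β) ^ d}.Nonempty := by
    obtain ⟨β, hβ⟩ := pow_unbounded_of_one_lt T (one_lt_two : (1 : ℝ) < 2)
    exact ⟨β, hβ.le.trans (le_self_pow₀ (one_le_pow₀ one_le_two) (by omega))⟩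
  exact Nat.sInf_mem hne

theorem one_le_bucketExp {d : ℕ} (hd : 1 ≤ d) {T : ℝ} (hT : 1 < T) : 1 ≤ bucketExp d T := by
  by_contra h
  have h0 : bucketExp d T = 0 := by omega
  have := le_bucketExp hd T
  rw [h0] at this
  simp at this
  linarith

theorem bucketExp_mono {d : ℕ} (hd : 1 ≤ d) {T T' : ℝ} (h : T ≤ T') :
    bucketExp d T ≤ bucketExp d T' :=
  Nat.sInf_le (h.trans (le_bucketExp hd T'))

/-- Halving the side would make the table too small; `1 < T` ensures that the side can be halved. -/
theorem two_pow_bucketExp_le {d : ℕ} (hd : 1 ≤ d) {T : ℝ} (hT : 1 < T) :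
    ((2 : ℝ) ^ bucketExp d T) ^ d ≤ 2 ^ d * T := by
  have h1 := one_le_bucketExp hd hT
  have h2 : bucketExp d T - 1 ∉ {β : ℕ | T ≤ ((2 : ℝ) ^ β) ^ d} :=
    Nat.notMem_of_lt_sInf (by rw [← bucketExp]; omega)
  simp only [Set.mem_setOf_eq, not_le] at h2
  calc ((2 : ℝ) ^ bucketExp d T) ^ d = 2 ^ d * ((2 : ℝ) ^ (bucketExp d T - 1)) ^ d := by
        rw [← mul_pow, ← pow_succ', Nat.sub_add_cancel h1]
    _ ≤ _ := by gcongr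

variable {d n m k : ℕ} {α ε : ℝ}

theorem sharpness_le_locBuckets (hα : 0 < α) (hα1 : α ≤ 1) (hk : 1 ≤ k) (hε : 0 < ε) (hε1 : ε ≤ 1) :
    (2 * π) ^ (4 * d * sharp d) * (k / ε) ≤ locBuckets d α k ε := by
  rw [locBuckets, mul_div_assoc]
  have : α ^ d ≤ 1 := pow_le_one₀ hα.le hα1
  gcongr
  exact mul_le_of_le_one_right hε.le this

theorem locBuckets_le_estBuckets (hα : 0 < α) (hα1 : α ≤ 1) (hε : 0 < ε) :
    locBuckets d α k ε ≤ estBuckets d α (2 * k) ε := by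
  rw [locBuckets, estBuckets]
  have h1 : α ^ (2 * d) ≤ α ^ d := pow_le_pow_of_le_one hα.le hα1 (by omega)
  gcongr
  omega

theorem estBuckets_le (hα : 0 < α) (hα1 : α ≤ 1) (hε : 0 < ε) :
    (2 * π) ^ (4 * d * sharp d) * (k / ε) ≤ estBuckets d α k ε := by
  rw [estBuckets, mul_div_assoc]
  have : α ^ (2 * d) ≤ 1 := pow_le_one₀ hα.le hα1
  gcongr
  exact mul_le_of_le_one_right hε.le this

/-- As the table for estimation fits into the signal, this forces `N ≥ 2 ^ (20 d)` and thus `m ≥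
20`. Small `n`, for which `Δ` or `log log N` would degenerate, do not occur. -/
theorem two_pi_pow_ge (hd : 1 ≤ d) : (2 : ℝ) ^ (20 * d) ≤ (2 * π) ^ (4 * d * sharp d) := by
  have h1 : 4 * d * sharp d = 8 * d * d := by rw [sharp]; ring
  have h2 : (2 : ℝ) ^ 20 ≤ (2 * π) ^ 8 := by
    calc (2 : ℝ) ^ 20 ≤ (2 * 3) ^ 8 := by norm_num
      _ ≤ (2 * π) ^ 8 := by gcongr; exact Real.pi_gt_three.le
  calc (2 : ℝ) ^ (20 * d) = (2 ^ 20) ^ d := by rw [pow_mul]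
    _ ≤ ((2 * π) ^ 8) ^ d := by gcongr
    _ = (2 * π) ^ (8 * d) := by rw [pow_mul]
    _ ≤ _ := by
      rw [h1]
      exact pow_le_pow_right₀ (by linarith [Real.pi_gt_three]) (Nat.le_mul_of_pos_right _ hd)

/-- The situation in a call for `2 k`, with sides `2 ^ β` and `2 ^ β'` of the hash tables for
location and estimation. -/
structure GoodCall (d n m k : ℕ) (α ε : ℝ) : Prop where
  d_pos : 1 ≤ d
  n_eq : n = 2 ^ m
  k_pos : 1 ≤ k
  α_pos : 0 < α
  α_le : α ≤ 1
  ε_pos : 0 < ε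
  ε_le : ε ≤ 1
  fits : 2 ^ bucketExp d (estBuckets d α (2 * (2 * k)) ε) ≤ n

namespace GoodCall



theorem sharpness_one_lt (H : GoodCall d n m k α ε) : 1 < (2 * π) ^ (4 * d * sharp d) :=
  lt_of_lt_of_le (one_lt_pow₀ one_lt_two (by have := H.d_pos; omega)) (two_pi_pow_ge H.d_pos)

theorem two_k_div_ge (H : GoodCall d n m k α ε) : 1 ≤ ((2 * k : ℕ) : ℝ) / ε := by
  rw [le_div_iff₀ H.ε_pos]
  have : (1 : ℝ) ≤ k := by exact_mod_cast H.k_pos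
  push_cast
  linarith [H.ε_le]

theorem one_lt_locBuckets (H : GoodCall d n m k α ε) : 1 < locBuckets d α (2 * k) ε := by
  refine lt_of_lt_of_le H.sharpness_one_lt (le_trans ?_
    (sharpness_le_locBuckets H.α_pos H.α_le (by have := H.k_pos; omega) H.ε_pos H.ε_le))
  exact le_mul_of_one_le_right (by linarith [H.sharpness_one_lt]) H.two_k_div_ge

theorem one_lt_estBuckets (H : GoodCall d n m k α ε) : 1 < estBuckets d α (2 * (2 * k)) ε :=
  lt_of_lt_of_le H.one_lt_locBuckets (locBuckets_le_estBuckets H.α_pos H.α_le H.ε_pos)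

theorem side_le_len (H : GoodCall d n m k α ε) : ((2 : ℝ) ^ bucketExp d (estBuckets d α (2 * (2 * k)) ε)) ^ d ≤ len d n := by
  rw [len]
  refine pow_le_pow_left₀ (by positivity) ?_ d
  exact_mod_cast H.fits

theorem estBuckets_le_len (H : GoodCall d n m k α ε) : estBuckets d α (2 * (2 * k)) ε ≤ len d n :=
  (le_bucketExp H.d_pos _).trans H.side_le_len

theorem sharpness_mul_le_len (H : GoodCall d n m k α ε) : (2 * π) ^ (4 * d * sharp d) * (k / ε) ≤ len d n := by
  refine le_trans ?_ ((estBuckets_le H.α_pos H.α_le H.ε_pos).trans H.estBuckets_le_len)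
  have := H.ε_pos
  gcongr
  omega

theorem k_div_ge (H : GoodCall d n m k α ε) : 1 ≤ (k : ℝ) / ε := by
  rw [le_div_iff₀ H.ε_pos]
  have : (1 : ℝ) ≤ k := by exact_mod_cast H.k_pos
  linarith [H.ε_le]

theorem sharpness_le_len (H : GoodCall d n m k α ε) : (2 * π) ^ (4 * d * sharp d) ≤ len d n :=
  (le_mul_of_one_le_right (by linarith [H.sharpness_one_lt]) H.k_div_ge).trans
    H.sharpness_mul_le_len

theorem k_div_le_len (H : GoodCall d n m k α ε) : (k : ℝ) / ε ≤ len d n :=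
  (le_mul_of_one_le_left (by linarith [H.k_div_ge]) H.sharpness_one_lt.le).trans
    H.sharpness_mul_le_len

theorem k_le_len (H : GoodCall d n m k α ε) : (k : ℝ) ≤ len d n := by
  refine le_trans ?_ H.k_div_le_len
  rw [le_div_iff₀ H.ε_pos]
  exact mul_le_of_le_one_right (Nat.cast_nonneg _) H.ε_le

theorem inv_eps_le_len (H : GoodCall d n m k α ε) : 1 / ε ≤ len d n := by
  refine le_trans ?_ H.k_div_le_len
  have := H.ε_pos
  have : (1 : ℝ) ≤ k := by exact_mod_cast H.k_pos
  gcongr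

theorem two_pow_le_len (H : GoodCall d n m k α ε) : (2 : ℝ) ^ (20 * d) ≤ len d n :=
  (two_pi_pow_ge H.d_pos).trans H.sharpness_le_len

theorem d_le_len (H : GoodCall d n m k α ε) : (d : ℝ) ≤ len d n := by
  have h1 : d ≤ 2 ^ (20 * d) := (Nat.lt_two_pow_self).le.trans (Nat.pow_le_pow_right two_pos (by omega))
  exact le_trans (by exact_mod_cast h1) H.two_pow_le_len

theorem twenty_le_m (H : GoodCall d n m k α ε) : 20 ≤ m := by
  have h1 := H.two_pow_le_len
  rw [len, H.n_eq, Nat.cast_pow, ← pow_mul, Nat.cast_two] at h1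
  have h2 := (pow_le_pow_iff_right₀ (one_lt_two : (1 : ℝ) < 2)).1 h1
  exact Nat.le_of_mul_le_mul_right h2 H.d_pos

theorem centralLoss_le_len (H : GoodCall d n m k α ε) : centralLoss d ≤ len d n := by
  refine le_trans ?_ H.sharpness_le_len
  rw [centralLoss, show 4 * d * sharp d = 8 * d ^ 2 by rw [sharp]; ring]
  have hπ := Real.pi_gt_three
  calc (π / 2) ^ (2 * d ^ 2) ≤ (2 * π) ^ (2 * d ^ 2) := by gcongr; linarith
    _ ≤ _ := pow_le_pow_right₀ (by linarith) (by omega)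

theorem estSide (H : GoodCall d n m k α ε) : GoodSide n m (bucketExp d (estBuckets d α (2 * (2 * k)) ε)) where
  n_eq := H.n_eq
  one_le := one_le_bucketExp H.d_pos H.one_lt_estBuckets
  le := by
    have h := H.fits
    conv_rhs at h => rw [H.n_eq]
    exact (Nat.pow_le_pow_iff_right (by norm_num)).1 h

theorem locSide (H : GoodCall d n m k α ε) : GoodSide n m (bucketExp d (locBuckets d α (2 * k) ε)) where
  n_eq := H.n_eq
  one_le := one_le_bucketExp H.d_pos H.one_lt_locBuckets
  le := (bucketExp_mono H.d_pos (locBuckets_le_estBuckets H.α_pos H.α_le H.ε_pos)).trans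
    H.estSide.le

/-- Here the number of buckets meets the collision estimate: head and tail are reduced by the factor
`ε / (2 k)`, after payment for the filter loss. -/
theorem collision_le (H : GoodCall d n m k α ε) {T : ℝ} (hT : (2 * π) ^ (4 * d * sharp d) * (((2 * k : ℕ) : ℝ) / ε) ≤ T) :
    centralLoss d ^ 2 * (collisionConst d / (2 ^ bucketExp d T) ^ d) ≤ ε / (2 * k) := by
  have hk : (0 : ℝ) < k := by exact_mod_cast H.k_pos
  have hε := H.ε_pos
  have h1 := hT.trans (le_bucketExp H.d_pos T)
  have h2 := centralLoss_sq_mul_le H.d_pos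
  have h3 : (0 : ℝ) < ((2 : ℝ) ^ bucketExp d T) ^ d := by positivity
  rw [← mul_div_assoc, div_le_iff₀ h3]
  refine h2.trans ?_
  calc (2 * π) ^ (4 * d * sharp d) = ε / (2 * k) *
        ((2 * π) ^ (4 * d * sharp d) * (((2 * k : ℕ) : ℝ) / ε)) := by
        push_cast; field_simp
    _ ≤ _ := by gcongr

theorem loc_collision_le (H : GoodCall d n m k α ε) :
    centralLoss d ^ 2 * (collisionConst d / (2 ^ bucketExp d (locBuckets d α (2 * k) ε)) ^ d) ≤
      ε / (2 * k) :=
  H.collision_le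
    (sharpness_le_locBuckets H.α_pos H.α_le (by have := H.k_pos; omega) H.ε_pos H.ε_le)

theorem est_collision_le (H : GoodCall d n m k α ε) :
    centralLoss d ^ 2 *
      (collisionConst d / (2 ^ bucketExp d (estBuckets d α (2 * (2 * k)) ε)) ^ d) ≤ ε / (2 * k) :=
  H.collision_le
    ((sharpness_le_locBuckets H.α_pos H.α_le (by have := H.k_pos; omega) H.ε_pos H.ε_le).trans
      (locBuckets_le_estBuckets H.α_pos H.α_le H.ε_pos))

theorem log_len_eq (H : GoodCall d n m k α ε) : Real.log (len d n) = (d * m : ℕ) * Real.log 2 := by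
  rw [len, H.n_eq, Nat.cast_pow, ← pow_mul, Nat.cast_two, Real.log_pow, mul_comm m d]

theorem twenty_le_dm (H : GoodCall d n m k α ε) : 20 ≤ d * m :=
  H.twenty_le_m.trans (Nat.le_mul_of_pos_left _ H.d_pos)

theorem half_le_log_len (H : GoodCall d n m k α ε) : ((d * m : ℕ) : ℝ) / 2 ≤ Real.log (len d n) := by
  rw [H.log_len_eq, div_eq_mul_one_div]
  gcongr
  linarith [Real.log_two_gt_d9]

theorem ten_le_log_len (H : GoodCall d n m k α ε) : 10 ≤ Real.log (len d n) := by
  have h1 : (20 : ℝ) ≤ (d * m : ℕ) := by exact_mod_cast H.twenty_le_dm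
  linarith [H.half_le_log_len]

theorem one_le_loglog (H : GoodCall d n m k α ε) : 1 ≤ Real.log (Real.log (len d n)) := by
  have h1 := H.ten_le_log_len
  rw [Real.le_log_iff_exp_le (by linarith)]
  linarith [Real.exp_one_lt_d9]

/-- There are at most `d m + 1` shifts and `d m ≤ 2 log N`, whereas the choice of `C` makes the
exponential at least `(log N) ^ 2`. -/
theorem shifts_length_le (H : GoodCall d n m k α ε) {C : ℝ} (hC : 1500 ≤ C) :
    (((shifts d n).length : ℕ) : ℝ) ≤ Real.exp ((numShifts C d n : ℝ) / 200) := by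
  have hll := H.one_le_loglog
  have hl := H.ten_le_log_len
  have hlen : (shifts d n).length ≤ d * m + 1 := by
    rw [shifts, List.length_cons, List.length_map, digits, List.length_flatMap]
    simp only [List.length_map, List.length_range, List.map_const', List.length_finRange,
      List.sum_replicate, smul_eq_mul]
    have := numDigits_le H.n_eq (by have := H.twenty_le_m; omega)
    exact Nat.add_le_add_right (Nat.mul_le_mul_left _ this) 1
  have h1 : (((shifts d n).length : ℕ) : ℝ) ≤ (d * m : ℕ) + 1 := by exact_mod_cast hlen
  have h2 : (20 : ℝ) ≤ (d * m : ℕ) := by exact_mod_cast H.twenty_le_dm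
  have h3 := H.half_le_log_len
  have h4 : C * Real.log (Real.log (len d n)) ≤ numShifts C d n := Nat.le_ceil _
  have h5 : 2 * Real.log (Real.log (len d n)) ≤ (numShifts C d n : ℝ) / 200 := by nlinarith
  refine le_trans ?_ (Real.exp_le_exp.2 h5)
  rw [show 2 * Real.log (Real.log (len d n)) = (2 : ℕ) * Real.log (Real.log (len d n)) by push_cast; ring,
    Real.exp_nat_mul, Real.exp_log (by linarith)]
  nlinarith

/-- The value `1500 = 5 · 300` makes the exponential at most `(log N) ^ (-5)`. With `M = d m ≤ 2 log
N` and `M ≥ 20` the product is at most `32 / M ^ 3 ≤ 1/250`. -/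
theorem balanced_bound (H : GoodCall d n m k α ε) {C : ℝ} (hC : 1500 ≤ C) :
    d * m * m * Real.exp (-((numShifts C d n : ℝ) / 300)) ≤ 1 / 250 := by
  have hll := H.one_le_loglog
  have hl := H.ten_le_log_len
  have h2 : (20 : ℝ) ≤ (d * m : ℕ) := by exact_mod_cast H.twenty_le_dm
  have h3 := H.half_le_log_len
  have h4 : C * Real.log (Real.log (len d n)) ≤ numShifts C d n := Nat.le_ceil _
  have h5 : 5 * Real.log (Real.log (len d n)) ≤ (numShifts C d n : ℝ) / 300 := by nlinarith
  have h6 : Real.exp (-((numShifts C d n : ℝ) / 300)) ≤ (Real.log (len d n) ^ 5)⁻¹ := by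
    rw [Real.exp_neg]
    refine inv_anti₀ (by positivity) ?_
    refine le_trans (le_of_eq ?_) (Real.exp_le_exp.2 h5)
    rw [show 5 * Real.log (Real.log (len d n)) = (5 : ℕ) * Real.log (Real.log (len d n)) by
      push_cast; ring, Real.exp_nat_mul, Real.exp_log (by linarith)]
  set M : ℝ := ((d * m : ℕ) : ℝ) with hM
  have h7 : (d : ℝ) * m * m ≤ M ^ 2 := by
    have : d * m * m ≤ (d * m) ^ 2 := by
      rw [sq]; exact Nat.mul_le_mul_left _ (Nat.le_mul_of_pos_left _ H.d_pos)
    rw [hM]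
    exact_mod_cast this
  have h8 : (M / 2) ^ 5 ≤ Real.log (len d n) ^ 5 := pow_le_pow_left₀ (by linarith) h3 5
  have h9 : (0 : ℝ) < (M / 2) ^ 5 := by positivity
  calc _ ≤ M ^ 2 * ((M / 2) ^ 5)⁻¹ := by
        refine mul_le_mul h7 (h6.trans (inv_anti₀ h9 h8)) (Real.exp_pos _).le (by positivity)
    _ ≤ 1 / 250 := by
        rw [← div_eq_mul_inv, div_le_iff₀ h9]
        have h10 : (20 : ℝ) ^ 3 ≤ M ^ 3 := pow_le_pow_left₀ (by norm_num) h2 3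
        have h11 : 0 ≤ M ^ 2 := by positivity
        nlinarith [mul_le_mul_of_nonneg_left h10 h11]

end GoodCall

end Sizes

end SparseFT

namespace SparseFT

/-! ## The error of the recovered signal -/

section Error

variable {d n m k : ℕ} [NeZero n] {α ε : ℝ}

theorem errK_nonneg (k : ℕ) (x : Idx d n → ℂ) : 0 ≤ errK k x := by
  refine Real.sInf_nonneg ?_
  rintro e ⟨y, -, rfl⟩
  exact Real.sqrt_nonneg _

/-- The precision constant that suffices for the constants `A` and `p`. -/
noncomputable def precision (A : ℝ) (p : ℕ) : ℕ :=
  4 * (p + 5 + ⌈300 * (windowConst + 1) * (A + 2)⌉₊)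

namespace GoodCall

theorem windowWidth_pos (H : GoodCall d n m k α ε) {c : ℕ} (hc : 1 ≤ c) :
    1 ≤ windowWidth d n c := by
  refine Nat.one_le_iff_ne_zero.2 (Nat.ceil_pos.2 ?_).ne'
  have := H.ten_le_log_len
  have : (1 : ℝ) ≤ c := by exact_mod_cast hc
  nlinarith

/-- With enough precision the numerical error is negligible. -/
theorem numerical_error (H : GoodCall d n m k α ε) {A : ℝ} (hA : 0 ≤ A) {p c : ℕ}
    (hc : precision A p ≤ c) {μ s : ℝ} (hμ : 0 ≤ μ) (hs0 : 0 ≤ s)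
    (hs : s ≤ (A + 2) * len d n ^ (p + 2) * μ) :
    centralLoss d * (150 * (semiErr d (windowWidth d n c) * s)) ≤ √ε * μ := by
  set N := len d n with hN
  set u := ⌈300 * (windowConst + 1) * (A + 2)⌉₊ with hu
  set η := windowConst * Real.exp (-((windowWidth d n c : ℝ) / 4)) with hη
  have hw := windowConst_pos
  have hN1 : 1 ≤ N := le_trans (one_le_pow₀ one_le_two) H.two_pow_le_len
  have hN2 : 2 ≤ N := by
    have h1 := H.two_pow_le_len
    have h2 : (2 : ℝ) ^ 1 ≤ 2 ^ (20 * d) :=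
      pow_le_pow_right₀ one_le_two (by have := H.d_pos; omega)
    linarith
  have hN0 : 0 < N := by linarith
  have hη0 : 0 ≤ η := by positivity
  -- The width `c log N` makes the window error a power of `N`. The filter loss and `semiErr` cost a
  -- factor `N` each, `‖χ‖₁` costs `N ^ (p + 2)` and `1 / √ε` costs `N`, in total `N ^ (p + 5)`; the
  -- extra `N ^ u` absorbs the constants.
  have hexp : Real.exp (-((windowWidth d n c : ℝ) / 4)) ≤ (N ^ (p + 5 + u))⁻¹ := by
    rw [Real.exp_neg]
    refine inv_anti₀ (by positivity) ?_
    have h1 : (c : ℝ) * Real.log N ≤ windowWidth d n c := Nat.le_ceil _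
    have h2 : ((p + 5 + u : ℕ) : ℝ) * Real.log N ≤ (windowWidth d n c : ℝ) / 4 := by
      have h3 : (((precision A p : ℕ)) : ℝ) ≤ c := by exact_mod_cast hc
      have h4 : ((precision A p : ℕ) : ℝ) = 4 * ((p + 5 + u : ℕ) : ℝ) := by
        rw [precision]; push_cast; ring
      have h5 : 0 ≤ Real.log N := Real.log_nonneg hN1
      nlinarith
    calc N ^ (p + 5 + u) = Real.exp (((p + 5 + u : ℕ) : ℝ) * Real.log N) := by
          rw [Real.exp_nat_mul, Real.exp_log hN0]
      _ ≤ _ := Real.exp_le_exp.2 h2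
  have hu1 : 300 * (windowConst + 1) * (A + 2) ≤ N ^ u := by
    calc 300 * (windowConst + 1) * (A + 2) ≤ u := Nat.le_ceil _
      _ ≤ (2 : ℝ) ^ u := by exact_mod_cast (Nat.lt_two_pow_self (n := u)).le
      _ ≤ _ := pow_le_pow_left₀ zero_le_two hN2 u
  have hηle : η * N ^ (p + 5) * (300 * (A + 2)) ≤ 1 := by
    have h1 : η ≤ windowConst * (N ^ (p + 5 + u))⁻¹ := mul_le_mul_of_nonneg_left hexp hw.le
    have h2 : η * N ^ (p + 5) ≤ windowConst * (N ^ u)⁻¹ := by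
      calc η * N ^ (p + 5) ≤ windowConst * (N ^ (p + 5 + u))⁻¹ * N ^ (p + 5) := by gcongr
        _ = _ := by rw [pow_add]; field_simp
    have h3 : windowConst * (N ^ u)⁻¹ * (300 * (A + 2)) ≤ 1 := by
      rw [mul_right_comm, ← div_eq_mul_inv, div_le_one (by positivity)]
      nlinarith
    calc _ ≤ windowConst * (N ^ u)⁻¹ * (300 * (A + 2)) := by gcongr
      _ ≤ 1 := h3
  have hdη : (d : ℝ) * η ≤ 1 := by
    have h1 : (d : ℝ) * η ≤ N ^ (p + 5) * η := by
      gcongr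
      exact H.d_le_len.trans (le_self_pow₀ hN1 (by omega))
    nlinarith [mul_nonneg hη0 (pow_nonneg hN0.le (p + 5))]
  have hsemi : semiErr d (windowWidth d n c) ≤ 2 * N * η := by
    have h1 : (1 + η) ^ d ≤ Real.exp (d * η) := by
      rw [Real.exp_nat_mul]
      refine pow_le_pow_left₀ (by linarith) ?_ d
      linarith [Real.add_one_le_exp η]
    have h2 := Real.abs_exp_sub_one_le (x := (d : ℝ) * η) (by rwa [abs_of_nonneg (by positivity)])
    rw [abs_of_nonneg (by positivity : (0 : ℝ) ≤ d * η)] at h2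
    have h3 := le_abs_self (Real.exp (d * η) - 1)
    have h4 : (d : ℝ) * η ≤ N * η := mul_le_mul_of_nonneg_right H.d_le_len hη0
    rw [semiErr, ← hη]
    linarith
  have hε : N⁻¹ ≤ √ε := by
    have h1 : N⁻¹ ≤ ε := by
      have := H.inv_eps_le_len
      rw [one_div] at this
      exact inv_le_of_inv_le₀ H.ε_pos this
    refine h1.trans ?_
    rw [Real.le_sqrt' H.ε_pos]
    nlinarith [H.ε_pos, H.ε_le]
  calc centralLoss d * (150 * (semiErr d (windowWidth d n c) * s))
      ≤ N * (150 * (2 * N * η * ((A + 2) * N ^ (p + 2) * μ))) := by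
        have h1 : semiErr d (windowWidth d n c) * s ≤ 2 * N * η * ((A + 2) * N ^ (p + 2) * μ) :=
          mul_le_mul hsemi hs hs0 (by positivity)
        exact mul_le_mul H.centralLoss_le_len (mul_le_mul_of_nonneg_left h1 (by norm_num))
          (mul_nonneg (by norm_num) (mul_nonneg (semiErr_nonneg _ _) hs0)) hN0.le
    _ = η * N ^ (p + 5) * (300 * (A + 2)) * (N⁻¹ * μ) := by
        field_simp
        ring
    _ ≤ 1 * (√ε * μ) := by gcongr
    _ = _ := one_mul _

end GoodCall

/-- The noise level `Err_k(x) / √k`. -/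
noncomputable def noiseLevel (k : ℕ) (x : Idx d n → ℂ) : ℝ := errK k x / √(k : ℝ)

/-- The assumptions on the signal and on its approximation. -/
structure GoodInput (k : ℕ) (x χ : Idx d n → ℂ) (Q : Finset (Idx d n)) (A : ℝ) (p : ℕ) : Prop where
  k_pos : 1 ≤ k
  A_ge : 1 ≤ A
  card_eq : Q.card = 2 * k
  head_le : ∑ i ∈ Q, ‖(x - χ) i‖ ≤ A * √(k : ℝ) * errK k x
  tail_le : ∑ i ∈ Qᶜ, ‖(x - χ) i‖ ^ 2 ≤ errK k x ^ 2
  norm_le : ∀ i, ‖x i‖ ≤ len d n ^ p * noiseLevel k x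

namespace GoodInput

variable {x χ : Idx d n → ℂ} {Q : Finset (Idx d n)} {A : ℝ} {p : ℕ}

theorem noiseLevel_nonneg (k : ℕ) (x : Idx d n → ℂ) : 0 ≤ noiseLevel k x :=
  div_nonneg (errK_nonneg k x) (Real.sqrt_nonneg _)

theorem one_le_k (I : GoodInput k x χ Q A p) : (1 : ℝ) ≤ k := by exact_mod_cast I.k_pos

theorem sqrt_mul_noiseLevel (I : GoodInput k x χ Q A p) : √(k : ℝ) * noiseLevel k x = errK k x := by
  have := Real.sqrt_pos.2 (lt_of_lt_of_le one_pos I.one_le_k)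
  rw [noiseLevel]; field_simp

theorem mul_noiseLevel_sq (I : GoodInput k x χ Q A p) :
    (k : ℝ) * noiseLevel k x ^ 2 = errK k x ^ 2 := by
  rw [← I.sqrt_mul_noiseLevel, mul_pow, Real.sq_sqrt (by linarith [I.one_le_k])]

theorem head_le' (I : GoodInput k x χ Q A p) :
    ∑ i ∈ Q, ‖(x - χ) i‖ ≤ A * k * noiseLevel k x := by
  refine I.head_le.trans (le_of_eq ?_)
  conv_lhs => rw [← I.sqrt_mul_noiseLevel]
  conv_rhs => rw [← Real.sq_sqrt (show (0 : ℝ) ≤ k by linarith [I.one_le_k])]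
  ring

theorem errK_le (I : GoodInput k x χ Q A p) (hk : (k : ℝ) ≤ len d n) :
    errK k x ≤ len d n * noiseLevel k x := by
  rw [← I.sqrt_mul_noiseLevel]
  refine mul_le_mul_of_nonneg_right (le_trans ?_ hk) (noiseLevel_nonneg k x)
  rw [Real.sqrt_le_left (by linarith [I.one_le_k])]
  nlinarith [I.one_le_k]

theorem sum_tail_le (I : GoodInput k x χ Q A p) :
    ∑ l ∈ Qᶜ, ‖(x - χ) l‖ ≤ len d n * errK k x := by
  have he0 := errK_nonneg k x
  have h4 : ∀ l ∈ Qᶜ, ‖(x - χ) l‖ ≤ errK k x := by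
    intro l hl
    have h5 : ‖(x - χ) l‖ ^ 2 ≤ errK k x ^ 2 :=
      (Finset.single_le_sum (f := fun l => ‖(x - χ) l‖ ^ 2) (fun _ _ => by positivity) hl).trans
        I.tail_le
    exact (le_abs_self _).trans (abs_le_of_sq_le_sq h5 he0)
  refine (Finset.sum_le_sum h4).trans ?_
  rw [Finset.sum_const, nsmul_eq_mul]
  refine mul_le_mul_of_nonneg_right ?_ he0
  rw [len, ← card_idx]
  exact_mod_cast Finset.card_le_univ _

/-- The numerical error is relative to `‖χ‖₁`. Since `χ = x - (x - χ)`, the bounds on `x`, on the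
head and on the tail limit it to a power of `N` times the noise level. -/
theorem sum_norm_le (I : GoodInput k x χ Q A p) (hk : (k : ℝ) ≤ len d n) :
    ∑ l, ‖χ l‖ ≤ (A + 2) * len d n ^ (p + 2) * noiseLevel k x := by
  have hN1 : 1 ≤ len d n := I.one_le_k.trans hk
  set N := len d n with hN
  set μ := noiseLevel k x with hμ
  have hμ0 : 0 ≤ μ := noiseLevel_nonneg k x
  have hA := I.A_ge
  have h1 : ∑ l, ‖χ l‖ ≤ ∑ l, ‖x l‖ + ∑ l, ‖(x - χ) l‖ := by
    rw [← Finset.sum_add_distrib]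
    refine Finset.sum_le_sum fun l _ => ?_
    have h2 : χ l = x l - (x - χ) l := by rw [Pi.sub_apply, sub_sub_cancel]
    conv_lhs => rw [h2]
    exact norm_sub_le _ _
  have h2 : ∑ l, ‖x l‖ ≤ N ^ (p + 1) * μ := by
    refine (Finset.sum_le_sum fun l _ => I.norm_le l).trans (le_of_eq ?_)
    rw [Finset.sum_const, nsmul_eq_mul, Finset.card_univ, card_idx, ← len, ← hN, pow_succ]
    ring
  have h3 := I.sum_tail_le
  have h4 := I.errK_le hk
  have h6 : N ≤ N ^ (p + 2) := le_self_pow₀ hN1 (by omega)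
  have h8 : ∑ i ∈ Q, ‖(x - χ) i‖ ≤ A * N ^ (p + 2) * μ := by
    refine I.head_le'.trans ?_
    have : (k : ℝ) ≤ N ^ (p + 2) := hk.trans h6
    gcongr
  have h9 : N * errK k x ≤ N ^ (p + 2) * μ := by
    calc N * errK k x ≤ N * (N * μ) := mul_le_mul_of_nonneg_left h4 (by linarith)
      _ = N ^ 2 * μ := by ring
      _ ≤ _ := mul_le_mul_of_nonneg_right (pow_le_pow_right₀ hN1 (by omega)) hμ0
  have h10 : N ^ (p + 1) * μ ≤ N ^ (p + 2) * μ :=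
    mul_le_mul_of_nonneg_right (pow_le_pow_right₀ hN1 (by omega)) hμ0
  rw [← Finset.sum_add_sum_compl Q (fun l => ‖(x - χ) l‖)] at h1
  linarith

end GoodInput

namespace GoodCall

variable {x χ : Idx d n → ℂ} {Q : Finset (Idx d n)} {A C : ℝ} {p c : ℕ}

theorem numerical (H : GoodCall d n m k α ε) (I : GoodInput k x χ Q A p) (hc : precision A p ≤ c) :
    centralLoss d * (150 * (semiErr d (windowWidth d n c) * ∑ l, ‖χ l‖)) ≤ √ε * noiseLevel k x :=
  H.numerical_error (by linarith [I.A_ge]) hc (GoodInput.noiseLevel_nonneg k x)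
    (Finset.sum_nonneg fun _ _ => norm_nonneg _) (I.sum_norm_le H.k_le_len)

theorem one_le_windowWidth (H : GoodCall d n m k α ε) (hc : precision A p ≤ c) :
    1 ≤ windowWidth d n c :=
  H.windowWidth_pos (by refine le_trans ?_ hc; rw [precision]; omega)

theorem mul_collision_le {K : ℝ} (hK : 0 ≤ K)
    (h : centralLoss d ^ 2 * K ≤ ε / (2 * k)) : centralLoss d * K ≤ ε / (2 * k) := by
  refine le_trans ?_ h
  have := one_le_centralLoss d
  have := centralLoss_pos d
  nlinarith [mul_nonneg this.le hK]

theorem eps_le_sqrt (H : GoodCall d n m k α ε) : ε ≤ √ε := by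
  rw [Real.le_sqrt' H.ε_pos]
  nlinarith [H.ε_pos, H.ε_le]

/-- The medians are used with `δ = 300 A √ε μ`. In a bucket the head is of order `A ε μ` and the
tail has mean square of order `ε μ ^ 2`, so it is the tail that dictates the order `√ε`. -/
theorem prob_estimates (H : GoodCall d n m k α ε) (I : GoodInput k x χ Q A p) (hC : 1500 ≤ C)
    (hc : precision A p ≤ c) :
    prob (fun ρ : Fin (numEst C d n) → OddMat d n × Idx d n × Idx d n =>
      ∃ i, 600 * A * √ε * noiseLevel k x <
        ‖medEst (bucketExp d (estBuckets d α (2 * (2 * k)) ε)) c x χ ρ i - (x - χ) i‖) ≤ 1 / 1000 := by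
  have hA := I.A_ge
  have hμ0 := GoodInput.noiseLevel_nonneg k x
  have hk := I.one_le_k
  have hcol := H.est_collision_le
  have hκ0 : 0 ≤ collisionConst d / (2 ^ bucketExp d (estBuckets d α (2 * (2 * k)) ε)) ^ d :=
    div_nonneg (collisionConst_pos d).le (by positivity)
  have hcol2 := mul_collision_le hκ0 hcol
  have hnum := H.numerical I hc
  have hε0 := H.ε_pos
  have hεs := H.eps_le_sqrt
  have hsε : √ε ^ 2 = ε := Real.sq_sqrt hε0.le
  have hlog := H.ten_le_log_len
  have hεk : ε / (2 * k) * k = ε / 2 := by field_simp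
  have hδ0 : 0 ≤ 300 * A * √ε * noiseLevel k x := by positivity
  have hest := prob_medEst (r := numEst C d n) H.estSide (H.one_le_windowWidth hc) x χ Q hδ0
    (by
      have : 0 ≤ √ε * noiseLevel k x := by positivity
      nlinarith)
    (by
      rw [← mul_assoc]
      calc _ ≤ ε / (2 * k) * (A * k * noiseLevel k x) :=
            mul_le_mul hcol2 I.head_le' (Finset.sum_nonneg fun _ _ => norm_nonneg _) (by positivity)
        _ = ε / (2 * k) * k * (A * noiseLevel k x) := by ring
        _ = ε / 2 * (A * noiseLevel k x) := by rw [hεk]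
        _ ≤ √ε / 2 * (A * noiseLevel k x) := by gcongr
        _ = _ := by ring)
    (by
      rw [← mul_assoc]
      calc _ ≤ ε / (2 * k) * errK k x ^ 2 :=
            mul_le_mul hcol I.tail_le (Finset.sum_nonneg fun _ _ => by positivity) (by positivity)
        _ = ε / (2 * k) * k * noiseLevel k x ^ 2 := by rw [← I.mul_noiseLevel_sq]; ring
        _ = ε / 2 * noiseLevel k x ^ 2 * 1 := by rw [hεk]; ring
        _ ≤ ε / 2 * noiseLevel k x ^ 2 * A ^ 2 := by gcongr; exact one_le_pow₀ hA
        _ ≤ 50 * (√ε ^ 2 * noiseLevel k x ^ 2 * A ^ 2) := by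
            rw [hsε]
            have : 0 ≤ ε * noiseLevel k x ^ 2 * A ^ 2 := by positivity
            linarith
        _ = _ := by ring)
    (by
      refine Nat.one_le_iff_ne_zero.2 (Nat.ceil_pos.2 ?_).ne'
      nlinarith)
    (by
      refine le_trans ?_ (Nat.le_ceil _)
      nlinarith)
  refine (prob_mono fun ρ hρ => ?_).trans (hest.trans ?_)
  · obtain ⟨i, hi⟩ := hρ
    exact ⟨i, lt_of_le_of_lt (le_of_eq (by ring)) hi⟩
  · rw [one_div]
    refine inv_anti₀ (by norm_num) ?_
    refine le_trans ?_ H.two_pow_le_len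
    calc (1000 : ℝ) ≤ 2 ^ 10 := by norm_num
      _ ≤ _ := pow_le_pow_right₀ one_le_two (by have := H.d_pos; omega)

/-- The missed energy is bounded with `τ = √ε μ`. Entries below `τ` give `2 ε Err ^ 2`, the head
gives `1000 · 150 · A ^ 2 ε / 2` and the tail `1000 · 150 ^ 2 · shiftLoss · ε` times `Err ^ 2`. -/
theorem prob_location (H : GoodCall d n m k α ε) (I : GoodInput k x χ Q A p) (hC : 1500 ≤ C)
    (hc : precision A p ≤ c) :
    prob (fun ω : (OddMat d n × Idx d n) × (Fin (numShifts C d n) → Idx d n × Idx d n) =>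
      (2 + 75000 * A ^ 2 + 22500000 * shiftLoss) * ε * errK k x ^ 2 <
        ∑ i ∈ Q \ located c x χ (bucketExp d (locBuckets d α (2 * k) ε)) ω, ‖(x - χ) i‖ ^ 2) ≤
      1 / 200 := by
  have hA := I.A_ge
  have hμ0 := GoodInput.noiseLevel_nonneg k x
  have hk := I.one_le_k
  have hcol := H.loc_collision_le
  have hκ0 : 0 ≤ collisionConst d / (2 ^ bucketExp d (locBuckets d α (2 * k) ε)) ^ d :=
    div_nonneg (collisionConst_pos d).le (by positivity)
  have hcol2 := mul_collision_le hκ0 hcol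
  have hε0 := H.ε_pos
  have hsε : √ε ^ 2 = ε := Real.sq_sqrt hε0.le
  have hεk : ε / (2 * k) * k = ε / 2 := by field_simp
  have hsl := shiftLoss_pos
  have hcA : 0 < numShifts C d n := by
    refine Nat.ceil_pos.2 ?_
    have := H.one_le_loglog
    nlinarith
  have hloc := prob_missedMass H.locSide (by have := H.twenty_le_m; omega)
    (H.one_le_windowWidth hc) x χ Q hcA (H.shifts_length_le hC) (by positivity) (H.numerical I hc)
  refine (prob_mono fun ω hω => ?_).trans (hloc.trans ?_)
  · refine lt_of_le_of_lt ?_ hω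
    set κ := collisionConst d / (2 ^ bucketExp d (locBuckets d α (2 * k) ε)) ^ d
    set Γ := centralLoss d
    set μ := noiseLevel k x
    have hQ : (Q.card : ℝ) = 2 * k := by rw [I.card_eq]; push_cast; ring
    have h1 : (∑ i ∈ Q, ‖(x - χ) i‖) ^ 2 ≤ (A * k * μ) ^ 2 :=
      pow_le_pow_left₀ (Finset.sum_nonneg fun _ _ => norm_nonneg _) I.head_le' 2
    have h2 : Γ * κ * (∑ i ∈ Q, ‖(x - χ) i‖) ^ 2 ≤ ε / 2 * (A ^ 2 * (k * μ ^ 2)) := by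
      calc _ ≤ ε / (2 * k) * (A * k * μ) ^ 2 := mul_le_mul hcol2 h1 (by positivity) (by positivity)
        _ = ε / (2 * k) * k * (A ^ 2 * (k * μ ^ 2)) := by ring
        _ = _ := by rw [hεk]
    have h3 : Γ ^ 2 * κ * (∑ i ∈ Qᶜ, ‖(x - χ) i‖ ^ 2) ≤ ε / (2 * k) * errK k x ^ 2 :=
      mul_le_mul hcol I.tail_le (Finset.sum_nonneg fun _ _ => by positivity) (by positivity)
    have h4 : 2 * k * (Γ ^ 2 * κ * (∑ i ∈ Qᶜ, ‖(x - χ) i‖ ^ 2)) ≤ ε * errK k x ^ 2 := by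
      calc _ ≤ 2 * k * (ε / (2 * k) * errK k x ^ 2) := by gcongr
        _ = _ := by field_simp
    rw [I.mul_noiseLevel_sq] at h2
    have h5 := mul_le_mul_of_nonneg_left h4 (show 0 ≤ 22500000 * shiftLoss by positivity)
    have h6 : (Q.card : ℝ) * (√ε * μ) ^ 2 = 2 * ε * errK k x ^ 2 := by
      rw [hQ, mul_pow, hsε, ← I.mul_noiseLevel_sq]; ring
    rw [h6, hQ]
    nlinarith
  · linarith [H.balanced_bound hC]

/-- The probability that the recovered signal is accurate. -/
theorem prob_error (H : GoodCall d n m k α ε) (I : GoodInput k x χ Q A p) (hC : 1500 ≤ C)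
    (hc : precision A p ≤ c) :
    99 / 100 ≤ prob fun ρ : Coins C d n =>
      ∑ i, ‖(x - χ) i - (recoverAtConstantSNR α C c (dft x) χ (2 * k) ε ρ).val i‖ ^ 2 ≤
        (1 + (2 + 8000000 * A ^ 2 + 22500000 * shiftLoss) * ε) * errK k x ^ 2 := by
  have hne : Nonempty (OddMat d n) := oddMat_nonempty H.locSide.one_le_m H.n_eq
  have h1 := H.prob_location (C := C) (c := c) I hC hc
  have h2 := H.prob_estimates (C := C) (c := c) I hC hc
  have h3 : prob (fun ρ : Coins C d n =>
      (2 + 75000 * A ^ 2 + 22500000 * shiftLoss) * ε * errK k x ^ 2 <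
        ∑ i ∈ Q \ located c x χ (bucketExp d (locBuckets d α (2 * k) ε)) (ρ.1, ρ.2.1),
          ‖(x - χ) i‖ ^ 2) ≤ 1 / 200 := by
    refine le_trans ?_ h1
    rw [prob_prod, prob_prod]
    exact avg_mono fun a => prob_fst_le (fun A' : Fin (numShifts C d n) → Idx d n × Idx d n =>
      (2 + 75000 * A ^ 2 + 22500000 * shiftLoss) * ε * errK k x ^ 2 <
        ∑ i ∈ Q \ located c x χ (bucketExp d (locBuckets d α (2 * k) ε)) (a, A'),
          ‖(x - χ) i‖ ^ 2)
  have h4 : prob (fun ρ : Coins C d n => ∃ i, 600 * A * √ε * noiseLevel k x <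
        ‖medEst (bucketExp d (estBuckets d α (2 * (2 * k)) ε)) c x χ ρ.2.2 i - (x - χ) i‖) ≤
      1 / 1000 := by
    refine le_trans ?_ h2
    refine (prob_snd_le fun ρ : (Fin (numShifts C d n) → Idx d n × Idx d n) ×
      (Fin (numEst C d n) → OddMat d n × Idx d n × Idx d n) => ∃ i, 600 * A * √ε * noiseLevel k x <
        ‖medEst (bucketExp d (estBuckets d α (2 * (2 * k)) ε)) c x χ ρ.2 i - (x - χ) i‖).trans ?_
    exact prob_snd_le fun ρ : Fin (numEst C d n) → OddMat d n × Idx d n × Idx d n =>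
      ∃ i, 600 * A * √ε * noiseLevel k x <
        ‖medEst (bucketExp d (estBuckets d α (2 * (2 * k)) ε)) c x χ ρ i - (x - χ) i‖
  have hor := prob_or_le (fun ρ : Coins C d n =>
      (2 + 75000 * A ^ 2 + 22500000 * shiftLoss) * ε * errK k x ^ 2 <
        ∑ i ∈ Q \ located c x χ (bucketExp d (locBuckets d α (2 * k) ε)) (ρ.1, ρ.2.1),
          ‖(x - χ) i‖ ^ 2) (fun ρ => ∃ i, 600 * A * √ε * noiseLevel k x <
        ‖medEst (bucketExp d (estBuckets d α (2 * (2 * k)) ε)) c x χ ρ.2.2 i - (x - χ) i‖)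
  rw [prob_not]
  have hbad : prob (fun ρ : Coins C d n => ¬
      ∑ i, ‖(x - χ) i - (recoverAtConstantSNR α C c (dft x) χ (2 * k) ε ρ).val i‖ ^ 2 ≤
        (1 + (2 + 8000000 * A ^ 2 + 22500000 * shiftLoss) * ε) * errK k x ^ 2) ≤
      1 / 200 + 1 / 1000 := by
    refine (prob_mono fun ρ hρ => ?_).trans (hor.trans (add_le_add h3 h4))
    by_contra hcon
    rw [not_or, not_lt] at hcon
    push Not at hcon
    refine hρ ?_
    rw [recoverAtConstantSNR_val]
    refine (selection_error H.k_pos (x - χ) _ hcon.2 _ Q I.card_eq).trans ?_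
    -- The estimation error with `η = 600 A √ε μ`; its coefficient `7200000` and the `75000` from
    -- the location stay below `8000000`.
    have h5 : 20 * (k : ℝ) * (600 * A * √ε * noiseLevel k x) ^ 2 =
        7200000 * A ^ 2 * ε * errK k x ^ 2 := by
      rw [← I.mul_noiseLevel_sq]
      have hsε : √ε ^ 2 = ε := Real.sq_sqrt H.ε_pos.le
      conv_rhs => rw [← hsε]
      ring
    have h6 := I.tail_le
    have h7 : 0 ≤ A ^ 2 * ε * errK k x ^ 2 := by
      have := H.ε_pos
      positivity
    linarith [hcon.1]
  linarith

end GoodCall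

end Error

end SparseFT

namespace SparseFT

/-! ## Running times and numbers of samples -/

section Times

theorem pulseConv_time (b R : ℕ) (v : ℤ → ℝ) :
    (pulseConv b R v).time ≤ (2 * R + 2 * (b / 2 - 1) + 2) * 5 + (2 * R + 1) * 8 := by
  rw [pulseConv]
  simp only [bind_time]
  refine add_le_add ?_ ?_
  · refine (loop_time_le _ _ _ 4 fun i _ s => ?_).trans (le_of_eq ?_)
    · simp
    · simp
  · refine (tabulate_time_le _ _ 6 fun i _ => ?_).trans (le_of_eq ?_)
    · simp
    · simp

theorem pulseConv_samples (b R : ℕ) (v : ℤ → ℝ) : (pulseConv b R v).samples = 0 := by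
  rw [pulseConv]
  simp only [bind_samples]
  have h1 := loop_samples_le (List.range (2 * R + 2 * (b / 2 - 1) + 2))
    ((0 : ℝ), fun _ : ℤ => (0 : ℝ)) (fun (t : ℕ) st =>
      op 4 (st.1 + v (-(R : ℤ) - (b / 2 - 1 : ℕ) - 1 + t),
        Function.update st.2 (-(R : ℤ) - (b / 2 - 1 : ℕ) - 1 + t)
          (st.1 + v (-(R : ℤ) - (b / 2 - 1 : ℕ) - 1 + t)))) 0
    fun i _ s => by simp
  rw [mul_zero, Nat.le_zero] at h1
  rw [h1, zero_add]
  refine Nat.le_zero.1 ((tabulate_samples_le _ _ 0 fun i _ => ?_).trans (le_of_eq (mul_zero _)))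
  simp

theorem filterTable_time (d b : ℕ) :
    (filterTable d b).time ≤ sharp d * ((2 * filterRadius d b + 2 * (b / 2 - 1) + 2) * 5 +
      (2 * filterRadius d b + 1) * 8 + 1) := by
  rw [filterTable]
  refine (loop_time_le _ _ _ _ fun i _ s => pulseConv_time _ _ s).trans (le_of_eq ?_)
  rw [List.length_range]

theorem filterTable_samples (d b : ℕ) : (filterTable d b).samples = 0 := by
  rw [filterTable]
  exact Nat.le_zero.1 ((loop_samples_le _ _ _ 0 fun i _ s => (pulseConv_samples _ _ s).le).trans
    (le_of_eq (mul_zero _)))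

variable {d n : ℕ} [NeZero n]

theorem card_window_le (W : ℕ) (v : ℝ) : (Finset.Icc ⌈v - W⌉ ⌊v + W⌋).card ≤ 2 * W + 1 := by
  rw [Int.card_Icc, Int.toNat_le]
  have h1 : ⌊v + W⌋ = ⌊v⌋ + W := Int.floor_add_natCast v W
  have h2 : ⌈v - W⌉ = ⌈v⌉ - W := Int.ceil_sub_natCast v W
  have h3 := Int.floor_le_ceil v
  rw [h1, h2]
  push_cast
  omega

/-- A bound for the running time of `semiEquispaced`. -/
def semiTime (d W m s : ℕ) : ℕ :=
  (2 ^ m) ^ d + (s * (3 * d + (10 * d * (2 * W + 1) + (2 * W + 1) ^ d * (4 * d + 5)) + 1) +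
    (d * ((2 * d + 4) * (2 ^ m) ^ (d - 1) * (m * 2 ^ m) + 1) + 2 * (2 ^ m) ^ d))

theorem semiEquispaced_time (W m : ℕ) (entries : List (Idx d n × ℂ)) :
    (semiEquispaced W m entries).time ≤ semiTime d W m entries.length := by
  rw [semiEquispaced, semiTime]
  simp only [bind_time, op_time]
  refine add_le_add le_rfl (add_le_add ?_ (add_le_add (fft_time _ _ _) le_rfl))
  refine loop_time_le _ _ _ _ fun e _ y => ?_
  simp only [bind_time, op_time, op_val]
  refine add_le_add le_rfl (add_le_add le_rfl ?_)
  refine (loop_time_le _ _ _ (4 * d + 4) fun p _ y => by simp).trans ?_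
  refine Nat.mul_le_mul ?_ le_rfl
  rw [Finset.length_toList, Fintype.card_piFinset]
  refine (Finset.prod_le_pow_card _ _ _ fun s _ => card_window_le W _).trans ?_
  simp

theorem semiEquispaced_samples (W m : ℕ) (entries : List (Idx d n × ℂ)) :
    (semiEquispaced W m entries).samples = 0 := by
  rw [semiEquispaced]
  simp only [bind_samples, op_samples, fft_samples, zero_add, add_zero]
  refine Nat.le_zero.1 ((loop_samples_le _ _ _ 0 fun e _ y => ?_).trans (le_of_eq (mul_zero _)))
  simp only [bind_samples, op_samples, zero_add]
  exact (loop_samples_le _ _ _ 0 fun p _ y => by simp).trans (le_of_eq (mul_zero _))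

/-- The number of cells in the support of the filter. -/
def filterCells (d b : ℕ) : ℕ := (2 * filterRadius d b + 1) ^ d

theorem card_filterBox (d b : ℕ) :
    (Fintype.piFinset fun _ : Fin d =>
      Finset.Icc (-(filterRadius d b : ℤ)) (filterRadius d b)).toList.length = filterCells d b := by
  rw [Finset.length_toList, Fintype.card_piFinset_const, Int.card_Icc, filterCells]
  congr 1
  omega

/-- A bound for the running time of `hashToBins`. -/
def hashTime (d β W s : ℕ) : ℕ :=
  sharp d * ((2 * filterRadius d (2 ^ β) + 2 * (2 ^ β / 2 - 1) + 2) * 5 +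
      (2 * filterRadius d (2 ^ β) + 1) * 8 + 1) +
    (s * (4 * d ^ 2 + 4 * d + 4 + 1) +
      (semiTime d W (Nat.clog 2 (4 * sharp d * 2 ^ β)) s +
        ((2 ^ β) ^ d +
          (filterCells d (2 ^ β) *
              (d + (2 * d ^ 2 + 2 * d + (d + 1 + (2 * d ^ 2 + 8 * d + 8))) + 1) +
            d * ((2 * d + 4) * (2 ^ β) ^ (d - 1) * (β * 2 ^ β) + 1)))))

theorem length_entries (c : ℕ) (χ : Idx d n → ℂ) (f : Idx d n → Idx d n × ℂ) :
    (loop (supp χ).toList ([] : List (Idx d n × ℂ)) fun l es => op c (f l :: es)).val.length =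
      (supp χ).card := by
  rw [loop_val]
  simp only [op_val]
  rw [foldl_cons_map]
  simp

theorem hashToBins_time (c : ℕ) (read : Idx d n → Cost ℂ) (hread : ∀ j, (read j).time ≤ d + 1)
    (χ : Idx d n → ℂ) (β : ℕ) (S : Matrix (Fin d) (Fin d) (ZMod n)) (q a : Idx d n) :
    (hashToBins c read χ β S q a).time ≤ hashTime d β (windowWidth d n c) (supp χ).card := by
  rw [hashToBins, hashTime]
  simp only [bind_time, op_time]
  refine add_le_add (filterTable_time _ _) (add_le_add ?_ (add_le_add ?_ (add_le_add le_rfl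
    (add_le_add ?_ (fft_time _ _ _)))))
  · refine (loop_time_le _ _ _ (4 * d ^ 2 + 4 * d + 4) fun l _ es => by simp).trans ?_
    rw [Finset.length_toList]
  · refine (semiEquispaced_time _ _ _).trans (le_of_eq ?_)
    rw [length_entries]
  · refine (loop_time_le _ _ _
      (d + (2 * d ^ 2 + 2 * d + (d + 1 + (2 * d ^ 2 + 8 * d + 8)))) fun i _ y => ?_).trans ?_
    · simp only [bind_time, op_time]
      have := hread
      gcongr
      exact this _
    · rw [card_filterBox]

theorem hashToBins_samples_le (c : ℕ) (read : Idx d n → Cost ℂ) (r : ℕ)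
    (hread : ∀ j, (read j).samples ≤ r)
    (χ : Idx d n → ℂ) (β : ℕ) (S : Matrix (Fin d) (Fin d) (ZMod n)) (q a : Idx d n) :
    (hashToBins c read χ β S q a).samples ≤ filterCells d (2 ^ β) * r := by
  have h1 : ∀ f : Idx d n → Idx d n × ℂ, (loop (supp χ).toList ([] : List (Idx d n × ℂ))
      fun l es => op (4 * d ^ 2 + 4 * d + 4) (f l :: es)).samples = 0 := fun f =>
    Nat.le_zero.1 ((loop_samples_le _ _ _ 0 fun i _ s => by simp).trans (le_of_eq (mul_zero _)))
  rw [hashToBins]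
  simp only [bind_samples, op_samples, filterTable_samples, semiEquispaced_samples, fft_samples, h1,
    zero_add, add_zero]
  refine (loop_samples_le _ _ _ r fun i _ y => ?_).trans ?_
  · simp only [bind_samples, op_samples, zero_add, add_zero]
    exact hread _
  · rw [card_filterBox]

/-- A bound for the running time of `decodeBucket`. -/
def decodeTime (d n cA : ℕ) : ℕ :=
  d * numDigits n * (base n * (cA * (2 * d + 17) + 5) + 5)

theorem length_digits (d n : ℕ) : (digits d n).length = d * numDigits n := by
  simp [digits]

theorem decodeBucket_time {cA : ℕ} (A : Fin cA → Idx d n × Idx d n)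
    (mm : Fin cA × Idx d n → Arr d) (j : Fin d → ℕ) :
    (decodeBucket A mm j).time ≤ decodeTime d n cA := by
  rw [decodeBucket, decodeTime]
  refine (loop_time_le _ _ _ (base n * (cA * (2 * d + 17) + 5) + 4) fun p _ st => ?_).trans ?_
  · cases st with
    | none => simp only [op_time]; omega
    | some f =>
      simp only [bind_time]
      refine add_le_add ?_ ?_
      · refine (loop_time_le _ _ _ (cA * (2 * d + 17) + 4) fun r _ acc => ?_).trans ?_
        · simp only [bind_time, op_time]
          refine add_le_add ?_ le_rfl
          refine (loop_time_le _ _ _ (2 * d + 16) fun a _ cnt => by simp).trans ?_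
          rw [List.length_finRange]
        · rw [List.length_range]
          exact Nat.mul_le_mul_right _ (digitRange_le_base _ _)
      · split <;> simp
  · rw [length_digits]

theorem decodeBucket_samples {cA : ℕ} (A : Fin cA → Idx d n × Idx d n)
    (mm : Fin cA × Idx d n → Arr d) (j : Fin d → ℕ) : (decodeBucket A mm j).samples = 0 := by
  rw [decodeBucket]
  refine Nat.le_zero.1 ((loop_samples_le _ _ _ 0 fun p _ st => ?_).trans (le_of_eq (mul_zero _)))
  cases st with
  | none => simp
  | some f =>
    simp only [bind_samples]
    refine (add_le_add (b := 0) (d := 0) ?_ ?_).trans (le_of_eq (add_zero 0))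
    · refine (loop_samples_le _ _ _ 0 fun r _ acc => ?_).trans (le_of_eq (mul_zero _))
      simp only [bind_samples, op_samples, add_zero]
      exact (loop_samples_le _ _ _ 0 fun a _ cnt => by simp).trans (le_of_eq (mul_zero _))
    · split <;> simp

/-- A bound for the running time of `locateSignal`. -/
def locateTime (d n β W s cA : ℕ) : ℕ :=
  cA * (shifts d n).length * (hashTime d β W s + (3 * d + (2 ^ β) ^ d) + 2) +
    (8 * d ^ 3 * (Nat.log 2 n + 1) +
      (2 ^ β) ^ d * (decodeTime d n cA + (2 * d ^ 2 + d + 1) + 1))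

theorem length_product_shifts (cA : ℕ) :
    (List.product (List.finRange cA) (shifts d n)).length = cA * (shifts d n).length := by
  exact (List.length_product _ _).trans (by rw [List.length_finRange])

theorem card_bucketBox (d β : ℕ) :
    (Fintype.piFinset fun _ : Fin d => Finset.range (2 ^ β)).toList.length = (2 ^ β) ^ d := by
  rw [Finset.length_toList, Fintype.card_piFinset_const, Finset.card_range]

theorem locateSignal_time (c : ℕ) (χ : Idx d n → ℂ) (β : ℕ)
    (S : Matrix (Fin d) (Fin d) (ZMod n)) (q : Idx d n) {cA : ℕ} (A : Fin cA → Idx d n × Idx d n)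
    (m : Fin cA × Idx d n → Arr d) :
    (locateSignal c χ β S q A m).time ≤
      locateTime d n β (windowWidth d n c) (supp χ).card cA := by
  rw [locateSignal, locateTime]
  simp only [bind_time, op_time]
  refine add_le_add ?_ (add_le_add le_rfl ?_)
  · refine (tabulate_time_le _ _ (hashTime d β (windowWidth d n c) (supp χ).card +
      (3 * d + (2 ^ β) ^ d)) fun p _ => ?_).trans ?_
    · simp only [bind_time, op_time]
      exact add_le_add (hashToBins_time c _ (fun j => by simp [zeroSignal]) χ β S q _) le_rfl
    · rw [length_product_shifts]
  · refine (loop_time_le _ _ _ (decodeTime d n cA + (2 * d ^ 2 + d + 1)) fun j _ L => ?_).trans ?_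
    · simp only [bind_time]
      refine add_le_add (decodeBucket_time _ _ _) ?_
      split
      · simp
      · simp
    · rw [card_bucketBox]

theorem locateSignal_samples (c : ℕ) (χ : Idx d n → ℂ) (β : ℕ)
    (S : Matrix (Fin d) (Fin d) (ZMod n)) (q : Idx d n) {cA : ℕ} (A : Fin cA → Idx d n × Idx d n)
    (m : Fin cA × Idx d n → Arr d) : (locateSignal c χ β S q A m).samples = 0 := by
  rw [locateSignal]
  simp only [bind_samples, op_samples, zero_add]
  refine Nat.le_zero.1 ((add_le_add (b := 0) (d := 0) ?_ ?_).trans (le_of_eq (add_zero 0)))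
  · refine (tabulate_samples_le _ _ 0 fun p _ => ?_).trans (le_of_eq (mul_zero _))
    simp only [bind_samples, op_samples, add_zero]
    exact (hashToBins_samples_le c _ 0 (fun j => by simp [zeroSignal]) χ β S q _).trans
      (le_of_eq (mul_zero _))
  · refine (loop_samples_le _ _ _ 0 fun j _ L => ?_).trans (le_of_eq (mul_zero _))
    simp only [bind_samples, decodeBucket_samples, zero_add]
    split <;> simp

theorem locateSignal_card_le (c : ℕ) (χ : Idx d n → ℂ) (β : ℕ)
    (S : Matrix (Fin d) (Fin d) (ZMod n)) (q : Idx d n) {cA : ℕ} (A : Fin cA → Idx d n × Idx d n)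
    (m : Fin cA × Idx d n → Arr d) :
    (locateSignal c χ β S q A m).val.card ≤ (2 ^ β) ^ d := by
  have key : ∀ (l : List (Fin d → ℕ)) (step : Finset (Idx d n) → (Fin d → ℕ) → Finset (Idx d n))
      (L : Finset (Idx d n)), (∀ L j, (step L j).card ≤ L.card + 1) →
      (l.foldl step L).card ≤ L.card + l.length := by
    intro l step L h
    induction l generalizing L with
    | nil => simp
    | cons a l ih =>
      rw [List.foldl_cons, List.length_cons]
      have := ih (step L a)
      have := h L a
      omega
  rw [locateSignal]
  simp only [bind_val, op_val, loop_val]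
  refine (key _ _ _ fun L j => ?_).trans ?_
  · split
    · simp
    · exact Finset.card_insert_le _ _
  · rw [card_bucketBox]
    simp

/-- A bound for the running time of `estimateValues`. -/
def estimateTime (d β W s r l : ℕ) : ℕ :=
  r * (8 * d ^ 3 + 2 * d + hashTime d β W s + 2) +
    l * (r * (6 * d ^ 2 + 16 * d + 8 + 1) + (4 * r * Nat.clog 2 r + 1 +
      (4 * r * Nat.clog 2 r + 1 + (d + 4))) + 1)

theorem estimateValues_time (α : ℝ) (c : ℕ) (x χ : Idx d n → ℂ) (L : Finset (Idx d n)) (k : ℕ)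
    (ε ν : ℝ) {r : ℕ} (ρ : Fin r → OddMat d n × Idx d n × Idx d n) :
    (estimateValues α c (dft x) χ L k ε ν ρ).time ≤
      estimateTime d (bucketExp d (estBuckets d α k ε)) (windowWidth d n c) (supp χ).card r L.card := by
  rw [estimateValues, estimateTime]
  simp only [bind_time]
  refine add_le_add ?_ ?_
  · refine (tabulate_time_le _ _ (8 * d ^ 3 + 2 * d + hashTime d (bucketExp d (estBuckets d α k ε))
      (windowWidth d n c) (supp χ).card) fun p _ => ?_).trans ?_
    · simp only [bind_time, op_time]
      exact add_le_add le_rfl (hashToBins_time c _ (fun j => by simp [sample]) χ _ _ _ _)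
    · rw [List.length_finRange]
  · refine (loop_time_le _ _ _ (r * (6 * d ^ 2 + 16 * d + 8 + 1) + (4 * r * Nat.clog 2 r + 1 +
      (4 * r * Nat.clog 2 r + 1 + (d + 4)))) fun f _ st => ?_).trans ?_
    · simp only [bind_time, op_time]
      have hlen : ∀ g : Fin r → ℂ, (loop (List.finRange r) ([] : List ℂ) fun t ws =>
          op (6 * d ^ 2 + 16 * d + 8) (g t :: ws)).val.length = r := by
        intro g
        rw [loop_val]
        simp only [op_val]
        rw [foldl_cons_map]
        simp
      refine add_le_add ?_ (add_le_add ?_ (add_le_add ?_ le_rfl))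
      · refine (loop_time_le _ _ _ (6 * d ^ 2 + 16 * d + 8) fun t _ ws => by simp).trans ?_
        rw [List.length_finRange]
      · refine (median_time _).trans (le_of_eq ?_)
        rw [List.length_map, hlen]
      · refine (median_time _).trans (le_of_eq ?_)
        rw [List.length_map, hlen]
    · rw [Finset.length_toList]

theorem estimateValues_samples_le (α : ℝ) (c : ℕ) (x χ : Idx d n → ℂ) (L : Finset (Idx d n)) (k : ℕ)
    (ε ν : ℝ) {r : ℕ} (ρ : Fin r → OddMat d n × Idx d n × Idx d n) :
    (estimateValues α c (dft x) χ L k ε ν ρ).samples ≤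
      r * filterCells d (2 ^ bucketExp d (estBuckets d α k ε)) := by
  rw [estimateValues]
  simp only [bind_samples]
  refine (add_le_add (d := 0) ?_ ?_).trans (le_of_eq (add_zero _))
  · refine (tabulate_samples_le _ _ (filterCells d (2 ^ bucketExp d (estBuckets d α k ε)))
      fun p _ => ?_).trans ?_
    · simp only [bind_samples, op_samples, zero_add]
      exact (hashToBins_samples_le c _ 1 (fun j => by simp [sample]) χ _ _ _ _).trans
        (le_of_eq (mul_one _))
    · rw [List.length_finRange]
  · refine (loop_samples_le _ _ _ 0 fun f _ st => ?_).trans (le_of_eq (mul_zero _))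
    simp only [bind_samples, op_samples, median_samples, add_zero]
    exact (loop_samples_le _ _ _ 0 fun t _ ws => by simp).trans (le_of_eq (mul_zero _))

theorem keepTop_time (m : ℕ) (w : Finset (Idx d n) × (Idx d n → ℂ)) :
    (keepTop m w).time ≤ 4 * w.1.card * Nat.clog 2 w.1.card + m * (d + 2) := by
  rw [keepTop]
  simp only [bind_time]
  refine add_le_add ?_ ?_
  · refine (sortList_time _ _).trans (le_of_eq ?_)
    rw [Finset.length_toList]
  · refine (loop_time_le _ _ _ (d + 1) fun i _ y => by simp).trans ?_
    exact Nat.mul_le_mul_right _ (List.length_take_le _ _)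

theorem keepTop_samples (m : ℕ) (w : Finset (Idx d n) × (Idx d n → ℂ)) :
    (keepTop m w).samples = 0 := by
  rw [keepTop]
  simp only [bind_samples, sortList_samples, zero_add]
  exact Nat.le_zero.1 ((loop_samples_le _ _ _ 0 fun i _ y => by simp).trans (le_of_eq (mul_zero _)))

/-- A bound for the running time of `recoverAtConstantSNR`. -/
def recoverTime (d n β β' W s cA r k : ℕ) : ℕ :=
  8 * d ^ 3 + d + (2 * d * cA + (cA * (shifts d n).length * (hashTime d β W s + 2) +
    (locateTime d n β W s cA + (estimateTime d β' W s r ((2 ^ β) ^ d) +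
      (4 * (2 ^ β) ^ d * (d * β) + 4 * k * (d + 2))))))

theorem hashTime_mono (d β W : ℕ) {s s' : ℕ} (h : s ≤ s') : hashTime d β W s ≤ hashTime d β W s' := by
  rw [hashTime, hashTime, semiTime, semiTime]
  gcongr

/-- Each bucket yields at most one position. This bounds the number of values to be estimated and
the length of the list to be sorted, whose binary logarithm is at most `d β`. -/
theorem recoverAtConstantSNR_time (α C : ℝ) (c : ℕ) (x χ : Idx d n → ℂ) (k : ℕ) (ε : ℝ)
    (ρ : Coins C d n) :
    (recoverAtConstantSNR α C c (dft x) χ k ε ρ).time ≤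
      recoverTime d n (bucketExp d (locBuckets d α k ε)) (bucketExp d (estBuckets d α (2 * k) ε))
        (windowWidth d n c) (supp χ).card (numShifts C d n) (numEst C d n) k := by
  rw [recoverAtConstantSNR, recoverTime]
  simp only [bind_time, op_time, op_val]
  refine add_le_add le_rfl (add_le_add le_rfl (add_le_add ?_ (add_le_add
    (locateSignal_time _ _ _ _ _ _ _) ?_)))
  · refine (tabulate_time_le _ _ (hashTime d (bucketExp d (locBuckets d α k ε))
      (windowWidth d n c) (supp χ).card) fun p _ => ?_).trans ?_
    · refine (hashToBins_time c _ (fun j => by simp [sample]) 0 _ _ _ _).trans (hashTime_mono _ _ _ ?_)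
      simp [supp]
    · rw [length_product_shifts]
  · refine add_le_add ?_ ?_
    · refine (estimateValues_time _ _ _ _ _ _ _ _ _).trans ?_
      rw [estimateTime, estimateTime]
      have := locateSignal_card_le c χ (bucketExp d (locBuckets d α k ε)) ρ.1.1.1 ρ.1.2 ρ.2.1
        (tabulate (List.product (List.finRange (numShifts C d n)) (shifts d n)) fun p =>
          hashToBins c (sample (dft x)) 0 (bucketExp d (locBuckets d α k ε)) ρ.1.1.1 ρ.1.2
            (star (ρ.2.1 p.1) p.2)).val
      gcongr
    · refine (keepTop_time _ _).trans (add_le_add ?_ le_rfl)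
      rw [estimateValues_val]
      have h1 := (Finset.card_filter_le _ fun f =>
          0 < ‖medEst (bucketExp d (estBuckets d α (2 * k) ε)) c x χ ρ.2.2 f‖).trans
        (locateSignal_card_le c χ (bucketExp d (locBuckets d α k ε)) ρ.1.1.1 ρ.1.2 ρ.2.1
        (tabulate (List.product (List.finRange (numShifts C d n)) (shifts d n)) fun p =>
          hashToBins c (sample (dft x)) 0 (bucketExp d (locBuckets d α k ε)) ρ.1.1.1 ρ.1.2
            (star (ρ.2.1 p.1) p.2)).val)
      refine Nat.mul_le_mul (Nat.mul_le_mul_left _ h1) (Nat.clog_le_of_le_pow (h1.trans (le_of_eq ?_)))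
      rw [← pow_mul, mul_comm]

theorem recoverAtConstantSNR_samples_le (α C : ℝ) (c : ℕ) (x χ : Idx d n → ℂ) (k : ℕ) (ε : ℝ)
    (ρ : Coins C d n) :
    (recoverAtConstantSNR α C c (dft x) χ k ε ρ).samples ≤
      numShifts C d n * (shifts d n).length *
          filterCells d (2 ^ bucketExp d (locBuckets d α k ε)) +
        numEst C d n * filterCells d (2 ^ bucketExp d (estBuckets d α (2 * k) ε)) := by
  rw [recoverAtConstantSNR]
  simp only [bind_samples, op_samples, locateSignal_samples, keepTop_samples, zero_add, add_zero]
  refine add_le_add ?_ (estimateValues_samples_le _ _ _ _ _ _ _ _ _)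
  refine (tabulate_samples_le _ _ (filterCells d (2 ^ bucketExp d (locBuckets d α k ε)))
    fun p _ => ?_).trans ?_
  · exact (hashToBins_samples_le c _ 1 (fun j => by simp [sample]) 0 _ _ _ _).trans
      (le_of_eq (mul_one _))
  · rw [length_product_shifts]

end Times

end SparseFT

namespace SparseFT

/-! ## Asymptotics -/

section Asymptotics

/-- The parameters of a call, with a bound `s` for the number of nonzero entries. -/
structure Inst (α D : ℝ) : Type where
  d : ℕ
  n : ℕ
  m : ℕ
  k : ℕ
  ε : ℝ
  s : ℕ
  good : GoodCall d n m k α ε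
  s_le : (s : ℝ) ≤ D * ((2 : ℝ) ^ bucketExp d (locBuckets d α (2 * k) ε)) ^ d

variable {α D : ℝ}

/-- `f` is at most `2 ^ O(d ^ 2)` times `g`. -/
def Dom (f : Inst α D → ℕ) (g : Inst α D → ℝ) : Prop :=
  ∃ K : ℝ, 1 ≤ K ∧ ∀ I, (f I : ℝ) ≤ K ^ (I.d ^ 2) * g I

variable {f f₁ f₂ : Inst α D → ℕ} {g g₁ g₂ h : Inst α D → ℝ}

namespace Inst

/-- `log N`. -/
noncomputable def L (I : Inst α D) : ℝ := Real.log (len I.d I.n)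

/-- `k / ε`. -/
noncomputable def U (I : Inst α D) : ℝ := (I.k : ℝ) / I.ε

theorem one_le_L (I : Inst α D) : 1 ≤ I.L := by
  have := I.good.ten_le_log_len
  rw [L]; linarith

theorem one_le_U (I : Inst α D) : 1 ≤ I.U := I.good.k_div_ge

theorem one_le_sq (I : Inst α D) : 1 ≤ I.d ^ 2 := Nat.one_le_pow _ _ I.good.d_pos

end Inst

namespace Dom

theorem nonneg (hf : Dom f g) (I : Inst α D) : 0 ≤ g I := by
  obtain ⟨K, hK, h1⟩ := hf
  have h2 : 0 ≤ K ^ (I.d ^ 2) * g I := (Nat.cast_nonneg _).trans (h1 I)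
  exact nonneg_of_mul_nonneg_right h2 (pow_pos (by linarith) _)

theorem mono_left (hf : Dom f₂ g) (h : ∀ I, f₁ I ≤ f₂ I) : Dom f₁ g := by
  obtain ⟨K, hK, h1⟩ := hf
  exact ⟨K, hK, fun I => le_trans (by exact_mod_cast h I) (h1 I)⟩

theorem mono_right (hf : Dom f g₁) (h : ∀ I, g₁ I ≤ g₂ I) : Dom f g₂ := by
  obtain ⟨K, hK, h1⟩ := hf
  exact ⟨K, hK, fun I => (h1 I).trans
    (mul_le_mul_of_nonneg_left (h I) (pow_nonneg (by linarith) _))⟩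

theorem add (hf₁ : Dom f₁ g) (hf₂ : Dom f₂ g) : Dom (fun I => f₁ I + f₂ I) g := by
  have hg := hf₁.nonneg
  obtain ⟨K, hK, h1⟩ := hf₁
  obtain ⟨K', hK', h2⟩ := hf₂
  refine ⟨K + K', by linarith, fun I => ?_⟩
  have h3 : K ^ (I.d ^ 2) + K' ^ (I.d ^ 2) ≤ (K + K') ^ (I.d ^ 2) :=
    pow_add_pow_le (by linarith) (by linarith) (by have := I.one_le_sq; omega)
  have h4 := mul_le_mul_of_nonneg_right h3 (hg I)
  push_cast
  linarith [h1 I, h2 I]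

theorem mul (hf₁ : Dom f₁ g₁) (hf₂ : Dom f₂ g₂) :
    Dom (fun I => f₁ I * f₂ I) (fun I => g₁ I * g₂ I) := by
  have hg := hf₁.nonneg
  obtain ⟨K, hK, h1⟩ := hf₁
  obtain ⟨K', hK', h2⟩ := hf₂
  refine ⟨K * K', by nlinarith, fun I => ?_⟩
  push_cast
  calc (f₁ I : ℝ) * f₂ I ≤ (K ^ (I.d ^ 2) * g₁ I) * (K' ^ (I.d ^ 2) * g₂ I) :=
        mul_le_mul (h1 I) (h2 I) (Nat.cast_nonneg _)
          (mul_nonneg (pow_nonneg (by linarith) _) (hg I))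
    _ = _ := by rw [mul_pow]; ring

theorem coef_mul (hf₁ : Dom f₁ fun _ => 1) (hf₂ : Dom f₂ g) : Dom (fun I => f₁ I * f₂ I) g :=
  (hf₁.mul hf₂).mono_right fun _ => (one_mul _).le

theorem mul_coef (hf₁ : Dom f₁ g) (hf₂ : Dom f₂ fun _ => 1) : Dom (fun I => f₁ I * f₂ I) g :=
  (hf₁.mul hf₂).mono_right fun _ => (mul_one _).le

theorem of_one (hf : Dom f fun _ => 1) (h : ∀ I, 1 ≤ g I) : Dom f g := hf.mono_right h

theorem const (c : ℕ) : Dom (fun _ : Inst α D => c) fun _ => 1 := by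
  refine ⟨max 1 c, le_max_left _ _, fun I => ?_⟩
  rw [mul_one]
  exact (le_max_right 1 (c : ℝ)).trans
    (le_self_pow₀ (le_max_left _ _) (by have := I.one_le_sq; omega))

theorem of_pow_le {c : ℝ} (hc : 1 ≤ c) (h : ∀ I, (f I : ℝ) ≤ c ^ I.d * g I) : Dom f g := by
  have hg : ∀ I, 0 ≤ g I := fun I =>
    nonneg_of_mul_nonneg_right ((Nat.cast_nonneg _).trans (h I)) (pow_pos (by linarith) _)
  refine ⟨c, hc, fun I => (h I).trans (mul_le_mul_of_nonneg_right ?_ (hg I))⟩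
  exact pow_le_pow_right₀ hc (Nat.le_self_pow two_ne_zero _)

theorem dim : Dom (fun I : Inst α D => I.d) fun _ => 1 :=
  of_pow_le one_le_two fun I => by
    rw [mul_one]
    exact_mod_cast (Nat.lt_two_pow_self (n := I.d)).le

theorem pow_const (hf : Dom f fun _ => 1) (j : ℕ) : Dom (fun I => f I ^ j) fun _ => 1 := by
  induction j with
  | zero => exact (const 1).mono_left fun I => (pow_zero _).le
  | succ j ih => exact (ih.coef_mul hf).mono_left fun I => (pow_succ _ _).le

/-- The source of the exponent `d ^ 2`: a factor `c ^ d` on each of `d` axes. -/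
theorem pow_dim {c : ℝ} (hc : 1 ≤ c) (h : ∀ I, (f I : ℝ) ≤ c ^ I.d * g I) :
    Dom (fun I => f I ^ I.d) fun I => g I ^ I.d := by
  refine ⟨c, hc, fun I => ?_⟩
  push_cast
  refine (pow_le_pow_left₀ (Nat.cast_nonneg _) (h I) _).trans (le_of_eq ?_)
  rw [mul_pow, ← pow_mul, ← sq]

end Dom

theorem dom_log : Dom (fun I : Inst α D => I.m) Inst.L := by
  refine Dom.of_pow_le one_le_two fun I => ?_
  have h1 := I.good.half_le_log_len
  have h2 : (I.m : ℝ) ≤ ((I.d * I.m : ℕ) : ℝ) := by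
    exact_mod_cast Nat.le_mul_of_pos_left _ I.good.d_pos
  have h3 : (2 : ℝ) ≤ 2 ^ I.d := le_self_pow₀ one_le_two (by have := I.good.d_pos; omega)
  have h4 := I.one_le_L
  rw [← Inst.L] at h1
  nlinarith

/-- The factor by which the prescribed numbers of buckets exceed `k / ε`. -/
noncomputable def sideFactor (α : ℝ) : ℝ := 4 * (2 * (2 * π) ^ 8 * (α⁻¹) ^ 2)

theorem one_le_sideFactor (hα : 0 < α) (hα1 : α ≤ 1) : 1 ≤ sideFactor α := by
  have h1 : 1 ≤ α⁻¹ := (one_le_inv₀ hα).2 hα1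
  have h2 : (1 : ℝ) ≤ (2 * π) ^ 8 := one_le_pow₀ (by linarith [Real.pi_gt_three])
  have h3 : (1 : ℝ) ≤ α⁻¹ ^ 2 := one_le_pow₀ h1
  rw [sideFactor]
  nlinarith

theorem est_side_le (I : Inst α D) :
    ((2 : ℝ) ^ bucketExp I.d (estBuckets I.d α (2 * (2 * I.k)) I.ε)) ^ I.d ≤
      sideFactor α ^ (I.d ^ 2) * I.U := by
  have H := I.good
  have hdd : I.d ≤ I.d ^ 2 := Nat.le_self_pow two_ne_zero _
  have h1 : 1 ≤ α⁻¹ := (one_le_inv₀ H.α_pos).2 H.α_le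
  have h2 : α⁻¹ ^ (2 * I.d) ≤ (α⁻¹ ^ 2) ^ (I.d ^ 2) := by
    rw [pow_mul]
    exact pow_le_pow_right₀ (one_le_pow₀ h1) hdd
  have h3 : (2 : ℝ) ^ I.d ≤ 2 ^ (I.d ^ 2) := pow_le_pow_right₀ one_le_two hdd
  have h4 : (4 : ℝ) ≤ 4 ^ (I.d ^ 2) :=
    le_self_pow₀ (by norm_num) (by have := I.one_le_sq; omega)
  have h5 : (2 * π) ^ (4 * I.d * sharp I.d) = ((2 * π) ^ 8) ^ (I.d ^ 2) := by
    rw [← pow_mul, sharp]; ring_nf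
  have h6 : estBuckets I.d α (2 * (2 * I.k)) I.ε =
      4 * ((2 * π) ^ 8) ^ (I.d ^ 2) * α⁻¹ ^ (2 * I.d) * I.U := by
    have := H.α_pos
    have := H.ε_pos
    rw [estBuckets, h5, Inst.U, inv_pow]
    push_cast
    field_simp
    ring
  refine (two_pow_bucketExp_le H.d_pos H.one_lt_estBuckets).trans ?_
  have hU := I.one_le_U
  rw [h6, sideFactor, mul_pow 4, mul_pow (2 * (2 * π) ^ 8), mul_pow 2 ((2 * π) ^ 8)]
  calc (2 : ℝ) ^ I.d * (4 * ((2 * π) ^ 8) ^ (I.d ^ 2) * α⁻¹ ^ (2 * I.d) * I.U)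
      ≤ 2 ^ (I.d ^ 2) * (4 ^ (I.d ^ 2) * ((2 * π) ^ 8) ^ (I.d ^ 2) * (α⁻¹ ^ 2) ^ (I.d ^ 2) * I.U) := by
        have := H.α_pos
        gcongr
    _ = _ := by ring

theorem loc_side_le_est_side (I : Inst α D) :
    bucketExp I.d (locBuckets I.d α (2 * I.k) I.ε) ≤
      bucketExp I.d (estBuckets I.d α (2 * (2 * I.k)) I.ε) :=
  bucketExp_mono I.good.d_pos (locBuckets_le_estBuckets I.good.α_pos I.good.α_le I.good.ε_pos)

theorem loc_side_le (I : Inst α D) :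
    ((2 : ℝ) ^ bucketExp I.d (locBuckets I.d α (2 * I.k) I.ε)) ^ I.d ≤
      sideFactor α ^ (I.d ^ 2) * I.U := by
  refine le_trans ?_ (est_side_le I)
  exact pow_le_pow_left₀ (by positivity) (pow_le_pow_right₀ one_le_two (loc_side_le_est_side I)) _

theorem dom_est_side (hα : 0 < α) (hα1 : α ≤ 1) : Dom (fun I : Inst α D =>
    (2 ^ bucketExp I.d (estBuckets I.d α (2 * (2 * I.k)) I.ε)) ^ I.d) Inst.U :=
  ⟨_, one_le_sideFactor hα hα1, fun I => by push_cast; exact est_side_le I⟩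

theorem dom_loc_side (hα : 0 < α) (hα1 : α ≤ 1) : Dom (fun I : Inst α D =>
    (2 ^ bucketExp I.d (locBuckets I.d α (2 * I.k) I.ε)) ^ I.d) Inst.U :=
  ⟨_, one_le_sideFactor hα hα1, fun I => by push_cast; exact loc_side_le I⟩

theorem dom_supp (hα : 0 < α) (hα1 : α ≤ 1) : Dom (fun I : Inst α D => I.s) Inst.U := by
  refine Dom.mono_left ((Dom.const ⌈D⌉₊).coef_mul (dom_loc_side hα hα1)) fun I => ?_
  have h1 := I.s_le
  have h2 : D * ((2 : ℝ) ^ bucketExp I.d (locBuckets I.d α (2 * I.k) I.ε)) ^ I.d ≤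
      ⌈D⌉₊ * ((2 : ℝ) ^ bucketExp I.d (locBuckets I.d α (2 * I.k) I.ε)) ^ I.d :=
    mul_le_mul_of_nonneg_right (Nat.le_ceil D) (by positivity)
  exact_mod_cast h1.trans h2

theorem dom_k : Dom (fun I : Inst α D => I.k) Inst.U := by
  refine Dom.of_pow_le le_rfl fun I => ?_
  rw [one_pow, one_mul, Inst.U, le_div_iff₀ I.good.ε_pos]
  exact mul_le_of_le_one_right (Nat.cast_nonneg _) I.good.ε_le

theorem dom_dim_pow : Dom (fun I : Inst α D => I.d ^ I.d) fun _ => 1 := by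
  refine (Dom.pow_dim (f := fun I : Inst α D => I.d) (g := fun _ => 1) one_le_two fun I => ?_).mono_right
    fun I => (one_pow _).le
  rw [mul_one]
  exact_mod_cast (Nat.lt_two_pow_self (n := I.d)).le

theorem dom_const_pow (c : ℕ) : Dom (fun I : Inst α D => c ^ I.d) fun _ => 1 := by
  refine Dom.of_pow_le (c := max 1 c) (le_max_left _ _) fun I => ?_
  push_cast
  rw [mul_one]
  exact pow_le_pow_left₀ (Nat.cast_nonneg _) (le_max_right _ _) _

theorem filterRadius_le (d b : ℕ) : filterRadius d b ≤ 2 * d * b := by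
  rw [filterRadius, sharp]
  exact Nat.mul_le_mul_left _ (by omega)

/-- The filter has at most `5 d b` frequencies per axis, and `d ^ d` is absorbed by `2 ^ (d ^ 2)`.
-/
theorem dom_filterCells {b : Inst α D → ℕ} (hb0 : ∀ I, 1 ≤ b I)
    (hb : Dom (fun I => b I ^ I.d) Inst.U) : Dom (fun I => filterCells I.d (b I)) Inst.U := by
  refine Dom.mono_left (((dom_const_pow 5).coef_mul dom_dim_pow).coef_mul hb) fun I => ?_
  rw [filterCells, ← mul_pow, ← mul_pow]
  refine Nat.pow_le_pow_left ?_ _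
  have h1 := filterRadius_le I.d (b I)
  have h2 : 1 ≤ I.d * b I := Nat.mul_pos I.good.d_pos (hb0 I)
  rw [mul_assoc] at h1 ⊢
  omega

theorem dom_numEst (C : ℝ) (hC : 1 ≤ C) : Dom (fun I : Inst α D => numEst C I.d I.n) Inst.L := by
  refine Dom.mono_left (f₂ := fun I : Inst α D => ⌈2 * C⌉₊ * ⌈I.L⌉₊) ?_ fun I => ?_
  · refine (Dom.const _).coef_mul (Dom.of_pow_le one_le_two fun I => ?_)
    have h1 := Nat.ceil_lt_add_one (show 0 ≤ I.L by linarith [I.one_le_L])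
    have h3 : (2 : ℝ) ≤ 2 ^ I.d := le_self_pow₀ one_le_two (by have := I.good.d_pos; omega)
    nlinarith [I.one_le_L]
  · rw [numEst, ← Inst.L, Nat.ceil_le]
    push_cast
    refine mul_le_mul ?_ (Nat.le_ceil _) (by linarith [I.one_le_L]) (Nat.cast_nonneg _)
    exact le_trans (by linarith) (Nat.le_ceil _)

/-- With `Δ = 2 ^ e` there are about `m / e` digits. The saved factor `e`, of order `log log n`,
compensates for the `log log N` pairs of evaluation points. -/
theorem numDigits_mul_le {n m : ℕ} (hn : n = 2 ^ m) (hm : 4 ≤ m) :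
    numDigits n * (Nat.log 2 m / 2) ≤ 2 * m := by
  set e := Nat.log 2 m / 2 with he
  have hb : base n = 2 ^ e := by rw [base, hn, Nat.log_pow (by norm_num)]
  have he1 : 1 ≤ e := by
    have : 2 ≤ Nat.log 2 m := Nat.le_log_of_pow_le (by norm_num) (by omega)
    omega
  have hem : e ≤ m := (Nat.div_le_self _ _).trans (Nat.log_le_self _ _)
  have h1 : numDigits n ≤ m / e + 1 := by
    refine Nat.clog_le_of_le_pow ?_
    rw [hb, ← pow_mul]
    conv_lhs => rw [hn]
    refine Nat.pow_le_pow_right (by norm_num) ?_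
    rw [mul_add, mul_one]
    have := Nat.div_add_mod m e
    have := Nat.mod_lt m he1
    omega
  calc numDigits n * e ≤ (m / e + 1) * e := Nat.mul_le_mul_right _ h1
    _ = m / e * e + e := by ring
    _ ≤ m + m := add_le_add (Nat.div_mul_le_self _ _) hem
    _ = _ := by ring

/-- The number of measurements in the location step. -/
theorem dom_measurements (C : ℝ) (hC : 1 ≤ C) :
    Dom (fun I : Inst α D => numShifts C I.d I.n * (shifts I.d I.n).length) Inst.L := by
  -- `log log N ≤ 5 d e`, while the number of shifts times `e` is at most `3 d m`; the factors `e`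
  -- cancel and the product is linear in `m`.
  have key : ∀ I : Inst α D, numShifts C I.d I.n * (shifts I.d I.n).length ≤
      ⌈2 * C⌉₊ * (5 * I.d) * (3 * I.d * I.m) := by
    intro I
    have hm := I.good.twenty_le_m
    have hd := I.good.d_pos
    set e := Nat.log 2 I.m / 2 with he
    have he1 : 1 ≤ e := by
      have : 4 ≤ Nat.log 2 I.m := Nat.le_log_of_pow_le (by norm_num) (by omega)
      omega
    have hem : e ≤ I.m := (Nat.div_le_self _ _).trans (Nat.log_le_self _ _)
    have hll := I.good.one_le_loglog
    have hlog : Real.log (Real.log (len I.d I.n)) ≤ 5 * I.d * e := by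
      have h1 : Real.log (len I.d I.n) ≤ I.d * I.m := by
        rw [I.good.log_len_eq]
        push_cast
        refine mul_le_of_le_one_right (by positivity) ?_
        linarith [Real.log_two_lt_d9]
      have h2 : I.m ≤ 2 ^ (2 * e + 2) := by
        have h3 := Nat.lt_pow_succ_log_self (b := 2) (by norm_num) I.m
        exact h3.le.trans (Nat.pow_le_pow_right (by norm_num) (by omega))
      have h3 : I.d * I.m ≤ 2 ^ (5 * I.d * e) := by
        calc I.d * I.m ≤ 2 ^ I.d * 2 ^ (2 * e + 2) :=
              Nat.mul_le_mul (Nat.lt_two_pow_self).le h2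
          _ = 2 ^ (I.d + (2 * e + 2)) := (pow_add _ _ _).symm
          _ ≤ _ := Nat.pow_le_pow_right (by norm_num) (by nlinarith)
      have h4 : Real.log (len I.d I.n) ≤ 2 ^ (5 * I.d * e) := h1.trans (by exact_mod_cast h3)
      have h5 := Real.log_le_log (by linarith [I.good.ten_le_log_len]) h4
      rw [Real.log_pow] at h5
      push_cast at h5
      have h6 : (0 : ℝ) ≤ 5 * I.d * e := by positivity
      nlinarith [Real.log_two_lt_d9]
    have hcA : numShifts C I.d I.n ≤ ⌈2 * C⌉₊ * (5 * I.d * e) := by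
      rw [numShifts, Nat.ceil_le]
      push_cast
      refine mul_le_mul ?_ hlog (by linarith) (Nat.cast_nonneg _)
      exact le_trans (by linarith) (Nat.le_ceil _)
    have hsh : (shifts I.d I.n).length * e ≤ 3 * I.d * I.m := by
      have h1 : (shifts I.d I.n).length = I.d * numDigits I.n + 1 := by
        rw [shifts, List.length_cons, List.length_map, length_digits]
      have h2 := numDigits_mul_le I.good.n_eq (by omega)
      rw [← he] at h2
      rw [h1]
      nlinarith
    calc _ ≤ ⌈2 * C⌉₊ * (5 * I.d * e) * (shifts I.d I.n).length := Nat.mul_le_mul_right _ hcA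
      _ = ⌈2 * C⌉₊ * (5 * I.d) * ((shifts I.d I.n).length * e) := by ring
      _ ≤ _ := Nat.mul_le_mul_left _ hsh
  refine Dom.mono_left ?_ key
  exact ((Dom.const _).coef_mul ((Dom.const 5).coef_mul Dom.dim)).coef_mul
    (((Dom.const 3).coef_mul Dom.dim).coef_mul dom_log)

/-- The number of samples. -/
theorem dom_samples (hα : 0 < α) (hα1 : α ≤ 1) (C : ℝ) (hC : 1 ≤ C) :
    Dom (fun I : Inst α D => numShifts C I.d I.n * (shifts I.d I.n).length *
        filterCells I.d (2 ^ bucketExp I.d (locBuckets I.d α (2 * I.k) I.ε)) +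
      numEst C I.d I.n *
        filterCells I.d (2 ^ bucketExp I.d (estBuckets I.d α (2 * (2 * I.k)) I.ε)))
      (fun I => I.L * I.U) :=
  ((dom_measurements C hC).mul
    (dom_filterCells (fun _ => Nat.one_le_two_pow) (dom_loc_side hα hα1))).add
  ((dom_numEst C hC).mul
    (dom_filterCells (fun _ => Nat.one_le_two_pow) (dom_est_side hα hα1)))

end Asymptotics

end SparseFT

namespace SparseFT

/-! ### Asymptotics of the running time -/

section TimeAsymptotics

variable {α D : ℝ}

namespace Inst

/-- The bound for the running time of one hashing. -/
noncomputable def T (I : Inst α D) : ℝ := I.U * I.L ^ I.d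

theorem L_le_pow (I : Inst α D) : I.L ≤ I.L ^ I.d :=
  le_self_pow₀ I.one_le_L (by have := I.good.d_pos; omega)

theorem one_le_pow (I : Inst α D) : 1 ≤ I.L ^ I.d := one_le_pow₀ I.one_le_L

theorem U_le_T (I : Inst α D) : I.U ≤ I.T :=
  le_mul_of_one_le_right (by linarith [I.one_le_U]) I.one_le_pow

theorem L_mul_U_le_T (I : Inst α D) : I.L * I.U ≤ I.T := by
  rw [T, mul_comm]
  exact mul_le_mul_of_nonneg_left I.L_le_pow (by linarith [I.one_le_U])

theorem one_le_T (I : Inst α D) : 1 ≤ I.T := I.one_le_U.trans I.U_le_T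

theorem T_le (I : Inst α D) : I.T ≤ I.L * I.T :=
  le_mul_of_one_le_left (by linarith [I.one_le_T]) I.one_le_L

theorem L_le (I : Inst α D) : I.L ≤ I.L * I.T :=
  le_mul_of_one_le_right (by linarith [I.one_le_L]) I.one_le_T

theorem one_le_LT (I : Inst α D) : 1 ≤ I.L * I.T := I.one_le_T.trans I.T_le

end Inst

theorem dom_window_le (c : ℕ) (I : Inst α D) :
    ((2 * windowWidth I.d I.n c + 1 : ℕ) : ℝ) ≤ (2 * c + 3 : ℝ) ^ I.d * I.L := by
  have hL := I.one_le_L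
  have hc : (0 : ℝ) ≤ c := Nat.cast_nonneg _
  have h1 : (windowWidth I.d I.n c : ℝ) < c * I.L + 1 :=
    Nat.ceil_lt_add_one (mul_nonneg hc (by rw [← Inst.L]; linarith))
  have h2 : (2 * c + 3 : ℝ) ≤ (2 * c + 3 : ℝ) ^ I.d :=
    le_self_pow₀ (by linarith) (by have := I.good.d_pos; omega)
  have h3 : (2 * c + 3 : ℝ) * I.L ≤ (2 * c + 3 : ℝ) ^ I.d * I.L :=
    mul_le_mul_of_nonneg_right h2 (by linarith)
  push_cast
  nlinarith

theorem dom_window (c : ℕ) : Dom (fun I : Inst α D => 2 * windowWidth I.d I.n c + 1) Inst.L :=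
  Dom.of_pow_le (by linarith [(Nat.cast_nonneg c : (0 : ℝ) ≤ c)]) (dom_window_le c)

/-- Each entry of `χ` is spread over this many grid points; hence the factor `log ^ d N` in a single
hashing. -/
theorem dom_window_pow (c : ℕ) : Dom (fun I : Inst α D => (2 * windowWidth I.d I.n c + 1) ^ I.d)
    fun I => I.L ^ I.d :=
  Dom.pow_dim (by linarith [(Nat.cast_nonneg c : (0 : ℝ) ≤ c)]) (dom_window_le c)

/-- The side of a hash table. -/
structure SmallSide (b : Inst α D → ℕ) : Prop where
  pow : Dom (fun I => (2 ^ b I) ^ I.d) Inst.U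
  exp : Dom b Inst.L

theorem dom_fft {b : Inst α D → ℕ} (hb : SmallSide b) :
    Dom (fun I => I.d * ((2 * I.d + 4) * (2 ^ b I) ^ (I.d - 1) * (b I * 2 ^ b I) + 1)) Inst.T := by
  have h1 : ∀ I : Inst α D, I.d * ((2 * I.d + 4) * (2 ^ b I) ^ (I.d - 1) * (b I * 2 ^ b I) + 1) ≤
      I.d * ((2 * I.d + 4) * (b I * (2 ^ b I) ^ I.d) + 1) := by
    intro I
    have h2 : (2 ^ b I) ^ I.d = (2 ^ b I) ^ (I.d - 1) * 2 ^ b I := by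
      rw [← pow_succ, Nat.sub_add_cancel I.good.d_pos]
    rw [h2]
    refine Nat.mul_le_mul_left _ (Nat.add_le_add_right (le_of_eq ?_) 1)
    ring
  refine Dom.mono_left ?_ h1
  refine Dom.dim.coef_mul (Dom.add ?_ ((Dom.const 1).of_one Inst.one_le_T))
  refine Dom.coef_mul ?_ ((hb.exp.mul hb.pow).mono_right Inst.L_mul_U_le_T)
  exact ((Dom.const 2).coef_mul Dom.dim).add (Dom.const 4)

/-- The side of the oversampled grid is less than twice `8 d b`, so its volume exceeds that of the
table by at most `(16 d) ^ d`. -/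
theorem SmallSide.grid {b : Inst α D → ℕ} (hb : SmallSide b) :
    SmallSide fun I => Nat.clog 2 (4 * sharp I.d * 2 ^ b I) := by
  have hx : ∀ I : Inst α D, 1 < 4 * sharp I.d * 2 ^ b I := by
    intro I
    have h1 : 1 ≤ I.d * 2 ^ b I := Nat.mul_pos I.good.d_pos (by positivity)
    rw [sharp]
    nlinarith
  constructor
  · refine Dom.mono_left (((dom_const_pow 16).coef_mul dom_dim_pow).coef_mul hb.pow) fun I => ?_
    rw [← mul_pow, ← mul_pow]
    refine Nat.pow_le_pow_left ?_ _
    have h1 := Nat.pow_pred_clog_lt_self (b := 2) (by norm_num) (hx I)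
    have h2 : 0 < Nat.clog 2 (4 * sharp I.d * 2 ^ b I) := Nat.clog_pos (by norm_num) (hx I)
    obtain ⟨t, ht⟩ := Nat.exists_eq_succ_of_ne_zero h2.ne'
    rw [ht] at h1 ⊢
    rw [Nat.pred_succ] at h1
    rw [pow_succ]
    rw [sharp] at h1
    nlinarith
  · refine Dom.mono_left (f₂ := fun I => 3 + I.d + b I) ?_ fun I => ?_
    · exact (((Dom.const 3).add Dom.dim).of_one Inst.one_le_L).add hb.exp
    · refine Nat.clog_le_of_le_pow ?_
      rw [pow_add, pow_add, sharp]
      refine Nat.mul_le_mul_right _ ?_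
      have := (Nat.lt_two_pow_self (n := I.d)).le
      omega

theorem dom_semiTime (c : ℕ) {b : Inst α D → ℕ} (hb : SmallSide b)
    (hs : Dom (fun I : Inst α D => I.s) Inst.U) :
    Dom (fun I : Inst α D => semiTime I.d (windowWidth I.d I.n c) (b I) I.s) Inst.T := by
  refine (hb.pow.mono_right Inst.U_le_T).add (Dom.add (hs.mul ?_)
    ((dom_fft hb).add ((Dom.const 2).coef_mul (hb.pow.mono_right Inst.U_le_T))))
  refine Dom.add (Dom.add ?_ (Dom.add ?_ ?_)) ((Dom.const 1).of_one Inst.one_le_pow)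
  · exact ((Dom.const 3).coef_mul Dom.dim).of_one Inst.one_le_pow
  · exact ((Dom.const 10).coef_mul Dom.dim).coef_mul ((dom_window c).mono_right Inst.L_le_pow)
  · exact (dom_window_pow c).mul_coef (((Dom.const 4).coef_mul Dom.dim).add (Dom.const 5))

theorem SmallSide.side {b : Inst α D → ℕ} (hb : SmallSide b) : Dom (fun I => 2 ^ b I) Inst.U :=
  hb.pow.mono_left fun I => Nat.le_self_pow (by have := I.good.d_pos; omega) _

theorem SmallSide.radius {b : Inst α D → ℕ} (hb : SmallSide b) :
    Dom (fun I => filterRadius I.d (2 ^ b I)) Inst.U :=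
  Dom.mono_left (((Dom.const 2).coef_mul Dom.dim).coef_mul hb.side) fun _ => filterRadius_le _ _

theorem dom_hashTime (c : ℕ) {b : Inst α D → ℕ} (hb : SmallSide b)
    (hs : Dom (fun I : Inst α D => I.s) Inst.U) :
    Dom (fun I : Inst α D => hashTime I.d (b I) (windowWidth I.d I.n c) I.s) Inst.T := by
  have hone : ∀ j : ℕ, Dom (fun _ : Inst α D => j) Inst.U := fun j =>
    (Dom.const j).of_one Inst.one_le_U
  refine Dom.add (Dom.mono_right ?_ Inst.U_le_T) (Dom.add (Dom.mono_right ?_ Inst.U_le_T)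
    (Dom.add (dom_semiTime c hb.grid hs) (Dom.add (hb.pow.mono_right Inst.U_le_T)
      (Dom.add (Dom.mono_right ?_ Inst.U_le_T) (dom_fft hb)))))
  · refine Dom.coef_mul ((Dom.const 2).coef_mul Dom.dim) (Dom.add (Dom.add ?_ ?_) (hone 1))
    · refine Dom.mul_coef (Dom.add (Dom.add ((Dom.const 2).coef_mul hb.radius) ?_) (hone 2))
        (Dom.const 5)
      exact (Dom.const 2).coef_mul (hb.side.mono_left fun I =>
        (Nat.sub_le _ _).trans (Nat.div_le_self _ _))
    · exact (((Dom.const 2).coef_mul hb.radius).add (hone 1)).mul_coef (Dom.const 8)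
  · refine hs.mul_coef ?_
    repeat' first
      | exact Dom.const _
      | exact Dom.dim
      | apply Dom.pow_const
      | apply Dom.add
      | apply Dom.coef_mul
  · refine (dom_filterCells (fun _ => Nat.one_le_two_pow) hb.pow).mul_coef ?_
    repeat' first
      | exact Dom.const _
      | exact Dom.dim
      | apply Dom.pow_const
      | apply Dom.add
      | apply Dom.coef_mul

theorem smallSide_loc (hα : 0 < α) (hα1 : α ≤ 1) :
    SmallSide fun I : Inst α D => bucketExp I.d (locBuckets I.d α (2 * I.k) I.ε) where
  pow := dom_loc_side hα hα1
  exp := dom_log.mono_left fun I => I.good.locSide.le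

theorem smallSide_est (hα : 0 < α) (hα1 : α ≤ 1) :
    SmallSide fun I : Inst α D => bucketExp I.d (estBuckets I.d α (2 * (2 * I.k)) I.ε) where
  pow := dom_est_side hα hα1
  exp := dom_log.mono_left fun I => I.good.estSide.le

theorem one_le_numShifts {C : ℝ} (hC : 1 ≤ C) (I : Inst α D) : 1 ≤ numShifts C I.d I.n := by
  refine Nat.one_le_iff_ne_zero.2 (Nat.ceil_pos.2 ?_).ne'
  nlinarith [I.good.one_le_loglog]

theorem dom_digits {C : ℝ} (hC : 1 ≤ C) :
    Dom (fun I : Inst α D => numShifts C I.d I.n * (I.d * numDigits I.n)) Inst.L :=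
  (dom_measurements C hC).mono_left fun I => by
    refine Nat.mul_le_mul_left _ ?_
    rw [shifts, List.length_cons, List.length_map, length_digits]
    omega

/-- Each measurement is compared with at most `Δ ≤ m` values of a digit, one more logarithm than the
number of measurements. -/
theorem dom_decodeTime {C : ℝ} (hC : 1 ≤ C) :
    Dom (fun I : Inst α D => decodeTime I.d I.n (numShifts C I.d I.n)) fun I => I.L * I.L := by
  refine Dom.mono_left (f₂ := fun I : Inst α D => numShifts C I.d I.n * (I.d * numDigits I.n) *
    (I.m * (2 * I.d + 22) + 5)) ?_ fun I => ?_
  · refine (dom_digits hC).mul (Dom.add (dom_log.mul_coef ?_) ((Dom.const 5).of_one Inst.one_le_L))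
    exact ((Dom.const 2).coef_mul Dom.dim).add (Dom.const 22)
  · have hcA := one_le_numShifts hC I
    set cA := numShifts C I.d I.n
    have hbase : base I.n ≤ I.m := (Nat.le_self_pow two_ne_zero _).trans
      (base_sq_le I.good.n_eq (by have := I.good.twenty_le_m; omega))
    have h1 : cA * (2 * I.d + 17) + 5 ≤ cA * (2 * I.d + 22) := by
      have : 5 ≤ cA * 5 := Nat.le_mul_of_pos_left _ hcA
      calc _ ≤ cA * (2 * I.d + 17) + cA * 5 := Nat.add_le_add_left this _
        _ = _ := by ring
    have h2 : base I.n * (cA * (2 * I.d + 17) + 5) + 5 ≤ cA * (I.m * (2 * I.d + 22) + 5) := by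
      calc _ ≤ I.m * (cA * (2 * I.d + 22)) + cA * 5 :=
            add_le_add (Nat.mul_le_mul hbase h1) (Nat.le_mul_of_pos_left _ hcA)
        _ = _ := by ring
    calc decodeTime I.d I.n cA ≤ I.d * numDigits I.n * (cA * (I.m * (2 * I.d + 22) + 5)) :=
          Nat.mul_le_mul_left _ h2
      _ = _ := by ring

/-- Terms with two logarithms per bucket fit into the bound because `d + 1 ≥ 2`. -/
theorem L_sq_U_le (I : Inst α D) : I.U * (I.L * I.L) ≤ I.L * I.T := by
  calc I.U * (I.L * I.L) = I.L * (I.L * I.U) := by ring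
    _ ≤ _ := mul_le_mul_of_nonneg_left I.L_mul_U_le_T (by linarith [I.one_le_L])

/-- The running time. -/
theorem dom_recoverTime (hα : 0 < α) (hα1 : α ≤ 1) {C : ℝ} (hC : 1 ≤ C) (c : ℕ) :
    Dom (fun I : Inst α D => recoverTime I.d I.n (bucketExp I.d (locBuckets I.d α (2 * I.k) I.ε))
        (bucketExp I.d (estBuckets I.d α (2 * (2 * I.k)) I.ε)) (windowWidth I.d I.n c) I.s
        (numShifts C I.d I.n) (numEst C I.d I.n) (2 * I.k))
      fun I => I.L * I.T := by
  have hs : Dom (fun I : Inst α D => I.s) Inst.U := dom_supp hα hα1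
  have hloc := smallSide_loc (D := D) hα hα1
  have hest := smallSide_est (D := D) hα hα1
  have hhl := dom_hashTime c hloc hs
  have hhe := dom_hashTime c hest hs
  have hmeas := dom_measurements (α := α) (D := D) C hC
  have hr := dom_numEst (α := α) (D := D) C hC
  have hconst : ∀ j : ℕ, Dom (fun _ : Inst α D => j) Inst.T := fun j =>
    (Dom.const j).of_one Inst.one_le_T
  have hd3 : Dom (fun I : Inst α D => 8 * I.d ^ 3) fun _ => 1 :=
    (Dom.const 8).coef_mul (Dom.dim.pow_const 3)
  have hcA : Dom (fun I : Inst α D => numShifts C I.d I.n) Inst.L := hmeas.mono_left fun I => by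
    refine Nat.le_mul_of_pos_right _ ?_
    rw [shifts, List.length_cons]
    omega
  have hlogn : Dom (fun I : Inst α D => Nat.log 2 I.n) Inst.L := dom_log.mono_left fun I => by
    conv_lhs => rw [I.good.n_eq]
    rw [Nat.log_pow (by norm_num)]
  have hclog : Dom (fun I : Inst α D => Nat.clog 2 (numEst C I.d I.n)) Inst.L :=
    hr.mono_left fun I => Nat.clog_le_of_le_pow (Nat.lt_two_pow_self).le
  have honeL : ∀ j : ℕ, Dom (fun _ : Inst α D => j) Inst.L := fun j =>
    (Dom.const j).of_one Inst.one_le_L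
  have hd : Dom (fun I : Inst α D => I.d) fun _ => 1 := Dom.dim
  have hLL : ∀ I : Inst α D, I.L ≤ I.L * I.L := fun I =>
    le_mul_of_one_le_left (by linarith [I.one_le_L]) I.one_le_L
  have hLL1 : ∀ I : Inst α D, 1 ≤ I.L * I.L := fun I => I.one_le_L.trans (hLL I)
  have hlocate : Dom (fun I : Inst α D => locateTime I.d I.n
      (bucketExp I.d (locBuckets I.d α (2 * I.k) I.ε)) (windowWidth I.d I.n c) I.s
      (numShifts C I.d I.n)) fun I => I.L * I.T := by
    refine Dom.add (hmeas.mul (Dom.add (Dom.add hhl (Dom.add ?_ ?_)) (hconst 2))) (Dom.add ?_ ?_)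
    · exact ((Dom.const 3).coef_mul hd).of_one Inst.one_le_T
    · exact hloc.pow.mono_right Inst.U_le_T
    · exact hd3.coef_mul ((hlogn.add (honeL 1)).mono_right Inst.L_le)
    · refine (hloc.pow.mul (Dom.add (Dom.add (dom_decodeTime hC) ?_) ?_)).mono_right L_sq_U_le
      · refine Dom.of_one ?_ hLL1
        exact (((Dom.const 2).coef_mul (hd.pow_const 2)).add hd).add (Dom.const 1)
      · exact (Dom.const 1).of_one hLL1
  have hmed : Dom (fun I : Inst α D => 4 * numEst C I.d I.n * Nat.clog 2 (numEst C I.d I.n) + 1)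
      fun I => I.L * I.L :=
    (((Dom.const 4).coef_mul hr).mul hclog).add ((Dom.const 1).of_one hLL1)
  have hestimate : Dom (fun I : Inst α D => estimateTime I.d
      (bucketExp I.d (estBuckets I.d α (2 * (2 * I.k)) I.ε)) (windowWidth I.d I.n c) I.s
      (numEst C I.d I.n) ((2 ^ bucketExp I.d (locBuckets I.d α (2 * I.k) I.ε)) ^ I.d))
      fun I => I.L * I.T := by
    refine Dom.add (hr.mul (Dom.add (Dom.add ?_ hhe) (hconst 2))) ?_
    · exact (hd3.add ((Dom.const 2).coef_mul hd)).of_one Inst.one_le_T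
    · refine (hloc.pow.mul (Dom.add (Dom.add ?_ (Dom.add hmed (Dom.add hmed ?_))) ?_)).mono_right
        L_sq_U_le
      · refine (hr.mul_coef ?_).mono_right hLL
        exact ((((Dom.const 6).coef_mul (hd.pow_const 2)).add ((Dom.const 16).coef_mul hd)).add
          (Dom.const 8)).add (Dom.const 1)
      · exact (hd.add (Dom.const 4)).of_one hLL1
      · exact (Dom.const 1).of_one hLL1
  refine Dom.add ?_ (Dom.add ?_ (Dom.add ?_ (Dom.add hlocate (Dom.add hestimate (Dom.add ?_ ?_)))))
  · exact (hd3.add hd).of_one Inst.one_le_LT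
  · exact (((Dom.const 2).coef_mul hd).coef_mul hcA).mono_right Inst.L_le
  · exact hmeas.mul (hhl.add (hconst 2))
  · refine Dom.mono_right (((Dom.const 4).coef_mul hloc.pow).mul (hd.coef_mul hloc.exp)) fun I => ?_
    rw [mul_comm]
    exact I.L_mul_U_le_T.trans I.T_le
  · refine Dom.mono_right ?_ fun I => I.U_le_T.trans I.T_le
    exact ((Dom.const 4).coef_mul ((Dom.const 2).coef_mul dom_k)).mul_coef
      (hd.add (Dom.const 2))

end TimeAsymptotics

end SparseFT

/-- The order of the quantifiers records on what each implied constant may depend: `Ks` precedes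
`A`, `p`, `c` and `D`, `Ke` depends on `A` but not on the precision, and `Kt` comes last. As `d ≥
1`, the condition that the `b' ^ d` buckets are at most `N` is expressed as `b' ≤ n`. -/
theorem mainTheorem5 :
    ∃ α₀ : ℝ, 0 < α₀ ∧ ∀ α : ℝ, 0 < α → α ≤ α₀ →
    ∃ C₀ : ℝ, ∀ C : ℝ, C₀ ≤ C →
    -- constant of the sample complexity
    ∃ Ks : ℝ, 0 < Ks ∧
    -- constant in the assumption on the head, and the resulting constant in the error bound
    ∀ A : ℝ, ∃ Ke : ℝ, 0 < Ke ∧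
    -- exponent of the signal-to-noise ratio, and the resulting precision
    ∀ p : ℕ, ∃ c₀ : ℕ, ∀ c : ℕ, c₀ ≤ c →
    -- constant of the running time
    ∀ D : ℝ, ∃ Kt : ℝ, 0 < Kt ∧
    ∀ (d n : ℕ) [NeZero n], 1 ≤ d → (∃ m : ℕ, n = 2 ^ m) →
    ∀ k : ℕ, 1 ≤ k → ∀ ε : ℝ, 0 < ε → ε ≤ 1 →
    2 ^ SparseFT.bucketExp d (SparseFT.estBuckets d α (2 * (2 * k)) ε) ≤ n →
    ∀ x χ : SparseFT.Idx d n → ℂ,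
      (∀ Q : Finset (SparseFT.Idx d n), SparseFT.IsTop (2 * k) (x - χ) Q →
        ∑ i ∈ Q, ‖(x - χ) i‖ ≤ A * √(k : ℝ) * SparseFT.errK k x →
        ∑ i ∈ Qᶜ, ‖(x - χ) i‖ ^ 2 ≤ SparseFT.errK k x ^ 2 →
        (∀ i, ‖x i‖ ≤ SparseFT.len d n ^ p * (SparseFT.errK k x / √(k : ℝ))) →
        99 / 100 ≤ SparseFT.prob fun ρ : SparseFT.Coins C d n =>
          ∑ i, ‖(x - χ) i - (SparseFT.recoverAtConstantSNR α C c (SparseFT.dft x) χ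
            (2 * k) ε ρ).val i‖ ^ 2 ≤ (1 + Ke * ε) * SparseFT.errK k x ^ 2) ∧
      (∀ ρ : SparseFT.Coins C d n,
        ((SparseFT.recoverAtConstantSNR α C c (SparseFT.dft x) χ (2 * k) ε ρ).samples : ℝ) ≤
          Ks ^ (d ^ 2) * (1 / ε) * k * Real.log (SparseFT.len d n)) ∧
      (((SparseFT.supp χ).card : ℝ) ≤
          D * ((2 : ℝ) ^ SparseFT.bucketExp d (SparseFT.locBuckets d α (2 * k) ε)) ^ d →
        ∀ ρ : SparseFT.Coins C d n,
          ((SparseFT.recoverAtConstantSNR α C c (SparseFT.dft x) χ (2 * k) ε ρ).time : ℝ) ≤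
            Kt ^ (d ^ 2) * (1 / ε) * k * Real.log (SparseFT.len d n) ^ (d + 1)) := by
  refine ⟨1, one_pos, fun α hα hα1 => ⟨1500, fun C hC => ?_⟩⟩
  have hC1 : 1 ≤ C := by linarith
  -- The number of samples does not involve the support of `χ`, so it is dominated with `D = 0` and
  -- `s = 0`; this makes `Ks` independent of the constants chosen later.
  obtain ⟨Ks, hKs, hsamples⟩ := SparseFT.dom_samples (D := 0) hα hα1 C hC1
  refine ⟨Ks, by linarith, fun A => ?_⟩
  have hshift := SparseFT.shiftLoss_pos
  -- `|A| + 1` replaces `A`, since `GoodInput` requires a head constant of at least `1`.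
  refine ⟨2 + 8000000 * (|A| + 1) ^ 2 + 22500000 * SparseFT.shiftLoss, by positivity, fun p =>
    ⟨SparseFT.precision (|A| + 1) p, fun c hc D => ?_⟩⟩
  obtain ⟨Kt, hKt, htime⟩ := SparseFT.dom_recoverTime (D := D) hα hα1 hC1 c
  refine ⟨Kt, by linarith, fun d n _ hd ⟨m, hn⟩ k hk ε hε hε1 hfits x χ => ?_⟩
  have H : SparseFT.GoodCall d n m k α ε := ⟨hd, hn, hk, hα, hα1, hε, hε1, hfits⟩
  refine ⟨fun Q hQ hhead htail hnorm => ?_, fun ρ => ?_, fun hs ρ => ?_⟩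
  · have I : SparseFT.GoodInput k x χ Q (|A| + 1) p :=
      { k_pos := hk
        A_ge := by linarith [abs_nonneg A]
        card_eq := hQ.1
        head_le := hhead.trans <| mul_le_mul_of_nonneg_right (mul_le_mul_of_nonneg_right
          (by linarith [le_abs_self A]) (Real.sqrt_nonneg _)) (SparseFT.errK_nonneg k x)
        tail_le := htail
        norm_le := hnorm }
    exact H.prob_error I hC hc
  · refine (Nat.cast_le.2 (SparseFT.recoverAtConstantSNR_samples_le α C c x χ (2 * k) ε ρ)).trans
      ((hsamples ⟨d, n, m, k, ε, 0, H, by simp⟩).trans (le_of_eq ?_))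
    simp only [SparseFT.Inst.L, SparseFT.Inst.U]
    ring
  · refine (Nat.cast_le.2 (SparseFT.recoverAtConstantSNR_time α C c x χ (2 * k) ε ρ)).trans
      ((htime ⟨d, n, m, k, ε, _, H, hs⟩).trans (le_of_eq ?_))
    simp only [SparseFT.Inst.L, SparseFT.Inst.T, SparseFT.Inst.U]
    ring
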